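/- Let $d\in\{2,3\}$, $\ell\ge 1$, and let $\Omega\subset\mathbb R^d$ be a bounded open set. Let $A$ be a symmetric-matrix-valued function on $\Omega$ with $a_1|\xi|^2\le A(x)\xi\cdot\xi\le a_2|\xi|^2$ for all $x\in\Omega$, $\xi\in\mathbb R^d$ ($a_1,a_2>0$), which is piecewise $W^{1,\infty}$: there is an open set $P\subset\Omega$ with $|\Omega\setminus P|=0$ such that $A|_P$ is (continuous and) of class $W^{1,\infty}(P)$. Let $B$ be a measurable function on $\Omega$ with $0<b_1\le B\le b_2$. Put $a(u,v)=\int_\Omega A\nabla u\cdot\nabla v$ and $b(u,v)=\int_\Omega B\,u\,v$ for $u,v\in H^1_0(\Omega)$. A (conforming) triangulation $\mathcal T$ of $\Omega$ is a finite set of nondegenerate closed $d$-simplices, the interior of whose union is $\Omega$, any two of which intersect in the empty set or in a common full face spanned by their common vertices. Let $\kappa_{\mathcal T}=\max_{T\in\mathcal T}\operatorname{diam}(T)/\rho_T$ with $\rho_T$ the radius of the largest ball contained in $T$, let $h_T=|T|^{1/d}$, $\mathcal N_{\mathcal T}(T)=\{T'\in\mathcal T: T'\cap T\ne\emptyset\}$,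 $\omega_{\mathcal T}(T)=\bigcup_{T'\in\mathcal N_{\mathcal T}(T)}T'$, and $\mathbb V_{\mathcal T}=\{v\in H^1_0(\Omega): v|_T\in\mathbb P_\ell(T)\ \forall\, T\in\mathcal T\}$; the last definition is also used for partitions into simplices that are not conforming. Triangulations are assumed to match the discontinuities of $A$: the interior of each element is contained in $P$. For $\mu\in\mathbb R$ and $v\in\mathbb V_{\mathcal T}$, let $R(\mu,v)=-\nabla\cdot(A\nabla v)-\mu Bv$ in each element, let $J(v)=(A\nabla v)|_{T_1}\cdot n_1+(A\nabla v)|_{T_2}\cdot n_2$ on each interior side shared by $T_1$ and $T_2$ ($n_i$ the outward unit normal of $T_i$), $J(v)=0$ on $\partial\Omega$, and let $\eta_{\mathcal T}(\mu,v;T)^2=h_T^2\|R(\mu,v)\|_{L^2(T)}^2+h_T\|J(v)\|_{L^2(\partial T)}^2$. The elements of $\mathcal T$ carry labels (an order of the vertices, and a type if $d=3$) for newest-vertex bisection if $d=2$ and Kossaczký's bisection if $d=3$; let $n_2=3$ and $n_3=6$. **Claim.** For every $\kappa$ there is a constant $C>0$, depending only on $d$, $\ell$, $\Omega$, $A$,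 $B$ and $\kappa$, such that the following holds for each triangulation $\mathcal T$ of $\Omega$ with $\kappa_{\mathcal T}\le\kappa$ and each $T\in\mathcal T$. Let $\mathcal T_*$ be obtained from $\mathcal T$ by bisecting each element of $\mathcal N_{\mathcal T}(T)$ (at least) $n_d$ times, where $\mathcal T_*$ is conforming or at least can be completed to a conforming triangulation of $\Omega$ by further bisections. Let $\lambda_{\mathcal T}\in\mathbb R$, $u_{\mathcal T}\in\mathbb V_{\mathcal T}$ satisfy $a(u_{\mathcal T},v)=\lambda_{\mathcal T}b(u_{\mathcal T},v)$ for all $v\in\mathbb V_{\mathcal T}$ and $b(u_{\mathcal T},u_{\mathcal T})^{1/2}=1$. Let $\mathbb W$ be a subspace of $H^1_0(\Omega)$ with $\mathbb V_{\mathcal T_*}\subset\mathbb W$, and let $\mu\in\mathbb R$, $w\in\mathbb W$ satisfy $a(w,v)=\mu\,b(w,v)$ for all $v\in\mathbb W$ and $b(w,w)^{1/2}=1$. Then, with $R=R(\lambda_{\mathcal T},u_{\mathcal T})$ and $J=J(u_{\mathcal T})$, $$h_T\|R-\overline R\|_{L^2(\omega_{\mathcal T}(T))}+h_T^{1/2}\|J-\overline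 J\|_{L^2(\partial T)}\le C\,h_T(2+\lambda_{\mathcal T})\|u_{\mathcal T}\|_{H^1(\omega_{\mathcal T}(T))},$$ where $\overline R|_{T'}$ is the $L^2(T')$-projection of $R$ onto $\mathbb P_{\ell-1}$ for each $T'\in\mathcal N_{\mathcal T}(T)$ and $\overline J|_S$ is the $L^2(S)$-projection of $J$ onto $\mathbb P_{\ell-1}$ for each side $S$ of $T$, and $$\eta_{\mathcal T}(\lambda_{\mathcal T},u_{\mathcal T};T)\le C\Big(\|\nabla(w-u_{\mathcal T})\|_{L^2(\omega_{\mathcal T}(T))}+h_T\|\mu w\|_{L^2(\omega_{\mathcal T}(T))}+h_T(1+\lambda_{\mathcal T})\|u_{\mathcal T}\|_{H^1(\omega_{\mathcal T}(T))}\Big).$$ -/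

import Mathlib

open MeasureTheory Set
open scoped ContDiff ENNReal

noncomputable section

namespace FEM

/-- Euclidean space of dimension `d`. -/
abbrev E (d : ℕ) : Type := EuclideanSpace ℝ (Fin d)

/-- The `L²` norm with respect to a measure. -/
def l2Norm {d : ℕ} {F : Type} [NormedAddCommGroup F] (ν : Measure (E d)) (f : E d → F) : ℝ :=
  (eLpNorm f 2 ν).toReal

/-! ### Sobolev spaces -/

/-- Test functions: smooth functions with compact support contained in `Ω`. -/
structure IsTest {d : ℕ} (Ω : Set (E d)) (φ : E d → ℝ) : Prop where
  smooth : ContDiff ℝ ∞ φ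
  compact : HasCompactSupport φ
  supp : tsupport φ ⊆ Ω

/-- `G` is a weak (distributional) gradient of `u` on `Ω`. -/
def IsWeakGrad {d : ℕ} (Ω : Set (E d)) (u : E d → ℝ) (G : E d → E d) : Prop :=
  ∀ φ : E d → ℝ, IsTest Ω φ →
    ∫ x in Ω, u x • gradient φ x = - ∫ x in Ω, φ x • G x

/-- `u ∈ W^{1,p}(Ω)` with weak gradient `G`. -/
structure IsSobolevPair {d : ℕ} (p : ℝ≥0∞) (Ω : Set (E d)) (u : E d → ℝ) (G : E d → E d) :
    Prop where
  memLp : MemLp u p (volume.restrict Ω)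
  memLp_grad : MemLp G p (volume.restrict Ω)
  weak : IsWeakGrad Ω u G

/-- `u ∈ W^{1,∞}(U)`. -/
def MemW1Inf {d : ℕ} (U : Set (E d)) (u : E d → ℝ) : Prop :=
  ∃ G : E d → E d, IsSobolevPair ∞ U u G

/-- `u ∈ H¹₀(Ω)`: `u ∈ H¹(Ω)` is a limit in `H¹(Ω)` of test functions. -/
def MemH10 {d : ℕ} (Ω : Set (E d)) (u : E d → ℝ) : Prop :=
  ∃ G : E d → E d, IsSobolevPair 2 Ω u G ∧
    ∀ ε : ℝ≥0∞, 0 < ε → ∃ φ : E d → ℝ, IsTest Ω φ ∧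
      eLpNorm (fun x => u x - φ x) 2 (volume.restrict Ω) < ε ∧
      eLpNorm (fun x => G x - gradient φ x) 2 (volume.restrict Ω) < ε

open Classical in
/-- The weak gradient of a function of `H¹(Ω)` (unique almost everywhere in `Ω`). -/
def weakGrad {d : ℕ} (Ω : Set (E d)) (u : E d → ℝ) : E d → E d :=
  if h : ∃ G : E d → E d, IsSobolevPair 2 Ω u G then h.choose else 0

/-- The norm of `H¹(D)`, for `D` contained (up to a null set) in `Ω` and `u ∈ H¹(Ω)`. -/
def h1Norm {d : ℕ} (Ω D : Set (E d)) (u : E d → ℝ) : ℝ :=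
  √(l2Norm (volume.restrict D) u ^ 2 + l2Norm (volume.restrict D) (weakGrad Ω u) ^ 2)

/-! ### Coefficients and bilinear forms -/

/-- `A` is a symmetric-matrix-valued function, uniformly positive definite and bounded on `Ω`,
which is piecewise `W^{1,∞}`: it is `W^{1,∞}` on the open set `P`, the complement of a null set of
discontinuities. On `P` the values of `A` are those of the continuous representative. -/
structure IsDiffusion {d : ℕ} (Ω P : Set (E d)) (A : E d → Matrix (Fin d) (Fin d) ℝ)
    (a₁ a₂ : ℝ) : Prop where
  isOpen : IsOpen P
  subset : P ⊆ Ω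
  null : volume (Ω \ P) = 0
  continuousOn : ContinuousOn A P
  sobolev : ∀ i j, MemW1Inf P (fun x => A x i j)
  symm : ∀ x ∈ Ω, (A x).IsSymm
  pos : 0 < a₁
  lower : ∀ x ∈ Ω, ∀ ξ : E d, a₁ * ‖ξ‖ ^ 2 ≤ inner ℝ (Matrix.toEuclideanLin (A x) ξ) ξ
  upper : ∀ x ∈ Ω, ∀ ξ : E d, inner ℝ (Matrix.toEuclideanLin (A x) ξ) ξ ≤ a₂ * ‖ξ‖ ^ 2

/-- `B` is a measurable scalar function on `Ω` with positive lower and upper bounds. -/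
structure IsWeight {d : ℕ} (Ω : Set (E d)) (B : E d → ℝ) (b₁ b₂ : ℝ) : Prop where
  meas : AEStronglyMeasurable B (volume.restrict Ω)
  pos : 0 < b₁
  lower : ∀ x ∈ Ω, b₁ ≤ B x
  upper : ∀ x ∈ Ω, B x ≤ b₂

/-- `a(u,v) = ∫_Ω A ∇u · ∇v`. -/
def aForm {d : ℕ} (Ω : Set (E d)) (A : E d → Matrix (Fin d) (Fin d) ℝ) (u v : E d → ℝ) : ℝ :=
  ∫ x in Ω, inner ℝ (Matrix.toEuclideanLin (A x) (weakGrad Ω u x)) (weakGrad Ω v x)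

/-- `b(u,v) = ∫_Ω B u v`. -/
def bForm {d : ℕ} (Ω : Set (E d)) (B : E d → ℝ) (u v : E d → ℝ) : ℝ :=
  ∫ x in Ω, B x * u x * v x

/-- `(μ, w)` is a normalized eigenpair on the space `W`: `w ∈ W`, `a(w,v) = μ b(w,v)` for all
`v ∈ W`, and `b(w,w)^{1/2} = 1`. -/
structure IsEigenpair {d : ℕ} (Ω : Set (E d)) (A : E d → Matrix (Fin d) (Fin d) ℝ)
    (B : E d → ℝ) (W : Set (E d → ℝ)) (μ : ℝ) (w : E d → ℝ) : Prop where
  mem : w ∈ W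
  eq : ∀ v ∈ W, aForm Ω A w v = μ * bForm Ω B w v
  norm : √(bForm Ω B w w) = 1

/-! ### Simplices and triangulations -/

/-- A simplex with ordered vertices `z₀, …, z_d` and a type in `{0,1,2}`. The order and the type
are the labels used by the bisection rule; the edge `z₀z₁` is the refinement edge. -/
structure Elt (d : ℕ) where
  vertex : Fin (d + 1) → E d
  type : ZMod 3

/-- The closed simplex spanned by the vertices. -/
def Elt.carrier {d : ℕ} (t : Elt d) : Set (E d) := convexHull ℝ (range t.vertex)

/-- `h_T = |T|^{1/d}`. -/
def Elt.size {d : ℕ} (t : Elt d) : ℝ := (volume.real t.carrier) ^ (1 / (d : ℝ))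

/-- The radius of the largest ball contained in `T`. -/
def Elt.inradius {d : ℕ} (t : Elt d) : ℝ :=
  sSup {r : ℝ | ∃ x, Metric.closedBall x r ⊆ t.carrier}

/-- A finite family of labelled simplices. -/
abbrev Mesh (d : ℕ) : Type := Finset (Elt d)

/-- `𝒯` is a conforming triangulation of `Ω`: a finite set of nondegenerate closed simplices, the
interior of whose union is `Ω`, any two of which intersect in the (possibly empty) common face
spanned by their common vertices. -/
structure IsTriangulation {d : ℕ} (Ω : Set (E d)) (𝒯 : Mesh d) : Prop where
  indep : ∀ t ∈ 𝒯, AffineIndependent ℝ t.vertex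
  cover : interior (⋃ t ∈ 𝒯, t.carrier) = Ω
  inj : ∀ t ∈ 𝒯, ∀ t' ∈ 𝒯, range t.vertex = range t'.vertex → t = t'
  conforming : ∀ t ∈ 𝒯, ∀ t' ∈ 𝒯,
    t.carrier ∩ t'.carrier = convexHull ℝ (range t.vertex ∩ range t'.vertex)

/-- The regularity `κ_𝒯 = max_T diam(T) / ρ_T`. -/
def regularity {d : ℕ} (𝒯 : Mesh d) : ℝ :=
  ⨆ t : 𝒯, Metric.diam t.1.carrier / t.1.inradius

/-- `𝒯` matches the discontinuities of the coefficient: they do not meet the interior of any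
element. -/
def Matches {d : ℕ} (P : Set (E d)) (𝒯 : Mesh d) : Prop :=
  ∀ t ∈ 𝒯, interior t.carrier ⊆ P

open Classical in
/-- `𝒩_𝒯(T)`: the elements that intersect `T`. -/
def nbrs {d : ℕ} (𝒯 : Mesh d) (t : Elt d) : Finset (Elt d) :=
  𝒯.filter (fun t' => (t'.carrier ∩ t.carrier).Nonempty)

/-- `ω_𝒯(T)`: the union of the elements that intersect `T`. -/
def patch {d : ℕ} (𝒯 : Mesh d) (t : Elt d) : Set (E d) := ⋃ t' ∈ nbrs 𝒯 t, t'.carrier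

open Classical in
/-- The elements that share a side with `T`; they correspond to the interior sides
`S = T ∩ T'` of `T`. -/
def sideNbrs {d : ℕ} (𝒯 : Mesh d) (t : Elt d) : Finset (Elt d) :=
  𝒯.filter (fun t' => (range t.vertex ∩ range t'.vertex).ncard = d)

/-- The side shared by two elements. -/
def side {d : ℕ} (t t' : Elt d) : Set (E d) := t.carrier ∩ t'.carrier

/-! ### Bisection -/

/-- The midpoint of the refinement edge. -/
def Elt.newVertex {d : ℕ} (t : Elt d) : E d := midpoint ℝ (t.vertex 0) (t.vertex 1)

/-- First child. With `m` the midpoint of `z₀z₁`: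
for `d = 2`, `(z₀, z₂, m)`; for `d = 3`, `(z₀, z₂, z₃, m)`. -/
def Elt.child₀ {d : ℕ} (t : Elt d) : Elt d where
  vertex i := if i = 0 then t.vertex 0 else if i = Fin.last d then t.newVertex
    else t.vertex (i + 1)
  type := t.type + 1

/-- Second child. With `m` the midpoint of `z₀z₁`:
for `d = 2`, `(z₁, z₂, m)`; for `d = 3`, `(z₁, z₃, z₂, m)` if the type is `0`, and
`(z₁, z₂, z₃, m)` if the type is `1` or `2`.
This is newest-vertex bisection for `d = 2` and Kossaczký's bisection for `d = 3`. -/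
def Elt.child₁ {d : ℕ} (t : Elt d) : Elt d where
  vertex i := if i = 0 then t.vertex 1 else if i = Fin.last d then t.newVertex
    else if t.type = 0 then t.vertex (Fin.rev i + 1) else t.vertex (i + 1)
  type := t.type + 1

/-- The descendants of generation `n` of an element (they result from `n` bisections). -/
def Elt.descendants {d : ℕ} : ℕ → Elt d → Set (Elt d)
  | 0, t => {t}
  | n + 1, t => Elt.descendants n t.child₀ ∪ Elt.descendants n t.child₁

open Classical in
/-- `𝒯'` results from `𝒯` by the bisection of one element. -/
def Bisects {d : ℕ} (𝒯 𝒯' : Mesh d) : Prop :=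
  ∃ t ∈ 𝒯, 𝒯' = insert t.child₀ (insert t.child₁ (𝒯.erase t))

/-- `𝒯'` results from `𝒯` by finitely many bisections of single elements. -/
def IsBisectionRefinement {d : ℕ} (𝒯 𝒯' : Mesh d) : Prop :=
  Relation.ReflTransGen Bisects 𝒯 𝒯'

/-- `n_d`: `3` in dimension two and `6` in dimension three. -/
def bisectionNumber (d : ℕ) : ℕ := if d = 2 then 3 else 6

/-- `𝒯'` results from `𝒯` by bisecting the elements of `𝒩_𝒯(T)` (at least) `n_d` times, and
it is a conforming triangulation or can be completed to one by further bisections. -/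
structure IsLocalRefinement {d : ℕ} (Ω : Set (E d)) (𝒯 : Mesh d) (t : Elt d) (𝒯' : Mesh d) :
    Prop where
  refines : IsBisectionRefinement 𝒯 𝒯'
  deep : ∀ t' ∈ nbrs 𝒯 t, ∀ n < bisectionNumber d, ∀ s ∈ Elt.descendants n t', s ∉ 𝒯'
  completable : ∃ 𝒯'' : Mesh d, IsBisectionRefinement 𝒯' 𝒯'' ∧ IsTriangulation Ω 𝒯''

/-! ### Finite element spaces -/

/-- The value of a polynomial at a point of Euclidean space. -/
def polyEval {d : ℕ} (p : MvPolynomial (Fin d) ℝ) (x : E d) : ℝ := MvPolynomial.eval (fun i => x i) p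

/-- The finite element space: functions of `H¹₀(Ω)` that are polynomials of degree at most `ℓ` on
each closed element, extended by zero outside `Ω`. -/
def femSpace {d : ℕ} (Ω : Set (E d)) (𝒯 : Mesh d) (ℓ : ℕ) : Set (E d → ℝ) :=
  {v | MemH10 Ω v ∧ (∀ x ∉ Ω, v x = 0) ∧
    ∀ t ∈ 𝒯, ∃ p : MvPolynomial (Fin d) ℝ, p.totalDegree ≤ ℓ ∧ ∀ x ∈ t.carrier, v x = polyEval p x}

/-! ### Residuals and estimators -/

/-- The (classical) divergence of a vector field. -/
def divergence {d : ℕ} (F : E d → E d) (x : E d) : ℝ :=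
  ∑ i, (fderiv ℝ F x (EuclideanSpace.single i 1)) i

/-- The element residual `R(μ,v) = -∇·(A∇v) - μ B v`, at points interior to the elements. -/
def residual {d : ℕ} (A : E d → Matrix (Fin d) (Fin d) ℝ) (B : E d → ℝ) (μ : ℝ)
    (v : E d → ℝ) (x : E d) : ℝ :=
  - divergence (fun y => Matrix.toEuclideanLin (A y) (gradient v y)) x - μ * B x * v x

/-- `(A∇v)|_T` as a function on the closed element `T`, boundary included: the value of `A` is
its continuous extension from the interior of `T`, and the gradient is that of `v|_T`. -/
def traceFlux {d : ℕ} (A : E d → Matrix (Fin d) (Fin d) ℝ) (v : E d → ℝ) (t : Elt d)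
    (x : E d) : E d :=
  Matrix.toEuclideanLin (extendFrom (interior t.carrier) A x) (gradientWithin v t.carrier x)

/-- The outward unit normal of `T` on its side `S`. -/
def outwardNormal {d : ℕ} (t : Elt d) (S : Set (E d)) : E d :=
  Classical.epsilon fun n : E d => ‖n‖ = 1 ∧ (∀ x ∈ S, ∀ y ∈ S, inner ℝ (y - x) n = 0) ∧
    ∀ x ∈ S, ∀ y ∈ t.carrier, inner ℝ (y - x) n ≤ 0

/-- The jump residual on the interior side shared by `T` and `T'`. -/
def jump {d : ℕ} (A : E d → Matrix (Fin d) (Fin d) ℝ) (v : E d → ℝ) (t t' : Elt d)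
    (x : E d) : ℝ :=
  inner ℝ (traceFlux A v t x) (outwardNormal t (side t t')) +
    inner ℝ (traceFlux A v t' x) (outwardNormal t' (side t t'))

/-- The surface measure on the side shared by `T` and `T'`. -/
def sideMeasure {d : ℕ} (t t' : Elt d) : Measure (E d) := μHE[d - 1].restrict (side t t')

/-- The local error estimator: `η(μ,v;T)² = h_T² ‖R(μ,v)‖_T² + h_T ‖J(v)‖_{∂T}²`, the jump
residual being zero on the boundary of the domain. -/
def estimator {d : ℕ} (A : E d → Matrix (Fin d) (Fin d) ℝ) (B : E d → ℝ) (𝒯 : Mesh d)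
    (μ : ℝ) (v : E d → ℝ) (t : Elt d) : ℝ :=
  √(t.size ^ 2 * l2Norm (volume.restrict t.carrier) (residual A B μ v) ^ 2 +
    t.size * ∑ t' ∈ sideNbrs 𝒯 t, l2Norm (sideMeasure t t') (jump A v t t') ^ 2)

/-- The `L²(ν)`-projection of `f` onto the polynomials of degree at most `k`. -/
def polyProj {d : ℕ} (k : ℕ) (ν : Measure (E d)) (f : E d → ℝ) : E d → ℝ :=
  polyEval (Classical.epsilon fun p : MvPolynomial (Fin d) ℝ => p.totalDegree ≤ k ∧
    ∀ q : MvPolynomial (Fin d) ℝ, q.totalDegree ≤ k →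
      ∫ x, (f x - polyEval p x) * polyEval q x ∂ν = 0)

/-- `‖R - R̄‖_{ω(T)}`, where `R̄` is on each `T' ∈ 𝒩(T)` the `L²(T')`-projection of `R` onto the
polynomials of degree at most `ℓ - 1`. -/
def residualOsc {d : ℕ} (A : E d → Matrix (Fin d) (Fin d) ℝ) (B : E d → ℝ) (𝒯 : Mesh d)
    (ℓ : ℕ) (μ : ℝ) (v : E d → ℝ) (t : Elt d) : ℝ :=
  √(∑ t' ∈ nbrs 𝒯 t, l2Norm (volume.restrict t'.carrier)
    (fun x => residual A B μ v x -
      polyProj (ℓ - 1) (volume.restrict t'.carrier) (residual A B μ v) x) ^ 2)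

/-- `‖J - J̄‖_{∂T}`, where `J̄` is on each side `S` of `T` the `L²(S)`-projection of `J` onto the
polynomials of degree at most `ℓ - 1`. -/
def jumpOsc {d : ℕ} (A : E d → Matrix (Fin d) (Fin d) ℝ) (𝒯 : Mesh d)
    (ℓ : ℕ) (v : E d → ℝ) (t : Elt d) : ℝ :=
  √(∑ t' ∈ sideNbrs 𝒯 t, l2Norm (sideMeasure t t')
    (fun x => jump A v t t' x - polyProj (ℓ - 1) (sideMeasure t t') (jump A v t t') x) ^ 2)

end FEM

end

noncomputable section

namespace FEM

/-! ### Integer barycentric coordinates of the descendants -/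

/-! The proof is the bubble-function argument for residual estimators, arranged so that every test
function belongs to the refined discrete space. On an element contained in a shape-regular ball pair
of radii `ρ` and `Λ * ρ`, freeze `A` at the centre `x₀`. The frozen residual and the frozen jump are
polynomials of degree at most `ℓ - 1`. Since `A` is Lipschitz on the element, `A - A(x₀)` is of
order `ρ`, which compensates the factor `1 / ρ` that an inverse estimate pays for a derivative; the
term `λBu` is simply part of the error. As the `L²` projection is a best approximation, this yields
the oscillation estimate (`exists_oscillation_bound`).

For the lower bound, multiply the frozen polynomial `q` by a nonnegative bubble `φ` that is
piecewise linear on the descendants of generation `n_d`. Then `qφ` has degree at most `ℓ` on each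
element of the refinement and lies in its finite element space (`IsBubbleFun.mem_femSpace`), hence
in `W`. The equation for `w` gives `a(u,v) - λ b(u,v) = a(u-w,v) + μ b(w,v) - λ b(u,v)` for `v =
qφ`, while integration by parts turns the left side into an integral of the residual, and of the
jump if the bubble belongs to a side. Equivalence of norms on polynomials (`exists_polyEval_sq_le`),
transported from a reference simplex, bounds `q` by `∫ q²φ`. See `exists_element_efficiency` and
`exists_side_efficiency`.

What is specific to bisection is the existence of the bubbles. They are written as positive parts of
minima of integer linear forms in the barycentric coordinates. Linearity on every descendant and
vanishing on the required faces then become finitely many integer inequalities, which are evaluated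
(`isBubbleForms_element`, `isBubbleForms_side`). A side bubble must have the same trace from both
elements (`side_bubble_eq`). In dimension three this trace is determined by the edge of the side
that is bisected first, and the two elements must agree on it. If they did not, two different
medians of the side would cross in its centroid, and the completion to a conforming mesh would force
a common vertex of descendants there; vertices of descendants have dyadic coordinates, but the
centroid has the coordinate `1/3` (`sideEdge_unique`).

The analytic groundwork is: Lipschitz functions vanishing outside `Ω` are in `H¹₀`
(`memH10_of_lipschitz`), continuous `W^{1,∞}` coefficients are Lipschitz on convex open sets
(`exists_lipschitzOnWith_of_memW1Inf`), and integration by parts on an element follows from the same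
formula on a half-space (`setIntegral_lineDeriv_halfspace`). -/

/-- The value of an integer linear form at an integer vector. -/
def intForm {n : ℕ} (g c : Fin n → ℤ) : ℤ := ((List.finRange n).map fun k => g k * c k).sum

/-- The value of an integer linear form at a real vector. -/
def realForm {n : ℕ} (g : Fin n → ℤ) (μ : Fin n → ℝ) : ℝ := ∑ k, (g k : ℝ) * μ k

/-- Twice the barycentric coordinates of the vertices of the first child. -/
def intChild₀ {d n : ℕ} (V : Fin (d + 1) → Fin n → ℤ) (i : Fin (d + 1)) (k : Fin n) : ℤ :=
  if i = 0 then 2 * V 0 k else if i = Fin.last d then V 0 k + V 1 k else 2 * V (i + 1) k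

/-- Twice the barycentric coordinates of the vertices of the second child. -/
def intChild₁ {d n : ℕ} (τ : ZMod 3) (V : Fin (d + 1) → Fin n → ℤ) (i : Fin (d + 1)) (k : Fin n) :
    ℤ :=
  if i = 0 then 2 * V 1 k else if i = Fin.last d then V 0 k + V 1 k
    else if τ = 0 then 2 * V (Fin.rev i + 1) k else 2 * V (i + 1) k

/-- `Q` holds for the (scaled) barycentric coordinates of all descendants of generation `m`. -/
def allDescendants {d n : ℕ} (Q : (Fin (d + 1) → Fin n → ℤ) → Bool) :
    ℕ → ZMod 3 → (Fin (d + 1) → Fin n → ℤ) → Bool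
  | 0, _, V => Q V
  | m + 1, τ, V => allDescendants Q m (τ + 1) (intChild₀ V) &&
        allDescendants Q m (τ + 1) (intChild₁ τ V)

/-- The barycentric coordinates of the vertices of a simplex. -/
def intUnit {n : ℕ} (i k : Fin n) : ℤ := if i = k then 1 else 0

/-- The positive part of the minimum of the forms in `gs` is linear on the simplex with
vertices `V`, by inspection of the values at the vertices. -/
def linearOnSimplex {d n : ℕ} (gs : List (Fin n → ℤ)) (V : Fin (d + 1) → Fin n → ℤ) : Bool :=
  gs.any fun g =>
    (List.finRange (d + 1)).all (fun i => decide (intForm g (V i) ≤ 0)) ||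
    (List.finRange (d + 1)).all (fun i => decide (0 ≤ intForm g (V i)) &&
      gs.all fun h => decide (intForm g (V i) ≤ intForm h (V i)))

/-- One of the forms in `gs` is nonnegative at the vertices `V`. -/
def someNonneg {d n : ℕ} (gs : List (Fin n → ℤ)) (V : Fin (d + 1) → Fin n → ℤ) : Bool :=
  gs.any fun g => (List.finRange (d + 1)).all (fun i => decide (0 ≤ intForm g (V i)))

theorem realForm_smul_intForm {n : ℕ} {g c : Fin n → ℤ} {μ : Fin n → ℝ} {r : ℝ}
    (h : ∀ k, (c k : ℝ) = r * μ k) : (intForm g c : ℝ) = r * realForm g μ := by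
  have : intForm g c = ∑ k, g k * c k := by
    rw [intForm, ← List.ofFn_eq_map, List.sum_ofFn]
  rw [this, realForm, Finset.mul_sum]
  push_cast
  exact Finset.sum_congr rfl fun k _ => by rw [h]; ring

/-- A midpoint costs one factor `2` in the denominators. Doubling the scale at each bisection
therefore keeps all coordinates integral, and properties of descendants become integer computations.
-/
theorem child₀_coords {d n : ℕ} (t : Elt d) (co : E d →ᵃ[ℝ] (Fin n → ℝ))
    {V : Fin (d + 1) → Fin n → ℤ} {c : ℝ} (hV : ∀ i k, (V i k : ℝ) = c * co (t.vertex i) k)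
    (i : Fin (d + 1)) (k : Fin n) :
    (intChild₀ V i k : ℝ) = (2 * c) * co (t.child₀.vertex i) k := by
  unfold intChild₀ Elt.child₀
  dsimp only
  split_ifs
  · push_cast; rw [hV]; ring
  · push_cast
    rw [hV, hV, Elt.newVertex, AffineMap.map_midpoint, midpoint_eq_smul_add]
    simp only [invOf_eq_inv, Pi.smul_apply, Pi.add_apply, smul_eq_mul]
    ring
  · push_cast; rw [hV]; ring

theorem child₁_coords {d n : ℕ} (t : Elt d) (co : E d →ᵃ[ℝ] (Fin n → ℝ))
    {V : Fin (d + 1) → Fin n → ℤ} {c : ℝ} (hV : ∀ i k, (V i k : ℝ) = c * co (t.vertex i) k)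
    (i : Fin (d + 1)) (k : Fin n) :
    (intChild₁ t.type V i k : ℝ) = (2 * c) * co (t.child₁.vertex i) k := by
  unfold intChild₁ Elt.child₁
  dsimp only
  split_ifs
  · push_cast; rw [hV]; ring
  · push_cast
    rw [hV, hV, Elt.newVertex, AffineMap.map_midpoint, midpoint_eq_smul_add]
    simp only [invOf_eq_inv, Pi.smul_apply, Pi.add_apply, smul_eq_mul]
    ring
  · push_cast; rw [hV]; ring
  · push_cast; rw [hV]; ring

/-- The scaled barycentric coordinates of the vertices of a descendant are integers with the
property that was checked for all descendants. -/
theorem exists_intCoords {d n : ℕ} (Q : (Fin (d + 1) → Fin n → ℤ) → Bool)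
    (co : E d →ᵃ[ℝ] (Fin n → ℝ)) (m : ℕ) : ∀ (t : Elt d) (V : Fin (d + 1) → Fin n → ℤ) (c : ℝ),
    (∀ i k, (V i k : ℝ) = c * co (t.vertex i) k) → allDescendants Q m t.type V = true →
    ∀ s ∈ Elt.descendants m t, ∃ V' : Fin (d + 1) → Fin n → ℤ, Q V' = true ∧
      ∀ i k, (V' i k : ℝ) = 2 ^ m * c * co (s.vertex i) k := by
  induction m with
  | zero =>
    intro t V c hV hQ s hs
    obtain rfl : s = t := hs
    exact ⟨V, hQ, by simpa using hV⟩
  | succ m ih =>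
    intro t V c hV hQ s hs
    simp only [allDescendants, Bool.and_eq_true] at hQ
    rcases hs with hs | hs
    · obtain ⟨V', h1, h2⟩ := ih t.child₀ _ (2 * c) (child₀_coords t co hV) hQ.1 s hs
      exact ⟨V', h1, fun i k => by rw [h2]; ring⟩
    · obtain ⟨V', h1, h2⟩ := ih t.child₁ _ (2 * c) (child₁_coords t co hV) hQ.2 s hs
      exact ⟨V', h1, fun i k => by rw [h2]; ring⟩

/-- With the trivial property, `exists_intCoords` still provides the integrality of the scaled
coordinates; `coord_mul_two_pow` needs nothing else. -/
theorem allDescendants_true {d n : ℕ} (m : ℕ) : ∀ (τ : ZMod 3) (V : Fin (d + 1) → Fin n → ℤ),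
    allDescendants (fun _ => true) m τ V = true := by
  induction m with
  | zero => intros; rfl
  | succ m ih => intro τ V; simp [allDescendants, ih]

/-! ### Bubble functions -/

/-- The positive part of the minimum of a list of linear forms (and of the number `8`). -/
def bubble {n : ℕ} (gs : List (Fin n → ℤ)) (μ : Fin n → ℝ) : ℝ :=
  max 0 (gs.foldr (fun g r => min (realForm g μ) r) 8)

theorem foldr_min_le {n : ℕ} {gs : List (Fin n → ℤ)} {μ : Fin n → ℝ} {g : Fin n → ℤ}
    (hg : g ∈ gs) : gs.foldr (fun g r => min (realForm g μ) r) 8 ≤ realForm g μ := by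
  induction gs with
  | nil => simp at hg
  | cons a l ih =>
    rcases List.mem_cons.1 hg with rfl | h
    · exact min_le_left _ _
    · exact (min_le_right _ _).trans (ih h)

theorem foldr_min_le_eight {n : ℕ} (gs : List (Fin n → ℤ)) (μ : Fin n → ℝ) :
    gs.foldr (fun g r => min (realForm g μ) r) 8 ≤ 8 := by
  induction gs with
  | nil => simp
  | cons a l ih => exact (min_le_right _ _).trans ih

theorem le_foldr_min {n : ℕ} {gs : List (Fin n → ℤ)} {μ : Fin n → ℝ} {r : ℝ}
    (h : ∀ g ∈ gs, r ≤ realForm g μ) (h8 : r ≤ 8) :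
    r ≤ gs.foldr (fun g r => min (realForm g μ) r) 8 := by
  induction gs with
  | nil => simpa using h8
  | cons a l ih =>
    exact le_min (h a List.mem_cons_self) (ih fun g hg => h g (List.mem_cons_of_mem _ hg))

theorem bubble_nonneg {n : ℕ} (gs : List (Fin n → ℤ)) (μ : Fin n → ℝ) : 0 ≤ bubble gs μ :=
  le_max_left _ _

theorem bubble_le_eight {n : ℕ} (gs : List (Fin n → ℤ)) (μ : Fin n → ℝ) : bubble gs μ ≤ 8 :=
  max_le (by norm_num) (foldr_min_le_eight _ _)

theorem bubble_pos {n : ℕ} {gs : List (Fin n → ℤ)} {μ : Fin n → ℝ}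
    (h : ∀ g ∈ gs, 0 < realForm g μ) : 0 < bubble gs μ := by
  refine lt_max_of_lt_right ?_
  induction gs with
  | nil => norm_num
  | cons a l ih =>
    exact lt_min (h a List.mem_cons_self) (ih fun g hg => h g (List.mem_cons_of_mem _ hg))

theorem bubble_eq_zero {n : ℕ} {gs : List (Fin n → ℤ)} {μ : Fin n → ℝ} {g : Fin n → ℤ}
    (hg : g ∈ gs) (h : realForm g μ ≤ 0) : bubble gs μ = 0 :=
  max_eq_left ((foldr_min_le hg).trans h)

/-- The seed `8` of the fold must not be the minimum. It is not on the simplex, where forms with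
coefficients at most `8` are at most `8`; its benefit is a bound of the bubble at every point. -/
theorem bubble_eq_form {n : ℕ} {gs : List (Fin n → ℤ)} {μ : Fin n → ℝ} {g : Fin n → ℤ}
    (hg : g ∈ gs) (h0 : 0 ≤ realForm g μ) (h8 : realForm g μ ≤ 8)
    (h : ∀ g' ∈ gs, realForm g μ ≤ realForm g' μ) : bubble gs μ = realForm g μ := by
  have : gs.foldr (fun g r => min (realForm g μ) r) 8 = realForm g μ :=
    le_antisymm (foldr_min_le hg) (le_foldr_min h h8)
  rw [bubble, this, max_eq_right h0]

/-- A minimum is at most the mean of any two of its entries. -/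
theorem bubble_le_of_forms {n : ℕ} {gs hs : List (Fin n → ℤ)} {μ : Fin n → ℝ}
    (h : ∀ f ∈ hs, ∃ g ∈ gs, ∃ g' ∈ gs, realForm g μ + realForm g' μ ≤ 2 * realForm f μ) :
    bubble gs μ ≤ bubble hs μ := by
  refine max_le_max le_rfl (le_foldr_min (fun f hf => ?_) (foldr_min_le_eight _ _))
  obtain ⟨g, hg, g', hg', hle⟩ := h f hf
  linarith [foldr_min_le (μ := μ) hg, foldr_min_le (μ := μ) hg']

/-- A list of forms that defines a bubble function which is linear on the descendants of generation
`m` of a simplex of type `τ` and vanishes on the faces in `F`. -/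
structure IsBubbleForms {d : ℕ} (m : ℕ) (τ : ZMod 3) (F : Finset (Fin (d + 1)))
    (gs : List (Fin (d + 1) → ℤ)) : Prop where
  linear : allDescendants (linearOnSimplex gs) m τ (intUnit (n := d + 1)) = true
  le_eight : ∀ g ∈ gs, ∀ k, g k ≤ 8
  -- On the face `μ k = 0` the two forms have a nonpositive sum, so one of them is nonpositive
  -- there. Thus `F` lists the vertices opposite to the faces on which the bubble vanishes.
  vanish : ∀ k ∈ F, ∃ g ∈ gs, ∃ g' ∈ gs, ∀ j, j ≠ k → g j + g' j ≤ 0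
  -- After normalization this is a point in the relative interior of the face spanned by the
  -- vertices in `F`, where the bubble is positive.
  pos : ∃ c : Fin (d + 1) → ℤ, (∀ k, 0 ≤ c k) ∧ (∀ k, k ∈ F ↔ 0 < c k) ∧
    ∀ g ∈ gs, 0 < intForm g c

/-- The forms of a bubble function on a side in dimension `d` with first refinement edge
`(a, b)`. -/
def traceForms (d : ℕ) (a b : Fin (d + 1)) : List (Fin (d + 1) → ℤ) :=
  if d = 2 then [fun k => if k = a then 2 else 0, fun k => if k = b then 2 else 0]
  -- As the coordinates add up to one, the last two forms are `2 - 4 μ a` and `2 - 4 μ b`. On a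
  -- triangle this is the tent of height one whose peak, with coordinates `1/4, 1/4, 1/2`, is the
  -- midpoint of the median that ends on the edge `(a, b)`.
  else [fun k => if k = a then 4 else 0, fun k => if k = b then 4 else 0,
    fun k => if k = a then -2 else 2, fun k => if k = b then -2 else 2]

/-- The restrictions of the two lists of forms to the face opposite to the vertex `i`
define the same bubble function. -/
def SameTrace {n : ℕ} (i : Fin n) (gs hs : List (Fin n → ℤ)) : Prop :=
  (∀ f ∈ hs, ∃ g ∈ gs, ∃ g' ∈ gs, ∀ k, k ≠ i → g k + g' k ≤ 2 * f k) ∧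
  (∀ f ∈ gs, ∃ g ∈ hs, ∃ g' ∈ hs, ∀ k, k ≠ i → g k + g' k ≤ 2 * f k)

/-- Forms of bubble functions of a triangle. -/
def elementForms₂ : List (Fin 3 → ℤ) := [![4, 0, 0], ![0, 4, 0], ![-2, 2, 2], ![2, -2, 2]]

/-- Forms of bubble functions of the sides of a triangle. -/
def sideForms₂ : Fin 3 → List (Fin 3 → ℤ) :=
  ![[![-2, 2, 0], ![0, 0, 2]], [![2, -2, 0], ![0, 0, 2]], [![2, 0, 0], ![0, 2, 0]]]

/-- The first refinement edge of a side of a triangle. -/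
def sideEdge₂ : Fin 3 → Fin 3 × Fin 3 := ![(1, 2), (0, 2), (0, 1)]

/-- Forms of bubble functions of a tetrahedron. -/
def elementForms₃ (τ : ZMod 3) : List (Fin 4 → ℤ) :=
  if τ = 0 then [![0, 0, 0, 4], ![2, 2, -2, 2], ![-4, 4, 4, 0], ![-2, 6, 2, -2], ![0, 0, 4, 0],
    ![2, 2, 2, -2], ![4, -4, 0, 4], ![6, -2, -2, 2]]
  else if τ = 1 then [![0, 0, 0, 4], ![-2, 6, -2, 2], ![-4, 4, 4, 0], ![2, 2, 2, -2],
    ![6, -2, -2, 2], ![4, -4, 4, 0]]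
  else [![0, 8, 0, 0], ![2, 2, 2, -2], ![-4, 4, 4, 4], ![-2, -2, 6, 2], ![0, 0, 0, 4],
    ![2, -6, 2, 2], ![4, 4, -4, 0], ![6, -2, -2, -2]]

/-- Forms of bubble functions of the sides of a tetrahedron. -/
def sideForms₃ (τ : ZMod 3) : Fin 4 → List (Fin 4 → ℤ) :=
  if τ = 0 then ![
    [![-4, 4, 0, 0], ![0, 0, 0, 4], ![-2, -2, 2, 2], ![-6, 2, 2, -2]],
    [![4, -4, 0, 0], ![0, 0, 4, 0], ![-2, -2, 2, 2], ![2, -6, -2, 2]],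
    [![4, 0, 0, 0], ![0, 4, 0, 0], ![-2, 2, 2, 2], ![2, -2, -2, 2]],
    [![4, 0, 0, 0], ![0, 4, 0, 0], ![-2, 2, 2, -2], ![2, -2, 2, 2]]]
  else if τ = 1 then ![
    [![-4, 4, 0, 0], ![0, 0, 4, 0], ![2, -2, 2, 2], ![-2, 2, -2, 2]],
    [![4, -4, 0, 0], ![0, 0, 4, 0], ![-2, 2, 2, 2], ![2, -2, -2, 2]],
    [![4, 0, 0, 0], ![0, 4, 0, 0], ![-2, 2, -2, 2], ![2, -2, -2, 2]],
    [![4, 0, 0, 0], ![0, 4, 0, 0], ![-2, 2, 2, -2], ![2, -2, 2, -2]]]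
  else ![
    [![-4, 4, 0, 0], ![0, 0, 4, 0], ![-2, -2, 2, 2], ![2, 2, -2, 2]],
    [![4, -4, 0, 0], ![0, 0, 4, 0], ![-2, -2, 2, 2], ![2, 2, -2, 2]],
    [![4, 0, 0, 0], ![0, 4, 0, 0], ![-2, 2, 2, 2], ![2, -2, 2, 2], ![0, 0, 0, 2], ![2, 2, -2, 0]],
    [![4, 0, 0, 0], ![0, 4, 0, 0], ![-2, 2, 2, 0], ![2, -2, 2, 0]]]

/-- The first refinement edge of a side of a tetrahedron. -/
def sideEdge₃ (τ : ZMod 3) : Fin 4 → Fin 4 × Fin 4 :=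
  if τ = 0 then ![(1, 3), (0, 2), (0, 1), (0, 1)] else ![(1, 2), (0, 2), (0, 1), (0, 1)]

/-- All descendants are enumerated with scaled integer vertices, so each condition is a finite
check. The same method serves the other three families. -/
theorem isBubbleForms_element₂ (τ : ZMod 3) :
    IsBubbleForms (d := 2) 3 τ Finset.univ elementForms₂ where
  linear := by revert τ; decide +kernel
  le_eight := by decide +kernel
  vanish := by decide +kernel
  -- The peak: the midpoint between `z₂` and the midpoint of `z₀z₁`, a vertex that appears with the
  -- third bisection.
  pos := ⟨![1, 1, 2], by decide +kernel, by decide +kernel, by decide +kernel⟩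

theorem isBubbleForms_side₂ (τ : ZMod 3) (i : Fin 3) :
    IsBubbleForms (d := 2) 3 τ (Finset.univ.erase i) (sideForms₂ i) where
  linear := by revert τ i; decide +kernel
  le_eight := by revert i; decide +kernel
  vanish := by revert i; decide +kernel
  pos := ⟨fun k => if k = i then 0 else 1, by revert i; decide +kernel,
    by revert i; decide +kernel, by revert i; decide +kernel⟩

theorem isBubbleForms_element₃ (τ : ZMod 3) :
    IsBubbleForms (d := 3) 6 τ Finset.univ (elementForms₃ τ) where
  linear := by revert τ; decide +kernel
  le_eight := by revert τ; decide +kernel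
  vanish := by revert τ; decide +kernel
  -- The peak of the bubble: divided by the sum of the entries, it is a point at which every form
  -- equals `1`.
  pos := ⟨if τ = 2 then ![3, 1, 2, 2] else ![1, 1, 1, 1], by revert τ; decide +kernel,
    by revert τ; decide +kernel, by revert τ; decide +kernel⟩

theorem isBubbleForms_side₃ (τ : ZMod 3) (i : Fin 4) :
    IsBubbleForms (d := 3) 6 τ (Finset.univ.erase i) (sideForms₃ τ i) where
  linear := by revert τ i; decide +kernel
  le_eight := by revert τ i; decide +kernel
  vanish := by revert τ i; decide +kernel
  -- Weight one on the ends of the first refinement edge and two on the third vertex of the side: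
  -- the midpoint of the median.
  pos := ⟨fun k => if k = i then 0 else if k = (sideEdge₃ τ i).1 ∨ k = (sideEdge₃ τ i).2 then 1
    else 2, by revert τ i; decide +kernel, by revert τ i; decide +kernel,
    by revert τ i; decide +kernel⟩

/-- The forms of an element depend on its vertex order, and for `d = 3` on its type. This reduces
the trace on a side to data of the side itself, namely its first refinement edge, so that two
neighbours can be compared. -/
theorem sameTrace₂ (i : Fin 3) :
    SameTrace i (sideForms₂ i) (traceForms 2 (sideEdge₂ i).1 (sideEdge₂ i).2) := by
  unfold SameTrace; revert i; decide +kernel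

theorem sameTrace₃ (τ : ZMod 3) (i : Fin 4) :
    SameTrace i (sideForms₃ τ i) (traceForms 3 (sideEdge₃ τ i).1 (sideEdge₃ τ i).2) := by
  unfold SameTrace; revert τ i; decide +kernel

/-- The descendants of generation two do not cross the median of a side that starts from the
midpoint of the first refinement edge. -/
theorem medianForms₃ (τ : ZMod 3) (i : Fin 4) :
    allDescendants (d := 3) (someNonneg
      [fun k => if k = (sideEdge₃ τ i).1 then 1 else if k = (sideEdge₃ τ i).2 then -1 else
          if k = i then 4 else 0,
        fun k => if k = (sideEdge₃ τ i).1 then -1 else if k = (sideEdge₃ τ i).2 then 1 else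
          if k = i then 4 else 0]) 2 τ (intUnit (n := 4)) = true := by
  revert τ i; decide +kernel

theorem sideEdge₃_ne (τ : ZMod 3) (i : Fin 4) : (sideEdge₃ τ i).1 ≠ i ∧ (sideEdge₃ τ i).2 ≠ i ∧
    (sideEdge₃ τ i).1 ≠ (sideEdge₃ τ i).2 := by
  revert τ i; decide +kernel

theorem sideEdge₂_ne (i : Fin 3) : (sideEdge₂ i).1 ≠ i ∧ (sideEdge₂ i).2 ≠ i ∧
    (sideEdge₂ i).1 ≠ (sideEdge₂ i).2 := by
  revert i; decide +kernel

/-- Forms of a bubble function of a simplex. -/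
def elementForms : (d : ℕ) → ZMod 3 → List (Fin (d + 1) → ℤ)
  | 2, _ => elementForms₂
  | 3, τ => elementForms₃ τ
  | _, _ => []

/-- Forms of bubble functions of the sides of a simplex. -/
def sideForms : (d : ℕ) → ZMod 3 → Fin (d + 1) → List (Fin (d + 1) → ℤ)
  | 2, _, i => sideForms₂ i
  | 3, τ, i => sideForms₃ τ i
  | _, _, _ => []

/-- The first refinement edge of a side of a simplex. -/
def sideEdge : (d : ℕ) → ZMod 3 → Fin (d + 1) → Fin (d + 1) × Fin (d + 1)
  | 2, _, i => sideEdge₂ i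
  | 3, τ, i => sideEdge₃ τ i
  | _, _, _ => (0, 0)

theorem isBubbleForms_element {d : ℕ} (hd : d = 2 ∨ d = 3) (τ : ZMod 3) :
    IsBubbleForms (bisectionNumber d) τ Finset.univ (elementForms d τ) := by
  rcases hd with rfl | rfl
  · exact isBubbleForms_element₂ τ
  · exact isBubbleForms_element₃ τ

theorem isBubbleForms_side {d : ℕ} (hd : d = 2 ∨ d = 3) (τ : ZMod 3) (i : Fin (d + 1)) :
    IsBubbleForms (bisectionNumber d) τ (Finset.univ.erase i) (sideForms d τ i) := by
  rcases hd with rfl | rfl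
  · exact isBubbleForms_side₂ τ i
  · exact isBubbleForms_side₃ τ i

theorem sameTrace_side {d : ℕ} (hd : d = 2 ∨ d = 3) (τ : ZMod 3) (i : Fin (d + 1)) :
    SameTrace i (sideForms d τ i) (traceForms d (sideEdge d τ i).1 (sideEdge d τ i).2) := by
  rcases hd with rfl | rfl
  · exact sameTrace₂ i
  · exact sameTrace₃ τ i

/-! ### Descendants and bisection refinements -/

theorem Elt.vertex_mem_carrier {d : ℕ} (t : Elt d) (i : Fin (d + 1)) : t.vertex i ∈ t.carrier :=
  subset_convexHull ℝ _ (mem_range_self i)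

theorem Elt.convex_carrier {d : ℕ} (t : Elt d) : Convex ℝ t.carrier := convex_convexHull ℝ _

theorem Elt.newVertex_mem_carrier {d : ℕ} (t : Elt d) : t.newVertex ∈ t.carrier :=
  t.convex_carrier.midpoint_mem (t.vertex_mem_carrier 0) (t.vertex_mem_carrier 1)

theorem Elt.carrier_child₀_subset {d : ℕ} (t : Elt d) : t.child₀.carrier ⊆ t.carrier := by
  refine convexHull_min ?_ t.convex_carrier
  rintro _ ⟨i, rfl⟩
  simp only [Elt.child₀]
  split_ifs
  exacts [t.vertex_mem_carrier _, t.newVertex_mem_carrier, t.vertex_mem_carrier _]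

theorem Elt.carrier_child₁_subset {d : ℕ} (t : Elt d) : t.child₁.carrier ⊆ t.carrier := by
  refine convexHull_min ?_ t.convex_carrier
  rintro _ ⟨i, rfl⟩
  simp only [Elt.child₁]
  split_ifs
  exacts [t.vertex_mem_carrier _, t.newVertex_mem_carrier, t.vertex_mem_carrier _,
    t.vertex_mem_carrier _]

theorem carrier_subset_of_mem_descendants {d : ℕ} (n : ℕ) : ∀ {t s : Elt d},
    s ∈ Elt.descendants n t → s.carrier ⊆ t.carrier := by
  induction n with
  | zero => rintro t s rfl; exact subset_rfl
  | succ n ih =>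
    rintro t s (h | h)
    · exact (ih h).trans t.carrier_child₀_subset
    · exact (ih h).trans t.carrier_child₁_subset

theorem mem_descendants_add {d : ℕ} (m n : ℕ) : ∀ {t s : Elt d},
    s ∈ Elt.descendants (m + n) t ↔ ∃ r ∈ Elt.descendants m t, s ∈ Elt.descendants n r := by
  induction m with
  | zero => intro t s; simp [Elt.descendants]
  | succ m ih =>
    intro t s
    rw [Nat.succ_add]
    simp only [Elt.descendants, mem_union, ih]
    constructor
    · rintro (⟨r, h1, h2⟩ | ⟨r, h1, h2⟩)
      exacts [⟨r, Or.inl h1, h2⟩, ⟨r, Or.inr h1, h2⟩]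
    · rintro ⟨r, h1 | h1, h2⟩
      exacts [Or.inl ⟨r, h1, h2⟩, Or.inr ⟨r, h1, h2⟩]

theorem mem_convexHull_range {d n : ℕ} {v : Fin n → E d} {x : E d}
    (h : x ∈ convexHull ℝ (range v)) :
    ∃ w : Fin n → ℝ, (∀ i, 0 ≤ w i) ∧ ∑ i, w i = 1 ∧ ∑ i, w i • v i = x := by
  rw [convexHull_range_eq_exists_affineCombination] at h
  obtain ⟨s, w, hw0, hw1, rfl⟩ := h
  refine ⟨fun i => if i ∈ s then w i else 0, fun i => ?_, ?_, ?_⟩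
  · dsimp only; split_ifs with h
    exacts [hw0 i h, le_rfl]
  · simpa using hw1
  · rw [s.affineCombination_eq_linear_combination _ _ hw1]
    simp [ite_smul]

/-- If `w 1 ≤ w 0`, then `w 0 • z 0 + w 1 • z 1 = (w 0 - w 1) • z 0 + (2 * w 1) • m` with the
midpoint `m`: again a convex combination, now of the vertices of a child. -/
theorem sum_mem_of_midpoint {d e : ℕ} {C : Set (E d)} (hC : Convex ℝ C) {z : Fin (e + 2) → E d}
    {w : Fin (e + 2) → ℝ} (hw0 : ∀ i, 0 ≤ w i) (hw1 : ∑ i, w i = 1) (h : w 1 ≤ w 0)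
    (hz : z 0 ∈ C) (hm : midpoint ℝ (z 0) (z 1) ∈ C) (hs : ∀ j : Fin e, z j.succ.succ ∈ C) :
    ∑ i, w i • z i ∈ C := by
  have e1 : ∑ i, w i • z i = ∑ i, (Fin.cons (w 0 - w 1) (Fin.cons (2 * w 1)
      fun j => w j.succ.succ) : Fin (e + 2) → ℝ) i • (Fin.cons (z 0) (Fin.cons
      (midpoint ℝ (z 0) (z 1)) fun j => z j.succ.succ) : Fin (e + 2) → E d) i := by
    have hm : (2 : ℝ) • midpoint ℝ (z 0) (z 1) = z 0 + z 1 := by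
      rw [midpoint_eq_smul_add, invOf_eq_inv, smul_inv_smul₀ two_ne_zero]
    simp only [Fin.sum_univ_succ, Fin.cons_zero, Fin.cons_succ, Fin.succ_zero_eq_one]
    rw [mul_comm 2, mul_smul, hm]
    module
  rw [e1]
  refine hC.sum_mem (fun i _ => ?_) ?_ (fun i _ => ?_)
  · refine Fin.cases (sub_nonneg.2 h) (fun i => ?_) i
    refine Fin.cases (mul_nonneg zero_le_two (hw0 1)) (fun j => hw0 _) i
  · simp only [Fin.sum_univ_succ, Fin.cons_zero, Fin.cons_succ, Fin.succ_zero_eq_one] at hw1 ⊢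
    linarith
  · refine Fin.cases hz (fun i => ?_) i
    exact Fin.cases hm (fun j => hs j) i

theorem Elt.sum_mem_carrier_child₀ {d : ℕ} (hd : d = 2 ∨ d = 3) (t : Elt d) {w : Fin (d + 1) → ℝ}
    (hw0 : ∀ i, 0 ≤ w i) (hw1 : ∑ i, w i = 1) (h : w 1 ≤ w 0) :
    ∑ i, w i • t.vertex i ∈ t.child₀.carrier := by
  have hz := t.child₀.vertex_mem_carrier
  rcases hd with rfl | rfl
  · refine sum_mem_of_midpoint (e := 1) (Elt.convex_carrier _) hw0 hw1 h (hz 0) (hz 2) fun j => ?_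
    fin_cases j
    exact hz 1
  · refine sum_mem_of_midpoint (e := 2) (Elt.convex_carrier _) hw0 hw1 h (hz 0) (hz 3) fun j => ?_
    fin_cases j
    exacts [hz 1, hz 2]

theorem Elt.sum_mem_carrier_child₁ {d : ℕ} (hd : d = 2 ∨ d = 3) (t : Elt d) {w : Fin (d + 1) → ℝ}
    (hw0 : ∀ i, 0 ≤ w i) (hw1 : ∑ i, w i = 1) (h : w 0 ≤ w 1) :
    ∑ i, w i • t.vertex i ∈ t.child₁.carrier := by
  have hz := t.child₁.vertex_mem_carrier
  have key : ∑ i, w (Equiv.swap 0 1 i) • t.vertex (Equiv.swap 0 1 i) ∈ t.child₁.carrier := by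
    have hw1' : ∑ i, w (Equiv.swap 0 1 i) = 1 := by
      rw [← hw1]; exact Equiv.sum_comp (Equiv.swap 0 1) w
    rcases hd with rfl | rfl
    · refine sum_mem_of_midpoint (e := 1) (z := fun i => t.vertex (Equiv.swap 0 1 i))
        (w := fun i => w (Equiv.swap 0 1 i)) (Elt.convex_carrier _)
        (fun i => hw0 _) hw1' h (hz 0) ?_ fun j => ?_
      · rw [midpoint_comm]; exact hz 2
      · fin_cases j
        have := hz 1
        simp only [Elt.child₁] at this
        by_cases ht : t.type = 0
        · rw [if_pos ht] at this; exact this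
        · rw [if_neg ht] at this; exact this
    · refine sum_mem_of_midpoint (e := 2) (z := fun i => t.vertex (Equiv.swap 0 1 i))
        (w := fun i => w (Equiv.swap 0 1 i)) (Elt.convex_carrier _)
        (fun i => hw0 _) hw1' h (hz 0) ?_ fun j => ?_
      · rw [midpoint_comm]; exact hz 3
      · have h1 := hz 1
        have h2 := hz 2
        simp only [Elt.child₁] at h1 h2
        by_cases ht : t.type = 0
        · rw [if_pos ht] at h1 h2
          fin_cases j
          exacts [h2, h1]
        · rw [if_neg ht] at h1 h2
          fin_cases j
          exacts [h1, h2]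
  rwa [Equiv.sum_comp (Equiv.swap 0 1) fun i => w i • t.vertex i] at key

theorem Elt.carrier_subset_union {d : ℕ} (hd : d = 2 ∨ d = 3) (t : Elt d) :
    t.carrier ⊆ t.child₀.carrier ∪ t.child₁.carrier := by
  intro x hx
  obtain ⟨w, hw0, hw1, rfl⟩ := mem_convexHull_range hx
  rcases le_total (w 1) (w 0) with h | h
  · exact Or.inl (t.sum_mem_carrier_child₀ hd hw0 hw1 h)
  · exact Or.inr (t.sum_mem_carrier_child₁ hd hw0 hw1 h)

theorem exists_ancestor {d : ℕ} {𝒯 𝒯' : Mesh d} (h : IsBisectionRefinement 𝒯 𝒯') {s : Elt d}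
    (hs : s ∈ 𝒯') : ∃ t ∈ 𝒯, ∃ n, s ∈ Elt.descendants n t := by
  induction h generalizing s with
  | refl => exact ⟨s, hs, 0, rfl⟩
  | tail h1 h2 ih =>
    obtain ⟨r, hr, rfl⟩ := h2
    simp only [Finset.mem_insert, Finset.mem_erase] at hs
    rcases hs with rfl | rfl | ⟨-, hs⟩
    · obtain ⟨t, ht, n, hn⟩ := ih hr
      exact ⟨t, ht, n + 1, (mem_descendants_add n 1).2 ⟨r, hn, Or.inl rfl⟩⟩
    · obtain ⟨t, ht, n, hn⟩ := ih hr
      exact ⟨t, ht, n + 1, (mem_descendants_add n 1).2 ⟨r, hn, Or.inr rfl⟩⟩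
    · exact ih hs

/-- A bisection replaces an element by two children that cover it, so a point stays covered by
descendants of the element it came from. -/
theorem exists_descendant {d : ℕ} (hd : d = 2 ∨ d = 3) {𝒯 𝒯' : Mesh d}
    (h : IsBisectionRefinement 𝒯 𝒯') {t : Elt d} (ht : t ∈ 𝒯) {x : E d} (hx : x ∈ t.carrier) :
    ∃ s ∈ 𝒯', (∃ n, s ∈ Elt.descendants n t) ∧ x ∈ s.carrier := by
  induction h with
  | refl => exact ⟨t, ht, ⟨0, rfl⟩, hx⟩
  | tail h1 h2 ih =>
    classical
    obtain ⟨r, hr, rfl⟩ := h2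
    obtain ⟨s, hs, ⟨n, hn⟩, hxs⟩ := ih
    by_cases hsr : s = r
    · subst hsr
      rcases s.carrier_subset_union hd hxs with hx0 | hx1
      · exact ⟨_, Finset.mem_insert_self _ _,
          ⟨n + 1, (mem_descendants_add n 1).2 ⟨s, hn, Or.inl rfl⟩⟩, hx0⟩
      · exact ⟨_, Finset.mem_insert_of_mem (Finset.mem_insert_self _ _),
          ⟨n + 1, (mem_descendants_add n 1).2 ⟨s, hn, Or.inr rfl⟩⟩, hx1⟩
    · exact ⟨s, Finset.mem_insert_of_mem (Finset.mem_insert_of_mem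
        (Finset.mem_erase.2 ⟨hsr, hs⟩)), ⟨n, hn⟩, hxs⟩

/-! ### Barycentric coordinates -/

/-- The vertices of a nondegenerate simplex form an affine basis. -/
def Elt.basis {d : ℕ} (t : Elt d) (h : AffineIndependent ℝ t.vertex) :
    AffineBasis (Fin (d + 1)) ℝ (E d) :=
  ⟨t.vertex, h, h.affineSpan_eq_top_iff_card_eq_finrank_add_one.2 (by simp)⟩

theorem Elt.basis_apply {d : ℕ} (t : Elt d) (h : AffineIndependent ℝ t.vertex) (i : Fin (d + 1)) :
    t.basis h i = t.vertex i := rfl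

theorem Elt.carrier_eq {d : ℕ} (t : Elt d) (h : AffineIndependent ℝ t.vertex) :
    t.carrier = {x | ∀ i, 0 ≤ (t.basis h).coord i x} :=
  (t.basis h).convexHull_eq_nonneg_coord

theorem Elt.interior_carrier {d : ℕ} (t : Elt d) (h : AffineIndependent ℝ t.vertex) :
    interior t.carrier = {x | ∀ i, 0 < (t.basis h).coord i x} :=
  (t.basis h).interior_convexHull

theorem convexHull_face {d n : ℕ} (b : AffineBasis (Fin (n + 1)) ℝ (E d)) (i : Fin (n + 1)) :
    convexHull ℝ (b '' {i}ᶜ) = {x | (∀ k, 0 ≤ b.coord k x) ∧ b.coord i x = 0} := by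
  apply Subset.antisymm
  · refine convexHull_min ?_ ?_
    · rintro _ ⟨k, hk, rfl⟩
      refine ⟨fun j => ?_, b.coord_apply_ne (Ne.symm hk)⟩
      rw [b.coord_apply]; split_ifs <;> norm_num
    · intro x hx y hy r s hr hs hrs
      simp only [mem_ofPred_eq] at hx hy ⊢
      have key : ∀ k, b.coord k (r • x + s • y) = r * b.coord k x + s * b.coord k y := by
        intro k
        have := Convex.combo_affine_apply (f := b.coord k) hrs (x := x) (y := y)
        simpa using this
      refine ⟨fun k => ?_, ?_⟩
      · rw [key]; exact add_nonneg (mul_nonneg hr (hx.1 k)) (mul_nonneg hs (hy.1 k))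
      · rw [key, hx.2, hy.2]; simp
  · rintro x ⟨h0, hi⟩
    have hsum := b.sum_coord_apply_eq_one x
    have hx := b.linear_combination_coord_eq_self x
    rw [← Finset.add_sum_erase _ _ (Finset.mem_univ i), hi, zero_add] at hsum
    rw [← Finset.add_sum_erase _ _ (Finset.mem_univ i), hi, zero_smul, zero_add] at hx
    rw [← hx]
    refine (convex_convexHull ℝ _).sum_mem (fun k _ => h0 k) hsum fun k hk => ?_
    exact subset_convexHull ℝ _ ⟨k, by simpa using (Finset.mem_erase.1 hk).1, rfl⟩

/-- `T` and `T'` share the side opposite to the vertex `i` of `T` and `i'` of `T'`. -/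
structure IsSharedSide {d : ℕ} (t t' : Elt d) (i i' : Fin (d + 1)) : Prop where
  left : range t.vertex ∩ range t'.vertex = t.vertex '' {i}ᶜ
  right : range t.vertex ∩ range t'.vertex = t'.vertex '' {i'}ᶜ

theorem IsSharedSide.symm {d : ℕ} {t t' : Elt d} {i i' : Fin (d + 1)}
    (h : IsSharedSide t t' i i') : IsSharedSide t' t i' i :=
  ⟨by rw [inter_comm, h.right], by rw [inter_comm, h.left]⟩

theorem exists_opposite {d : ℕ} {t t' : Elt d} (hi : Function.Injective t.vertex)
    (h : (range t.vertex ∩ range t'.vertex).ncard = d) :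
    ∃ i, range t.vertex ∩ range t'.vertex = t.vertex '' {i}ᶜ := by
  have e : range t.vertex ∩ range t'.vertex = t.vertex '' (t.vertex ⁻¹' range t'.vertex) := by
    rw [image_preimage_eq_inter_range, inter_comm]
  rw [e, ncard_image_of_injective _ hi] at h
  have h2 := ncard_add_ncard_compl (t.vertex ⁻¹' range t'.vertex)
  rw [h, Nat.card_eq_fintype_card, Fintype.card_fin] at h2
  obtain ⟨i, hi⟩ := ncard_eq_one.1 (show (t.vertex ⁻¹' range t'.vertex)ᶜ.ncard = 1 by omega)
  exact ⟨i, by rw [e, ← hi, compl_compl]⟩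

theorem exists_isSharedSide {d : ℕ} {t t' : Elt d} (hi : Function.Injective t.vertex)
    (hi' : Function.Injective t'.vertex) (h : (range t.vertex ∩ range t'.vertex).ncard = d) :
    ∃ i i', IsSharedSide t t' i i' := by
  obtain ⟨i, h1⟩ := exists_opposite hi h
  obtain ⟨i', h2⟩ := exists_opposite hi' (t' := t) (by rwa [inter_comm])
  exact ⟨i, i', h1, by rw [inter_comm, h2]⟩

theorem IsSharedSide.exists_index {d : ℕ} {t t' : Elt d} {i i' : Fin (d + 1)}
    (h : IsSharedSide t t' i i') {k : Fin (d + 1)} (hk : k ≠ i) :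
    ∃ k', k' ≠ i' ∧ t.vertex k = t'.vertex k' := by
  have : t.vertex k ∈ t'.vertex '' {i'}ᶜ := by
    rw [← h.right, h.left]; exact ⟨k, hk, rfl⟩
  obtain ⟨k', hk', e⟩ := this
  exact ⟨k', hk', e.symm⟩

/-- The difference of the two coordinates is affine and vanishes at all common vertices, hence on
their convex hull. -/
theorem coord_eq_coord {d : ℕ} {t t' : Elt d} (ht : AffineIndependent ℝ t.vertex)
    (ht' : AffineIndependent ℝ t'.vertex) {k k' : Fin (d + 1)} (hk : t.vertex k = t'.vertex k')
    {x : E d} (hx : x ∈ convexHull ℝ (range t.vertex ∩ range t'.vertex)) :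
    (t.basis ht).coord k x = (t'.basis ht').coord k' x := by
  have hsub : range t.vertex ∩ range t'.vertex ⊆
      {x | ((t.basis ht).coord k - (t'.basis ht').coord k') x ∈ ({0} : Set ℝ)} := by
    rintro _ ⟨⟨j, rfl⟩, ⟨j', hj⟩⟩
    show (t.basis ht).coord k (t.vertex j) - (t'.basis ht').coord k' (t.vertex j) = 0
    rw [← t.basis_apply ht, AffineBasis.coord_apply, t.basis_apply, ← hj, ← t'.basis_apply ht',
      AffineBasis.coord_apply]
    have : k = j ↔ k' = j' := by
      rw [← ht.injective.eq_iff, ← ht'.injective.eq_iff, hj, hk]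
    simp [this]
  have hc : Convex ℝ {x | ((t.basis ht).coord k - (t'.basis ht').coord k') x ∈ ({0} : Set ℝ)} :=
    (convex_singleton (𝕜 := ℝ) (0 : ℝ)).affine_preimage _
  exact sub_eq_zero.1 (convexHull_min hsub hc hx)

theorem IsSharedSide.coord_eq_zero {d : ℕ} {t t' : Elt d} {i i' : Fin (d + 1)}
    (h : IsSharedSide t t' i i') (ht : AffineIndependent ℝ t.vertex)
    {x : E d} (hx : x ∈ convexHull ℝ (range t.vertex ∩ range t'.vertex)) :
    (t.basis ht).coord i x = 0 := by
  rw [h.left] at hx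
  exact ((convexHull_face (t.basis ht) i).subset hx).2

/-! ### Bubble functions on a simplex -/

theorem nonneg_on_carrier {d : ℕ} (s : Elt d) (f : E d →ᵃ[ℝ] ℝ) (h : ∀ i, 0 ≤ f (s.vertex i))
    {x : E d} (hx : x ∈ s.carrier) : 0 ≤ f x := by
  have : s.carrier ⊆ f ⁻¹' Ici 0 :=
    convexHull_min (by rintro _ ⟨i, rfl⟩; exact h i) ((convex_Ici 0).affine_preimage f)
  exact this hx

/-- A linear form in affine coordinates. -/
def formMap {n : ℕ} (g : Fin n → ℤ) : (Fin n → ℝ) →ₗ[ℝ] ℝ :=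
  ∑ k, (g k : ℝ) • LinearMap.proj k

theorem formMap_apply {n : ℕ} (g : Fin n → ℤ) (μ : Fin n → ℝ) : formMap g μ = realForm g μ := by
  simp [formMap, realForm]

theorem realForm_coords_unit {d : ℕ} (t : Elt d) (ht : AffineIndependent ℝ t.vertex)
    (i k : Fin (d + 1)) :
    (intUnit i k : ℝ) = 1 * (t.basis ht).coords (t.vertex i) k := by
  rw [AffineBasis.coords_apply, ← t.basis_apply ht, AffineBasis.coord_apply, one_mul, intUnit]
  simp [eq_comm]

theorem realForm_le {n : ℕ} {g : Fin n → ℤ} {μ : Fin n → ℝ} (hμ : ∀ k, 0 ≤ μ k)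
    (h1 : ∑ k, μ k = 1) {c : ℤ} (hg : ∀ k, g k ≤ c) : realForm g μ ≤ c := by
  calc realForm g μ ≤ ∑ k, (c : ℝ) * μ k :=
        Finset.sum_le_sum fun k _ => mul_le_mul_of_nonneg_right (by exact_mod_cast hg k) (hμ k)
    _ = c := by rw [← Finset.mul_sum, h1, mul_one]

/-- Inequalities between affine functions on a simplex hold as soon as they hold at its vertices.
The integer test for generation `m` thus selects the form that equals the bubble, or shows that the
bubble is zero; deeper descendants inherit this by inclusion. -/
theorem IsBubbleForms.linear_on_descendant {d m : ℕ} {F : Finset (Fin (d + 1))} {t : Elt d}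
    {gs : List (Fin (d + 1) → ℤ)} (hgs : IsBubbleForms m t.type F gs)
    (ht : AffineIndependent ℝ t.vertex) {n : ℕ} (hn : m ≤ n) {s : Elt d}
    (hs : s ∈ Elt.descendants n t) :
    ∃ g : Fin (d + 1) → ℤ, ∀ x ∈ s.carrier,
      bubble gs ((t.basis ht).coords x) = realForm g ((t.basis ht).coords x) := by
  obtain ⟨j, rfl⟩ := Nat.exists_eq_add_of_le hn
  obtain ⟨r, hr, hsr⟩ := (mem_descendants_add m j).1 hs
  have hsub := carrier_subset_of_mem_descendants _ hsr
  have hrt := carrier_subset_of_mem_descendants _ hr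
  suffices ∃ g : Fin (d + 1) → ℤ, ∀ x ∈ r.carrier,
      bubble gs ((t.basis ht).coords x) = realForm g ((t.basis ht).coords x) from
    this.imp fun g h x hx => h x (hsub hx)
  obtain ⟨V, hV, hVc⟩ := exists_intCoords _ (t.basis ht).coords m t _ 1
    (realForm_coords_unit t ht) hgs.linear r hr
  have hc : (0 : ℝ) < 2 ^ m * 1 := by positivity
  have hval : ∀ g i, (intForm g (V i) : ℝ) = 2 ^ m * 1 *
      realForm g ((t.basis ht).coords (r.vertex i)) := fun g i =>
    realForm_smul_intForm (hVc i)
  let f : (Fin (d + 1) → ℤ) → E d →ᵃ[ℝ] ℝ := fun g =>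
    (formMap g).toAffineMap.comp (t.basis ht).coords
  have hf : ∀ g x, f g x = realForm g ((t.basis ht).coords x) := fun g x => formMap_apply g _
  simp only [linearOnSimplex, List.any_eq_true, List.all_eq_true, Bool.or_eq_true,
    Bool.and_eq_true, decide_eq_true_eq, List.mem_finRange, forall_true_left] at hV
  obtain ⟨g, hg, h | h⟩ := hV
  -- One form is nonpositive on the whole descendant, so the bubble vanishes there and the zero form
  -- represents it.
  · refine ⟨0, fun x hx => ?_⟩
    have : 0 ≤ (-f g) x := nonneg_on_carrier r _ (fun i => by
      have h1 : (intForm g (V i) : ℝ) ≤ 0 := by exact_mod_cast h i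
      rw [hval] at h1
      have := nonpos_of_mul_nonpos_right h1 hc
      simpa [hf] using this) hx
    rw [bubble_eq_zero hg (by simpa [hf] using this)]
    simp [realForm]
  · refine ⟨g, fun x hx => bubble_eq_form hg ?_ ?_ fun g' hg' => ?_⟩
    · rw [← hf]
      refine nonneg_on_carrier r _ (fun i => ?_) hx
      have h1 : (0 : ℝ) ≤ intForm g (V i) := by exact_mod_cast (h i).1
      rw [hval] at h1
      rw [hf]
      exact nonneg_of_mul_nonneg_right h1 hc
    · have hx' := (t.carrier_eq ht).subset (hrt hx)
      exact_mod_cast realForm_le (c := 8) hx' ((t.basis ht).sum_coord_apply_eq_one x)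
        (hgs.le_eight g hg)
    · have : 0 ≤ (f g' - f g) x := nonneg_on_carrier r _ (fun i => by
        have h1 : (intForm g (V i) : ℝ) ≤ intForm g' (V i) := by exact_mod_cast (h i).2 g' hg'
        rw [hval, hval] at h1
        have := le_of_mul_le_mul_left h1 hc
        simpa [hf] using this) hx
      simpa [hf] using this

/-- Two numbers with a nonpositive sum are not both positive. -/
theorem IsBubbleForms.eq_zero {d m : ℕ} {F : Finset (Fin (d + 1))} {τ : ZMod 3}
    {gs : List (Fin (d + 1) → ℤ)} (hgs : IsBubbleForms m τ F gs) {μ : Fin (d + 1) → ℝ}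
    (hμ : ∀ k, 0 ≤ μ k) {k : Fin (d + 1)} (hk : k ∈ F) (h0 : μ k = 0) : bubble gs μ = 0 := by
  obtain ⟨g, hg, g', hg', h⟩ := hgs.vanish k hk
  have hsum : realForm g μ + realForm g' μ ≤ 0 := by
    rw [realForm, realForm, ← Finset.sum_add_distrib]
    refine Finset.sum_nonpos fun j _ => ?_
    rw [← add_mul]
    by_cases hj : j = k
    · rw [hj, h0, mul_zero]
    · exact mul_nonpos_of_nonpos_of_nonneg (by exact_mod_cast h j hj) (hμ j)
  rcases le_or_gt (realForm g μ) 0 with h1 | h1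
  · exact bubble_eq_zero hg h1
  · exact bubble_eq_zero hg' (by linarith)

theorem SameTrace.bubble_eq {n : ℕ} {i : Fin n} {gs hs : List (Fin n → ℤ)} (h : SameTrace i gs hs)
    {μ : Fin n → ℝ} (hμ : ∀ k, 0 ≤ μ k) (hi : μ i = 0) : bubble gs μ = bubble hs μ := by
  have key : ∀ g g' f : Fin n → ℤ, (∀ k, k ≠ i → g k + g' k ≤ 2 * f k) →
      realForm g μ + realForm g' μ ≤ 2 * realForm f μ := by
    intro g g' f hk
    rw [realForm, realForm, realForm, ← Finset.sum_add_distrib, Finset.mul_sum]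
    refine Finset.sum_le_sum fun k _ => ?_
    by_cases hki : k = i
    · rw [hki, hi]; simp
    · rw [← add_mul, ← mul_assoc]
      exact mul_le_mul_of_nonneg_right (by exact_mod_cast hk k hki) (hμ k)
  refine le_antisymm (bubble_le_of_forms fun f hf => ?_) (bubble_le_of_forms fun f hf => ?_)
  · obtain ⟨g, hg, g', hg', hk⟩ := h.1 f hf
    exact ⟨g, hg, g', hg', key _ _ _ hk⟩
  · obtain ⟨g, hg, g', hg', hk⟩ := h.2 f hf
    exact ⟨g, hg, g', hg', key _ _ _ hk⟩

/-- In this normal form the trace depends only on the coordinates belonging to the ends of the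
refinement edge, and symmetrically on the two. -/
theorem bubble_traceForms {d : ℕ} (a b : Fin (d + 1)) {μ : Fin (d + 1) → ℝ} (h1 : ∑ k, μ k = 1) :
    bubble (traceForms d a b) μ = max 0 (if d = 2 then min (2 * μ a) (min (2 * μ b) 8) else
      min (4 * μ a) (min (4 * μ b) (min (2 - 4 * μ a) (min (2 - 4 * μ b) 8)))) := by
  have r1 : ∀ (c : ℤ) (a : Fin (d + 1)), realForm (fun k => if k = a then c else 0) μ = c * μ a := by
    intro c a; simp [realForm]
  have r2 : ∀ a : Fin (d + 1), realForm (fun k => if k = a then -2 else 2) μ = 2 - 4 * μ a := by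
    intro a
    have : realForm (fun k => if k = a then -2 else 2) μ =
        ∑ k, (2 * μ k - if k = a then 4 * μ k else 0) := by
      refine Finset.sum_congr rfl fun k _ => ?_
      by_cases hk : k = a
      · simp [hk]; ring
      · simp [hk]
    rw [this, Finset.sum_sub_distrib, ← Finset.mul_sum, h1]
    simp
  unfold bubble traceForms
  split_ifs
  · simp [r1]
  · simp only [List.foldr_cons, List.foldr_nil, r1, r2]; norm_num

theorem bubble_traceForms_congr {d : ℕ} {a b a' b' : Fin (d + 1)} {μ μ' : Fin (d + 1) → ℝ}
    (h1 : ∑ k, μ k = 1) (h1' : ∑ k, μ' k = 1)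
    (h : (μ a = μ' a' ∧ μ b = μ' b') ∨ (μ a = μ' b' ∧ μ b = μ' a')) :
    bubble (traceForms d a b) μ = bubble (traceForms d a' b') μ' := by
  rw [bubble_traceForms a b h1, bubble_traceForms a' b' h1']
  rcases h with ⟨h2, h3⟩ | ⟨h2, h3⟩
  · rw [h2, h3]
  · rw [h2, h3]
    congr 1
    split_ifs
    · rw [min_left_comm]
    · rw [min_left_comm]
      congr 2
      rw [min_left_comm]

/-! ### Matching of the bubble functions of a shared side -/

theorem realForm_median {n : ℕ} {a b i : Fin n} (hab : a ≠ b) (hai : a ≠ i) (hbi : b ≠ i) (c : ℤ)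
    (μ : Fin n → ℝ) :
    realForm (fun k => if k = a then c else if k = b then -c else if k = i then 4 else 0) μ =
      c * (μ a - μ b) + 4 * μ i := by
  have : realForm (fun k => if k = a then c else if k = b then -c else if k = i then 4 else 0) μ =
      ∑ k, ((if k = a then c * μ k else 0) - (if k = b then c * μ k else 0) +
        if k = i then 4 * μ k else 0) := by
    refine Finset.sum_congr rfl fun k _ => ?_
    by_cases h1 : k = a
    · subst h1; simp [hab, hai]
    · by_cases h2 : k = b
      · subst h2; simp [h1, hbi]
      · simp only [h1, h2, if_false]
        by_cases h3 : k = i <;> simp [h3]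
  rw [this, Finset.sum_add_distrib, Finset.sum_sub_distrib]
  simp
  ring

/-- At generation two the coordinates are multiples of `1/4`, so a vertex off the side has `4 *
coord i ≥ 1` and satisfies the inequality for either sign. On the side the extra term is zero, and
the inequality says that the descendant stays on one side of the median. -/
theorem exists_median_sign {t : Elt 3} (ht : AffineIndependent ℝ t.vertex) (i : Fin 4) {n : ℕ}
    (hn : 2 ≤ n) {s : Elt 3} (hs : s ∈ Elt.descendants n t) :
    ∃ c : ℤ, c ≠ 0 ∧ ∀ x ∈ s.carrier,
      0 ≤ c * ((t.basis ht).coord (sideEdge₃ t.type i).1 x -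
        (t.basis ht).coord (sideEdge₃ t.type i).2 x) + 4 * (t.basis ht).coord i x := by
  obtain ⟨j, rfl⟩ := Nat.exists_eq_add_of_le hn
  obtain ⟨r, hr, hsr⟩ := (mem_descendants_add 2 j).1 hs
  have hsub := carrier_subset_of_mem_descendants _ hsr
  obtain ⟨V, hV, hVc⟩ := exists_intCoords _ (t.basis ht).coords 2 t _ 1
    (realForm_coords_unit t ht) (medianForms₃ t.type i) r hr
  have hc : (0 : ℝ) < 2 ^ 2 * 1 := by positivity
  obtain ⟨ha, hb, hab⟩ := sideEdge₃_ne t.type i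
  have key : ∀ g : Fin 4 → ℤ, (∀ j, 0 ≤ intForm g (V j)) → ∀ x ∈ s.carrier,
      0 ≤ realForm g ((t.basis ht).coords x) := by
    intro g hg x hx
    have := nonneg_on_carrier r ((formMap g).toAffineMap.comp (t.basis ht).coords) (fun i => by
      have h1 : (0 : ℝ) ≤ intForm g (V i) := by exact_mod_cast hg i
      rw [realForm_smul_intForm (hVc i)] at h1
      have := nonneg_of_mul_nonneg_right h1 hc
      simpa [formMap_apply] using this) (hsub hx)
    simpa [formMap_apply] using this
  simp only [someNonneg, List.any_eq_true, List.all_eq_true, decide_eq_true_eq,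
    List.mem_finRange, forall_true_left] at hV
  obtain ⟨g, hg, h⟩ := hV
  simp only [List.mem_cons, List.not_mem_nil, or_false] at hg
  rcases hg with rfl | rfl
  · refine ⟨1, one_ne_zero, fun x hx => ?_⟩
    have := key _ h x hx
    rw [realForm_median hab ha hb] at this
    exact this
  · refine ⟨-1, by norm_num, fun x hx => ?_⟩
    have := key _ h x hx
    have e := realForm_median hab ha hb (-1) ((t.basis ht).coords x)
    rw [neg_neg] at e
    rw [e] at this
    exact this

theorem coord_mul_two_pow {d n : ℕ} {t s : Elt d} (ht : AffineIndependent ℝ t.vertex)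
    (hs : s ∈ Elt.descendants n t) (i k : Fin (d + 1)) :
    ∃ z : ℤ, (z : ℝ) = 2 ^ n * (t.basis ht).coord k (s.vertex i) := by
  obtain ⟨V, -, hV⟩ := exists_intCoords (fun _ => true) (t.basis ht).coords n t _ 1
    (realForm_coords_unit t ht) (allDescendants_true _ _ _) s hs
  exact ⟨V i k, by rw [hV]; simp [AffineBasis.coords_apply]⟩

theorem two_pow_div_three_not_int (n : ℕ) (z : ℤ) : (z : ℝ) ≠ 2 ^ n * (1 / 3) := by
  intro h
  have h1 : z * 3 = 2 ^ n := by
    have : (z : ℝ) * 3 = 2 ^ n := by rw [h]; ring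
    exact_mod_cast this
  have h2 : (3 : ℤ) ∣ 2 ^ n := ⟨z, by rw [← h1]; ring⟩
  have := Int.prime_three.dvd_of_dvd_pow h2
  norm_num at this

/-- The centroid of a side of a tetrahedron. -/
theorem exists_side_centroid {t : Elt 3} (ht : AffineIndependent ℝ t.vertex) (i : Fin 4) :
    ∃ g : E 3, (t.basis ht).coord i g = 0 ∧ ∀ k, k ≠ i → (t.basis ht).coord k g = 1 / 3 := by
  let w : Fin 4 → ℝ := fun k => if k = i then 0 else 1 / 3
  have hw : ∑ k, w k = 1 := by
    rw [Finset.sum_ite, Finset.sum_const_zero, Finset.sum_const, zero_add, Finset.filter_ne',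
      Finset.card_erase_of_mem (Finset.mem_univ i)]
    norm_num
  refine ⟨Finset.univ.affineCombination ℝ (t.basis ht) w, ?_, fun k hk => ?_⟩
  · rw [(t.basis ht).coord_apply_combination_of_mem (Finset.mem_univ i) hw]; simp [w]
  · rw [(t.basis ht).coord_apply_combination_of_mem (Finset.mem_univ k) hw]; simp [w, hk]

theorem exists_third_index (i a b p q : Fin 4) (hab : a ≠ b) (ha : a ≠ i) (hb : b ≠ i)
    (hpq : p ≠ q) (hp : p ≠ i) (hq : q ≠ i) (hne : ¬((p = a ∧ q = b) ∨ (p = b ∧ q = a))) :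
    ∃ c, (c = p ∧ (q = a ∨ q = b) ∨ c = q ∧ (p = a ∨ p = b)) ∧ a ≠ c ∧ b ≠ c ∧ i ≠ c := by
  by_cases h : p = a ∨ p = b
  · exact ⟨q, Or.inr ⟨rfl, h⟩, by omega⟩
  · exact ⟨p, Or.inl ⟨rfl, by omega⟩, by omega⟩

/-- Two different edges of a triangle have a common end, so the two equalities make all three
coordinates equal. -/
theorem eq_third {μ : Fin 4 → ℝ} {i a b p q : Fin 4} (hab : a ≠ b) (ha : a ≠ i) (hb : b ≠ i)
    (hpq : p ≠ q) (hp : p ≠ i) (hq : q ≠ i) (hne : ¬((p = a ∧ q = b) ∨ (p = b ∧ q = a)))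
    (hsum : ∑ k, μ k = 1) (hi : μ i = 0) (e1 : μ a = μ b) (e2 : μ p = μ q) : μ a = 1 / 3 := by
  obtain ⟨c, hc, hac, hbc, hic⟩ := exists_third_index i a b p q hab ha hb hpq hp hq hne
  have huniv : (Finset.univ : Finset (Fin 4)) = {i, a, b, c} := by
    symm
    rw [← Finset.card_eq_iff_eq_univ]
    rw [Finset.card_insert_of_notMem (by simp [ha.symm, hb.symm, hic]),
      Finset.card_insert_of_notMem (by simp [hab, hac]), Finset.card_pair hbc, Fintype.card_fin]
  rw [huniv, Finset.sum_insert (by simp [ha.symm, hb.symm, hic]),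
    Finset.sum_insert (by simp [hab, hac]), Finset.sum_pair hbc] at hsum
  have hca : μ c = μ a := by
    rcases hc with ⟨rfl, rfl | rfl⟩ | ⟨rfl, rfl | rfl⟩ <;> linarith
  linarith

/-- If the descendants of two tetrahedra with a shared side match, then the two first refinement
edges of the side coincide: the medians from the midpoints of two different edges would
intersect in the centroid, which cannot be a vertex of a descendant. -/
theorem sideEdge_unique {t t' : Elt 3} (ht : AffineIndependent ℝ t.vertex)
    (ht' : AffineIndependent ℝ t'.vertex) {i i' : Fin 4} (hsh : IsSharedSide t t' i i')
    (hconf : t.carrier ∩ t'.carrier = convexHull ℝ (range t.vertex ∩ range t'.vertex))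
    (H : ∀ x ∈ t.carrier ∩ t'.carrier, ∃ n n', 2 ≤ n ∧ 2 ≤ n' ∧ ∃ s ∈ Elt.descendants n t,
      ∃ s' ∈ Elt.descendants n' t', x ∈ s.carrier ∧ x ∈ s'.carrier ∧
      s.carrier ∩ s'.carrier = convexHull ℝ (range s.vertex ∩ range s'.vertex)) :
    (t.vertex (sideEdge₃ t.type i).1 = t'.vertex (sideEdge₃ t'.type i').1 ∧
      t.vertex (sideEdge₃ t.type i).2 = t'.vertex (sideEdge₃ t'.type i').2) ∨
    (t.vertex (sideEdge₃ t.type i).1 = t'.vertex (sideEdge₃ t'.type i').2 ∧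
      t.vertex (sideEdge₃ t.type i).2 = t'.vertex (sideEdge₃ t'.type i').1) := by
  obtain ⟨ha, hb, hab⟩ := sideEdge₃_ne t.type i
  obtain ⟨ha', hb', hab'⟩ := sideEdge₃_ne t'.type i'
  obtain ⟨g, hgi, hgk⟩ := exists_side_centroid ht i
  have hgS : g ∈ t.carrier ∩ t'.carrier := by
    rw [hconf, hsh.left]
    refine (convexHull_face (t.basis ht) i).superset ⟨fun k => ?_, hgi⟩
    by_cases hk : k = i
    · rw [hk, hgi]
    · rw [hgk k hk]; norm_num
  obtain ⟨n, n', hn, hn', s, hs, s', hs', hgs, hgs', hss⟩ := H g hgS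
  obtain ⟨c, hc, hpos⟩ := exists_median_sign ht i hn hs
  obtain ⟨c', hc', hpos'⟩ := exists_median_sign ht' i' hn' hs'
  have hst := carrier_subset_of_mem_descendants _ hs
  have hst' := carrier_subset_of_mem_descendants _ hs'
  obtain ⟨p, hp, hpe⟩ := hsh.symm.exists_index ha'
  obtain ⟨q, hq, hqe⟩ := hsh.symm.exists_index hb'
  set a := (sideEdge₃ t.type i).1
  set b := (sideEdge₃ t.type i).2
  set a' := (sideEdge₃ t'.type i').1
  set b' := (sideEdge₃ t'.type i').2
  have hpq : p ≠ q := by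
    rintro rfl
    exact hab' (ht'.injective (hpe.trans hqe.symm))
  rw [hpe, hqe, ht.injective.eq_iff, ht.injective.eq_iff, ht.injective.eq_iff,
    ht.injective.eq_iff]
  by_contra hne
  -- On the intersection of the two descendants `F` is a sum of nonnegative terms, and it vanishes
  -- at the centroid, which lies in the hull of their common vertices. Hence `F ≤ 0` at some common
  -- vertex, and both median forms vanish there.
  let F : E 3 →ᵃ[ℝ] ℝ := ((c : ℝ) • ((t.basis ht).coord a - (t.basis ht).coord b) +
    (4 : ℝ) • (t.basis ht).coord i) + ((c' : ℝ) • ((t'.basis ht').coord a' -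
    (t'.basis ht').coord b') + (4 : ℝ) • (t'.basis ht').coord i') + (t.basis ht).coord i
  have hF : ∀ x, F x = (c * ((t.basis ht).coord a x - (t.basis ht).coord b x) +
      4 * (t.basis ht).coord i x) + (c' * ((t'.basis ht').coord a' x -
      (t'.basis ht').coord b' x) + 4 * (t'.basis ht').coord i' x) + (t.basis ht).coord i x :=
    fun x => rfl
  have hg2 : g ∈ convexHull ℝ (range t.vertex ∩ range t'.vertex) := hconf ▸ hgS
  have hFg : F g = 0 := by
    rw [hF, hgi, hgk a ha, hgk b hb, ← coord_eq_coord ht ht' hpe.symm hg2,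
      ← coord_eq_coord ht ht' hqe.symm hg2, hgk p hp, hgk q hq,
      hsh.symm.coord_eq_zero ht' (by rwa [inter_comm])]
    ring
  obtain ⟨v, hv, hFv⟩ : ∃ v ∈ range s.vertex ∩ range s'.vertex, F v ≤ 0 := by
    by_contra! hcon
    have hsub : convexHull ℝ (range s.vertex ∩ range s'.vertex) ⊆ F ⁻¹' Ioi 0 :=
      convexHull_min hcon ((convex_Ioi 0).affine_preimage F)
    exact absurd hFg (ne_of_gt (hsub (hss ▸ ⟨hgs, hgs'⟩)))
  have hvs : v ∈ s.carrier := subset_convexHull ℝ _ hv.1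
  have hvs' : v ∈ s'.carrier := subset_convexHull ℝ _ hv.2
  have hvS : v ∈ convexHull ℝ (range t.vertex ∩ range t'.vertex) :=
    hconf ▸ ⟨hst hvs, hst' hvs'⟩
  have hvi := hsh.coord_eq_zero ht hvS
  have hvi' := hsh.symm.coord_eq_zero ht' (x := v) (by rwa [inter_comm])
  have p1 := hpos v hvs
  have p2 := hpos' v hvs'
  rw [hF] at hFv
  rw [hvi, mul_zero, add_zero] at p1
  rw [hvi', mul_zero, add_zero] at p2
  rw [hvi, hvi'] at hFv
  have e1 : (c : ℝ) * ((t.basis ht).coord a v - (t.basis ht).coord b v) = 0 := by linarith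
  have e2 : (c' : ℝ) * ((t'.basis ht').coord a' v - (t'.basis ht').coord b' v) = 0 := by linarith
  have e1' := sub_eq_zero.1 ((mul_eq_zero.1 e1).resolve_left (by exact_mod_cast hc))
  have e2' := sub_eq_zero.1 ((mul_eq_zero.1 e2).resolve_left (by exact_mod_cast hc'))
  rw [← coord_eq_coord ht ht' hpe.symm hvS, ← coord_eq_coord ht ht' hqe.symm hvS] at e2'
  have hsum := (t.basis ht).sum_coord_apply_eq_one v
  have hthird : (t.basis ht).coord a v = 1 / 3 := by
    refine eq_third hab ha hb hpq hp hq (fun h => hne ?_) hsum hvi e1' e2'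
    rcases h with ⟨h1, h2⟩ | ⟨h1, h2⟩
    exacts [Or.inl ⟨h1.symm, h2.symm⟩, Or.inr ⟨h2.symm, h1.symm⟩]
  -- The common vertex has the coordinate `1/3`, which no power of two makes integral.
  obtain ⟨j, rfl⟩ := hv.1
  obtain ⟨z, hz⟩ := coord_mul_two_pow ht hs j a
  rw [hthird] at hz
  exact two_pow_div_three_not_int n z hz

/-- Both traces are in normal form, so it suffices that the refinement edges of the side coincide.
For `d = 2` the side is itself that edge. For `d = 3` the conforming completion consists, over both
elements, of descendants of generation at least two, and `sideEdge_unique` applies. -/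
theorem side_bubble_eq {d : ℕ} (hd : d = 2 ∨ d = 3) {Ω : Set (E d)} {𝒯 𝒯' : Mesh d}
    (h𝒯 : IsTriangulation Ω 𝒯) {T : Elt d} (href : IsLocalRefinement Ω 𝒯 T 𝒯') {t t' : Elt d}
    (htT : t ∈ nbrs 𝒯 T) (htT' : t' ∈ nbrs 𝒯 T) (ht : AffineIndependent ℝ t.vertex)
    (ht' : AffineIndependent ℝ t'.vertex) {i i' : Fin (d + 1)} (hsh : IsSharedSide t t' i i')
    {x : E d} (hx : x ∈ side t t') :
    bubble (sideForms d t.type i) ((t.basis ht).coords x) =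
      bubble (sideForms d t'.type i') ((t'.basis ht').coords x) := by
  classical
  have hmem : t ∈ 𝒯 := (Finset.mem_filter.1 htT).1
  have hmem' : t' ∈ 𝒯 := (Finset.mem_filter.1 htT').1
  have hconf := h𝒯.conforming t hmem t' hmem'
  have hx2 : x ∈ convexHull ℝ (range t.vertex ∩ range t'.vertex) := hconf ▸ hx
  rw [(sameTrace_side hd t.type i).bubble_eq (μ := (t.basis ht).coords x)
      ((t.carrier_eq ht).subset hx.1) (hsh.coord_eq_zero ht hx2),
    (sameTrace_side hd t'.type i').bubble_eq (μ := (t'.basis ht').coords x)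
      ((t'.carrier_eq ht').subset hx.2) (hsh.symm.coord_eq_zero ht' (by rwa [inter_comm]))]
  refine bubble_traceForms_congr ((t.basis ht).sum_coord_apply_eq_one x)
    ((t'.basis ht').sum_coord_apply_eq_one x) ?_
  suffices (t.vertex (sideEdge d t.type i).1 = t'.vertex (sideEdge d t'.type i').1 ∧
      t.vertex (sideEdge d t.type i).2 = t'.vertex (sideEdge d t'.type i').2) ∨
    (t.vertex (sideEdge d t.type i).1 = t'.vertex (sideEdge d t'.type i').2 ∧
      t.vertex (sideEdge d t.type i).2 = t'.vertex (sideEdge d t'.type i').1) by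
    rcases this with ⟨h1, h2⟩ | ⟨h1, h2⟩
    · exact Or.inl ⟨coord_eq_coord ht ht' h1 hx2, coord_eq_coord ht ht' h2 hx2⟩
    · exact Or.inr ⟨coord_eq_coord ht ht' h1 hx2, coord_eq_coord ht ht' h2 hx2⟩
  rcases hd with rfl | rfl
  · obtain ⟨ha, hb, hab⟩ := sideEdge₂_ne i
    obtain ⟨ha', hb', hab'⟩ := sideEdge₂_ne i'
    obtain ⟨p, hp, hpe⟩ := hsh.symm.exists_index ha'
    obtain ⟨q, hq, hqe⟩ := hsh.symm.exists_index hb'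
    have hpq : p ≠ q := by
      rintro rfl
      exact hab' (ht'.injective (hpe.trans hqe.symm))
    simp only [sideEdge]
    rw [hpe, hqe, ht.injective.eq_iff, ht.injective.eq_iff, ht.injective.eq_iff,
      ht.injective.eq_iff]
    generalize (sideEdge₂ i).1 = a at *
    generalize (sideEdge₂ i).2 = b at *
    clear hpe hqe ha' hb' hab'
    clear hx hx2 hsh
    omega
  · refine sideEdge_unique ht ht' hsh hconf fun y hy => ?_
    obtain ⟨𝒯'', hr, htri⟩ := href.completable
    have key : ∀ r ∈ nbrs 𝒯 T, y ∈ r.carrier → ∃ n, 2 ≤ n ∧ ∃ s ∈ Elt.descendants n r,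
        y ∈ s.carrier ∧ s ∈ 𝒯'' := by
      intro r hrT hyr
      obtain ⟨s, hs, ⟨n, hn⟩, hys⟩ :=
        exists_descendant (Or.inr rfl) href.refines (Finset.mem_filter.1 hrT).1 hyr
      obtain ⟨s', hs', ⟨n', hn'⟩, hys'⟩ := exists_descendant (Or.inr rfl) hr hs hys
      have h6 : 6 ≤ n := by
        by_contra hlt
        exact href.deep r hrT n (by simpa [bisectionNumber] using hlt) s hn hs
      exact ⟨n + n', by omega, s', (mem_descendants_add n n').2 ⟨s, hn, hn'⟩, hys', hs'⟩
    obtain ⟨n, hn, s, hs, hys, hmems⟩ := key t htT hy.1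
    obtain ⟨n', hn', s', hs', hys', hmems'⟩ := key t' htT' hy.2
    exact ⟨n, n', hn, hn', s, hs, s', hs', hys, hys', htri.conforming s hmems s' hmems'⟩

/-! ### Lipschitz continuity on a closed cover -/

open Filter Topology NNReal in
/-- A function which is Lipschitz on finitely many closed sets that cover the space is
Lipschitz. -/
theorem lipschitzWith_of_closed_cover {F X : Type*} [NormedAddCommGroup F] [NormedSpace ℝ F]
    [PseudoMetricSpace X] {ι : Type*} [Finite ι] {C : ι → Set F} (hC : ∀ i, IsClosed (C i))
    (hcov : ∀ x, ∃ i, x ∈ C i) {f : F → X} {K : ℝ≥0} (hf : ∀ i, LipschitzOnWith K f (C i)) :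
    LipschitzWith K f := by
  have hcont : Continuous f :=
    (locallyFinite_of_finite C).continuous (by ext x; simpa using hcov x) hC
      fun i => (hf i).continuousOn
  refine LipschitzWith.of_dist_le_mul fun x y => ?_
  let γ : ℝ → F := fun s => AffineMap.lineMap x y s
  have hγ : Continuous γ := AffineMap.lineMap_continuous
  let S : Set ℝ := {s | dist (f x) (f (γ s)) ≤ K * (s * dist x y)}
  have hS : IsClosed S :=
    isClosed_le (continuous_const.dist (hcont.comp hγ)) (by fun_prop)
  have h0 : (0 : ℝ) ∈ S := by simp [S, γ]
  have key : Icc (0 : ℝ) 1 ⊆ S := by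
    refine (hS.inter isClosed_Icc).Icc_subset_of_forall_exists_gt h0 fun s hs y' hy' => ?_
    -- Near `s`, the curve can only meet those sets of the cover that already contain `γ s`, because
    -- there are finitely many and they are closed. A set that contains `γ r` therefore contains `γ
    -- s`, and its Lipschitz bound extends the estimate beyond `s`.
    have hnear : ∀ᶠ r in 𝓝 s, ∀ i, γ r ∈ C i → γ s ∈ C i := by
      rw [eventually_all]
      intro i
      by_cases hi : γ s ∈ C i
      · exact Eventually.of_forall fun _ _ => hi
      · filter_upwards [hγ.continuousAt.eventually ((hC i).isOpen_compl.mem_nhds hi)] with r hr h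
        exact absurd h hr
    obtain ⟨r, hr, hrs⟩ := ((hnear.filter_mono nhdsWithin_le_nhds).and
      (Ioc_mem_nhdsGT hy')).exists
    obtain ⟨i, hi⟩ := hcov (γ r)
    refine ⟨r, ?_, hrs⟩
    have h1 := (hf i).dist_le_mul _ (hr i hi) _ hi
    have h2 : dist (γ s) (γ r) = (r - s) * dist x y := by
      simp only [γ, dist_lineMap_lineMap]
      rw [dist_comm, Real.dist_eq, abs_of_pos (sub_pos.2 hrs.1)]
    show dist (f x) (f (γ r)) ≤ K * (r * dist x y)
    calc dist (f x) (f (γ r)) ≤ dist (f x) (f (γ s)) + dist (f (γ s)) (f (γ r)) :=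
          dist_triangle _ _ _
      _ ≤ K * (s * dist x y) + K * ((r - s) * dist x y) := add_le_add hs.1 (h2 ▸ h1)
      _ = K * (r * dist x y) := by ring
  have := key (right_mem_Icc.2 zero_le_one)
  simpa [S, γ] using this

/-! ### Gradients -/

theorem inner_gradient {d : ℕ} (f : E d → ℝ) (x v : E d) :
    inner ℝ (gradient f x) v = fderiv ℝ f x v := by
  rw [gradient, InnerProductSpace.toDual_symm_apply]

theorem norm_gradient {d : ℕ} (f : E d → ℝ) (x : E d) : ‖gradient f x‖ = ‖fderiv ℝ f x‖ := by
  rw [gradient, LinearIsometryEquiv.norm_map]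

theorem measurable_gradient {d : ℕ} (f : E d → ℝ) : Measurable (gradient f) :=
  (InnerProductSpace.toDual ℝ (E d)).symm.continuous.measurable.comp (measurable_fderiv ℝ f)

theorem norm_gradient_le {d : ℕ} {f : E d → ℝ} {K : NNReal} {U : Set (E d)}
    (hf : LipschitzOnWith K f U) {x : E d} (hx : U ∈ nhds x) : ‖gradient f x‖ ≤ K := by
  rw [norm_gradient]; exact norm_fderiv_le_of_lipschitzOn ℝ hx hf

theorem gradient_congr {d : ℕ} {f g : E d → ℝ} {U : Set (E d)} (hU : IsOpen U)
    (h : EqOn f g U) {x : E d} (hx : x ∈ U) : gradient f x = gradient g x := by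
  rw [gradient, gradient, Filter.EventuallyEq.fderiv_eq (h.eventuallyEq_of_mem (hU.mem_nhds hx))]

theorem gradient_eq_zero_of_notMem_tsupport {d : ℕ} {f : E d → ℝ} {x : E d}
    (hx : x ∉ tsupport f) : gradient f x = 0 := by
  rw [gradient, Filter.EventuallyEq.fderiv_eq (notMem_tsupport_iff_eventuallyEq.1 hx)]
  simp

theorem IsTest.continuous_gradient {d : ℕ} {Ω : Set (E d)} {φ : E d → ℝ} (h : IsTest Ω φ) :
    Continuous (gradient φ) :=
  (InnerProductSpace.toDual ℝ (E d)).symm.continuous.comp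
    (h.smooth.continuous_fderiv (by simp))

theorem IsTest.hasCompactSupport_gradient {d : ℕ} {Ω : Set (E d)} {φ : E d → ℝ}
    (h : IsTest Ω φ) : HasCompactSupport (gradient φ) :=
  HasCompactSupport.intro h.compact fun _ hx => gradient_eq_zero_of_notMem_tsupport hx

theorem IsTest.mono {d : ℕ} {Ω Ω' : Set (E d)} {φ : E d → ℝ} (h : IsTest Ω φ) (hs : Ω ⊆ Ω') :
    IsTest Ω' φ := ⟨h.smooth, h.compact, h.supp.trans hs⟩

theorem IsTest.eq_zero {d : ℕ} {Ω : Set (E d)} {φ : E d → ℝ} (h : IsTest Ω φ) {x : E d}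
    (hx : x ∉ Ω) : φ x = 0 := image_eq_zero_of_notMem_tsupport fun hx' => hx (h.supp hx')

theorem IsTest.gradient_eq_zero {d : ℕ} {Ω : Set (E d)} {φ : E d → ℝ} (h : IsTest Ω φ) {x : E d}
    (hx : x ∉ Ω) : gradient φ x = 0 :=
  gradient_eq_zero_of_notMem_tsupport fun hx' => hx (h.supp hx')

theorem IsTest.setIntegral_gradient {d : ℕ} {Ω : Set (E d)} {φ : E d → ℝ} (h : IsTest Ω φ)
    (u : E d → ℝ) : ∫ x in Ω, u x • gradient φ x = ∫ x, u x • gradient φ x :=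
  setIntegral_eq_integral_of_forall_compl_eq_zero fun x hx => by
    rw [h.gradient_eq_zero hx, smul_zero]

theorem IsTest.setIntegral_smul {d : ℕ} {Ω : Set (E d)} {φ : E d → ℝ} (h : IsTest Ω φ)
    (G : E d → E d) : ∫ x in Ω, φ x • G x = ∫ x, φ x • G x :=
  setIntegral_eq_integral_of_forall_compl_eq_zero fun x hx => by
    rw [h.eq_zero hx, zero_smul]

/-- Integration by parts for a Lipschitz function and a test function. -/
theorem integral_smul_gradient_of_lipschitz {d : ℕ} {f φ : E d → ℝ} {K : NNReal}
    (hf : LipschitzWith K f) (hφ : IsTest univ φ) :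
    ∫ x, f x • gradient φ x = - ∫ x, φ x • gradient f x := by
  obtain ⟨D, hD⟩ := ContDiff.lipschitzWith_of_hasCompactSupport hφ.compact hφ.smooth (by simp)
  have i1 : Integrable fun x => f x • gradient φ x :=
    (hf.continuous.smul hφ.continuous_gradient).integrable_of_hasCompactSupport
      hφ.hasCompactSupport_gradient.smul_left
  have i2 : Integrable fun x => φ x • gradient f x :=
    Integrable.smul_bdd (hφ.smooth.continuous.integrable_of_hasCompactSupport hφ.compact) K
      (measurable_gradient f).aestronglyMeasurable (Filter.Eventually.of_forall fun x =>
        norm_gradient_le (U := univ) hf.lipschitzOnWith Filter.univ_mem)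
  refine ext_inner_left ℝ fun v => ?_
  rw [← integral_inner i1, inner_neg_right, ← integral_inner i2]
  have e1 : ∫ x, inner ℝ v (f x • gradient φ x) = - ∫ x, lineDeriv ℝ φ x (-v) * f x := by
    rw [← integral_neg]
    refine integral_congr_ae (Filter.Eventually.of_forall fun x => ?_)
    dsimp only
    rw [((hφ.smooth.differentiable (by simp)) x).lineDeriv_eq_fderiv, inner_smul_right,
      real_inner_comm, inner_gradient, map_neg]
    ring
  have e2 : ∫ x, inner ℝ v (φ x • gradient f x) = ∫ x, lineDeriv ℝ f x v * φ x := by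
    refine integral_congr_ae ?_
    filter_upwards [hf.ae_differentiableAt] with x hx
    rw [hx.lineDeriv_eq_fderiv, inner_smul_right, real_inner_comm, inner_gradient]
    ring
  rw [e1, e2, hf.integral_lineDeriv_mul_eq hD hφ.compact v]

/-- The function extends to a Lipschitz function on the whole space, and test functions supported in
`U` do not see the extension. -/
theorem isWeakGrad_of_lipschitzOn {d : ℕ} {f : E d → ℝ} {K : NNReal} {U : Set (E d)}
    (hU : IsOpen U) (hf : LipschitzOnWith K f U) : IsWeakGrad U f (gradient f) := by
  intro φ hφ
  obtain ⟨g, hg, hfg⟩ := hf.extend_real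
  have h1 : ∫ x in U, f x • gradient φ x = ∫ x in U, g x • gradient φ x :=
    setIntegral_congr_fun hU.measurableSet fun x hx => by simp only [hfg hx]
  have h2 : ∫ x in U, φ x • gradient f x = ∫ x in U, φ x • gradient g x :=
    setIntegral_congr_fun hU.measurableSet fun x hx => by
      simp only [gradient_congr hU hfg hx]
  rw [h1, h2, hφ.setIntegral_gradient, hφ.setIntegral_smul,
    integral_smul_gradient_of_lipschitz hg (hφ.mono (subset_univ _))]

/-- Weak gradients are unique. -/
theorem ae_eq_of_isWeakGrad {d : ℕ} {U : Set (E d)} (hU : IsOpen U) {u : E d → ℝ}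
    {G H : E d → E d} (hG : LocallyIntegrableOn G U) (hH : LocallyIntegrableOn H U)
    (h1 : IsWeakGrad U u G) (h2 : IsWeakGrad U u H) : G =ᵐ[volume.restrict U] H := by
  have key : ∀ᵐ x ∂(volume : Measure (E d)), x ∈ U → (G - H) x = 0 := by
    refine hU.ae_eq_zero_of_integral_contDiff_smul_eq_zero (hG.sub hH) fun φ h1φ h2φ h3φ => ?_
    have hφ : IsTest U φ := ⟨h1φ, h2φ, h3φ⟩
    have e := (h1 φ hφ).symm.trans (h2 φ hφ)
    rw [neg_inj] at e
    have int : ∀ {G : E d → E d}, LocallyIntegrableOn G U → IntegrableOn (fun x => φ x • G x) U := by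
      intro G hG
      have h := hG.integrableOn_compact_subset h3φ h2φ
      have h' : IntegrableOn (fun x => φ x • G x) (tsupport φ) :=
        h.continuousOn_smul h1φ.continuous.continuousOn h2φ
      refine (integrableOn_iff_integrable_of_support_subset ?_).1 h' |>.integrableOn
      intro x hx
      refine subset_tsupport φ fun h0 => hx ?_
      simp only [h0, zero_smul]
    have : ∫ x in U, φ x • (G - H) x = 0 := by
      simp only [Pi.sub_apply, smul_sub]
      rw [integral_sub (int hG) (int hH), e, sub_self]
    rw [← this, hφ.setIntegral_smul]
  rw [Filter.EventuallyEq, ae_restrict_iff' hU.measurableSet]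
  filter_upwards [key] with x hx hxU
  exact sub_eq_zero.1 (hx hxU)

/-- For a test function supported in `V`, the integrals over `U`, over `V` and over the whole space
coincide. -/
theorem IsWeakGrad.mono {d : ℕ} {U V : Set (E d)} (hVU : V ⊆ U) {u : E d → ℝ}
    {G : E d → E d} (h : IsWeakGrad U u G) : IsWeakGrad V u G := by
  intro φ hφ
  have := h φ (hφ.mono hVU)
  rwa [(hφ.mono hVU).setIntegral_gradient, (hφ.mono hVU).setIntegral_smul,
    ← hφ.setIntegral_gradient, ← hφ.setIntegral_smul] at this

theorem IsWeakGrad.congr_left {d : ℕ} {U : Set (E d)} (hU : IsOpen U) {u v : E d → ℝ}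
    {G : E d → E d} (h : IsWeakGrad U u G) (huv : EqOn u v U) : IsWeakGrad U v G := by
  intro φ hφ
  rw [← h φ hφ]
  exact setIntegral_congr_fun hU.measurableSet fun x hx => by simp only [huv hx]

theorem MemLp.locallyIntegrableOn {d : ℕ} {U : Set (E d)} {p : ℝ≥0∞} (hp : 1 ≤ p)
    {F : Type*} [NormedAddCommGroup F] {G : E d → F} (hG : MemLp G p (volume.restrict U)) :
    LocallyIntegrableOn G U :=
  locallyIntegrableOn_of_locallyIntegrable_restrict (hG.locallyIntegrable hp)

theorem isSobolevPair_weakGrad {d : ℕ} {Ω : Set (E d)} {u : E d → ℝ} (hu : MemH10 Ω u) :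
    IsSobolevPair 2 Ω u (weakGrad Ω u) := by
  have h : ∃ G : E d → E d, IsSobolevPair 2 Ω u G := hu.imp fun G hG => hG.1
  rw [weakGrad, dif_pos h]
  exact h.choose_spec

theorem weakGrad_ae_eq {d : ℕ} {Ω : Set (E d)} {u : E d → ℝ} (hu : MemH10 Ω u)
    {G : E d → E d} {U : Set (E d)} (hU : IsOpen U) (hUΩ : U ⊆ Ω) (hG : LocallyIntegrableOn G U)
    (hw : IsWeakGrad U u G) : weakGrad Ω u =ᵐ[volume.restrict U] G :=
  ae_eq_of_isWeakGrad hU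
    ((MemLp.locallyIntegrableOn one_le_two (isSobolevPair_weakGrad hu).memLp_grad).mono_set hUΩ)
    hG ((isSobolevPair_weakGrad hu).weak.mono hUΩ) hw

/-- The weak gradient is the classical gradient where the function is Lipschitz. -/
theorem weakGrad_ae_eq_gradient {d : ℕ} {Ω : Set (E d)} {u f : E d → ℝ}
    (hu : MemH10 Ω u) {U : Set (E d)} (hU : IsOpen U) (hUΩ : U ⊆ Ω) {K : NNReal}
    (hf : LipschitzOnWith K f U) (huf : EqOn u f U) :
    weakGrad Ω u =ᵐ[volume.restrict U] gradient f := by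
  refine weakGrad_ae_eq hu hU hUΩ ?_ ((isWeakGrad_of_lipschitzOn hU hf).congr_left hU huf.symm)
  have : MemLp (gradient f) ∞ (volume.restrict U) :=
    memLp_top_of_bound (measurable_gradient f).aestronglyMeasurable K
      ((ae_restrict_iff' hU.measurableSet).2 (Filter.Eventually.of_forall fun x hx =>
        norm_gradient_le hf (hU.mem_nhds hx)))
  exact MemLp.locallyIntegrableOn le_top this

theorem integrable_smul_of_memLp_two {X F : Type*} [MeasurableSpace X] {ν : Measure X}
    [NormedAddCommGroup F] [NormedSpace ℝ F] {u : X → ℝ} {G : X → F} (hu : MemLp u 2 ν)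
    (hG : MemLp G 2 ν) : Integrable (fun x => u x • G x) ν :=
  memLp_one_iff_integrable.1 (hG.smul hu)

theorem weakGrad_sub_ae_eq {d : ℕ} {Ω : Set (E d)} (hΩ : IsOpen Ω) {u v : E d → ℝ}
    (hu : MemH10 Ω u) (hv : MemH10 Ω v) (huv : MemH10 Ω fun x => u x - v x) :
    weakGrad Ω (fun x => u x - v x) =ᵐ[volume.restrict Ω]
      fun x => weakGrad Ω u x - weakGrad Ω v x := by
  have h1 := isSobolevPair_weakGrad hu
  have h2 := isSobolevPair_weakGrad hv
  refine weakGrad_ae_eq huv hΩ subset_rfl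
    (MemLp.locallyIntegrableOn one_le_two (h1.memLp_grad.sub h2.memLp_grad)) fun φ hφ => ?_
  have int1 : ∀ {u : E d → ℝ}, MemLp u 2 (volume.restrict Ω) →
      Integrable (fun x => u x • gradient φ x) (volume.restrict Ω) := fun {u} hu =>
    integrable_smul_of_memLp_two hu
      (hφ.continuous_gradient.memLp_of_hasCompactSupport hφ.hasCompactSupport_gradient)
  have int2 : ∀ {G : E d → E d}, MemLp G 2 (volume.restrict Ω) →
      Integrable (fun x => φ x • G x) (volume.restrict Ω) := fun {u} hu =>
    integrable_smul_of_memLp_two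
      (hφ.smooth.continuous.memLp_of_hasCompactSupport hφ.compact) hu
  simp only [sub_smul, smul_sub]
  rw [integral_sub (int1 h1.memLp) (int1 h2.memLp), integral_sub (int2 h1.memLp_grad)
    (int2 h2.memLp_grad), h1.weak φ hφ, h2.weak φ hφ]
  abel

/-! ### Mollification -/

open scoped Convolution in
open ContinuousLinearMap in
/-- The gradient of the mollification is the mollification of the weak gradient. -/
theorem hasGradientAt_convolution {d : ℕ} {f : E d → ℝ} {G : E d → E d} {U : Set (E d)}
    (hf : LocallyIntegrable f) (hG : LocallyIntegrable G)
    (hw : ∀ φ, IsTest U φ → ∫ x, f x • gradient φ x = - ∫ x, φ x • G x)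
    (ρ : ContDiffBump (0 : E d)) {x : E d} (hx : Metric.closedBall x ρ.rOut ⊆ U) :
    HasGradientAt (ρ.normed volume ⋆[lsmul ℝ ℝ, volume] f)
      ((ρ.normed volume ⋆[lsmul ℝ ℝ, volume] G) x) x := by
  set r := ρ.normed (volume : Measure (E d)) with hr
  have hrc : HasCompactSupport r := ρ.hasCompactSupport_normed
  have hrs : ContDiff ℝ ∞ r := ρ.contDiff_normed
  have hd := hrc.hasFDerivAt_convolution_left (lsmul ℝ ℝ) (hrs.of_le (by simp)) hf x
  rw [hasGradientAt_iff_hasFDerivAt]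
  convert! hd using 1
  -- The reflected and translated mollifier is a test function for the weak gradient;
  -- differentiation in `t` instead of `x` changes the sign, which cancels the minus sign of the
  -- integration by parts.
  let φ : E d → ℝ := fun t => r (x - t)
  have hφ' : ∀ t v, fderiv ℝ φ t v = - fderiv ℝ r (x - t) v := by
    intro t v
    have h1 : HasFDerivAt r (fderiv ℝ r (x - t)) (x - t) :=
      (hrs.differentiable (by simp) _).hasFDerivAt
    have h2 : HasFDerivAt (fun t : E d => x - t) (-ContinuousLinearMap.id ℝ (E d)) t :=
      (hasFDerivAt_id t).const_sub x
    rw [show φ = r ∘ fun t => x - t from rfl, (h1.comp t h2).fderiv]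
    simp
  have hφ : IsTest U φ := by
    refine ⟨hrs.comp (contDiff_const.sub contDiff_id),
      hrc.comp_homeomorph (Homeomorph.subLeft x), ?_⟩
    refine Subset.trans (closure_minimal (fun t ht => ?_) Metric.isClosed_closedBall) hx
    have : x - t ∈ Function.support r := ht
    rw [hr, ρ.support_normed_eq] at this
    rw [Metric.mem_closedBall, dist_comm, dist_eq_norm]
    simpa using (Metric.mem_ball.1 this).le
  have i1 : Integrable fun t => f t • gradient φ t :=
    (hf.integrable_smul_right_of_hasCompactSupport hφ.continuous_gradient
      hφ.hasCompactSupport_gradient)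
  have i2 : Integrable fun t => φ t • G t :=
    (hG.integrable_smul_left_of_hasCompactSupport hφ.smooth.continuous hφ.compact)
  refine ContinuousLinearMap.ext fun v => ?_
  rw [InnerProductSpace.toDual_apply_apply, convolution_eq_swap, convolution_eq_swap]
  simp only [lsmul_apply]
  have e1 : (∫ t, r (x - t) • G t) = - ∫ t, f t • gradient φ t := by rw [hw φ hφ, neg_neg]
  rw [e1, inner_neg_left, real_inner_comm, ← integral_inner i1]
  have hex := (hrc.fderiv ℝ).convolutionExists_left ((lsmul ℝ ℝ : ℝ →L[ℝ] ℝ →L[ℝ] ℝ).precompL (E d))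
    (hrs.continuous_fderiv (by simp)) hf x
  have hint := hex.integrable_swap
  rw [ContinuousLinearMap.integral_apply hint, ← integral_neg]
  refine integral_congr_ae (Filter.Eventually.of_forall fun t => ?_)
  dsimp only
  rw [inner_smul_right, real_inner_comm, inner_gradient, hφ', precompL_apply, lsmul_apply]
  simp only [smul_eq_mul]
  ring

open Filter Topology
open scoped Convolution
open ContinuousLinearMap (lsmul)

/-- The normalized bump is a probability density, so averaging with it preserves bounds. -/
theorem norm_normed_convolution_le {d : ℕ} {F : Type*} [NormedAddCommGroup F] [NormedSpace ℝ F]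
    {G : E d → F} {L : ℝ} (hG : ∀ᵐ x, ‖G x‖ ≤ L) (ρ : ContDiffBump (0 : E d)) (x : E d) :
    ‖(ρ.normed volume ⋆[lsmul ℝ ℝ, volume] G) x‖ ≤ L := by
  rw [convolution_eq_swap]
  have hcont : Continuous fun t => ρ.normed volume (x - t) :=
    ρ.continuous_normed.comp (continuous_const.sub continuous_id)
  have hint : Integrable fun t => ρ.normed volume (x - t) * L :=
    (hcont.mul continuous_const).integrable_of_hasCompactSupport
      ((ρ.hasCompactSupport_normed.comp_homeomorph (Homeomorph.subLeft x)).mul_right)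
  have h1 : ‖∫ t, (lsmul ℝ ℝ) (ρ.normed volume (x - t)) (G t)‖ ≤
      ∫ t, ρ.normed volume (x - t) * L := by
    refine norm_integral_le_of_norm_le hint ?_
    filter_upwards [hG] with t ht
    rw [ContinuousLinearMap.lsmul_apply, norm_smul, Real.norm_of_nonneg (ρ.nonneg_normed _)]
    exact mul_le_mul_of_nonneg_left ht (ρ.nonneg_normed _)
  refine h1.trans_eq ?_
  rw [integral_mul_const, integral_sub_left_eq_self, ρ.integral_normed, one_mul]

/-- A bump function of small support. -/
def smallBump {d : ℕ} (r : ℝ) (hr : 0 < r) : ContDiffBump (0 : E d) :=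
  ⟨r / 2, r, half_pos hr, half_lt_self hr⟩

/-- A continuous function of class `W^{1,∞}` is Lipschitz on convex open sets. -/
theorem exists_lipschitzOnWith_of_memW1Inf {d : ℕ} {P : Set (E d)} (hP : IsOpen P) {a : E d → ℝ}
    (ha : ContinuousOn a P) (h : MemW1Inf P a) :
    ∃ L : NNReal, ∀ U ⊆ P, IsOpen U → Convex ℝ U → LipschitzOnWith L a U := by
  obtain ⟨G, hG⟩ := h
  -- The constant is the essential supremum of the gradient over all of `P`, so one constant serves
  -- every convex subset. Mollifications satisfy the estimate along a segment, and continuity of `a`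
  -- allows passing to the limit.
  refine ⟨(eLpNorm G ∞ (volume.restrict P)).toNNReal, fun U hUP hU hUc => ?_⟩
  set L := (eLpNorm G ∞ (volume.restrict P)).toNNReal
  have hf : LocallyIntegrable (P.indicator a) :=
    ((memLp_indicator_iff_restrict hP.measurableSet).2 hG.memLp).locallyIntegrable le_top
  have hG' : MemLp (P.indicator G) ∞ volume :=
    (memLp_indicator_iff_restrict hP.measurableSet).2 hG.memLp_grad
  have hGL : ∀ᵐ x, ‖P.indicator G x‖ ≤ L := by
    have h1 : ∀ᵐ x ∂(volume.restrict P), ‖G x‖ ≤ L := by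
      filter_upwards [ae_le_eLpNormEssSup (f := G) (μ := volume.restrict P)] with x hx
      rw [← eLpNorm_exponent_top, ← ENNReal.coe_toNNReal hG.memLp_grad.2.ne] at hx
      exact_mod_cast hx
    rw [ae_restrict_iff' hP.measurableSet] at h1
    filter_upwards [h1] with x hx
    by_cases hxP : x ∈ P
    · rw [indicator_of_mem hxP]; exact hx hxP
    · rw [indicator_of_notMem hxP, norm_zero]; exact L.2
  have hw : ∀ φ, IsTest P φ → ∫ x, P.indicator a x • gradient φ x =
      - ∫ x, φ x • P.indicator G x := by
    intro φ hφ
    rw [← hφ.setIntegral_gradient, ← hφ.setIntegral_smul,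
      setIntegral_congr_fun (g := fun x => a x • gradient φ x) hP.measurableSet
        fun x hx => by simp only [indicator_of_mem hx],
      setIntegral_congr_fun (f := fun x => φ x • P.indicator G x) (g := fun x => φ x • G x)
        hP.measurableSet fun x hx => by simp only [indicator_of_mem hx]]
    exact hG.weak φ hφ
  refine LipschitzOnWith.of_dist_le_mul fun x hx y hy => ?_
  have hseg : segment ℝ x y ⊆ U := hUc.segment_subset hx hy
  have hcomp : IsCompact (segment ℝ x y) := by
    rw [← Path.range_segment]; exact isCompact_range (Path.segment x y).continuous
  -- Mollification with radius at most `δ` only uses values in a neighbourhood of the segment inside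
  -- `U`, where `G` is the weak gradient.
  obtain ⟨δ, hδ, hδU⟩ := hcomp.exists_cthickening_subset_open hU hseg
  let ρ : ℕ → ContDiffBump (0 : E d) := fun n =>
    smallBump (δ * (1 / ((n : ℝ) + 1))) (by positivity)
  have hρ : Tendsto (fun n => (ρ n).rOut) atTop (𝓝 0) := by
    have := (tendsto_one_div_add_atTop_nhds_zero_nat (𝕜 := ℝ)).const_mul δ
    rw [mul_zero] at this
    exact this
  have hρδ : ∀ n, (ρ n).rOut ≤ δ := fun n => by
    show δ * (1 / ((n : ℝ) + 1)) ≤ δ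
    refine mul_le_of_le_one_right hδ.le ?_
    rw [div_le_one (by positivity)]
    linarith [n.cast_nonneg (α := ℝ)]
  let f : ℕ → E d → ℝ := fun n => (ρ n).normed volume ⋆[lsmul ℝ ℝ, volume] P.indicator a
  have hbound : ∀ n, ‖f n y - f n x‖ ≤ L * ‖y - x‖ := by
    intro n
    refine (convex_segment x y).norm_image_sub_le_of_norm_hasFDerivWithin_le
      (f' := fun z => InnerProductSpace.toDual ℝ (E d)
        (((ρ n).normed volume ⋆[lsmul ℝ ℝ, volume] P.indicator G) z)) (fun z hz => ?_)
      (fun z hz => ?_) (left_mem_segment ℝ x y) (right_mem_segment ℝ x y)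
    · refine (hasGradientAt_convolution hf (hG'.locallyIntegrable le_top) hw (ρ n)
        ?_).hasFDerivAt.hasFDerivWithinAt
      exact (Metric.closedBall_subset_closedBall (hρδ n)).trans
        ((Metric.closedBall_subset_cthickening hz δ).trans (hδU.trans hUP))
    · rw [LinearIsometryEquiv.norm_map]
      exact norm_normed_convolution_le hGL _ _
  have hlim : ∀ z ∈ U, Tendsto (fun n => f n z) atTop (𝓝 (a z)) := by
    intro z hz
    refine ContDiffBump.convolution_tendsto_right hρ
      (Eventually.of_forall fun n => hf.aestronglyMeasurable) ?_ tendsto_const_nhds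
    have : ContinuousAt (P.indicator a) z := by
      have h1 : ContinuousAt a z := ha.continuousAt (hP.mem_nhds (hUP hz))
      refine h1.congr ?_
      filter_upwards [hP.mem_nhds (hUP hz)] with w hw
      rw [indicator_of_mem hw]
    have h2 := this.tendsto
    rw [indicator_of_mem (hUP hz)] at h2
    exact h2.comp tendsto_snd
  have := le_of_tendsto ((hlim y hy).sub (hlim x hx)).norm (Eventually.of_forall hbound)
  rw [dist_comm, dist_comm x y, dist_eq_norm, dist_eq_norm]
  exact this

theorem tendsto_eLpNorm_two_of_bounded {X F : Type*} [MeasurableSpace X] {ν : Measure X}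
    [IsFiniteMeasure ν] [NormedAddCommGroup F] {f : ℕ → X → F} {g : X → F}
    (hf : ∀ n, AEStronglyMeasurable (f n) ν) (hg : AEStronglyMeasurable g ν) {C : ℝ}
    (hC : ∀ n, ∀ᵐ x ∂ν, ‖g x - f n x‖ ≤ C)
    (hlim : ∀ᵐ x ∂ν, Tendsto (fun n => f n x) atTop (𝓝 (g x))) :
    Tendsto (fun n => eLpNorm (fun x => g x - f n x) 2 ν) atTop (𝓝 0) := by
  have h1 : Tendsto (fun n => ∫⁻ x, ‖g x - f n x‖ₑ ^ (2 : ℝ) ∂ν) atTop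
      (𝓝 (∫⁻ _, 0 ∂ν)) := by
    refine tendsto_lintegral_of_dominated_convergence' (fun _ => ENNReal.ofReal C ^ (2 : ℝ))
      (fun n => ((hg.sub (hf n)).enorm.pow_const _)) (fun n => ?_) ?_ ?_
    · filter_upwards [hC n] with x hx
      refine ENNReal.rpow_le_rpow ?_ zero_le_two
      rw [← ofReal_norm]
      exact ENNReal.ofReal_le_ofReal hx
    · rw [lintegral_const]
      exact ENNReal.mul_ne_top (ENNReal.rpow_ne_top_of_nonneg zero_le_two ENNReal.ofReal_ne_top)
        (measure_ne_top _ _)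
    · filter_upwards [hlim] with x hx
      have h2 : Tendsto (fun n => ‖g x - f n x‖ₑ) atTop (𝓝 0) := by
        have := (tendsto_const_nhds (x := g x)).sub hx
        rw [sub_self] at this
        simpa using this.enorm
      have := (ENNReal.continuous_rpow_const (y := 2)).continuousAt.tendsto.comp h2
      simpa [Function.comp_def] using this
  rw [lintegral_zero] at h1
  have h3 := (ENNReal.continuous_rpow_const (y := 1 / 2)).continuousAt.tendsto.comp h1
  simp only [one_div, ENNReal.zero_rpow_of_pos (show (0 : ℝ) < 2⁻¹ by norm_num)] at h3
  refine h3.congr fun n => ?_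
  rw [eLpNorm_eq_lintegral_rpow_enorm_toReal two_ne_zero ENNReal.ofNat_ne_top]
  simp

/-- Mollifications have supports in a small neighbourhood of the compact support. Their gradients
are the mollified gradients: they are bounded by `K` and converge almost everywhere, so dominated
convergence gives convergence in `L²`. -/
theorem exists_test_near_of_lipschitz {d : ℕ} {Ω : Set (E d)} (hΩ : IsOpen Ω)
    (hfin : volume Ω ≠ ⊤) {g : E d → ℝ} {K : NNReal} (hg : LipschitzWith K g)
    (hc : HasCompactSupport g) (hs : tsupport g ⊆ Ω) {ε : ℝ≥0∞} (hε : 0 < ε) :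
    ∃ φ, IsTest Ω φ ∧ eLpNorm (fun x => g x - φ x) 2 (volume.restrict Ω) < ε ∧
      eLpNorm (fun x => gradient g x - gradient φ x) 2 (volume.restrict Ω) < ε := by
  have : IsFiniteMeasure (volume.restrict Ω) :=
    ⟨by rw [Measure.restrict_apply_univ]; exact hfin.lt_top⟩
  obtain ⟨M, hM⟩ := hc.exists_bound_of_continuous hg.continuous
  obtain ⟨δ, hδ, hδΩ⟩ := IsCompact.exists_cthickening_subset_open hc hΩ hs
  let ρ : ℕ → ContDiffBump (0 : E d) := fun n =>
    smallBump (δ * (1 / ((n : ℝ) + 1))) (by positivity)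
  have hρ : Tendsto (fun n => (ρ n).rOut) atTop (𝓝 0) := by
    have := (tendsto_one_div_add_atTop_nhds_zero_nat (𝕜 := ℝ)).const_mul δ
    rw [mul_zero] at this
    exact this
  have hρδ : ∀ n, (ρ n).rOut ≤ δ := fun n => by
    show δ * (1 / ((n : ℝ) + 1)) ≤ δ
    refine mul_le_of_le_one_right hδ.le ?_
    rw [div_le_one (by positivity)]
    linarith [n.cast_nonneg (α := ℝ)]
  have hgl : LocallyIntegrable g := hg.continuous.locallyIntegrable
  have hGb : ∀ x, ‖gradient g x‖ ≤ K := fun x =>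
    norm_gradient_le (U := univ) hg.lipschitzOnWith univ_mem
  have hGl : LocallyIntegrable (gradient g) :=
    (memLp_top_of_bound (measurable_gradient g).aestronglyMeasurable K
      (Eventually.of_forall hGb)).locallyIntegrable le_top
  let f : ℕ → E d → ℝ := fun n => (ρ n).normed volume ⋆[lsmul ℝ ℝ, volume] g
  have hfg : ∀ n x, gradient (f n) x = ((ρ n).normed volume ⋆[lsmul ℝ ℝ, volume] gradient g) x :=
    fun n x => (hasGradientAt_convolution (U := univ) hgl hGl
      (fun φ hφ => integral_smul_gradient_of_lipschitz hg hφ) (ρ n) (subset_univ _)).gradient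
  have htest : ∀ n, IsTest Ω (f n) := by
    intro n
    have hsupp : tsupport (f n) ⊆ Metric.cthickening δ (tsupport g) := by
      refine closure_minimal (fun x hx => ?_) Metric.isClosed_cthickening
      by_contra hxn
      refine hx ?_
      simp only [f]
      rw [convolution_eq_swap]
      refine integral_eq_zero_of_ae (Eventually.of_forall fun t => ?_)
      simp only [ContinuousLinearMap.lsmul_apply, Pi.zero_apply]
      by_cases ht : g t = 0
      · rw [ht, smul_zero]
      · have h0 : (ρ n).normed volume (x - t) = 0 := by
          by_contra hne
          have hmem : x - t ∈ Function.support ((ρ n).normed volume) := hne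
          rw [(ρ n).support_normed_eq, mem_ball_zero_iff] at hmem
          refine hxn (Metric.mem_cthickening_of_dist_le x t δ _ (subset_tsupport g ht) ?_)
          rw [dist_eq_norm]
          exact hmem.le.trans (hρδ n)
        rw [h0, zero_smul]
    exact ⟨(ρ n).hasCompactSupport_normed.contDiff_convolution_left (n := ⊤) _
      (ρ n).contDiff_normed hgl,
      (IsCompact.cthickening hc).of_isClosed_subset (isClosed_tsupport _) hsupp,
      hsupp.trans hδΩ⟩
  have l1 : Tendsto (fun n => eLpNorm (fun x => g x - f n x) 2 (volume.restrict Ω)) atTop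
      (𝓝 0) := by
    refine tendsto_eLpNorm_two_of_bounded (C := M + M)
      (fun n => (htest n).smooth.continuous.aestronglyMeasurable)
      hg.continuous.aestronglyMeasurable (fun n => Eventually.of_forall fun x => ?_)
      (Eventually.of_forall fun x => ?_)
    · exact (norm_sub_le _ _).trans (add_le_add (hM x)
        (norm_normed_convolution_le (Eventually.of_forall hM) _ _))
    · exact ContDiffBump.convolution_tendsto_right_of_continuous hρ hg.continuous x
  have l2 : Tendsto (fun n => eLpNorm (fun x => gradient g x - gradient (f n) x) 2
      (volume.restrict Ω)) atTop (𝓝 0) := by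
    refine tendsto_eLpNorm_two_of_bounded (C := K + K)
      (fun n => (measurable_gradient _).aestronglyMeasurable)
      (measurable_gradient _).aestronglyMeasurable (fun n => Eventually.of_forall fun x => ?_)
      (ae_restrict_of_ae ?_)
    · refine (norm_sub_le _ _).trans (add_le_add (hGb x) ?_)
      rw [hfg]
      exact norm_normed_convolution_le (Eventually.of_forall hGb) _ _
    · simp only [hfg]
      -- Convergence at almost every point needs the outer radius of the bump to be comparable with
      -- the inner one; here the ratio is `2`.
      refine ContDiffBump.ae_convolution_tendsto_right_of_locallyIntegrable (K := 2) hρ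
        (Eventually.of_forall fun n => ?_) hGl
      show δ * (1 / ((n : ℝ) + 1)) ≤ 2 * (δ * (1 / ((n : ℝ) + 1)) / 2)
      linarith
  obtain ⟨n, hn1, hn2⟩ := ((l1.eventually_lt_const hε).and (l2.eventually_lt_const hε)).exists
  exact ⟨f n, htest n, hn1, hn2⟩

/-! ### Truncation, and Lipschitz functions in `H¹₀` -/

/-- Truncation of the values in `[-δ, δ]`. -/
def truncate (δ t : ℝ) : ℝ := max (t - δ) 0 + min (t + δ) 0

theorem lipschitzWith_truncate (δ : ℝ) : LipschitzWith 2 (truncate δ) := by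
  have h1 : LipschitzWith 1 fun t : ℝ => max (t - δ) 0 :=
    (LipschitzWith.mk_one fun x y => by simp [Real.dist_eq]).max_const 0
  have h2 : LipschitzWith 1 fun t : ℝ => min (t + δ) 0 :=
    (LipschitzWith.mk_one fun x y => by simp [Real.dist_eq]).min_const 0
  have := h1.add h2
  rwa [one_add_one_eq_two] at this

/-- A Lipschitz function which vanishes outside a bounded open set is in `H¹₀`. -/
theorem memH10_of_lipschitz {d : ℕ} {Ω : Set (E d)} (hΩ : IsOpen Ω)
    (hb : Bornology.IsBounded Ω) {v : E d → ℝ} {K : NNReal} (hv : LipschitzWith K v)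
    (h0 : ∀ x ∉ Ω, v x = 0) : MemH10 Ω v := by
  have hfin : volume Ω ≠ ⊤ := hb.measure_lt_top.ne
  have : IsFiniteMeasure (volume.restrict Ω) :=
    ⟨by rw [Measure.restrict_apply_univ]; exact hfin.lt_top⟩
  let δ : ℕ → ℝ := fun n => 1 / ((n : ℝ) + 1)
  have hδ0 : ∀ n, 0 < δ n := fun n => by positivity
  have hδ : Tendsto δ atTop (𝓝 0) := tendsto_one_div_add_atTop_nhds_zero_nat
  let f : ℕ → E d → ℝ := fun n x => truncate (δ n) (v x)
  have hf : ∀ n, LipschitzWith (2 * K) (f n) := fun n => (lipschitzWith_truncate (δ n)).comp hv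
  have hsmall : ∀ n x, |v x| < δ n → f n x = 0 := by
    intro n x hx
    rw [abs_lt] at hx
    simp only [f, truncate]
    rw [max_eq_right (by linarith), min_eq_right (by linarith), add_zero]
  -- The truncated function lives on the closed set `|v| ≥ δ n`. This set lies in `Ω` because `v`
  -- vanishes outside, so the support is compact in `Ω`.
  have hsupp : ∀ n, tsupport (f n) ⊆ {x | δ n ≤ |v x|} := fun n =>
    closure_minimal (fun x hx => not_lt.1 fun hlt => hx (hsmall n x hlt))
      (isClosed_le continuous_const hv.continuous.abs)
  have hsΩ : ∀ n, {x | δ n ≤ |v x|} ⊆ Ω := fun n x hx => by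
    by_contra hxΩ
    have : δ n ≤ |v x| := hx
    rw [h0 x hxΩ, abs_zero] at this
    exact absurd this (not_le.2 (hδ0 n))
  have hcs : ∀ n, HasCompactSupport (f n) := fun n =>
    Metric.isCompact_of_isClosed_isBounded (isClosed_tsupport _)
      (hb.subset ((hsupp n).trans (hsΩ n)))
  -- With the value `0` on the zero set of `v`, the gradients of the truncations converge to `G` at
  -- every point, being eventually constant. That `G` is the weak gradient follows by passing to the
  -- limit in the integrals.
  let G : E d → E d := fun x => if v x = 0 then 0 else gradient v x
  have hGm : Measurable G := Measurable.ite
    (measurableSet_eq_fun hv.continuous.measurable measurable_const) measurable_const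
    (measurable_gradient v)
  have hgb : ∀ x, ‖gradient v x‖ ≤ K := fun x =>
    norm_gradient_le (U := univ) hv.lipschitzOnWith univ_mem
  have hGb : ∀ x, ‖G x‖ ≤ K := fun x => by
    simp only [G]; split_ifs
    · rw [norm_zero]; exact K.2
    · exact hgb x
  have hfb : ∀ n x, ‖gradient (f n) x‖ ≤ (2 * K : NNReal) := fun n x =>
    norm_gradient_le (U := univ) (hf n).lipschitzOnWith univ_mem
  have hgrad : ∀ x, ∀ᶠ n in atTop, gradient (f n) x = G x := by
    intro x
    by_cases hx : v x = 0
    · refine Eventually.of_forall fun n => ?_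
      simp only [G, hx, if_true]
      refine gradient_eq_zero_of_notMem_tsupport fun hmem => ?_
      have : δ n ≤ |v x| := hsupp n hmem
      rw [hx, abs_zero] at this
      exact absurd this (not_le.2 (hδ0 n))
    · filter_upwards [hδ.eventually_lt_const (abs_pos.2 hx)] with n hn
      simp only [G, hx, if_false]
      rcases lt_or_gt_of_ne hx with hneg | hpos
      · have hU : IsOpen {y | v y < - δ n} := isOpen_lt hv.continuous continuous_const
        rw [abs_of_neg hneg] at hn
        have hxU : x ∈ {y | v y < - δ n} := by show v x < - δ n; linarith
        rw [gradient_congr (g := fun y => v y + δ n) hU (fun y hy => ?_) hxU, gradient, gradient,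
          fderiv_add_const]
        have hy' : v y < - δ n := hy
        simp only [f, truncate]
        rw [max_eq_right (by linarith [hδ0 n]), min_eq_left (by linarith), zero_add]
      · have hU : IsOpen {y | δ n < v y} := isOpen_lt continuous_const hv.continuous
        rw [abs_of_pos hpos] at hn
        rw [gradient_congr (g := fun y => v y - δ n) hU (fun y hy => ?_) hn, gradient, gradient,
          fderiv_sub_const]
        have hy' : δ n < v y := hy
        simp only [f, truncate]
        rw [max_eq_left (by linarith), min_eq_right (by linarith [hδ0 n]), add_zero]
  have hgradlim : ∀ x, Tendsto (fun n => gradient (f n) x) atTop (𝓝 (G x)) := fun x =>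
    tendsto_const_nhds.congr' ((hgrad x).mono fun n hn => hn.symm)
  have hdist : ∀ n x, |v x - f n x| ≤ δ n := by
    intro n x
    have := hδ0 n
    simp only [f, truncate]
    rcases le_total (v x - δ n) 0 with h1 | h1 <;> rcases le_total (v x + δ n) 0 with h2 | h2 <;>
    simp only [h1, h2, max_eq_left, max_eq_right, min_eq_left, min_eq_right] <;>
    rw [abs_le] <;> constructor <;> linarith
  have hlim : ∀ x, Tendsto (fun n => f n x) atTop (𝓝 (v x)) := by
    intro x
    rw [tendsto_iff_norm_sub_tendsto_zero]
    refine squeeze_zero (fun n => norm_nonneg _) (fun n => ?_) hδ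
    rw [norm_sub_rev]
    exact hdist n x
  obtain ⟨M, hM⟩ : ∃ M, ∀ x ∈ Ω, ‖v x‖ ≤ M := by
    obtain ⟨M, hM⟩ := (hb.isCompact_closure.image hv.continuous.norm).bddAbove
    exact ⟨M, fun x hx => hM ⟨x, subset_closure hx, rfl⟩⟩
  have hvL : MemLp v 2 (volume.restrict Ω) :=
    MemLp.of_bound hv.continuous.aestronglyMeasurable M
      ((ae_restrict_iff' hΩ.measurableSet).2 (Eventually.of_forall hM))
  have hGL : MemLp G 2 (volume.restrict Ω) :=
    MemLp.of_bound hGm.aestronglyMeasurable K (Eventually.of_forall hGb)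
  have hl1 : Tendsto (fun n => eLpNorm (fun x => v x - f n x) 2 (volume.restrict Ω)) atTop
      (𝓝 0) := by
    refine tendsto_eLpNorm_two_of_bounded (C := 1)
      (fun n => (hf n).continuous.aestronglyMeasurable) hv.continuous.aestronglyMeasurable
      (fun n => Eventually.of_forall fun x => (hdist n x).trans ?_) (Eventually.of_forall hlim)
    rw [div_le_one (by positivity)]
    linarith [n.cast_nonneg (α := ℝ)]
  have hl2 : Tendsto (fun n => eLpNorm (fun x => G x - gradient (f n) x) 2 (volume.restrict Ω))
      atTop (𝓝 0) :=
    tendsto_eLpNorm_two_of_bounded (C := K + (2 * K : NNReal))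
      (fun n => (measurable_gradient _).aestronglyMeasurable) hGm.aestronglyMeasurable
      (fun n => Eventually.of_forall fun x => (norm_sub_le _ _).trans
        (add_le_add (hGb x) (hfb n x))) (Eventually.of_forall hgradlim)
  refine ⟨G, ⟨hvL, hGL, fun φ hφ => ?_⟩, fun ε hε => ?_⟩
  · have t1 : Tendsto (fun n => ∫ x in Ω, f n x • gradient φ x) atTop
        (𝓝 (∫ x in Ω, v x • gradient φ x)) := by
      have hi : Integrable (fun x => (M + 1) * ‖gradient φ x‖) (volume.restrict Ω) :=
        ((hφ.continuous_gradient.integrable_of_hasCompactSupport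
          hφ.hasCompactSupport_gradient).norm.const_mul _).restrict
      refine tendsto_integral_of_dominated_convergence _
        (fun n => ((hf n).continuous.smul hφ.continuous_gradient).aestronglyMeasurable) hi
        (fun n => (ae_restrict_iff' hΩ.measurableSet).2 (Eventually.of_forall fun x hx => ?_))
        (Eventually.of_forall fun x => (hlim x).smul_const _)
      rw [norm_smul]
      refine mul_le_mul_of_nonneg_right ?_ (norm_nonneg _)
      have h1 : δ n ≤ 1 := by
        rw [div_le_one (by positivity)]; linarith [n.cast_nonneg (α := ℝ)]
      calc ‖f n x‖ = ‖v x - (v x - f n x)‖ := by rw [sub_sub_cancel]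
        _ ≤ ‖v x‖ + ‖v x - f n x‖ := norm_sub_le _ _
        _ ≤ M + 1 := add_le_add (hM x hx) ((hdist n x).trans h1)
    have t2 : Tendsto (fun n => ∫ x in Ω, φ x • gradient (f n) x) atTop
        (𝓝 (∫ x in Ω, φ x • G x)) := by
      have hi : Integrable (fun x => ‖φ x‖ * (2 * K : NNReal)) (volume.restrict Ω) :=
        ((hφ.smooth.continuous.integrable_of_hasCompactSupport
          hφ.compact).norm.mul_const _).restrict
      refine tendsto_integral_of_dominated_convergence _
        (fun n => hφ.smooth.continuous.aestronglyMeasurable.smul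
          (measurable_gradient _).aestronglyMeasurable) hi
        (fun n => Eventually.of_forall fun x => ?_)
        (Eventually.of_forall fun x => (hgradlim x).const_smul _)
      rw [norm_smul]
      exact mul_le_mul_of_nonneg_left (hfb n x) (norm_nonneg _)
    refine tendsto_nhds_unique t1 (t2.neg.congr fun n => ?_)
    exact (isWeakGrad_of_lipschitzOn hΩ (hf n).lipschitzOnWith φ hφ).symm
  · have hε2 : 0 < ε / 2 := ENNReal.half_pos hε.ne'
    obtain ⟨n, hn1, hn2⟩ := ((hl1.eventually_lt_const hε2).and
      (hl2.eventually_lt_const hε2)).exists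
    obtain ⟨φ, hφ, hφ1, hφ2⟩ := exists_test_near_of_lipschitz hΩ hfin (hf n) (hcs n)
      ((hsupp n).trans (hsΩ n)) hε2
    refine ⟨φ, hφ, ?_, ?_⟩
    · calc eLpNorm (fun x => v x - φ x) 2 (volume.restrict Ω)
          = eLpNorm ((fun x => v x - f n x) + fun x => f n x - φ x) 2 (volume.restrict Ω) := by
            congr 1; ext x; simp
        _ ≤ _ := eLpNorm_add_le (hv.continuous.sub (hf n).continuous).aestronglyMeasurable
            ((hf n).continuous.sub hφ.smooth.continuous).aestronglyMeasurable one_le_two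
        _ < ε / 2 + ε / 2 := ENNReal.add_lt_add hn1 hφ1
        _ = ε := ENNReal.add_halves ε
    · calc eLpNorm (fun x => G x - gradient φ x) 2 (volume.restrict Ω)
          = eLpNorm ((fun x => G x - gradient (f n) x) + fun x => gradient (f n) x - gradient φ x)
              2 (volume.restrict Ω) := by congr 1; ext x; simp
        _ ≤ _ := eLpNorm_add_le (hGm.sub (measurable_gradient _)).aestronglyMeasurable
            ((measurable_gradient _).sub (measurable_gradient _)).aestronglyMeasurable one_le_two
        _ < ε / 2 + ε / 2 := ENNReal.add_lt_add hn2 hφ2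
        _ = ε := ENNReal.add_halves ε

/-! ### Polynomial functions -/

/-- `f` is a polynomial function of degree at most `k`. -/
def IsPoly {d : ℕ} (k : ℕ) (f : E d → ℝ) : Prop :=
  ∃ p : MvPolynomial (Fin d) ℝ, p.totalDegree ≤ k ∧ ∀ x, f x = polyEval p x

theorem isPoly_polyEval {d k : ℕ} {p : MvPolynomial (Fin d) ℝ} (hp : p.totalDegree ≤ k) :
    IsPoly k (polyEval p) := ⟨p, hp, fun _ => rfl⟩

theorem isPoly_const {d : ℕ} (k : ℕ) (c : ℝ) : IsPoly k fun _ : E d => c :=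
  ⟨MvPolynomial.C c, by simp, fun x => by simp [polyEval]⟩

theorem isPoly_coord {d : ℕ} (i : Fin d) : IsPoly 1 fun x : E d => x i :=
  ⟨MvPolynomial.X i, by simp, fun x => by simp [polyEval]⟩

theorem IsPoly.mono {d k l : ℕ} {f : E d → ℝ} (hf : IsPoly k f) (h : k ≤ l) : IsPoly l f :=
  hf.imp fun _ hp => ⟨hp.1.trans h, hp.2⟩

theorem IsPoly.add {d k : ℕ} {f g : E d → ℝ} (hf : IsPoly k f) (hg : IsPoly k g) :
    IsPoly k fun x => f x + g x := by
  obtain ⟨p, hp, hp'⟩ := hf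
  obtain ⟨q, hq, hq'⟩ := hg
  exact ⟨p + q, (MvPolynomial.totalDegree_add _ _).trans (max_le hp hq),
    fun x => by simp [polyEval, hp', hq']⟩

theorem IsPoly.mul {d k l : ℕ} {f g : E d → ℝ} (hf : IsPoly k f) (hg : IsPoly l g) :
    IsPoly (k + l) fun x => f x * g x := by
  obtain ⟨p, hp, hp'⟩ := hf
  obtain ⟨q, hq, hq'⟩ := hg
  exact ⟨p * q, (MvPolynomial.totalDegree_mul _ _).trans (add_le_add hp hq),
    fun x => by simp [polyEval, hp', hq']⟩

theorem IsPoly.const_mul {d k : ℕ} {f : E d → ℝ} (hf : IsPoly k f) (c : ℝ) :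
    IsPoly k fun x => c * f x := by
  have := (isPoly_const 0 c).mul hf
  rwa [zero_add] at this

theorem IsPoly.neg {d k : ℕ} {f : E d → ℝ} (hf : IsPoly k f) : IsPoly k fun x => - f x := by
  simpa using hf.const_mul (-1)

theorem IsPoly.sum {d k : ℕ} {ι : Type*} {s : Finset ι} {f : ι → E d → ℝ}
    (hf : ∀ i ∈ s, IsPoly k (f i)) : IsPoly k fun x => ∑ i ∈ s, f i x := by
  classical
  induction s using Finset.induction_on with
  | empty => simpa using isPoly_const k 0
  | insert a s ha ih =>
    simp only [Finset.sum_insert ha]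
    exact (hf a (Finset.mem_insert_self _ _)).add
      (ih fun i hi => hf i (Finset.mem_insert_of_mem hi))

theorem IsPoly.pow {d k : ℕ} {f : E d → ℝ} (hf : IsPoly k f) (n : ℕ) :
    IsPoly (n * k) fun x => f x ^ n := by
  induction n with
  | zero => simpa using isPoly_const 0 1
  | succ n ih =>
    simp only [pow_succ, Nat.succ_mul]
    exact ih.mul hf

theorem isPoly_prod {d : ℕ} {ι : Type*} {s : Finset ι} {f : ι → E d → ℝ} {k : ι → ℕ}
    (hf : ∀ i ∈ s, IsPoly (k i) (f i)) : IsPoly (∑ i ∈ s, k i) fun x => ∏ i ∈ s, f i x := by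
  classical
  induction s using Finset.induction_on with
  | empty => simpa using isPoly_const 0 1
  | insert a s ha ih =>
    simp only [Finset.prod_insert ha, Finset.sum_insert ha]
    exact (hf a (Finset.mem_insert_self _ _)).mul
      (ih fun i hi => hf i (Finset.mem_insert_of_mem hi))

theorem isPoly_affine {d : ℕ} (f : E d →ᵃ[ℝ] ℝ) : IsPoly 1 f := by
  have : (f : E d → ℝ) = fun x => ∑ i, f.linear (EuclideanSpace.single i 1) * x i + f 0 := by
    ext x
    rw [f.decomp]
    simp only [Pi.add_apply]
    congr 1
    conv_lhs => rw [← (EuclideanSpace.basisFun (Fin d) ℝ).sum_repr x]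
    simp [mul_comm]
    rw [f.decomp]; simp
  rw [this]
  exact (IsPoly.sum fun i _ => (isPoly_coord i).const_mul _).add (isPoly_const _ _)

theorem IsPoly.comp_affine {d m k : ℕ} {f : E d → ℝ} (hf : IsPoly k f) (F : E m →ᵃ[ℝ] E d) :
    IsPoly k fun x => f (F x) := by
  obtain ⟨p, hp, hp'⟩ := hf
  have : (fun x => f (F x)) = fun x =>
      ∑ s ∈ p.support, p.coeff s * ∏ i ∈ s.support, (F x i) ^ s i := by
    ext x
    rw [hp', polyEval, MvPolynomial.eval_eq]
  rw [this]
  refine IsPoly.sum fun s hs => IsPoly.const_mul ?_ _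
  refine (isPoly_prod (k := fun i => s i * 1) fun i _ => IsPoly.pow ?_ (s i)).mono ?_
  · exact isPoly_affine ((LinearMap.toAffineMap
      (EuclideanSpace.proj (𝕜 := ℝ) i : E d →L[ℝ] ℝ).toLinearMap).comp F)
  · simp only [mul_one]
    exact (MvPolynomial.le_totalDegree hs).trans hp

theorem hasFDerivAt_polyEval {d : ℕ} (p : MvPolynomial (Fin d) ℝ) (x : E d) :
    HasFDerivAt (polyEval p) (∑ i, polyEval (MvPolynomial.pderiv i p) x •
      (EuclideanSpace.proj i : E d →L[ℝ] ℝ)) x := by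
  induction p using MvPolynomial.induction_on with
  | C a =>
    have : polyEval (MvPolynomial.C a) = fun _ : E d => a := by ext; simp [polyEval]
    rw [this]
    simpa [polyEval] using hasFDerivAt_const a x
  | add p q hp hq =>
    have : polyEval (p + q) = fun x : E d => polyEval p x + polyEval q x := by
      ext; simp [polyEval]
    rw [this]
    convert! hp.add hq using 1
    rw [← Finset.sum_add_distrib]
    refine Finset.sum_congr rfl fun i _ => ?_
    rw [← add_smul]; simp [polyEval]
  | mul_X p j hp =>
    have : polyEval (p * MvPolynomial.X j) = fun x : E d => polyEval p x * x j := by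
      ext; simp [polyEval]
    rw [this]
    have hj : HasFDerivAt (fun x : E d => x j) (EuclideanSpace.proj j : E d →L[ℝ] ℝ) x :=
      (EuclideanSpace.proj j : E d →L[ℝ] ℝ).hasFDerivAt
    convert! hp.mul hj using 1
    ext v
    simp only [MvPolynomial.pderiv_mul, MvPolynomial.pderiv_X, polyEval]
    simp [Finset.sum_add_distrib, Finset.mul_sum, add_mul, Pi.single_apply]
    rw [add_comm]
    congr 1
    · simp [apply_ite (MvPolynomial.eval fun i => x i)]
    · exact Finset.sum_congr rfl fun i _ => by ring

theorem totalDegree_pderiv_le {d : ℕ} (i : Fin d) (p : MvPolynomial (Fin d) ℝ) :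
    (MvPolynomial.pderiv i p).totalDegree ≤ p.totalDegree - 1 := by
  conv_lhs => rw [← p.support_sum_monomial_coeff]
  rw [map_sum]
  refine MvPolynomial.totalDegree_finsetSum_le fun s hs => ?_
  rw [MvPolynomial.pderiv_monomial]
  by_cases h0 : s i = 0
  · simp [h0]
  · refine (MvPolynomial.totalDegree_monomial_le _ _).trans ?_
    have h1 := MvPolynomial.le_totalDegree hs
    have h2 : (s - Finsupp.single i 1).degree + 1 = s.degree := by
      have h3 : s - Finsupp.single i 1 + Finsupp.single i 1 = s :=
        tsub_add_cancel_of_le (Finsupp.single_le_iff.2 (Nat.one_le_iff_ne_zero.2 h0))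
      conv_rhs => rw [← h3]
      rw [map_add, Finsupp.degree_single]
    have h4 : s.degree ≤ p.totalDegree := h1
    show (s - Finsupp.single i 1).degree ≤ _
    omega

theorem IsPoly.contDiff {d k : ℕ} {f : E d → ℝ} (hf : IsPoly k f) {n : WithTop ℕ∞} :
    ContDiff ℝ n f := by
  obtain ⟨p, -, hp⟩ := hf
  have : f = fun x => ∑ s ∈ p.support, p.coeff s * ∏ i ∈ s.support, (x i) ^ s i := by
    ext x; rw [hp, polyEval, MvPolynomial.eval_eq]
  rw [this]
  refine ContDiff.sum fun s _ => contDiff_const.mul (contDiff_prod fun i _ => ContDiff.pow ?_ _)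
  exact (EuclideanSpace.proj i : E d →L[ℝ] ℝ).contDiff

theorem IsPoly.continuous {d k : ℕ} {f : E d → ℝ} (hf : IsPoly k f) : Continuous f :=
  (hf.contDiff (n := 0)).continuous

theorem IsPoly.differentiable {d k : ℕ} {f : E d → ℝ} (hf : IsPoly k f) :
    Differentiable ℝ f := (hf.contDiff (n := 1)).differentiable one_ne_zero

theorem IsPoly.continuous_gradient {d k : ℕ} {f : E d → ℝ} (hf : IsPoly k f) :
    Continuous (gradient f) :=
  (InnerProductSpace.toDual ℝ (E d)).symm.continuous.comp
    ((hf.contDiff (n := 1)).continuous_fderiv one_ne_zero)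

theorem gradient_apply {d : ℕ} (f : E d → ℝ) (x : E d) (i : Fin d) :
    gradient f x i = fderiv ℝ f x (EuclideanSpace.single i 1) := by
  rw [← inner_gradient, EuclideanSpace.inner_single_right]; simp

theorem IsPoly.gradient_apply {d k : ℕ} {f : E d → ℝ} (hf : IsPoly k f) (i : Fin d) :
    IsPoly (k - 1) fun x => gradient f x i := by
  obtain ⟨p, hp, hp'⟩ := hf
  refine ⟨MvPolynomial.pderiv i p, (totalDegree_pderiv_le i p).trans (Nat.sub_le_sub_right hp 1),
    fun x => ?_⟩
  dsimp only
  rw [FEM.gradient_apply, show f = polyEval p from funext hp', (hasFDerivAt_polyEval p x).fderiv]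
  simp [PiLp.single_apply]

theorem IsPoly.analyticOnNhd {d k : ℕ} {f : E d → ℝ} (hf : IsPoly k f) :
    AnalyticOnNhd ℝ f univ := fun _ _ =>
  (hf.contDiff (n := ⊤)).contDiffAt.analyticAt

/-- Identity theorem for analytic functions. -/
theorem polyEval_injective {d : ℕ} {p : MvPolynomial (Fin d) ℝ} {U : Set (E d)} (hU : IsOpen U)
    (hne : U.Nonempty) (h : ∀ x ∈ U, polyEval p x = 0) : p = 0 := by
  obtain ⟨x, hx⟩ := hne
  have h1 : polyEval p = fun _ : E d => (0 : ℝ) :=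
    (isPoly_polyEval le_rfl).analyticOnNhd.eq_of_eventuallyEq
      (fun x _ => analyticAt_const) (z₀ := x)
      (Filter.eventually_of_mem (hU.mem_nhds hx) h)
  refine MvPolynomial.funext fun y => ?_
  have := congrFun h1 (WithLp.toLp 2 y)
  simpa [polyEval] using this

/-! ### Equivalence of norms on polynomials -/

/-- Both sides are quadratic in `p`, so it suffices to bound their ratio on the unit sphere of the
finite-dimensional coefficient space times `K'`, a compact set. The denominator is positive because
a polynomial that vanishes on `U` is zero. `K'` need not lie in `K`: the values far away are
controlled too. `D` is the identity or a partial derivative. -/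
theorem exists_polyEval_sq_le {m : ℕ} (k : ℕ) {K K' U : Set (E m)} (hK : IsCompact K)
    (hK' : IsCompact K') (hU : IsOpen U) (hUne : U.Nonempty) (hUK : U ⊆ K) {φ : E m → ℝ}
    (hφ : Continuous φ) (h0 : ∀ x ∈ K, 0 ≤ φ x) (hpos : ∀ x ∈ U, 0 < φ x)
    (D : MvPolynomial (Fin m) ℝ →ₗ[ℝ] MvPolynomial (Fin m) ℝ) :
    ∃ C : ℝ, 0 < C ∧ ∀ p : MvPolynomial (Fin m) ℝ, p.totalDegree ≤ k → ∀ x ∈ K',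
      polyEval (D p) x ^ 2 ≤ C * ∫ y in K, polyEval p y ^ 2 * φ y := by
  classical
  let V := MvPolynomial.restrictTotalDegree (Fin m) ℝ k
  let b := Module.finBasis ℝ V
  let Φ : (Fin (Module.finrank ℝ V) → ℝ) → MvPolynomial (Fin m) ℝ :=
    fun c => ∑ i, c i • (b i : MvPolynomial (Fin m) ℝ)
  have hΦ : ∀ p : V, Φ (b.equivFun p) = p := fun p => by
    have := congrArg Subtype.val (b.sum_equivFun p)
    simpa only [Φ, AddSubmonoidClass.coe_finsetSum, Submodule.coe_smul] using this
  have hcont : ∀ L : MvPolynomial (Fin m) ℝ →ₗ[ℝ] MvPolynomial (Fin m) ℝ,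
      Continuous fun z : (Fin (Module.finrank ℝ V) → ℝ) × E m => polyEval (L (Φ z.1)) z.2 := by
    intro L
    have : (fun z : (Fin (Module.finrank ℝ V) → ℝ) × E m => polyEval (L (Φ z.1)) z.2) =
        fun z => ∑ i, z.1 i * polyEval (L (b i)) z.2 := by
      ext z; simp [Φ, polyEval, map_sum, MvPolynomial.smul_eval]
    rw [this]
    refine continuous_finsetSum _ fun i _ => ((continuous_apply i).comp continuous_fst).mul ?_
    exact (isPoly_polyEval le_rfl).continuous.comp continuous_snd
  let N : (Fin (Module.finrank ℝ V) → ℝ) → ℝ := fun c => ∫ y in K, polyEval (Φ c) y ^ 2 * φ y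
  have hN : Continuous N :=
    continuous_parametric_integral_of_continuous
      (f := fun c y => polyEval (Φ c) y ^ 2 * φ y)
      (by exact ((hcont LinearMap.id).pow 2).mul (hφ.comp continuous_snd)) hK
  have hNpos : ∀ p : MvPolynomial (Fin m) ℝ, p ≠ 0 → 0 < ∫ y in K, polyEval p y ^ 2 * φ y := by
    intro p hp
    have hc : Continuous fun y => polyEval p y ^ 2 * φ y :=
      ((isPoly_polyEval le_rfl).continuous.pow 2).mul hφ
    rw [setIntegral_pos_iff_support_of_nonneg_ae]
    · by_contra hzero
      apply hp
      refine polyEval_injective hU hUne fun x hx => ?_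
      by_contra hne
      apply hzero
      have hopen : IsOpen (Function.support (fun y => polyEval p y ^ 2 * φ y) ∩ U) :=
        hc.isOpen_support.inter hU
      refine lt_of_lt_of_le (hopen.measure_pos volume ⟨x, ?_, hx⟩)
        (measure_mono (inter_subset_inter_right _ hUK))
      exact mul_ne_zero (pow_ne_zero 2 hne) (hpos x hx).ne'
    · exact (ae_restrict_iff' hK.measurableSet).2 (Filter.Eventually.of_forall fun x hx =>
        mul_nonneg (sq_nonneg _) (h0 x hx))
    · exact hc.continuousOn.integrableOn_compact hK
  have hΦ0 : ∀ c, c ≠ 0 → Φ c ≠ 0 := by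
    intro c hc h
    apply hc
    have h1 := hΦ (b.equivFun.symm c)
    rw [LinearEquiv.apply_symm_apply] at h1
    rw [h1] at h
    exact (LinearEquiv.map_eq_zero_iff _).1 (Subtype.ext h)
  have hcomp : IsCompact (Metric.sphere (0 : Fin (Module.finrank ℝ V) → ℝ) 1 ×ˢ K') :=
    (isCompact_sphere _ _).prod hK'
  obtain ⟨C, hC⟩ := hcomp.bddAbove_image (f := fun z => polyEval (D (Φ z.1)) z.2 ^ 2 / N z.1) <| by
    refine ((hcont D).pow 2).continuousOn.div (hN.comp continuous_fst).continuousOn ?_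
    rintro ⟨c, x⟩ ⟨hc, -⟩
    refine (hNpos _ (hΦ0 c ?_)).ne'
    rintro rfl
    simp at hc
  refine ⟨max C 1, by positivity, fun p hp x hx => ?_⟩
  by_cases hp0 : p = 0
  · simp [hp0, polyEval]
  let q : V := ⟨p, (MvPolynomial.mem_restrictTotalDegree _ _ _).2 hp⟩
  have hq0 : b.equivFun q ≠ 0 := by
    rw [Ne, LinearEquiv.map_eq_zero_iff]
    exact fun h => hp0 (congrArg Subtype.val h)
  set r := ‖b.equivFun q‖
  have hr : 0 < r := norm_pos_iff.2 hq0
  have hs : r⁻¹ • b.equivFun q ∈ Metric.sphere (0 : Fin (Module.finrank ℝ V) → ℝ) 1 := by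
    rw [mem_sphere_zero_iff_norm, norm_smul, norm_inv, norm_norm]
    exact inv_mul_cancel₀ hr.ne'
  have h1 := hC ⟨(r⁻¹ • b.equivFun q, x), ⟨hs, hx⟩, rfl⟩
  have h2 : Φ (r⁻¹ • b.equivFun q) = r⁻¹ • p := by
    rw [← map_smul, hΦ]; rfl
  have h3 : ∀ (p : MvPolynomial (Fin m) ℝ) y, polyEval (r⁻¹ • p) y = r⁻¹ * polyEval p y := by
    intro p y; simp [polyEval, MvPolynomial.smul_eval]
  simp only [N, h2, map_smul, h3, mul_pow, mul_assoc] at h1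
  rw [integral_const_mul, mul_div_mul_left _ _ (by positivity), div_le_iff₀ (hNpos p hp0)] at h1
  exact h1.trans (mul_le_mul_of_nonneg_right (le_max_left _ _) (hNpos p hp0).le)

theorem norm_sq_eq_sum {m : ℕ} (x : E m) : ‖x‖ ^ 2 = ∑ i, x i ^ 2 := by
  rw [EuclideanSpace.norm_sq_eq]; simp

theorem exists_sq_add_gradient_sq_le {m : ℕ} (k : ℕ) {K K' U : Set (E m)} (hK : IsCompact K)
    (hK' : IsCompact K') (hU : IsOpen U) (hUne : U.Nonempty) (hUK : U ⊆ K) {φ : E m → ℝ}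
    (hφ : Continuous φ) (h0 : ∀ x ∈ K, 0 ≤ φ x) (hpos : ∀ x ∈ U, 0 < φ x) :
    ∃ C : ℝ, 0 < C ∧ ∀ f : E m → ℝ, IsPoly k f → ∀ x ∈ K',
      f x ^ 2 + ‖gradient f x‖ ^ 2 ≤ C * ∫ y in K, f y ^ 2 * φ y := by
  obtain ⟨C, hC, h⟩ := exists_polyEval_sq_le k hK hK' hU hUne hUK hφ h0 hpos LinearMap.id
  choose C' hC' h' using fun i : Fin m => exists_polyEval_sq_le k hK hK' hU hUne hUK hφ h0 hpos
    (MvPolynomial.pderiv i : Derivation ℝ (MvPolynomial (Fin m) ℝ) _).toLinearMap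
  refine ⟨C + ∑ i, C' i, add_pos_of_pos_of_nonneg hC (Finset.sum_nonneg fun i _ => (hC' i).le),
    fun f ⟨p, hp, hf⟩ x hx => ?_⟩
  obtain rfl : f = polyEval p := funext hf
  rw [norm_sq_eq_sum, add_mul, Finset.sum_mul]
  refine add_le_add (h p hp x hx) (Finset.sum_le_sum fun i _ => ?_)
  refine le_trans (le_of_eq ?_) (h' i p hp x hx)
  rw [FEM.gradient_apply, (hasFDerivAt_polyEval p x).fderiv]
  simp [PiLp.single_apply]

/-! ### Affine changes of variables and scaled estimates -/

theorem setIntegral_image_affineEquiv {m : ℕ} (F : E m ≃ᵃ[ℝ] E m) {K : Set (E m)}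
    (hK : MeasurableSet K) (g : E m → ℝ) :
    ∫ x in F '' K, g x = |LinearMap.det (F.linear : E m →ₗ[ℝ] E m)| * ∫ x in K, g (F x) := by
  have hd : ∀ x ∈ K, HasFDerivWithinAt F
      (LinearMap.toContinuousLinearMap (F.linear : E m →ₗ[ℝ] E m)) K x := fun x _ => by
    have h1 : (F : E m → E m) = fun x =>
        LinearMap.toContinuousLinearMap (F.linear : E m →ₗ[ℝ] E m) x + F 0 := by
      ext1 x; exact congrFun (AffineMap.decomp F.toAffineMap) x
    rw [h1]
    exact ((ContinuousLinearMap.hasFDerivAt _).add_const _).hasFDerivWithinAt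
  rw [integral_image_eq_integral_abs_det_fderiv_smul volume hK hd F.injective.injOn,
    ← integral_const_mul]
  rfl

theorem volume_real_image_affineEquiv {m : ℕ} (F : E m ≃ᵃ[ℝ] E m) {K : Set (E m)}
    (hK : MeasurableSet K) :
    volume.real (F '' K) = |LinearMap.det (F.linear : E m →ₗ[ℝ] E m)| * volume.real K := by
  have := setIntegral_image_affineEquiv F hK fun _ => 1
  simpa using this

/-- Transfer of the equivalence of norms by an affine map. -/
theorem exists_sq_le_average {m : ℕ} (k : ℕ) {K U : Set (E m)} (hK : IsCompact K)
    (hU : IsOpen U) (hUne : U.Nonempty) (hUK : U ⊆ K) {φ : E m → ℝ}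
    (hφ : Continuous φ) (h0 : ∀ x ∈ K, 0 ≤ φ x) (hpos : ∀ x ∈ U, 0 < φ x) :
    ∃ C : ℝ, 0 < C ∧ ∀ (F : E m ≃ᵃ[ℝ] E m) (f : E m → ℝ), IsPoly k f → ∀ x ∈ K,
      volume.real (F '' K) * f (F x) ^ 2 ≤ C * ∫ y in F '' K, f y ^ 2 * φ (F.symm y) := by
  obtain ⟨C, hC, h⟩ := exists_sq_add_gradient_sq_le k hK hK hU hUne hUK hφ h0 hpos
  refine ⟨volume.real K * C + 1, by positivity, fun F f hf x hx => ?_⟩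
  have h1 := h _ (hf.comp_affine F.toAffineMap) x hx
  rw [setIntegral_image_affineEquiv F hK.measurableSet,
    volume_real_image_affineEquiv F hK.measurableSet]
  simp only [AffineEquiv.symm_apply_apply]
  simp only [AffineEquiv.coe_toAffineMap] at h1
  have h2 : 0 ≤ ∫ y in K, f (F y) ^ 2 * φ y :=
    setIntegral_nonneg hK.measurableSet fun y hy => mul_nonneg (sq_nonneg _) (h0 y hy)
  have h3 : f (F x) ^ 2 ≤ C * ∫ y in K, f (F y) ^ 2 * φ y :=
    le_trans (le_add_of_nonneg_right (sq_nonneg _)) h1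
  set D := |LinearMap.det (F.linear : E m →ₗ[ℝ] E m)|
  have hD : 0 ≤ D := abs_nonneg _
  calc D * volume.real K * f (F x) ^ 2 ≤
      D * volume.real K * (C * ∫ y in K, f (F y) ^ 2 * φ y) := by gcongr
    _ = (volume.real K * C) * (D * ∫ y in K, f (F y) ^ 2 * φ y) := by ring
    _ ≤ _ := by gcongr; linarith

/-- The homothety `x ↦ x₀ + ρ x`. -/
def scaling {m : ℕ} (x₀ : E m) {ρ : ℝ} (hρ : 0 < ρ) : E m ≃ᵃ[ℝ] E m :=
  (LinearEquiv.smulOfNeZero ℝ (E m) ρ hρ.ne').toAffineEquiv.trans (AffineEquiv.constVAdd ℝ _ x₀)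

theorem scaling_apply {m : ℕ} (x₀ : E m) {ρ : ℝ} (hρ : 0 < ρ) (x : E m) :
    scaling x₀ hρ x = x₀ + ρ • x := by
  simp [scaling]

theorem image_scaling {m : ℕ} (x₀ : E m) {ρ : ℝ} (hρ : 0 < ρ) {r : ℝ} (hr : 0 ≤ r) :
    scaling x₀ hρ '' Metric.closedBall 0 r = Metric.closedBall x₀ (r * ρ) := by
  have : (scaling x₀ hρ : E m → E m) = (fun x => x₀ + x) ∘ fun x => ρ • x := by
    ext1 x; simp [scaling_apply]
  rw [this, image_comp]
  have h2 : (fun x : E m => ρ • x) '' Metric.closedBall 0 r = Metric.closedBall 0 (r * ρ) := by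
    have := smul_closedBall ρ (0 : E m) hr
    rw [smul_zero, Real.norm_of_nonneg hρ.le, mul_comm] at this
    exact this
  rw [h2]
  simp

theorem det_scaling {m : ℕ} (x₀ : E m) {ρ : ℝ} (hρ : 0 < ρ) :
    |LinearMap.det ((scaling x₀ hρ).linear : E m →ₗ[ℝ] E m)| = ρ ^ m := by
  have : ((scaling x₀ hρ).linear : E m →ₗ[ℝ] E m) = ρ • LinearMap.id := by
    ext1; rfl
  rw [this, LinearMap.det_smul]
  simp [abs_of_pos hρ]

/-- The case of the unit ball, carried over by the homothety `x ↦ x₀ + ρ x`, under which the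
gradient gains a factor `ρ` and the volume a factor `ρ ^ m`. The points range over a larger ball so
that they can cover an element of which only the inscribed ball enters the integral. -/
theorem exists_inverse_estimate (m k : ℕ) (Λ : ℝ) :
    ∃ C : ℝ, 0 < C ∧ ∀ (x₀ : E m) (ρ : ℝ), 0 < ρ → ∀ f : E m → ℝ, IsPoly k f →
      ∀ x ∈ Metric.closedBall x₀ (Λ * ρ), ρ ^ m * (f x ^ 2 + ρ ^ 2 * ‖gradient f x‖ ^ 2) ≤
        C * ∫ y in Metric.closedBall x₀ ρ, f y ^ 2 := by
  obtain ⟨C, hC, h⟩ := exists_sq_add_gradient_sq_le (m := m) k (φ := fun _ => 1)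
    (isCompact_closedBall 0 1) (isCompact_closedBall 0 (max Λ 0))
    Metric.isOpen_ball ⟨0, by simp⟩ Metric.ball_subset_closedBall continuous_const
    (fun _ _ => zero_le_one) (fun _ _ => zero_lt_one)
  refine ⟨C, hC, fun x₀ ρ hρ f hf x hx => ?_⟩
  have hx' : x ∈ Metric.closedBall x₀ (max Λ 0 * ρ) :=
    Metric.closedBall_subset_closedBall (by gcongr; exact le_max_left _ _) hx
  rw [← image_scaling x₀ hρ (le_max_right _ _)] at hx'
  obtain ⟨z, hz, rfl⟩ := hx'
  have h1 := h _ (hf.comp_affine (scaling x₀ hρ).toAffineMap) z hz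
  have h2 : gradient (fun x => f ((scaling x₀ hρ).toAffineMap x)) z =
      ρ • gradient f (scaling x₀ hρ z) := by
    refine ext_inner_right ℝ fun v => ?_
    rw [inner_gradient, real_inner_smul_left, inner_gradient]
    have h3 : HasFDerivAt (fun x => x₀ + ρ • x) (ρ • ContinuousLinearMap.id ℝ (E m)) z :=
      ((hasFDerivAt_id z).const_smul ρ).const_add x₀
    have h4 : HasFDerivAt f (fderiv ℝ f (x₀ + ρ • z)) (x₀ + ρ • z) :=
      (hf.differentiable _).hasFDerivAt
    have h5 : (fun x => f ((scaling x₀ hρ).toAffineMap x)) = f ∘ fun x => x₀ + ρ • x := by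
      ext x; simp [scaling_apply]
    rw [h5, (h4.comp z h3).fderiv, scaling_apply]
    simp
  rw [h2, norm_smul, Real.norm_of_nonneg hρ.le, mul_pow] at h1
  have h6 := setIntegral_image_affineEquiv (scaling x₀ hρ)
    (Metric.isClosed_closedBall (x := (0 : E m)) (ε := 1)).measurableSet fun y => f y ^ 2
  rw [image_scaling x₀ hρ zero_le_one, one_mul, det_scaling] at h6
  rw [h6]
  simp only [mul_one, AffineEquiv.coe_toAffineMap] at h1
  calc _ ≤ ρ ^ m * (C * ∫ y in Metric.closedBall 0 1, f (scaling x₀ hρ y) ^ 2) := by gcongr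
    _ = _ := by ring

/-! ### Hyperplanes and half-spaces -/

/-- The hyperplane through `z` orthogonal to `b 0`, parametrized isometrically. -/
def planeMap {m : ℕ} (b : OrthonormalBasis (Fin (m + 1)) ℝ (E (m + 1))) (z : E (m + 1)) :
    E m →ᵃ[ℝ] E (m + 1) :=
  AffineMap.mk' (fun y => z + ∑ j, y j • b j.succ)
    { toFun := fun y => ∑ j, y j • b j.succ
      map_add' := fun x y => by simp [add_smul, Finset.sum_add_distrib]
      map_smul' := fun c y => by simp [mul_smul, Finset.smul_sum] } 0 (fun y => by simp [add_comm])

theorem planeMap_apply {m : ℕ} (b : OrthonormalBasis (Fin (m + 1)) ℝ (E (m + 1))) (z : E (m + 1))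
    (y : E m) : planeMap b z y = z + ∑ j, y j • b j.succ := rfl

/-- Orthogonal coordinates adapted to the hyperplane through `z` orthogonal to `b 0`. -/
def frame {m : ℕ} (b : OrthonormalBasis (Fin (m + 1)) ℝ (E (m + 1))) (z : E (m + 1)) :
    ℝ × E m ≃ᵐ E (m + 1) :=
  ((((MeasurableEquiv.prodCongr (MeasurableEquiv.refl ℝ)
    (MeasurableEquiv.toLp 2 (Fin m → ℝ)).symm).trans
    (MeasurableEquiv.piFinSuccAbove (fun _ : Fin (m + 1) => ℝ) 0).symm).trans
    (MeasurableEquiv.toLp 2 (Fin (m + 1) → ℝ))).trans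
    b.repr.symm.toHomeomorph.toMeasurableEquiv).trans (MeasurableEquiv.addLeft z)

theorem frame_apply {m : ℕ} (b : OrthonormalBasis (Fin (m + 1)) ℝ (E (m + 1))) (z : E (m + 1))
    (s : ℝ) (y : E m) : frame b z (s, y) = planeMap b z y + s • b 0 := by
  have h : frame b z (s, y) = z + b.repr.symm (WithLp.toLp 2 (Fin.cons s fun j => y j)) := by
    show z + b.repr.symm (WithLp.toLp 2 (Fin.insertNth 0 s fun j => y j)) = _
    rw [Fin.insertNth_zero']
  rw [h, ← b.sum_repr_symm, planeMap_apply, Fin.sum_univ_succ, add_assoc]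
  simp [add_comm]

theorem measurePreserving_frame {m : ℕ} (b : OrthonormalBasis (Fin (m + 1)) ℝ (E (m + 1)))
    (z : E (m + 1)) :
    MeasurePreserving (frame b z) ((volume : Measure ℝ).prod (volume : Measure (E m))) volume := by
  have h1 : MeasurePreserving (MeasurableEquiv.prodCongr (MeasurableEquiv.refl ℝ)
      (MeasurableEquiv.toLp 2 (Fin m → ℝ)).symm) ((volume : Measure ℝ).prod (volume : Measure (E m)))
      ((volume : Measure ℝ).prod (volume : Measure (Fin m → ℝ))) :=
    (MeasurePreserving.id _).prod (EuclideanSpace.volume_preserving_symm_measurableEquiv_toLp _)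
  have h2 := (volume_preserving_piFinSuccAbove (fun _ : Fin (m + 1) => ℝ) 0).symm
  have h3 := (EuclideanSpace.volume_preserving_symm_measurableEquiv_toLp (Fin (m + 1))).symm
  have h4 : MeasurePreserving b.repr.symm.toHomeomorph.toMeasurableEquiv volume volume :=
    b.repr.symm.measurePreserving
  have h5 : MeasurePreserving (MeasurableEquiv.addLeft z) volume volume :=
    measurePreserving_add_left volume z
  exact h5.comp (h4.comp (h3.comp (h2.comp h1)))

theorem planeMap_sub {m : ℕ} (b : OrthonormalBasis (Fin (m + 1)) ℝ (E (m + 1))) (z : E (m + 1))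
    (y y' : E m) : planeMap b z y - planeMap b z y' =
      b.repr.symm (WithLp.toLp 2 (Fin.cons 0 fun j => y j - y' j)) := by
  rw [← b.sum_repr_symm, Fin.sum_univ_succ]
  simp [planeMap_apply, sub_smul]

theorem isometry_planeMap {m : ℕ} (b : OrthonormalBasis (Fin (m + 1)) ℝ (E (m + 1)))
    (z : E (m + 1)) : Isometry (planeMap b z) := by
  refine Isometry.of_dist_eq fun y y' => ?_
  rw [dist_eq_norm, dist_eq_norm, planeMap_sub, LinearIsometryEquiv.norm_map,
    EuclideanSpace.norm_eq, EuclideanSpace.norm_eq, Fin.sum_univ_succ]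
  simp

theorem inner_planeMap_sub {m : ℕ} (b : OrthonormalBasis (Fin (m + 1)) ℝ (E (m + 1)))
    (z : E (m + 1)) (y : E m) : inner ℝ (planeMap b z y - z) (b 0) = 0 := by
  rw [planeMap_apply, add_sub_cancel_left, sum_inner]
  refine Finset.sum_eq_zero fun j _ => ?_
  rw [real_inner_smul_left, b.inner_eq_zero (Fin.succ_ne_zero j), mul_zero]

theorem inner_frame_sub {m : ℕ} (b : OrthonormalBasis (Fin (m + 1)) ℝ (E (m + 1)))
    (z : E (m + 1)) (s : ℝ) (y : E m) : inner ℝ (frame b z (s, y) - z) (b 0) = s := by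
  rw [frame_apply, add_sub_right_comm, inner_add_left, inner_planeMap_sub, real_inner_smul_left,
    real_inner_self_eq_norm_sq, b.norm_eq_one]
  simp

theorem range_planeMap {m : ℕ} (b : OrthonormalBasis (Fin (m + 1)) ℝ (E (m + 1)))
    (z : E (m + 1)) : range (planeMap b z) = {x | inner ℝ (x - z) (b 0) = 0} := by
  ext x
  refine ⟨?_, fun h => ?_⟩
  · rintro ⟨y, rfl⟩; exact inner_planeMap_sub b z y
  · obtain ⟨⟨s, y⟩, rfl⟩ := (frame b z).surjective x
    rw [mem_ofPred_eq, inner_frame_sub] at h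
    exact ⟨y, by rw [frame_apply, h]; simp⟩

theorem norm_le_norm_frame_sub {m : ℕ} (b : OrthonormalBasis (Fin (m + 1)) ℝ (E (m + 1)))
    (z : E (m + 1)) (s : ℝ) (y : E m) : ‖y‖ ≤ ‖frame b z (s, y) - z‖ := by
  have h1 : ‖planeMap b z y - z‖ = ‖y‖ := by
    have := (isometry_planeMap b z).dist_eq y 0
    rw [dist_eq_norm, dist_eq_norm, sub_zero] at this
    rw [← this]
    simp [planeMap_apply]
  have h2 : ‖frame b z (s, y) - z‖ ^ 2 = ‖y‖ ^ 2 + s ^ 2 := by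
    rw [frame_apply, add_sub_right_comm, norm_add_sq_real, h1, real_inner_smul_right,
      inner_planeMap_sub, norm_smul, b.norm_eq_one]
    simp
  exact le_of_sq_le_sq (by rw [h2]; nlinarith [sq_nonneg s]) (norm_nonneg _)

theorem exists_orthonormalBasis_zero {m : ℕ} {n : E (m + 1)} (hn : ‖n‖ = 1) :
    ∃ b : OrthonormalBasis (Fin (m + 1)) ℝ (E (m + 1)), b 0 = n := by
  have hv : Orthonormal ℝ (({0} : Set (Fin (m + 1))).domRestrict fun _ => n) :=
    ⟨fun i => hn, fun i j hij => (hij (Subsingleton.elim _ _)).elim⟩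
  obtain ⟨b, hb⟩ := hv.exists_orthonormalBasis_extension_of_card_eq (by simp)
  exact ⟨b, hb 0 rfl⟩

theorem setIntegral_range_planeMap {m : ℕ} (b : OrthonormalBasis (Fin (m + 1)) ℝ (E (m + 1)))
    (z : E (m + 1)) (g : E (m + 1) → ℝ) :
    ∫ x in range (planeMap b z), g x ∂μHE[m] = ∫ y, g (planeMap b z y) := by
  rw [← (isometry_planeMap b z).map_euclideanHausdorffMeasure,
    EuclideanSpace.euclideanHausdorffMeasure_eq_volume,
    (isometry_planeMap b z).isClosedEmbedding.measurableEmbedding.integral_map]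

theorem map_planeMap_restrict {m : ℕ} (b : OrthonormalBasis (Fin (m + 1)) ℝ (E (m + 1)))
    (z : E (m + 1)) {S : Set (E (m + 1))} (hS : MeasurableSet S) (hSr : S ⊆ range (planeMap b z)) :
    (volume.restrict (planeMap b z ⁻¹' S)).map (planeMap b z) = μHE[m].restrict S := by
  rw [← Measure.restrict_map (isometry_planeMap b z).continuous.measurable hS,
    ← EuclideanSpace.euclideanHausdorffMeasure_eq_volume,
    (isometry_planeMap b z).map_euclideanHausdorffMeasure, Measure.restrict_restrict hS,
    inter_eq_left.2 hSr]

/-- The derivative in direction `e` is a limit of difference quotients. Translating `g` by `t e`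
amounts to moving the bounding hyperplane by `t ⟨e, n⟩`, and by Fubini the integral over the layer
between the two hyperplanes, divided by `t`, tends to `⟨e, n⟩` times the integral over the
hyperplane. -/
theorem setIntegral_lineDeriv_halfspace {m : ℕ} {n : E (m + 1)} (hn : ‖n‖ = 1) (z e : E (m + 1))
    {g : E (m + 1) → ℝ} {L : NNReal} (hg : LipschitzWith L g) (hc : HasCompactSupport g) :
    ∫ x in {x | inner ℝ (x - z) n ≤ 0}, lineDeriv ℝ g x e =
      inner ℝ e n * ∫ x in {x | inner ℝ (x - z) n = 0}, g x ∂μHE[m] := by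
  obtain ⟨b, rfl⟩ := exists_orthonormalBasis_zero hn
  rw [← range_planeMap, setIntegral_range_planeMap]
  set H : ℝ → Set (E (m + 1)) := fun s => {x | inner ℝ (x - z) (b 0) ≤ s} with hHdef
  have hHc : ∀ s, MeasurableSet (H s) := fun s =>
    (isClosed_le (by fun_prop) continuous_const).measurableSet
  set Φ : ℝ → ℝ := fun s => ∫ y, g (frame b z (s, y)) with hΦdef
  have hgi : Integrable g := hg.continuous.integrable_of_hasCompactSupport hc
  obtain ⟨R, hR⟩ := hc.isCompact.isBounded.subset_closedBall z
  have hR0 : ∀ x, x ∉ Metric.closedBall z R → g x = 0 := fun x hx =>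
    image_eq_zero_of_notMem_tsupport fun h => hx (hR h)
  have hΦ : Continuous Φ := by
    have e1 : Φ = fun s => ∫ y in Metric.closedBall 0 R, g (frame b z (s, y)) := by
      ext s
      refine (setIntegral_eq_integral_of_forall_compl_eq_zero fun y hy => hR0 _ fun h => hy ?_).symm
      rw [mem_closedBall_zero_iff]
      rw [mem_closedBall_iff_norm] at h
      exact (norm_le_norm_frame_sub b z s y).trans h
    rw [e1]
    refine continuous_parametric_integral_of_continuous (f := fun s y => g (frame b z (s, y))) ?_
      (isCompact_closedBall _ _)
    refine hg.continuous.comp ?_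
    simp only [frame_apply]
    exact ((isometry_planeMap b z).continuous.comp continuous_snd).add
      (continuous_fst.smul continuous_const)
  -- Integrability in the orthogonal coordinates yields the slicing of half-space integrals into the
  -- hyperplane integrals `Φ`.
  have hprod : Integrable (fun p : ℝ × E m => g (frame b z p))
      ((volume : Measure ℝ).prod volume) :=
    ((measurePreserving_frame b z).integrable_comp_emb (frame b z).measurableEmbedding).2 hgi
  have hΦi : Integrable Φ := hprod.integral_prod_left
  have hslice : ∀ s, ∫ x in H s, g x = ∫ r in Iic s, Φ r := by
    intro s
    rw [← (measurePreserving_frame b z).setIntegral_preimage_emb (frame b z).measurableEmbedding]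
    have : frame b z ⁻¹' H s = Iic s ×ˢ univ := by
      ext ⟨r, y⟩
      simp only [hHdef, mem_preimage, mem_ofPred_eq, inner_frame_sub]
      simp
    rw [this, setIntegral_prod _ hprod.integrableOn]
    simp [hΦdef]
  set c := inner ℝ e (b 0)
  have hshift : ∀ t : ℝ, ∫ x in H 0, g (x + t • e) = ∫ x in H (t * c), g x := by
    intro t
    rw [← integral_indicator (hHc _), ← integral_indicator (hHc _),
      
      ← integral_add_right_eq_self ((H (t * c)).indicator g) (t • e)]
    congr 1
    ext x
    simp only [indicator, hHdef, mem_ofPred_eq]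
    have : inner ℝ (x + t • e - z) (b 0) = inner ℝ (x - z) (b 0) + t * c := by
      rw [add_sub_right_comm, inner_add_left, real_inner_smul_left]
    simp only [this, add_le_iff_nonpos_left]
  have hlim1 : Filter.Tendsto (fun t : ℝ => t⁻¹ • ((∫ x in H 0, g (x + t • e)) - ∫ x in H 0, g x))
      (nhdsWithin 0 (Ioi 0)) (nhds (c * Φ 0)) := by
    have h1 : HasDerivAt (fun t : ℝ => ∫ r in (0 : ℝ)..t * c, Φ r) (c * Φ 0) 0 := by
      have h2 : HasDerivAt (fun s : ℝ => ∫ r in (0 : ℝ)..s, Φ r) (Φ 0) (0 * c) := by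
        rw [zero_mul]
        exact intervalIntegral.integral_hasDerivAt_right (by simp)
          hΦ.stronglyMeasurable.stronglyMeasurableAtFilter hΦ.continuousAt
      have h3 := h2.comp (0 : ℝ) ((hasDerivAt_id (0 : ℝ)).mul_const c)
      rw [one_mul, mul_comm] at h3
      exact h3
    have h4 := h1.tendsto_slope_zero_right
    refine h4.congr fun t => ?_
    rw [hshift, hslice, hslice, intervalIntegral.integral_Iic_sub_Iic hΦi.integrableOn
      hΦi.integrableOn]
    simp
  -- The indicator of a half-space is not integrable. It is cut off by a ball that contains the
  -- supports of `g` and of its translates by `t e` for `0 < t ≤ 1`, which changes none of the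
  -- integrals.
  set D := Metric.closedBall z (R + ‖e‖)
  have hDm : MeasurableSet D := Metric.isClosed_closedBall.measurableSet
  have hlim2 := hg.integral_inv_smul_sub_mul_tendsto_integral_lineDeriv_mul (μ := volume)
    (g := (H 0 ∩ D).indicator fun _ => (1 : ℝ))
    ((integrable_indicator_iff ((hHc 0).inter hDm)).2 (integrableOn_const
      ((measure_mono inter_subset_right).trans_lt measure_closedBall_lt_top).ne)) e
  have hnorm : 0 ≤ ‖e‖ := norm_nonneg e
  have hline : ∀ x, x ∉ D → lineDeriv ℝ g x e = 0 := by
    intro x hx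
    have : g =ᶠ[nhds x] fun _ => 0 := by
      have hx' : x ∈ (Metric.closedBall z R)ᶜ := fun h => hx
        (Metric.closedBall_subset_closedBall (by linarith) h)
      exact Filter.eventually_of_mem
        (Metric.isClosed_closedBall.isOpen_compl.mem_nhds hx') fun y hy => hR0 y hy
    rw [this.lineDeriv_eq]
    simp [lineDeriv]
  have e2 : ∫ x, lineDeriv ℝ g x e * (H 0 ∩ D).indicator (fun _ => (1 : ℝ)) x =
      ∫ x in H 0, lineDeriv ℝ g x e := by
    rw [← integral_indicator (hHc 0)]
    congr 1
    ext x
    by_cases hx : x ∈ H 0 <;> by_cases hx' : x ∈ D <;> simp [indicator, hx, hx', hline]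
  rw [e2] at hlim2
  have hΦ0 : Φ 0 = ∫ y, g (planeMap b z y) := by
    simp [hΦdef, frame_apply]
  rw [← hΦ0]
  refine tendsto_nhds_unique hlim2 (hlim1.congr' ?_)
  filter_upwards [Ioc_mem_nhdsGT zero_lt_one] with t ht
  rw [← integral_sub (hgi.comp_add_right _).integrableOn hgi.integrableOn, ← integral_smul,
    ← integral_indicator (hHc 0)]
  congr 1
  ext x
  by_cases hx : x ∈ H 0
  · by_cases hx' : x ∈ D
    · simp [indicator, hx, hx']
    · have h1 : g x = 0 := hR0 x fun h => hx'
        (Metric.closedBall_subset_closedBall (by linarith) h)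
      have h2 : g (x + t • e) = 0 := hR0 _ fun h => hx' <| by
        rw [mem_closedBall_iff_norm] at h ⊢
        calc ‖x - z‖ = ‖(x + t • e - z) - t • e‖ := by congr 1; abel
          _ ≤ ‖x + t • e - z‖ + ‖t • e‖ := norm_sub_le _ _
          _ ≤ R + ‖e‖ := by
            refine add_le_add h ?_
            rw [norm_smul, Real.norm_of_nonneg ht.1.le]
            exact mul_le_of_le_one_left hnorm ht.2
      simp [indicator, hx, hx', h1, h2]
  · simp [indicator, hx]

/-! ### Affine bases -/

theorem affineMap_apply_eq_sum {n m : ℕ} (b : AffineBasis (Fin (n + 1)) ℝ (E m)) (f : E m →ᵃ[ℝ] ℝ)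
    (x : E m) : f x = ∑ i, b.coord i x * f (b i) := by
  conv_lhs => rw [← b.affineCombination_coord_eq_self x]
  rw [Finset.map_affineCombination _ _ _ (b.sum_coord_apply_eq_one x),
    Finset.affineCombination_eq_linear_combination _ _ _ (b.sum_coord_apply_eq_one x)]
  simp

theorem exists_coord_eq {n m : ℕ} (b : AffineBasis (Fin (n + 1)) ℝ (E m)) {c : Fin (n + 1) → ℝ}
    (hc : ∑ i, c i = 1) : ∃ x, ∀ i, b.coord i x = c i :=
  ⟨Finset.univ.affineCombination ℝ b c, fun i =>
    b.coord_apply_combination_of_mem (Finset.mem_univ i) hc⟩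

theorem continuous_coords {n m : ℕ} (b : AffineBasis (Fin (n + 1)) ℝ (E m)) :
    Continuous fun x => b.coords x :=
  continuous_pi fun i => by
    simpa only [AffineBasis.coords_apply] using continuous_barycentric_coord b i

/-- Every nondegenerate simplex is an affine image of one reference simplex, with equal barycentric
coordinates. Weights that are functions of these coordinates are therefore the same on all
simplices, which makes the constants uniform. -/
theorem exists_affineEquiv_coord {m : ℕ} (b₀ b : AffineBasis (Fin (m + 1)) ℝ (E m)) :
    ∃ F : E m ≃ᵃ[ℝ] E m, (∀ i, F (b₀ i) = b i) ∧ ∀ i x, b.coord i (F x) = b₀.coord i x := by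
  let e : E m ≃ₗ[ℝ] E m := (b₀.basisOf 0).equiv (b.basisOf 0) (Equiv.refl _)
  let F : E m ≃ᵃ[ℝ] E m := AffineEquiv.mk' (fun x => e (x - b₀ 0) + b 0) e (b₀ 0)
    (fun x => by simp)
  have hF : ∀ i, F (b₀ i) = b i := by
    intro i
    show e (b₀ i - b₀ 0) + b 0 = b i
    by_cases hi : i = 0
    · subst hi; simp
    · have h1 : b₀ i - b₀ 0 = b₀.basisOf 0 ⟨i, hi⟩ := by simp
      rw [h1, Module.Basis.equiv_apply]
      simp
  refine ⟨F, hF, fun i x => ?_⟩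
  have := affineMap_apply_eq_sum b₀ ((b.coord i).comp F.toAffineMap) x
  rw [AffineMap.comp_apply] at this
  rw [AffineEquiv.coe_toAffineMap] at this
  rw [this]
  simp [hF, AffineBasis.coord_apply]

/-- On a simplex, the maximum of a polynomial is controlled by its weighted mean square. The
constant does not depend on the simplex. -/
theorem exists_sq_le_simplex_average {m : ℕ} (k : ℕ) {w : (Fin (m + 1) → ℝ) → ℝ}
    (hw : Continuous w) (h0 : ∀ c, 0 ≤ w c)
    (hpos : ∃ c, (∀ i, 0 < c i) ∧ ∑ i, c i = 1 ∧ 0 < w c) :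
    ∃ C : ℝ, 0 < C ∧ ∀ (b : AffineBasis (Fin (m + 1)) ℝ (E m)) (f : E m → ℝ), IsPoly k f →
      ∀ x ∈ convexHull ℝ (range b), volume.real (convexHull ℝ (range b)) * f x ^ 2 ≤
        C * ∫ y in convexHull ℝ (range b), f y ^ 2 * w (b.coords y) := by
  obtain ⟨b₀⟩ := AffineBasis.exists_affineBasis_of_finiteDimensional (ι := Fin (m + 1)) (k := ℝ)
    (P := E m) (by simp)
  have hK : IsCompact (convexHull ℝ (range b₀)) := (finite_range b₀).isCompact_convexHull ℝ
  have hwc : Continuous fun x => w (b₀.coords x) := hw.comp (continuous_coords b₀)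
  set U := interior (convexHull ℝ (range b₀)) ∩ {x | 0 < w (b₀.coords x)}
  have hU : IsOpen U := isOpen_interior.inter (isOpen_lt continuous_const hwc)
  have hUne : U.Nonempty := by
    obtain ⟨c, hc0, hc1, hcw⟩ := hpos
    obtain ⟨x, hx⟩ := exists_coord_eq b₀ hc1
    refine ⟨x, ?_, ?_⟩
    · rw [b₀.interior_convexHull]; exact fun i => by rw [hx]; exact hc0 i
    · have : b₀.coords x = c := by ext i; rw [AffineBasis.coords_apply, hx]
      rw [mem_ofPred_eq, this]; exact hcw
  obtain ⟨C, hC, h⟩ := exists_sq_le_average k hK hU hUne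
    (inter_subset_left.trans interior_subset) hwc (fun _ _ => h0 _) (fun x hx => hx.2)
  refine ⟨C, hC, fun b f hf x hx => ?_⟩
  obtain ⟨F, hF, hFc⟩ := exists_affineEquiv_coord b₀ b
  have himg : F '' convexHull ℝ (range b₀) = convexHull ℝ (range b) := by
    have h1 := AffineMap.image_convexHull F.toAffineMap (range b₀)
    rw [AffineEquiv.coe_toAffineMap] at h1
    rw [h1, ← range_comp]
    congr 2
    ext1 i
    exact hF i
  rw [← himg] at hx
  obtain ⟨y, hy, rfl⟩ := hx
  have h2 := h F f hf y hy
  rw [himg] at h2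
  have h3 : ∀ y, b₀.coords (F.symm y) = b.coords y := fun y => by
    ext i
    rw [AffineBasis.coords_apply, AffineBasis.coords_apply, ← hFc, AffineEquiv.apply_symm_apply]
  simpa only [h3] using h2

/-! ### Shape-regular simplices -/

/-- `T` contains a ball of radius `ρ`, and it is contained in a ball of radius `Λ ρ`. -/
structure IsShaped {d : ℕ} (Λ : ℝ) (t : Elt d) (x₀ : E d) (ρ : ℝ) : Prop where
  indep : AffineIndependent ℝ t.vertex
  pos : 0 < ρ
  ball_subset : Metric.closedBall x₀ ρ ⊆ t.carrier
  subset_ball : t.carrier ⊆ Metric.closedBall x₀ (Λ * ρ)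

theorem Elt.isCompact_carrier {d : ℕ} (t : Elt d) : IsCompact t.carrier :=
  (finite_range t.vertex).isCompact_convexHull ℝ

theorem Elt.measurableSet_carrier {d : ℕ} (t : Elt d) : MeasurableSet t.carrier :=
  t.isCompact_carrier.measurableSet

theorem Elt.interior_nonempty {d : ℕ} (t : Elt d) (h : AffineIndependent ℝ t.vertex) :
    (interior t.carrier).Nonempty := by
  obtain ⟨x, hx⟩ := exists_coord_eq (t.basis h) (c := fun _ => ((d : ℝ) + 1)⁻¹)
    (by simp; field_simp)
  refine ⟨x, ?_⟩
  rw [t.interior_carrier h]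
  intro i
  rw [hx]; positivity

theorem Elt.closure_interior {d : ℕ} (t : Elt d) (h : AffineIndependent ℝ t.vertex) :
    closure (interior t.carrier) = t.carrier := by
  rw [t.convex_carrier.closure_interior_eq_closure_of_nonempty_interior (t.interior_nonempty h),
    t.isCompact_carrier.isClosed.closure_eq]

theorem Elt.interior_ae_eq {d : ℕ} (t : Elt d) :
    interior t.carrier =ᵐ[volume] t.carrier :=
  interior_ae_eq_of_null_frontier (t.convex_carrier.addHaar_frontier volume)

theorem exists_norm_eq_one {d : ℕ} (hd : 0 < d) : ∃ v : E d, ‖v‖ = 1 :=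
  ⟨EuclideanSpace.single ⟨0, hd⟩ 1, by simp⟩

theorem le_diam_of_closedBall_subset {d : ℕ} (hd : 0 < d) {K : Set (E d)}
    (hK : Bornology.IsBounded K) {x : E d} {r : ℝ} (hr : 0 ≤ r) (h : Metric.closedBall x r ⊆ K) :
    r ≤ Metric.diam K := by
  obtain ⟨v, hv⟩ := exists_norm_eq_one hd
  have h1 : dist (x + r • v) x = r := by
    simp [dist_eq_norm, norm_smul, hv, abs_of_nonneg hr]
  rw [← h1]
  exact Metric.dist_le_diam_of_mem hK (h (by rw [Metric.mem_closedBall, h1]))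
    (h (Metric.mem_closedBall_self hr))

theorem exists_isShaped {d : ℕ} (hd : 0 < d) {Ω : Set (E d)} {𝒯 : Mesh d}
    (h𝒯 : IsTriangulation Ω 𝒯) {κ : ℝ} (hκ : regularity 𝒯 ≤ κ) {t : Elt d} (ht : t ∈ 𝒯) :
    ∃ x₀ ρ, IsShaped (2 * κ) t x₀ ρ := by
  have hind := h𝒯.indep t ht
  have hb := t.isCompact_carrier.isBounded
  set S := {r : ℝ | ∃ x, Metric.closedBall x r ⊆ t.carrier} with hS
  have hbdd : BddAbove S := by
    refine ⟨Metric.diam t.carrier, ?_⟩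
    rintro r ⟨x, hx⟩
    -- Negative radii also belong to the set, since their balls are empty; they do not affect the
    -- supremum.
    rcases le_total 0 r with h | h
    · exact le_diam_of_closedBall_subset hd hb h hx
    · exact h.trans Metric.diam_nonneg
  obtain ⟨x, hx⟩ := t.interior_nonempty hind
  obtain ⟨r, hr, hxr⟩ := Metric.nhds_basis_closedBall.mem_iff.1 (mem_interior_iff_mem_nhds.1 hx)
  have hpos : 0 < t.inradius := hr.trans_le (le_csSup hbdd ⟨x, hxr⟩)
  -- A ball with more than half of the supremal radius avoids the question whether the supremum is
  -- attained; this is the factor `2` in `2 * κ`.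
  obtain ⟨ρ, ⟨x₀, hx₀⟩, hρ⟩ := exists_lt_of_lt_csSup (s := S) ⟨r, x, hxr⟩ (half_lt_self hpos)
  have hρ0 : 0 < ρ := (half_pos hpos).trans hρ
  refine ⟨x₀, ρ, hind, hρ0, hx₀, fun y hy => ?_⟩
  have h1 : Metric.diam t.carrier / t.inradius ≤ κ := by
    refine le_trans ?_ hκ
    exact le_ciSup (f := fun s : 𝒯 => Metric.diam s.1.carrier / s.1.inradius)
      (finite_range _).bddAbove ⟨t, ht⟩
  have hκ0 : 0 ≤ κ := le_trans (by positivity) h1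
  rw [div_le_iff₀ hpos] at h1
  rw [Metric.mem_closedBall]
  calc dist y x₀ ≤ Metric.diam t.carrier :=
        Metric.dist_le_diam_of_mem hb hy (hx₀ (Metric.mem_closedBall_self hρ0.le))
    _ ≤ κ * t.inradius := h1
    _ ≤ κ * (2 * ρ) := by
      have : t.inradius / 2 < ρ := hρ
      gcongr; linarith
    _ = 2 * κ * ρ := by ring

section Shaped

variable {d : ℕ} {Λ : ℝ} {t : Elt d} {x₀ : E d} {ρ : ℝ}

theorem IsShaped.center_mem (h : IsShaped Λ t x₀ ρ) : x₀ ∈ t.carrier :=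
  h.ball_subset (Metric.mem_closedBall_self h.pos.le)

theorem IsShaped.one_le (hd : 0 < d) (h : IsShaped Λ t x₀ ρ) : 1 ≤ Λ := by
  obtain ⟨v, hv⟩ := exists_norm_eq_one hd
  have h1 : x₀ + ρ • v ∈ Metric.closedBall x₀ (Λ * ρ) :=
    h.subset_ball (h.ball_subset (by simp [norm_smul, hv, abs_of_pos h.pos]))
  have h2 : ρ ≤ Λ * ρ := by simpa [norm_smul, hv, abs_of_pos h.pos] using h1
  exact le_of_mul_le_mul_right (by linarith) h.pos

theorem IsShaped.norm_sub_le (h : IsShaped Λ t x₀ ρ) {x y : E d} (hx : x ∈ t.carrier)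
    (hy : y ∈ t.carrier) : ‖x - y‖ ≤ 2 * Λ * ρ := by
  have h1 := h.subset_ball hx
  have h2 := h.subset_ball hy
  rw [Metric.mem_closedBall] at h1 h2
  rw [← dist_eq_norm]
  linarith [dist_triangle_right x y x₀]

theorem coord_nonneg (ht : AffineIndependent ℝ t.vertex) {x : E d} (hx : x ∈ t.carrier)
    (i : Fin (d + 1)) : 0 ≤ (t.basis ht).coord i x := by
  rw [t.carrier_eq ht] at hx; exact hx i

theorem coord_le_one (ht : AffineIndependent ℝ t.vertex) {x : E d} (hx : x ∈ t.carrier)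
    (i : Fin (d + 1)) : (t.basis ht).coord i x ≤ 1 := by
  rw [← (t.basis ht).sum_coord_apply_eq_one x]
  exact Finset.single_le_sum (f := fun i => (t.basis ht).coord i x)
    (fun i _ => coord_nonneg ht hx i) (Finset.mem_univ i)

/-- A barycentric coordinate takes values in `[0, 1]` on the inscribed ball, so it changes by at
most `1` over the distance `ρ` from the centre. Being affine, it has slope at most `1 / ρ`. -/
theorem IsShaped.abs_coord_sub_le (h : IsShaped Λ t x₀ ρ) (i : Fin (d + 1)) (x y : E d) :
    |(t.basis h.indep).coord i x - (t.basis h.indep).coord i y| ≤ ρ⁻¹ * ‖x - y‖ := by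
  set f := (t.basis h.indep).coord i
  have hlin : ∀ p v : E d, f (p + v) = f p + f.linear v := fun p v => by
    rw [add_comm p v, ← vadd_eq_add v p, f.map_vadd, vadd_eq_add, add_comm]
  have hxy : f x - f y = f.linear (x - y) := by
    have := hlin y (x - y)
    rw [add_sub_cancel] at this
    rw [this]; ring
  rw [hxy]
  set v := x - y
  by_cases hv : v = 0
  · simp [hv]
  have hv' : 0 < ‖v‖ := norm_pos_iff.2 hv
  have hmem : x₀ + (ρ / ‖v‖) • v ∈ t.carrier := h.ball_subset <| by
    rw [mem_closedBall_iff_norm, add_sub_cancel_left, norm_smul, norm_div, norm_norm,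
      Real.norm_of_nonneg h.pos.le, div_mul_cancel₀ _ hv'.ne']
  have h1 := hlin x₀ ((ρ / ‖v‖) • v)
  rw [map_smul, smul_eq_mul] at h1
  have h2 : |ρ / ‖v‖ * f.linear v| ≤ 1 := by
    rw [abs_le]
    have a1 := coord_nonneg h.indep hmem i
    have a2 := coord_le_one h.indep hmem i
    have a3 := coord_nonneg h.indep h.center_mem i
    have a4 := coord_le_one h.indep h.center_mem i
    constructor <;> linarith
  have h3 := h.pos
  rw [abs_mul, abs_of_pos (by positivity)] at h2
  calc |f.linear v| = (ρ⁻¹ * ‖v‖) * (ρ / ‖v‖ * |f.linear v|) := by field_simp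
    _ ≤ (ρ⁻¹ * ‖v‖) * 1 := by gcongr
    _ = _ := mul_one _

end Shaped

theorem exists_volume_bounds {d : ℕ} (hd : 0 < d) (Λ : ℝ) :
    ∃ C : ℝ, 1 ≤ C ∧ ∀ (t : Elt d) (x₀ : E d) (ρ : ℝ), IsShaped Λ t x₀ ρ →
      ρ ≤ C * t.size ∧ t.size ≤ C * ρ ∧ ρ ^ d ≤ C * volume.real t.carrier ∧
        volume.real t.carrier ≤ C * ρ ^ d := by
  set β := volume.real (Metric.ball (0 : E d) 1)
  have hβ : 0 < β := ENNReal.toReal_pos (Metric.measure_ball_pos _ _ one_pos).ne'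
    measure_ball_lt_top.ne
  set η := β ^ (1 / (d : ℝ))
  have hη : 0 < η := Real.rpow_pos_of_pos hβ _
  have hd' : (0 : ℝ) < d := by exact_mod_cast hd
  -- The sum of the constants of the four inequalities, obtained by comparing the volume with those
  -- of the inscribed and the surrounding ball. The absolute value keeps the sum positive for every
  -- `Λ`; the existence of a shaped element forces `Λ ≥ 1`.
  refine ⟨1 + η⁻¹ + η * |Λ| + β⁻¹ + β * |Λ| ^ d, ?_, fun t x₀ ρ h => ?_⟩
  · have : 0 ≤ η⁻¹ + η * |Λ| + β⁻¹ + β * |Λ| ^ d := by positivity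
    linarith
  have hΛ : |Λ| = Λ := abs_of_nonneg (zero_le_one.trans (h.one_le hd))
  have hΛ0 : 0 ≤ Λ := by rw [← hΛ]; exact abs_nonneg _
  have hρ := h.pos
  rw [hΛ]
  have hvol : ∀ (x : E d) (r : ℝ), 0 ≤ r → volume.real (Metric.closedBall x r) = r ^ d * β :=
    fun x r hr => by
      rw [Measure.addHaar_real_closedBall _ _ hr, finrank_euclideanSpace_fin]
  have hfin : volume t.carrier ≠ ⊤ := t.isCompact_carrier.measure_lt_top.ne
  have h1 : ρ ^ d * β ≤ volume.real t.carrier := by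
    rw [← hvol x₀ ρ h.pos.le]
    exact measureReal_mono h.ball_subset hfin
  have h2 : volume.real t.carrier ≤ (Λ * ρ) ^ d * β := by
    rw [← hvol x₀ (Λ * ρ) (by positivity)]
    exact measureReal_mono h.subset_ball (isCompact_closedBall _ _).measure_lt_top.ne
  have hroot : ∀ r : ℝ, 0 ≤ r → (r ^ d * β) ^ (1 / (d : ℝ)) = r * η := fun r hr => by
    rw [Real.mul_rpow (by positivity) hβ.le, ← Real.rpow_natCast, ← Real.rpow_mul hr,
      mul_one_div_cancel hd'.ne', Real.rpow_one]
  have h3 : ρ * η ≤ t.size := by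
    rw [← hroot ρ h.pos.le]
    exact Real.rpow_le_rpow (by positivity) h1 (by positivity)
  have h4 : t.size ≤ Λ * ρ * η := by
    rw [← hroot (Λ * ρ) (by positivity)]
    exact Real.rpow_le_rpow (by positivity) h2 (by positivity)
  have hs0 : 0 ≤ t.size := le_trans (by positivity) h3
  have hV0 : 0 ≤ volume.real t.carrier := measureReal_nonneg
  refine ⟨?_, ?_, ?_, ?_⟩
  · calc ρ = η⁻¹ * (ρ * η) := by field_simp
      _ ≤ η⁻¹ * t.size := by gcongr
      _ ≤ _ := mul_le_mul_of_nonneg_right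
        (by have : 0 ≤ 1 + η * Λ + β⁻¹ + β * Λ ^ d := by positivity
            linarith) hs0
  · calc t.size ≤ (η * Λ) * ρ := by linarith
      _ ≤ _ := mul_le_mul_of_nonneg_right
        (by have : 0 ≤ 1 + η⁻¹ + β⁻¹ + β * Λ ^ d := by positivity
            linarith) hρ.le
  · calc ρ ^ d = β⁻¹ * (ρ ^ d * β) := by field_simp
      _ ≤ β⁻¹ * volume.real t.carrier := by gcongr
      _ ≤ _ := mul_le_mul_of_nonneg_right
        (by have : 0 ≤ 1 + η⁻¹ + η * Λ + β * Λ ^ d := by positivity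
            linarith) hV0
  · calc volume.real t.carrier ≤ (β * Λ ^ d) * ρ ^ d := by rw [mul_pow] at h2; linarith
      _ ≤ _ := mul_le_mul_of_nonneg_right
        (by have : 0 ≤ 1 + η⁻¹ + η * Λ + β⁻¹ := by positivity
            linarith) (by positivity)

/-! ### Pairs of elements -/

/-- Distinct elements have different vertex sets of the same size, so some vertex of `t` is not a
vertex of `t'`, and the common face lies in the side opposite to it. -/
theorem IsTriangulation.exists_coord_eq_zero {d : ℕ} {Ω : Set (E d)} {𝒯 : Mesh d}
    (h𝒯 : IsTriangulation Ω 𝒯) {t t' : Elt d} (ht : t ∈ 𝒯) (ht' : t' ∈ 𝒯) (hne : t ≠ t') :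
    ∃ i, ∀ x ∈ t.carrier ∩ t'.carrier, (t.basis (h𝒯.indep t ht)).coord i x = 0 := by
  have hi : ∃ i, t.vertex i ∉ range t'.vertex := by
    by_contra! hall
    have hsub : range t.vertex ⊆ range t'.vertex := by rintro _ ⟨i, rfl⟩; exact hall i
    refine hne (h𝒯.inj t ht t' ht' (eq_of_subset_of_ncard_le hsub ?_ (finite_range _)))
    rw [← image_univ, ← image_univ, ncard_image_of_injective _ (h𝒯.indep t ht).injective,
      ncard_image_of_injective _ (h𝒯.indep t' ht').injective]
  obtain ⟨i, hi⟩ := hi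
  refine ⟨i, fun x hx => ?_⟩
  rw [h𝒯.conforming t ht t' ht'] at hx
  have hsub : range t.vertex ∩ range t'.vertex ⊆ (t.basis (h𝒯.indep t ht)) '' {i}ᶜ := by
    rintro _ ⟨⟨k, rfl⟩, hk⟩
    exact ⟨k, fun hki => hi (by rw [mem_singleton_iff] at hki; rwa [← hki]), rfl⟩
  exact ((convexHull_face _ i).subset (convexHull_mono hsub hx)).2

theorem IsTriangulation.disjoint_interior {d : ℕ} {Ω : Set (E d)} {𝒯 : Mesh d}
    (h𝒯 : IsTriangulation Ω 𝒯) {t t' : Elt d} (ht : t ∈ 𝒯) (ht' : t' ∈ 𝒯) (hne : t ≠ t') :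
    Disjoint (interior t.carrier) t'.carrier := by
  rw [disjoint_left]
  intro x hx hx'
  obtain ⟨i, hi⟩ := h𝒯.exists_coord_eq_zero ht ht' hne
  have h1 := hi x ⟨interior_subset hx, hx'⟩
  rw [t.interior_carrier (h𝒯.indep t ht)] at hx
  exact (hx i).ne' h1

theorem IsTriangulation.aedisjoint {d : ℕ} {Ω : Set (E d)} {𝒯 : Mesh d}
    (h𝒯 : IsTriangulation Ω 𝒯) {t t' : Elt d} (ht : t ∈ 𝒯) (ht' : t' ∈ 𝒯) (hne : t ≠ t') :
    AEDisjoint volume t.carrier t'.carrier := by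
  refine measure_mono_null ?_ (t.convex_carrier.addHaar_frontier volume)
  rintro x ⟨hx, hx'⟩
  rw [t.isCompact_carrier.isClosed.frontier_eq]
  exact ⟨hx, fun h => disjoint_left.1 (h𝒯.disjoint_interior ht ht' hne) h hx'⟩

theorem IsTriangulation.subset_closure {d : ℕ} {Ω : Set (E d)} {𝒯 : Mesh d}
    (h𝒯 : IsTriangulation Ω 𝒯) {t : Elt d} (ht : t ∈ 𝒯) : interior t.carrier ⊆ Ω := by
  rw [← h𝒯.cover]
  exact interior_mono (subset_biUnion_of_mem (u := fun t : Elt d => t.carrier) ht)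

section Side

variable {d : ℕ} {t t' : Elt d} {i i' : Fin (d + 1)}

theorem exists_side_center (hd : 0 < d) (ht : AffineIndependent ℝ t.vertex) (i : Fin (d + 1)) :
    ∃ x, (t.basis ht).coord i x = 0 ∧ ∀ k, k ≠ i → 0 < (t.basis ht).coord k x := by
  have hd' : (0 : ℝ) < d := by exact_mod_cast hd
  obtain ⟨x, hx⟩ := exists_coord_eq (t.basis ht) (c := fun k => if k = i then 0 else (d : ℝ)⁻¹) <| by
    rw [Finset.sum_ite, Finset.sum_const_zero, Finset.sum_const, zero_add, Finset.filter_ne',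
      Finset.card_erase_of_mem (Finset.mem_univ i)]
    simp [hd'.ne']
  exact ⟨x, by simp [hx], fun k hk => by simp [hx, hk, hd']⟩

theorem mem_hull_of_coord (ht : AffineIndependent ℝ t.vertex) (hsh : IsSharedSide t t' i i')
    {x : E d} (h0 : (t.basis ht).coord i x = 0) (hpos : ∀ k, k ≠ i → 0 ≤ (t.basis ht).coord k x) :
    x ∈ convexHull ℝ (range t.vertex ∩ range t'.vertex) := by
  rw [hsh.left]
  refine (convexHull_face (t.basis ht) i).superset ⟨fun k => ?_, h0⟩
  by_cases hk : k = i
  · rw [hk, h0]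
  · exact hpos k hk

theorem IsSharedSide.coord_pos (ht : AffineIndependent ℝ t.vertex)
    (ht' : AffineIndependent ℝ t'.vertex) (hsh : IsSharedSide t t' i i') {x : E d}
    (h0 : (t.basis ht).coord i x = 0) (hpos : ∀ k, k ≠ i → 0 < (t.basis ht).coord k x)
    {k' : Fin (d + 1)} (hk' : k' ≠ i') : 0 < (t'.basis ht').coord k' x := by
  obtain ⟨k, hk, e⟩ := hsh.symm.exists_index hk'
  rw [← coord_eq_coord ht ht' e.symm (mem_hull_of_coord ht hsh h0 fun k hk => (hpos k hk).le)]
  exact hpos k hk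

/-- Elements which share a side lie on opposite sides of it. -/
theorem IsSharedSide.exists_neg (hd : 0 < d) (ht : AffineIndependent ℝ t.vertex)
    (ht' : AffineIndependent ℝ t'.vertex) (hsh : IsSharedSide t t' i i')
    (hdisj : Disjoint (interior t.carrier) t'.carrier) :
    ∃ c : ℝ, 0 < c ∧ ∀ x, (t'.basis ht').coord i' x = - (c * (t.basis ht).coord i x) := by
  set b := t.basis ht
  set b' := t'.basis ht'
  set c := b'.coord i' (t.vertex i)
  -- The coordinate of `t'` is affine and vanishes at the vertices of the shared side, hence it is a
  -- multiple of the coordinate of `t`.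
  have hmul : ∀ x, b'.coord i' x = c * b.coord i x := by
    intro x
    rw [affineMap_apply_eq_sum b (b'.coord i') x, Finset.sum_eq_single i]
    · rw [mul_comm]; rfl
    · intro k _ hk
      obtain ⟨k', hk', e⟩ := hsh.exists_index hk
      have : b k = b' k' := e
      rw [this, b'.coord_apply_ne hk'.symm, mul_zero]
    · simp
  have hc0 : c ≠ 0 := fun h => by
    have := hmul (b' i')
    rw [b'.coord_apply_eq, h, zero_mul] at this
    exact one_ne_zero this
  refine ⟨-c, ?_, fun x => by rw [hmul]; ring⟩
  -- With a positive factor, a point slightly off the centre of the side would lie in `t'` and in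
  -- the interior of `t`.
  by_contra hneg
  have hc : 0 < c := lt_of_le_of_ne (by linarith) hc0.symm
  obtain ⟨x, hx0, hxpos⟩ := exists_side_center hd ht i
  set y : ℝ → E d := fun ε => AffineMap.lineMap x (t.vertex i) ε
  have hy : Continuous y := AffineMap.lineMap_continuous
  have hy0 : y 0 = x := by simp [y]
  have hev : ∀ᶠ ε in nhds (0 : ℝ), (∀ k, k ≠ i → 0 < b.coord k (y ε)) ∧
      ∀ k', k' ≠ i' → 0 < b'.coord k' (y ε) := by
    refine Filter.Eventually.and ?_ ?_
    · refine Filter.eventually_all.2 fun k => ?_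
      by_cases hk : k = i
      · simp [hk]
      · have := ((continuous_barycentric_coord b k).comp hy).continuousAt (x := 0)
        refine (this.eventually_const_lt ?_).mono fun ε h _ => h
        simp only [Function.comp, hy0]
        exact hxpos k hk
    · refine Filter.eventually_all.2 fun k' => ?_
      by_cases hk : k' = i'
      · simp [hk]
      · have := ((continuous_barycentric_coord b' k').comp hy).continuousAt (x := 0)
        refine (this.eventually_const_lt ?_).mono fun ε h _ => h
        simp only [Function.comp, hy0]
        exact hsh.coord_pos ht ht' hx0 hxpos hk
  obtain ⟨ε, ⟨h1, h2⟩, hε⟩ := ((hev.filter_mono nhdsWithin_le_nhds).and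
    (self_mem_nhdsWithin (s := Ioi (0 : ℝ)))).exists
  have hi : b.coord i (y ε) = ε := by
    show b.coord i (AffineMap.lineMap x (b i) ε) = ε
    rw [AffineMap.apply_lineMap, hx0, b.coord_apply_eq, AffineMap.lineMap_apply]
    simp
  refine Set.disjoint_left.1 hdisj (?_ : y ε ∈ interior t.carrier) ?_
  · rw [t.interior_carrier ht]
    intro k
    by_cases hk : k = i
    · rw [hk]; exact hi.symm ▸ hε
    · exact h1 k hk
  · rw [t'.carrier_eq ht']
    intro k
    by_cases hk : k = i'
    · rw [hk]
      show 0 ≤ b'.coord i' (y ε)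
      rw [hmul, hi]; exact (mul_pos hc hε).le
    · exact (h2 k hk).le

/-- At a point of the relative interior of the side, all other coordinates of both simplices are
positive in a neighbourhood. There the sign of the remaining coordinate, opposite for `t` and `t'`,
decides which of the two elements contains a point. -/
theorem IsSharedSide.mem_interior_union (hd : 0 < d) (ht : AffineIndependent ℝ t.vertex)
    (ht' : AffineIndependent ℝ t'.vertex) (hsh : IsSharedSide t t' i i')
    (hdisj : Disjoint (interior t.carrier) t'.carrier) {x : E d} (hx : x ∈ t.carrier)
    (hpos : ∀ k, k ≠ i → 0 < (t.basis ht).coord k x) :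
    x ∈ interior (t.carrier ∪ t'.carrier) := by
  set b := t.basis ht
  set b' := t'.basis ht'
  have hx0 : 0 ≤ b.coord i x := coord_nonneg ht hx i
  rcases hx0.eq_or_lt with h0 | h0
  · obtain ⟨c, hc, hneg⟩ := hsh.exists_neg hd ht ht' hdisj
    set U : Set (E d) := {y | (∀ k, k ≠ i → 0 < b.coord k y) ∧ ∀ k', k' ≠ i' → 0 < b'.coord k' y}
    have hU : IsOpen U := by
      have h1 : U = (⋂ k, ⋂ (_ : k ≠ i), {y | 0 < b.coord k y}) ∩
          ⋂ k', ⋂ (_ : k' ≠ i'), {y | 0 < b'.coord k' y} := by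
        ext y; simp [U]
      rw [h1]
      exact (isOpen_iInter_of_finite fun k => isOpen_iInter_of_finite fun _ =>
        isOpen_lt continuous_const (continuous_barycentric_coord b k)).inter
        (isOpen_iInter_of_finite fun k => isOpen_iInter_of_finite fun _ =>
        isOpen_lt continuous_const (continuous_barycentric_coord b' k))
    refine mem_interior.2 ⟨U, fun y hy => ?_, hU, hpos, fun k' hk' =>
      hsh.coord_pos ht ht' h0.symm hpos hk'⟩
    rcases le_total 0 (b.coord i y) with h | h
    · left
      rw [t.carrier_eq ht]
      intro k
      by_cases hk : k = i
      · rw [hk]; exact h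
      · exact (hy.1 k hk).le
    · right
      rw [t'.carrier_eq ht']
      intro k
      by_cases hk : k = i'
      · rw [hk]
        show 0 ≤ b'.coord i' y
        rw [hneg]; nlinarith
      · exact (hy.2 k hk).le
  · refine interior_mono subset_union_left ?_
    rw [t.interior_carrier ht]
    intro k
    by_cases hk : k = i
    · rw [hk]; exact h0
    · exact hpos k hk

/-- For `d ≥ 2` the shared side has an edge. Along it a barycentric coordinate of `t'` drops from
`1` to `0` with slope at most `1 / ρ'`, so the edge is at least `ρ'` long; as an edge of `t` its
length is at most `2 * Λ * ρ`. -/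
theorem IsSharedSide.radius_le (hd : 2 ≤ d) (hsh : IsSharedSide t t' i i') {Λ : ℝ} {x₀ x₀' : E d}
    {ρ ρ' : ℝ} (h : IsShaped Λ t x₀ ρ) (h' : IsShaped Λ t' x₀' ρ') : ρ' ≤ 2 * Λ * ρ := by
  obtain ⟨j, hj⟩ : ∃ j : Fin (d + 1), j ≠ i := by
    have : Nontrivial (Fin (d + 1)) := Fin.nontrivial_iff_two_le.2 (by omega)
    exact exists_ne i
  obtain ⟨k, hk⟩ : ∃ k : Fin (d + 1), k ∉ ({i, j} : Finset (Fin (d + 1))) := by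
    by_contra! hall
    have h1 : Finset.univ ⊆ ({i, j} : Finset (Fin (d + 1))) := fun k _ => hall k
    have h2 := (Finset.card_le_card h1).trans Finset.card_le_two
    simp at h2
    omega
  simp only [Finset.mem_insert, Finset.mem_singleton, not_or] at hk
  obtain ⟨j', hj', ej⟩ := hsh.exists_index hj
  obtain ⟨k', hk', ek⟩ := hsh.exists_index hk.1
  have hjk : j' ≠ k' := fun e => hk.2 (h.indep.injective (by rw [ek, ej, e]))
  have h1 := h'.abs_coord_sub_le j' (t'.vertex j') (t'.vertex k')
  have h2 := h.norm_sub_le (t.vertex_mem_carrier j) (t.vertex_mem_carrier k)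
  rw [ej, ek] at h2
  rw [← t'.basis_apply h'.indep, ← t'.basis_apply h'.indep, AffineBasis.coord_apply_eq,
    AffineBasis.coord_apply_ne _ hjk] at h1
  simp only [sub_zero, abs_one] at h1
  have h3 := h'.pos
  rw [← div_eq_inv_mul, le_div_iff₀ h3, one_mul] at h1
  exact h1.trans h2

end Side

/-! ### Bubble functions -/

theorem exists_lipschitz_bubble {n : ℕ} (gs : List (Fin n → ℤ)) :
    ∃ K : ℝ, 0 ≤ K ∧ ∀ (r : ℝ) (μ μ' : Fin n → ℝ), 0 ≤ r → (∀ k, |μ k - μ' k| ≤ r) →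
      |bubble gs μ - bubble gs μ'| ≤ K * r := by
  have habs : ∀ (g : Fin n → ℤ) (r : ℝ) (μ μ' : Fin n → ℝ), (∀ k, |μ k - μ' k| ≤ r) →
      |realForm g μ - realForm g μ'| ≤ (∑ k, |(g k : ℝ)|) * r := by
    intro g r μ μ' h
    rw [realForm, realForm, ← Finset.sum_sub_distrib, Finset.sum_mul]
    refine (Finset.abs_sum_le_sum_abs _ _).trans (Finset.sum_le_sum fun k _ => ?_)
    rw [← mul_sub, abs_mul]
    exact mul_le_mul_of_nonneg_left (h k) (abs_nonneg _)
  have hmin : ∃ K : ℝ, 0 ≤ K ∧ ∀ (r : ℝ) (μ μ' : Fin n → ℝ), 0 ≤ r → (∀ k, |μ k - μ' k| ≤ r) →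
      |gs.foldr (fun g r => min (realForm g μ) r) 8 - gs.foldr (fun g r => min (realForm g μ') r) 8|
        ≤ K * r := by
    induction gs with
    | nil => exact ⟨0, le_rfl, fun r μ μ' _ _ => by simp⟩
    | cons g gs ih =>
      obtain ⟨K, hK, h⟩ := ih
      refine ⟨max (∑ k, |(g k : ℝ)|) K, le_max_of_le_right hK, fun r μ μ' hr hμ => ?_⟩
      refine (abs_min_sub_min_le_max _ _ _ _).trans (max_le ?_ ?_)
      · exact (habs g r μ μ' hμ).trans (by gcongr; exact le_max_left _ _)
      · exact (h r μ μ' hr hμ).trans (by gcongr; exact le_max_right _ _)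
  obtain ⟨K, hK, h⟩ := hmin
  refine ⟨K, hK, fun r μ μ' hr hμ => ?_⟩
  refine (abs_max_sub_max_le_max _ _ _ _).trans (max_le ?_ (h r μ μ' hr hμ))
  simp; positivity

theorem continuous_bubble {n : ℕ} (gs : List (Fin n → ℤ)) : Continuous (bubble gs) := by
  refine continuous_const.max ?_
  induction gs with
  | nil => exact continuous_const
  | cons g gs ih =>
    refine Continuous.min ?_ ih
    exact continuous_finsetSum _ fun k _ => continuous_const.mul (continuous_apply k)

/-- Product rule for differences: by the inverse estimate a polynomial bounded by `M` has slope of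
order `M / ρ`, and the bubble is bounded by `8` with slope of order `1 / ρ`. -/
theorem exists_lipschitz_mul_bubble {d : ℕ} (k : ℕ) (Λ : ℝ)
    (gs : List (Fin (d + 1) → ℤ)) :
    ∃ C : ℝ, 0 ≤ C ∧ ∀ (t : Elt d) (x₀ : E d) (ρ : ℝ) (h : IsShaped Λ t x₀ ρ) (f : E d → ℝ),
      IsPoly k f → ∀ M, (∀ x ∈ t.carrier, |f x| ≤ M) → ∀ x ∈ t.carrier, ∀ y ∈ t.carrier,
        |f x * bubble gs ((t.basis h.indep).coords x) -
          f y * bubble gs ((t.basis h.indep).coords y)| ≤ C * (M / ρ) * ‖x - y‖ := by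
  obtain ⟨K, hK, hbub⟩ := exists_lipschitz_bubble gs
  obtain ⟨C, hC, hinv⟩ := exists_inverse_estimate d k Λ
  set β := volume.real (Metric.ball (0 : E d) 1)
  have hβ : 0 ≤ β := measureReal_nonneg
  refine ⟨8 * √(C * β) + K, by positivity, fun t x₀ ρ h f hf M hM x hx y hy => ?_⟩
  have hρ := h.pos
  have hM0 : 0 ≤ M := (abs_nonneg _).trans (hM x hx)
  have hgrad : ∀ z ∈ t.carrier, ‖fderiv ℝ f z‖ ≤ √(C * β) * (M / ρ) := by
    intro z hz
    have h1 := hinv x₀ ρ hρ f hf z (h.subset_ball hz)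
    have h2 : ∫ y in Metric.closedBall x₀ ρ, f y ^ 2 ≤ M ^ 2 * (ρ ^ d * β) := by
      have h3 : ∫ y in Metric.closedBall x₀ ρ, f y ^ 2 ≤ ∫ y in Metric.closedBall x₀ ρ, M ^ 2 := by
        refine setIntegral_mono_on
          (((hf.continuous.pow 2).continuousOn).integrableOn_compact (isCompact_closedBall _ _))
          (integrableOn_const (isCompact_closedBall _ _).measure_lt_top.ne)
          Metric.isClosed_closedBall.measurableSet fun y hy => ?_
        rw [← sq_abs]
        have := hM y (h.ball_subset hy)
        gcongr
      refine h3.trans (le_of_eq ?_)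
      rw [setIntegral_const, smul_eq_mul, Measure.addHaar_real_closedBall _ _ hρ.le,
        finrank_euclideanSpace_fin, mul_comm]
    have h4 : ρ ^ 2 * ‖gradient f z‖ ^ 2 ≤ C * β * M ^ 2 := by
      have h5 : ρ ^ d * (ρ ^ 2 * ‖gradient f z‖ ^ 2) ≤ ρ ^ d * (C * β * M ^ 2) := by
        calc ρ ^ d * (ρ ^ 2 * ‖gradient f z‖ ^ 2)
            ≤ ρ ^ d * (f z ^ 2 + ρ ^ 2 * ‖gradient f z‖ ^ 2) := by
              gcongr; exact le_add_of_nonneg_left (sq_nonneg _)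
          _ ≤ C * (M ^ 2 * (ρ ^ d * β)) := h1.trans (by gcongr)
          _ = _ := by ring
      exact le_of_mul_le_mul_left h5 (by positivity)
    rw [← norm_gradient]
    refine le_of_sq_le_sq ?_ (by positivity)
    rw [mul_pow, Real.sq_sqrt (by positivity), div_pow, ← mul_div_assoc, le_div_iff₀ (by positivity)]
    linarith
  have hfl : |f x - f y| ≤ √(C * β) * (M / ρ) * ‖x - y‖ :=
    t.convex_carrier.norm_image_sub_le_of_norm_fderiv_le (fun z _ => hf.differentiable z) hgrad hy hx
  set φ : E d → ℝ := fun z => bubble gs ((t.basis h.indep).coords z)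
  have hφl : |φ x - φ y| ≤ K * (ρ⁻¹ * ‖x - y‖) :=
    hbub _ _ _ (by positivity) fun k => h.abs_coord_sub_le k x y
  have hφ8 : |φ x| ≤ 8 := by
    rw [abs_of_nonneg (bubble_nonneg _ _)]; exact bubble_le_eight _ _
  calc |f x * φ x - f y * φ y| = |(f x - f y) * φ x + f y * (φ x - φ y)| := by congr 1; ring
    _ ≤ |f x - f y| * |φ x| + |f y| * |φ x - φ y| := by
      rw [← abs_mul, ← abs_mul]; exact abs_add_le _ _
    _ ≤ √(C * β) * (M / ρ) * ‖x - y‖ * 8 + M * (K * (ρ⁻¹ * ‖x - y‖)) := by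
      gcongr; exact hM y hy
    _ = _ := by field_simp

theorem isPoly_realForm_coords {d : ℕ} (b : AffineBasis (Fin (d + 1)) ℝ (E d))
    (g : Fin (d + 1) → ℤ) : IsPoly 1 fun x => realForm g (b.coords x) := by
  simp only [realForm, AffineBasis.coords_apply]
  exact IsPoly.sum fun k _ => (isPoly_affine (b.coord k)).const_mul _

/-- Piecewise products of a polynomial and a bubble function, supported in the elements of `F`. -/
structure IsBubbleFun {d : ℕ} (k : ℕ) (F : Finset (Elt d)) (v : E d → ℝ)
    (q : Elt d → E d → ℝ) (gs : Elt d → List (Fin (d + 1) → ℤ)) : Prop where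
  poly : ∀ t ∈ F, IsPoly k (q t)
  forms : ∀ t ∈ F, ∃ G, IsBubbleForms (bisectionNumber d) t.type G (gs t)
  eq : ∀ t ∈ F, ∀ h : AffineIndependent ℝ t.vertex, ∀ x ∈ t.carrier,
    v x = q t x * bubble (gs t) ((t.basis h).coords x)
  supp : ∀ x, v x ≠ 0 → x ∈ interior (⋃ t ∈ F, t.carrier)

/-- The elements of `F` and the closure of the complement of their union form a finite closed cover.
On the last set the function vanishes, since it is supported in the interior of the union. -/
theorem IsBubbleFun.exists_lipschitz {d : ℕ} {k : ℕ} {F : Finset (Elt d)}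
    {v : E d → ℝ} {q : Elt d → E d → ℝ} {gs : Elt d → List (Fin (d + 1) → ℤ)}
    (hv : IsBubbleFun k F v q gs) {Λ : ℝ} (hF : ∀ t ∈ F, ∃ x₀ ρ, IsShaped Λ t x₀ ρ) :
    ∃ K : NNReal, LipschitzWith K v := by
  have h1 : ∀ t : F, ∃ K : NNReal, LipschitzOnWith K v t.1.carrier := by
    rintro ⟨t, ht⟩
    obtain ⟨x₀, ρ, h⟩ := hF t ht
    obtain ⟨C, hC, hl⟩ := exists_lipschitz_mul_bubble k Λ (gs t)
    obtain ⟨M, hM⟩ := t.isCompact_carrier.exists_bound_of_continuousOn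
      (hv.poly t ht).continuous.continuousOn
    have hM0 : 0 ≤ M := (norm_nonneg _).trans (hM x₀ h.center_mem)
    have hρ := h.pos
    refine ⟨⟨C * (M / ρ), by positivity⟩, LipschitzOnWith.of_dist_le_mul fun x hx y hy => ?_⟩
    rw [hv.eq t ht h.indep x hx, hv.eq t ht h.indep y hy, dist_eq_norm, dist_eq_norm]
    exact hl t x₀ ρ h (q t) (hv.poly t ht) M hM x hx y hy
  choose K hK using h1
  refine ⟨∑ t, K t, lipschitzWith_of_closed_cover (ι := Option F)
    (C := fun o => o.elim (closure (⋃ t ∈ F, t.carrier)ᶜ) fun t => t.1.carrier) ?_ ?_ ?_⟩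
  · rintro (_ | t)
    · exact isClosed_closure
    · exact t.1.isCompact_carrier.isClosed
  · intro x
    by_cases hx : x ∈ ⋃ t ∈ F, t.carrier
    · simp only [mem_iUnion] at hx
      obtain ⟨t, ht, hx⟩ := hx
      exact ⟨some ⟨t, ht⟩, hx⟩
    · exact ⟨none, _root_.subset_closure hx⟩
  · rintro (_ | t)
    · have h0 : ∀ x ∈ closure (⋃ t ∈ F, t.carrier)ᶜ, v x = 0 := by
        intro x hx
        by_contra hne
        rw [closure_compl] at hx
        exact hx (hv.supp x hne)
      intro x hx y hy
      rw [h0 x hx, h0 y hy, edist_self]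
      exact bot_le
    · exact (hK t).weaken (Finset.single_le_sum (f := K) (fun _ _ => bot_le) (Finset.mem_univ t))

theorem mem_of_mem_nbrs {d : ℕ} {𝒯 : Mesh d} {T t : Elt d} (h : t ∈ nbrs 𝒯 T) : t ∈ 𝒯 := by
  classical
  exact (Finset.mem_filter.1 h).1

theorem femSpace_subset_of_refinement {d : ℕ} {Ω : Set (E d)} {𝒯 𝒯' : Mesh d} {ℓ : ℕ}
    (h : IsBisectionRefinement 𝒯 𝒯') : femSpace Ω 𝒯 ℓ ⊆ femSpace Ω 𝒯' ℓ := by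
  rintro v ⟨h1, h2, h3⟩
  refine ⟨h1, h2, fun s hs => ?_⟩
  obtain ⟨t, ht, n, hn⟩ := exists_ancestor h hs
  obtain ⟨p, hp, hpe⟩ := h3 t ht
  exact ⟨p, hp, fun x hx => hpe x (carrier_subset_of_mem_descendants n hn hx)⟩

/-- On descendants of generation at least `n_d` the bubble is linear, so the product with a
polynomial of degree `k` has degree at most `k + 1`. Global Lipschitz continuity and vanishing
outside `Ω` give membership in `H¹₀`. -/
theorem IsBubbleFun.mem_femSpace {d : ℕ} (hd : 0 < d) {Ω : Set (E d)} (hΩ : IsOpen Ω)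
    (hΩb : Bornology.IsBounded Ω) {𝒯 𝒯s : Mesh d} (h𝒯 : IsTriangulation Ω 𝒯) {T : Elt d}
    (href : IsLocalRefinement Ω 𝒯 T 𝒯s) {k : ℕ} {F : Finset (Elt d)} (hFT : F ⊆ nbrs 𝒯 T)
    {v : E d → ℝ} {q : Elt d → E d → ℝ} {gs : Elt d → List (Fin (d + 1) → ℤ)}
    (hv : IsBubbleFun k F v q gs) : v ∈ femSpace Ω 𝒯s (k + 1) := by
  have hF𝒯 : ∀ t ∈ F, t ∈ 𝒯 := fun t ht => mem_of_mem_nbrs (hFT ht)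
  obtain ⟨K, hK⟩ := hv.exists_lipschitz fun t ht =>
    exists_isShaped hd h𝒯 le_rfl (hF𝒯 t ht)
  have h0 : ∀ x ∉ Ω, v x = 0 := by
    intro x hx
    by_contra hne
    apply hx
    rw [← h𝒯.cover]
    exact interior_mono (biUnion_subset_biUnion_left fun t ht => hF𝒯 t ht) (hv.supp x hne)
  refine ⟨memH10_of_lipschitz hΩ hΩb hK h0, h0, fun s hs => ?_⟩
  obtain ⟨t, ht, n, hn⟩ := exists_ancestor href.refines hs
  have hst := carrier_subset_of_mem_descendants n hn
  by_cases htF : t ∈ F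
  · have hnn : bisectionNumber d ≤ n := by
      by_contra! hlt
      exact href.deep t (hFT htF) n hlt s hn hs
    obtain ⟨G, hG⟩ := hv.forms t htF
    have hi := h𝒯.indep t ht
    obtain ⟨g, hg⟩ := hG.linear_on_descendant hi hnn hn
    obtain ⟨p, hp, hpe⟩ := (hv.poly t htF).mul (isPoly_realForm_coords (t.basis hi) g)
    refine ⟨p, hp, fun x hx => ?_⟩
    rw [← hpe x, hv.eq t htF hi x (hst hx), hg x hx]
  -- An element outside `F` has its interior disjoint from the elements of `F`. The function
  -- vanishes there, and by continuity on the whole closed element.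
  · refine ⟨0, by simp, fun x hx => ?_⟩
    have hx' := hst hx
    have hz : ∀ x ∈ interior t.carrier, v x = 0 := by
      intro x hx
      by_contra hne
      have h1 := interior_subset (hv.supp x hne)
      simp only [mem_iUnion] at h1
      obtain ⟨r, hr, hxr⟩ := h1
      exact disjoint_left.1 (h𝒯.disjoint_interior ht (hF𝒯 r hr) fun e => htF (e ▸ hr)) hx hxr
    rw [← t.closure_interior (h𝒯.indep t ht)] at hx'
    have h2 : closure (interior t.carrier) ⊆ {x | v x = 0} :=
      closure_minimal hz (isClosed_eq hK.continuous continuous_const)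
    rw [show v x = 0 from h2 hx']
    simp [polyEval]

theorem exists_uniform_lipschitz_mul_bubble {d : ℕ} (k : ℕ) (Λ : ℝ) {ι : Type*} [Finite ι]
    (gs : ι → List (Fin (d + 1) → ℤ)) :
    ∃ C : ℝ, 0 ≤ C ∧ ∀ (j : ι) (t : Elt d) (x₀ : E d) (ρ : ℝ) (h : IsShaped Λ t x₀ ρ)
      (f : E d → ℝ), IsPoly k f → ∀ M, (∀ x ∈ t.carrier, |f x| ≤ M) → ∀ x ∈ t.carrier,
      ∀ y ∈ t.carrier, |f x * bubble (gs j) ((t.basis h.indep).coords x) -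
          f y * bubble (gs j) ((t.basis h.indep).coords y)| ≤ C * (M / ρ) * ‖x - y‖ := by
  choose C hC h using fun j => exists_lipschitz_mul_bubble (d := d) k Λ (gs j)
  have := Fintype.ofFinite ι
  refine ⟨∑ j, C j, Finset.sum_nonneg fun j _ => hC j, fun j t x₀ ρ hs f hf M hM x hx y hy => ?_⟩
  have hM0 : 0 ≤ M := (abs_nonneg _).trans (hM x hx)
  have hρ := hs.pos
  refine (h j t x₀ ρ hs f hf M hM x hx y hy).trans ?_
  gcongr
  exact Finset.single_le_sum (fun j _ => hC j) (Finset.mem_univ j)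

open Classical in
/-- The element bubble function times a polynomial. -/
def elementBubble {d : ℕ} (t : Elt d) (h : AffineIndependent ℝ t.vertex) (q : E d → ℝ)
    (x : E d) : ℝ :=
  if x ∈ t.carrier then q x * bubble (elementForms d t.type) ((t.basis h).coords x) else 0

theorem isBubbleFun_elementBubble {d : ℕ} (hd : d = 2 ∨ d = 3) {k : ℕ} {t : Elt d}
    (ht : AffineIndependent ℝ t.vertex) {q : E d → ℝ} (hq : IsPoly k q) :
    IsBubbleFun k {t} (elementBubble t ht q) (fun _ => q) (fun s => elementForms d s.type) where
  poly _ _ := hq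
  forms s _ := ⟨_, isBubbleForms_element hd s.type⟩
  eq s hs h x hx := by
    obtain rfl := Finset.mem_singleton.1 hs
    simp [elementBubble, hx]
  supp x hx := by
    have hxt : x ∈ t.carrier := by
      by_contra h; simp [elementBubble, h] at hx
    simp only [elementBubble, if_pos hxt] at hx
    have : x ∈ interior t.carrier := by
      rw [t.interior_carrier ht]
      intro i
      refine lt_of_le_of_ne (coord_nonneg ht hxt i) fun h0 => hx ?_
      rw [(isBubbleForms_element hd t.type).eq_zero (μ := (t.basis ht).coords x)
        (fun k => coord_nonneg ht hxt k) (Finset.mem_univ i) h0.symm, mul_zero]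
    simpa using this

/-- The affine map onto the hyperplane of the side opposite to vertex `i`, parallel to the edge
from vertex `i` to vertex `k`. -/
def sideProj {d : ℕ} (t : Elt d) (h : AffineIndependent ℝ t.vertex) (i k : Fin (d + 1)) :
    E d →ᵃ[ℝ] E d :=
  AffineMap.id ℝ (E d) + (LinearMap.toSpanSingleton ℝ (E d) (t.vertex k - t.vertex i)).toAffineMap.comp
    ((t.basis h).coord i)

theorem sideProj_apply {d : ℕ} (t : Elt d) (h : AffineIndependent ℝ t.vertex) (i k : Fin (d + 1))
    (x : E d) : sideProj t h i k x = x + (t.basis h).coord i x • (t.vertex k - t.vertex i) := by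
  simp [sideProj]

theorem affineMap_add_smul_sub {d : ℕ} (f : E d →ᵃ[ℝ] ℝ) (x y z : E d) (c : ℝ) :
    f (x + c • (y - z)) = f x + c * (f y - f z) := by
  rw [add_comm, ← vadd_eq_add, f.map_vadd, map_smul, ← vsub_eq_sub y z, f.linearMap_vsub]
  simp [add_comm]

theorem sideProj_eq_self {d : ℕ} {t : Elt d} (h : AffineIndependent ℝ t.vertex) {i : Fin (d + 1)}
    (k : Fin (d + 1)) {x : E d} (hx : (t.basis h).coord i x = 0) : sideProj t h i k x = x := by
  rw [sideProj_apply, hx]; simp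

theorem coord_sideProj {d : ℕ} {t : Elt d} (h : AffineIndependent ℝ t.vertex) {i k : Fin (d + 1)}
    (hk : k ≠ i) (j : Fin (d + 1)) (x : E d) : (t.basis h).coord j (sideProj t h i k x) =
      if j = i then 0 else (t.basis h).coord j x + if j = k then (t.basis h).coord i x else 0 := by
  rw [sideProj_apply, affineMap_add_smul_sub, ← t.basis_apply h, ← t.basis_apply h,
    AffineBasis.coord_apply, AffineBasis.coord_apply]
  by_cases hj : j = i
  · subst hj; simp [hk.symm]
  · simp [hj]

theorem sideProj_mem {d : ℕ} {t t' : Elt d} (h : AffineIndependent ℝ t.vertex) {i i' k : Fin (d + 1)}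
    (hk : k ≠ i) (hsh : IsSharedSide t t' i i') {x : E d} (hx : x ∈ t.carrier) :
    sideProj t h i k x ∈ convexHull ℝ (range t.vertex ∩ range t'.vertex) := by
  refine mem_hull_of_coord h hsh (by rw [coord_sideProj h hk]; simp) fun j hj => ?_
  rw [coord_sideProj h hk, if_neg hj]
  have h1 := coord_nonneg h hx j
  have h2 := coord_nonneg h hx i
  split_ifs <;> linarith

theorem exists_ne_index {d : ℕ} (hd : 0 < d) (i : Fin (d + 1)) : ∃ k, k ≠ i := by
  have : Nontrivial (Fin (d + 1)) := Fin.nontrivial_iff_two_le.2 (by omega)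
  exact exists_ne i

-- A polynomial on the side is extended to each element along an edge, by composition with
-- `sideProj`. This keeps its degree, and its values on the elements are values on the side, so a
-- maximum over the side bounds the extension. The two pieces agree on the side by `side_bubble_eq`.
open Classical in
theorem exists_sideBubble {d : ℕ} (hd : d = 2 ∨ d = 3) {Ω : Set (E d)} {𝒯 𝒯' : Mesh d}
    (h𝒯 : IsTriangulation Ω 𝒯) {T : Elt d} (href : IsLocalRefinement Ω 𝒯 T 𝒯') {t t' : Elt d}
    (htT : t ∈ nbrs 𝒯 T) (htT' : t' ∈ nbrs 𝒯 T) (hne : t ≠ t') (ht : AffineIndependent ℝ t.vertex)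
    {i i' : Fin (d + 1)} (hsh : IsSharedSide t t' i i') {k : ℕ}
    {q : E d → ℝ} (hq : IsPoly k q) :
    ∃ (v : E d → ℝ) (Q : Elt d → E d → ℝ) (j : Elt d → Fin (d + 1)),
      IsBubbleFun k {t, t'} v Q (fun s => sideForms d s.type (j s)) ∧
      (∀ x ∈ side t t', v x = q x * bubble (sideForms d t.type i) ((t.basis ht).coords x)) ∧
      (∀ s ∈ ({t, t'} : Finset (Elt d)), ∀ x ∈ s.carrier, ∃ y ∈ side t t', Q s x = q y) ∧
      ∀ x ∉ t.carrier ∪ t'.carrier, v x = 0 := by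
  have hd0 : 0 < d := by omega
  have ht' := h𝒯.indep t' (mem_of_mem_nbrs htT')
  have hconf := h𝒯.conforming t (mem_of_mem_nbrs htT) t' (mem_of_mem_nbrs htT')
  have hdisj := h𝒯.disjoint_interior (mem_of_mem_nbrs htT) (mem_of_mem_nbrs htT') hne
  have hdisj' := h𝒯.disjoint_interior (mem_of_mem_nbrs htT') (mem_of_mem_nbrs htT) hne.symm
  obtain ⟨k₀, hk₀⟩ := exists_ne_index hd0 i
  obtain ⟨k₁, hk₁⟩ := exists_ne_index hd0 i'
  let j : Elt d → Fin (d + 1) := fun s => if s = t then i else i'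
  let Q : Elt d → E d → ℝ := fun s x => if s = t then q (sideProj t ht i k₀ x) else
    q (sideProj t' ht' i' k₁ x)
  let f : E d → ℝ := fun x => q (sideProj t ht i k₀ x) *
    bubble (sideForms d t.type i) ((t.basis ht).coords x)
  let f' : E d → ℝ := fun x => q (sideProj t' ht' i' k₁ x) *
    bubble (sideForms d t'.type i') ((t'.basis ht').coords x)
  let v : E d → ℝ := fun x => if x ∈ t.carrier then f x else if x ∈ t'.carrier then f' x else 0
  have hff : ∀ x ∈ side t t', f x = f' x := by
    intro x hx
    have hx' : x ∈ convexHull ℝ (range t.vertex ∩ range t'.vertex) := hconf ▸ hx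
    have hx'' : x ∈ convexHull ℝ (range t'.vertex ∩ range t.vertex) := by rwa [inter_comm]
    simp only [f, f']
    rw [side_bubble_eq hd h𝒯 href htT htT' ht ht' hsh hx,
      sideProj_eq_self ht k₀ (hsh.coord_eq_zero ht hx'),
      sideProj_eq_self ht' k₁ (hsh.symm.coord_eq_zero ht' hx'')]
  have hvt : ∀ x ∈ t.carrier, v x = f x := fun x hx => by simp [v, hx]
  have hvt' : ∀ x ∈ t'.carrier, v x = f' x := fun x hx => by
    by_cases hxt : x ∈ t.carrier
    · rw [hvt x hxt, hff x ⟨hxt, hx⟩]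
    · simp [v, hx, hxt]
  have hside : ∀ x ∈ side t t', v x = q x *
      bubble (sideForms d t.type i) ((t.basis ht).coords x) := fun x hx => by
    rw [hvt x hx.1]
    simp only [f]
    rw [sideProj_eq_self ht k₀ (hsh.coord_eq_zero ht (hconf ▸ hx))]
  refine ⟨v, Q, j, ⟨?_, ?_, ?_, ?_⟩, hside, ?_, ?_⟩
  · intro s _
    by_cases hs : s = t
    · simp only [Q, if_pos hs]; exact hq.comp_affine _
    · simp only [Q, if_neg hs]; exact hq.comp_affine _
  · intro s _
    exact ⟨_, isBubbleForms_side hd s.type (j s)⟩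
  · intro s hs h x hx
    rcases Finset.mem_insert.1 hs with rfl | hs
    · rw [hvt x hx]; simp [Q, j, f]
    · obtain rfl := Finset.mem_singleton.1 hs
      rw [hvt' x hx]; simp [Q, j, f', hne.symm]
  · intro x hx
    have hU : (⋃ s ∈ ({t, t'} : Finset (Elt d)), s.carrier) = t.carrier ∪ t'.carrier := by
      simp
    rw [hU]
    by_cases hxt : x ∈ t.carrier
    · refine hsh.mem_interior_union hd0 ht ht' hdisj hxt fun m hm => ?_
      refine lt_of_le_of_ne (coord_nonneg ht hxt m) fun h0 => hx ?_
      rw [hvt x hxt]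
      simp only [f]
      rw [(isBubbleForms_side hd t.type i).eq_zero (μ := (t.basis ht).coords x)
        (fun k => coord_nonneg ht hxt k)
        (Finset.mem_erase.2 ⟨hm, Finset.mem_univ m⟩) h0.symm, mul_zero]
    · by_cases hxt' : x ∈ t'.carrier
      · rw [union_comm]
        refine hsh.symm.mem_interior_union hd0 ht' ht hdisj' hxt' fun m hm => ?_
        refine lt_of_le_of_ne (coord_nonneg ht' hxt' m) fun h0 => hx ?_
        rw [hvt' x hxt']
        simp only [f']
        rw [(isBubbleForms_side hd t'.type i').eq_zero (μ := (t'.basis ht').coords x)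
          (fun k => coord_nonneg ht' hxt' k)
          (Finset.mem_erase.2 ⟨hm, Finset.mem_univ m⟩) h0.symm, mul_zero]
      · simp [v, hxt, hxt'] at hx
  · intro s hs x hx
    rcases Finset.mem_insert.1 hs with rfl | hs
    · exact ⟨_, hconf.superset (sideProj_mem ht hk₀ hsh hx), by simp [Q]⟩
    · obtain rfl := Finset.mem_singleton.1 hs
      refine ⟨sideProj s ht' i' k₁ x, hconf.superset ?_, by simp [Q, hne.symm]⟩
      rw [inter_comm]
      exact sideProj_mem ht' hk₁ hsh.symm hx
  · intro x hx
    rw [mem_union, not_or] at hx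
    simp [v, hx.1, hx.2]

/-! ### The `L²` norm -/

section L2

variable {d : ℕ} {F G : Type} [NormedAddCommGroup F] [NormedAddCommGroup G] {ν ν' : Measure (E d)}

theorem l2Norm_nonneg (ν : Measure (E d)) (f : E d → F) : 0 ≤ l2Norm ν f := ENNReal.toReal_nonneg

theorem l2Norm_sq {f : E d → F} (hf : MemLp f 2 ν) : l2Norm ν f ^ 2 = ∫ x, ‖f x‖ ^ 2 ∂ν := by
  rw [l2Norm, hf.eLpNorm_eq_integral_rpow_norm (by norm_num) (by norm_num),
    ENNReal.toReal_ofReal (by positivity)]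
  simp only [ENNReal.toReal_ofNat, Real.rpow_two]
  rw [← Real.rpow_natCast, ← Real.rpow_mul (integral_nonneg fun x => by positivity)]
  norm_num

theorem l2Norm_mono {f : E d → F} {g : E d → G} (hg : MemLp g 2 ν)
    (h : ∀ᵐ x ∂ν, ‖f x‖ ≤ ‖g x‖) : l2Norm ν f ≤ l2Norm ν g :=
  ENNReal.toReal_mono hg.2.ne (eLpNorm_mono_ae h)

theorem l2Norm_mono_measure {f : E d → F} (hf : MemLp f 2 ν') (h : ν ≤ ν') :
    l2Norm ν f ≤ l2Norm ν' f :=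
  ENNReal.toReal_mono hf.2.ne (eLpNorm_mono_measure _ h)

theorem l2Norm_congr {f g : E d → F} (h : f =ᵐ[ν] g) : l2Norm ν f = l2Norm ν g := by
  rw [l2Norm, l2Norm, eLpNorm_congr_ae h]

theorem l2Norm_add_le {f g : E d → F} (hf : MemLp f 2 ν) (hg : MemLp g 2 ν) :
    l2Norm ν (fun x => f x + g x) ≤ l2Norm ν f + l2Norm ν g := by
  rw [l2Norm, l2Norm, l2Norm, ← ENNReal.toReal_add hf.2.ne hg.2.ne]
  exact ENNReal.toReal_mono (ENNReal.add_ne_top.2 ⟨hf.2.ne, hg.2.ne⟩)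
    (eLpNorm_add_le hf.1 hg.1 (by norm_num))

theorem l2Norm_const_mul (c : ℝ) (f : E d → ℝ) :
    l2Norm ν (fun x => c * f x) = |c| * l2Norm ν f := by
  have : (fun x => c * f x) = c • f := rfl
  rw [l2Norm, this, eLpNorm_const_smul, ENNReal.toReal_mul]
  simp [l2Norm]

theorem l2Norm_le_of_bound [IsFiniteMeasure ν] {f : E d → F} {M : ℝ} (hM : 0 ≤ M)
    (h : ∀ᵐ x ∂ν, ‖f x‖ ≤ M) : l2Norm ν f ≤ M * √(ν.real univ) := by
  have hm : MemLp (fun _ : E d => M) 2 ν := memLp_const M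
  refine (l2Norm_mono hm (h.mono fun x hx => by rwa [Real.norm_of_nonneg hM])).trans ?_
  refine le_of_sq_le_sq ?_ (by positivity)
  rw [l2Norm_sq hm, mul_pow, Real.sq_sqrt measureReal_nonneg, integral_const]
  simp [mul_comm]

theorem integral_norm_le_l2Norm [IsFiniteMeasure ν] {f : E d → F} (hf : MemLp f 2 ν) :
    ∫ x, ‖f x‖ ∂ν ≤ √(ν.real univ) * l2Norm ν f := by
  have h1 := eLpNorm_le_eLpNorm_mul_rpow_measure_univ (p := 1) (q := 2) (by norm_num) hf.1
  have h2 : ∫ x, ‖f x‖ ∂ν = (eLpNorm f 1 ν).toReal := by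
    rw [eLpNorm_one_eq_lintegral_enorm, integral_norm_eq_lintegral_enorm hf.1]
  rw [h2]
  have h3 : eLpNorm f 2 ν * ν univ ^ (1 / (1 : ℝ≥0∞).toReal - 1 / (2 : ℝ≥0∞).toReal) ≠ ⊤ :=
    ENNReal.mul_ne_top hf.2.ne (ENNReal.rpow_ne_top_of_nonneg (by norm_num) (measure_ne_top _ _))
  refine (ENNReal.toReal_mono h3 h1).trans (le_of_eq ?_)
  rw [ENNReal.toReal_mul, ← ENNReal.toReal_rpow, mul_comm, Real.sqrt_eq_rpow]
  norm_num [l2Norm, Measure.real]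

theorem abs_integral_mul_le [IsFiniteMeasure ν] {f g : E d → ℝ} (hf : MemLp f 2 ν) {M : ℝ}
    (hM : 0 ≤ M) (hg : ∀ᵐ x ∂ν, |g x| ≤ M) :
    |∫ x, f x * g x ∂ν| ≤ M * (√(ν.real univ) * l2Norm ν f) := by
  have h1 : |∫ x, f x * g x ∂ν| ≤ ∫ x, M * ‖f x‖ ∂ν := by
    rw [← Real.norm_eq_abs]
    refine norm_integral_le_of_norm_le ((hf.integrable (by norm_num)).norm.const_mul M) ?_
    filter_upwards [hg] with x hx
    rw [norm_mul, mul_comm]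
    exact mul_le_mul_of_nonneg_right hx (norm_nonneg _)
  refine h1.trans ?_
  rw [integral_const_mul]
  exact mul_le_mul_of_nonneg_left (integral_norm_le_l2Norm hf) hM

/-- The Cauchy–Schwarz inequality with a constant on `K`; `K` may exceed `Ω`, as closed elements at
the boundary do. -/
theorem abs_setIntegral_le_l2Norm {Ω K : Set (E d)} (hK : MeasurableSet K) (hKf : volume K ≠ ⊤)
    {f : E d → ℝ} {g : E d → F} (hg : MemLp g 2 (volume.restrict K)) {c : ℝ} (hc : 0 ≤ c)
    (hf : ∀ᵐ x ∂volume.restrict Ω, |f x| ≤ K.indicator (fun x => c * ‖g x‖) x) :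
    |∫ x in Ω, f x| ≤ c * (√(volume.real K) * l2Norm (volume.restrict K) g) := by
  have : IsFiniteMeasure (volume.restrict K) := ⟨by simpa using hKf.lt_top⟩
  have hi : IntegrableOn (fun x => c * ‖g x‖) K :=
    (hg.integrable (by norm_num)).norm.const_mul c
  have h1 : ‖∫ x in Ω, f x‖ ≤ ∫ x in Ω, K.indicator (fun x => c * ‖g x‖) x :=
    norm_integral_le_of_norm_le ((integrable_indicator_iff hK).2 hi).integrableOn hf
  refine h1.trans ?_
  rw [setIntegral_indicator hK]
  refine (setIntegral_mono_set hi (Filter.Eventually.of_forall fun x => by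
    show 0 ≤ c * ‖g x‖
    positivity) (Filter.Eventually.of_forall inter_subset_right)).trans ?_
  rw [integral_const_mul]
  refine mul_le_mul_of_nonneg_left ?_ hc
  simpa [Measure.real] using integral_norm_le_l2Norm hg

end L2

/-! ### Coefficients -/

theorem inner_toEuclideanLin {d : ℕ} (M : Matrix (Fin d) (Fin d) ℝ) (ξ η : E d) :
    inner ℝ (Matrix.toEuclideanLin M ξ) η = ∑ i, ∑ j, M i j * ξ j * η i := by
  rw [PiLp.inner_apply]
  refine Finset.sum_congr rfl fun i _ => ?_
  simp [Matrix.toLpLin_apply, Matrix.mulVec, dotProduct, Finset.mul_sum, mul_comm]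

theorem abs_coord_le_norm {d : ℕ} (ξ : E d) (i : Fin d) : |ξ i| ≤ ‖ξ‖ :=
  PiLp.norm_apply_le ξ i

theorem abs_inner_toEuclideanLin_le {d : ℕ} {M : Matrix (Fin d) (Fin d) ℝ} {a : ℝ}
    (h : ∀ i j, |M i j| ≤ a) (ξ η : E d) :
    |inner ℝ (Matrix.toEuclideanLin M ξ) η| ≤ (d : ℝ) ^ 2 * a * ‖ξ‖ * ‖η‖ := by
  rw [inner_toEuclideanLin]
  calc |∑ i, ∑ j, M i j * ξ j * η i| ≤ ∑ i : Fin d, ∑ j : Fin d, a * ‖ξ‖ * ‖η‖ := by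
        refine (Finset.abs_sum_le_sum_abs _ _).trans (Finset.sum_le_sum fun i _ => ?_)
        refine (Finset.abs_sum_le_sum_abs _ _).trans (Finset.sum_le_sum fun j _ => ?_)
        rw [abs_mul, abs_mul]
        have := h i j
        have h0 : 0 ≤ a := (abs_nonneg _).trans this
        gcongr
        · exact abs_coord_le_norm _ _
        · exact abs_coord_le_norm _ _
    _ = _ := by simp; ring

section Coefficients

variable {d : ℕ} {Ω P : Set (E d)} {A : E d → Matrix (Fin d) (Fin d) ℝ} {a₁ a₂ : ℝ}

/-- Testing with `e_i + e_j` and `e_i - e_j` gives `2 |A i j| ≤ A i i + A j j`, and diagonal entries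
are at most `a₂`. -/
theorem IsDiffusion.abs_le (hA : IsDiffusion Ω P A a₁ a₂) {x : E d} (hx : x ∈ Ω) (i j : Fin d) :
    |A x i j| ≤ a₂ := by
  have hform : ∀ (i j : Fin d) (s : ℝ), inner ℝ (Matrix.toEuclideanLin (A x)
      (EuclideanSpace.single i 1 + s • EuclideanSpace.single j 1))
      (EuclideanSpace.single i 1 + s • EuclideanSpace.single j 1) =
      A x i i + s * A x i j + s * A x j i + s ^ 2 * A x j j := by
    intro i j s
    rw [inner_toEuclideanLin]
    simp [PiLp.single_apply, mul_add, add_mul, Finset.sum_add_distrib]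
    ring
  have hn : ∀ (i j : Fin d) (s : ℝ), 0 ≤ A x i i + s * A x i j + s * A x j i + s ^ 2 * A x j j := by
    intro i j s
    rw [← hform]
    exact le_trans (mul_nonneg hA.pos.le (sq_nonneg _)) (hA.lower x hx _)
  have hdiag : ∀ i, A x i i ≤ a₂ := fun i => by
    have h1 := hA.upper x hx (EuclideanSpace.single i 1)
    have h2 := hform i i 0
    simp only [zero_smul, add_zero] at h2
    rw [h2] at h1
    simpa using h1
  have hsym : A x j i = A x i j := (hA.symm x hx).apply i j
  have h1 := hn i j 1
  have h2 := hn i j (-1)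
  rw [hsym] at h1 h2
  have h3 := hdiag i
  have h4 := hdiag j
  rw [_root_.abs_le]
  constructor <;> nlinarith

theorem IsDiffusion.nonneg (hd : 0 < d) (hA : IsDiffusion Ω P A a₁ a₂) (hne : Ω.Nonempty) :
    0 ≤ a₂ :=
  (abs_nonneg _).trans (hA.abs_le hne.some_mem ⟨0, hd⟩ ⟨0, hd⟩)

theorem IsDiffusion.restrict_eq (hA : IsDiffusion Ω P A a₁ a₂) :
    (volume.restrict P : Measure (E d)) = volume.restrict Ω := by
  refine Measure.restrict_congr_set ?_
  refine Filter.EventuallyLE.antisymm (Filter.Eventually.of_forall hA.subset) ?_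
  exact ae_le_set.2 hA.null

theorem IsDiffusion.aestronglyMeasurable (hA : IsDiffusion Ω P A a₁ a₂) (i j : Fin d) :
    AEStronglyMeasurable (fun x => A x i j) (volume.restrict Ω) := by
  rw [← hA.restrict_eq]
  refine ContinuousOn.aestronglyMeasurable ?_ hA.isOpen.measurableSet
  exact ((continuous_apply j).comp (continuous_apply i)).comp_continuousOn hA.continuousOn

theorem IsDiffusion.integrable (hΩ : IsOpen Ω) (hA : IsDiffusion Ω P A a₁ a₂) {G H : E d → E d}
    (hG : MemLp G 2 (volume.restrict Ω)) (hH : MemLp H 2 (volume.restrict Ω)) :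
    Integrable (fun x => inner ℝ (Matrix.toEuclideanLin (A x) (G x)) (H x))
      (volume.restrict Ω) := by
  have hGH : Integrable (fun x => ‖G x‖ * ‖H x‖) (volume.restrict Ω) :=
    integrable_smul_of_memLp_two hG.norm hH.norm
  refine Integrable.mono' (hGH.const_mul ((d : ℝ) ^ 2 * a₂)) ?_ ?_
  · simp only [inner_toEuclideanLin]
    refine Finset.aestronglyMeasurable_fun_sum _ fun i _ =>
      Finset.aestronglyMeasurable_fun_sum _ fun j _ => ?_
    have hc : ∀ (i : Fin d) {G : E d → E d}, MemLp G 2 (volume.restrict Ω) →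
        AEStronglyMeasurable (fun x => G x i) (volume.restrict Ω) := fun i G hG =>
      (EuclideanSpace.proj (𝕜 := ℝ) i : E d →L[ℝ] ℝ).continuous.comp_aestronglyMeasurable hG.1
    exact ((hA.aestronglyMeasurable i j).mul (hc j hG)).mul (hc i hH)
  · refine (ae_restrict_iff' hΩ.measurableSet).2 (Filter.Eventually.of_forall fun x hx => ?_)
    rw [Real.norm_eq_abs, ← mul_assoc]
    exact abs_inner_toEuclideanLin_le (hA.abs_le hx) _ _

variable {B : E d → ℝ} {b₁ b₂ : ℝ}

theorem IsWeight.abs_le (hB : IsWeight Ω B b₁ b₂) {x : E d} (hx : x ∈ Ω) : |B x| ≤ b₂ := by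
  rw [abs_of_pos (hB.pos.trans_le (hB.lower x hx))]
  exact hB.upper x hx

theorem IsWeight.integrable (hΩ : IsOpen Ω) (hB : IsWeight Ω B b₁ b₂) {u v : E d → ℝ}
    (hu : MemLp u 2 (volume.restrict Ω)) (hv : MemLp v 2 (volume.restrict Ω)) :
    Integrable (fun x => B x * u x * v x) (volume.restrict Ω) := by
  have huv : Integrable (fun x => u x * v x) (volume.restrict Ω) :=
    integrable_smul_of_memLp_two hu hv
  simp only [mul_assoc]
  refine huv.bdd_mul (c := b₂) hB.meas ?_
  exact (ae_restrict_iff' hΩ.measurableSet).2 (Filter.Eventually.of_forall fun x hx => hB.abs_le hx)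

/-- The residual of a pair, tested with a function of small support. -/
theorem abs_form_residual_le (hΩ : IsOpen Ω) (hA : IsDiffusion Ω P A a₁ a₂)
    (hB : IsWeight Ω B b₁ b₂) (ha : 0 ≤ a₂) (hb : 0 ≤ b₂) {u w v : E d → ℝ} (hu : MemH10 Ω u)
    (hw : MemH10 Ω w) (hv : MemH10 Ω v) (hwu : MemH10 Ω fun x => w x - u x) {lam μ : ℝ}
    (hlam : 0 ≤ lam) (hwv : aForm Ω A w v = μ * bForm Ω B w v) {K : Set (E d)}
    (hK : IsCompact K) (hKΩ : volume (K \ Ω) = 0) {L : NNReal} (hL : LipschitzWith L v)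
    (h0 : ∀ x ∉ K, v x = 0) {M G : ℝ} (hM0 : 0 ≤ M) (hM : ∀ x, |v x| ≤ M) (hG0 : 0 ≤ G)
    (hG : ∀ᵐ x ∂volume.restrict K, ‖gradient v x‖ ≤ G) :
    |aForm Ω A u v - lam * bForm Ω B u v| ≤ √(volume.real K) *
      ((d : ℝ) ^ 2 * a₂ * G * l2Norm (volume.restrict K) (weakGrad Ω fun x => w x - u x) +
        b₂ * M * l2Norm (volume.restrict K) (fun x => μ * w x) +
        lam * (b₂ * M * l2Norm (volume.restrict K) u)) := by
  have hle : (volume.restrict K : Measure (E d)) ≤ volume.restrict Ω :=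
    Measure.restrict_mono' (ae_le_set.2 hKΩ) le_rfl
  have pu := isSobolevPair_weakGrad hu
  have pw := isSobolevPair_weakGrad hw
  have pv := isSobolevPair_weakGrad hv
  have pwu := isSobolevPair_weakGrad hwu
  have hKf : (volume : Measure (E d)) K ≠ ⊤ := hK.measure_lt_top.ne
  have hgv : weakGrad Ω v =ᵐ[volume.restrict Ω] gradient v :=
    weakGrad_ae_eq_gradient hv hΩ subset_rfl hL.lipschitzOnWith (fun _ _ => rfl)
  have hg0 : ∀ x ∉ K, gradient v x = 0 := fun x hx => by
    rw [gradient_congr hK.isClosed.isOpen_compl (g := fun _ => 0) (fun y hy => h0 y hy) hx]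
    simp [gradient]
  have hGΩ : ∀ᵐ x ∂volume.restrict Ω, ‖gradient v x‖ ≤ K.indicator (fun _ => G) x := by
    refine ae_restrict_of_ae ?_
    rw [ae_restrict_iff' hK.measurableSet] at hG
    filter_upwards [hG] with x hx
    by_cases hxK : x ∈ K
    · simpa [hxK] using hx hxK
    · simp [hxK, hg0 x hxK]
  have h1 : |aForm Ω A u v - aForm Ω A w v| ≤ (d : ℝ) ^ 2 * a₂ * G *
      (√(volume.real K) * l2Norm (volume.restrict K) (weakGrad Ω fun x => w x - u x)) := by
    rw [aForm, aForm, ← integral_sub (hA.integrable hΩ pu.memLp_grad pv.memLp_grad)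
      (hA.integrable hΩ pw.memLp_grad pv.memLp_grad)]
    refine abs_setIntegral_le_l2Norm hK.measurableSet hKf (pwu.memLp_grad.mono_measure hle)
      (by positivity) ?_
    filter_upwards [hGΩ, hgv, weakGrad_sub_ae_eq hΩ hw hu hwu,
      ae_restrict_mem hΩ.measurableSet] with x hx1 hx2 hx3 hx4
    rw [← inner_sub_left, ← map_sub, hx2]
    refine (abs_inner_toEuclideanLin_le (hA.abs_le hx4) _ _).trans ?_
    by_cases hxK : x ∈ K
    · simp only [indicator_of_mem hxK] at hx1 ⊢
      rw [hx3, norm_sub_rev, mul_right_comm]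
      gcongr
    · simp [hxK, hg0 x hxK]
  have h2 : ∀ (c : ℝ) (f : E d → ℝ), MemLp f 2 (volume.restrict Ω) →
      |∫ x in Ω, c * (B x * f x * v x)| ≤
        b₂ * M * (√(volume.real K) * l2Norm (volume.restrict K) fun x => c * f x) := by
    intro c f hf
    refine abs_setIntegral_le_l2Norm hK.measurableSet hKf
      ((hf.const_mul c).mono_measure hle) (by positivity) ?_
    filter_upwards [ae_restrict_mem hΩ.measurableSet] with x hx
    by_cases hxK : x ∈ K
    · simp only [indicator_of_mem hxK]
      calc |c * (B x * f x * v x)| = |B x| * |v x| * |c * f x| := by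
            simp only [abs_mul]; ring
        _ ≤ b₂ * M * |c * f x| := by gcongr; exacts [hB.abs_le hx, hM x]
        _ = _ := rfl
    · simp [hxK, h0 x hxK]
  have h3 := h2 μ w pw.memLp
  have h4 := h2 1 u pu.memLp
  simp only [one_mul] at h4
  rw [integral_const_mul] at h3
  change |μ * bForm Ω B w v| ≤ _ at h3
  change |bForm Ω B u v| ≤ _ at h4
  -- The equation for `w` is used here: it replaces `a(w,v)`, so that only the error `u - w` meets
  -- the gradient of `v`.
  have e1 : aForm Ω A u v - lam * bForm Ω B u v =
      (aForm Ω A u v - aForm Ω A w v) + μ * bForm Ω B w v - lam * bForm Ω B u v := by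
    rw [hwv]; ring
  rw [e1]
  calc _ ≤ |aForm Ω A u v - aForm Ω A w v| + |μ * bForm Ω B w v| + lam * |bForm Ω B u v| := by
        refine (abs_sub _ _).trans ?_
        rw [abs_mul lam, abs_of_nonneg hlam]
        exact add_le_add_left (abs_add_le _ _) _
    _ ≤ _ := by
        refine (add_le_add (add_le_add h1 h3) (mul_le_mul_of_nonneg_left h4 hlam)).trans
          (le_of_eq ?_)
        ring

end Coefficients

/-! ### Normals -/

/-- The outward normal is the negative normalized gradient of the barycentric coordinate that
vanishes on the side. -/
theorem exists_normal {d : ℕ} (t : Elt d) (h : AffineIndependent ℝ t.vertex)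
    (hd : 0 < d) (i : Fin (d + 1)) : ∃ (n : E d) (c : ℝ), ‖n‖ = 1 ∧ 0 < c ∧
      ∀ x y, inner ℝ (x - y) n = c * ((t.basis h).coord i y - (t.basis h).coord i x) := by
  set f := (t.basis h).coord i
  set g : E d := (InnerProductSpace.toDual ℝ (E d)).symm (LinearMap.toContinuousLinearMap f.linear)
  have hg : ∀ x y, inner ℝ g (x - y) = f x - f y := fun x y => by
    rw [InnerProductSpace.toDual_symm_apply]
    show f.linear (x - y) = _
    rw [← vsub_eq_sub x y, f.linearMap_vsub]; rfl
  have hg0 : g ≠ 0 := fun h0 => by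
    obtain ⟨k, hk⟩ := exists_ne_index hd i
    have h1 := hg (t.basis h i) (t.basis h k)
    rw [h0, inner_zero_left, (t.basis h).coord_apply_eq, (t.basis h).coord_apply_ne hk.symm] at h1
    norm_num at h1
  have hn : 0 < ‖g‖ := norm_pos_iff.2 hg0
  refine ⟨-(‖g‖⁻¹ • g), ‖g‖⁻¹, ?_, by positivity, fun x y => ?_⟩
  · rw [norm_neg, norm_smul, norm_inv, norm_norm, inv_mul_cancel₀ hn.ne']
  · rw [inner_neg_right, real_inner_smul_right, real_inner_comm, hg]; ring

/-- The normal is an arbitrary choice subject to its defining properties, which nevertheless fix it.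
The affine function `⟨x - z₀, n⟩` vanishes at the vertices of the side and so is a multiple of the
opposite coordinate; unit length makes the factor nonzero and the outward condition fixes its sign.
-/
theorem outwardNormal_spec {d : ℕ} (hd : 0 < d) {t t' : Elt d} (h : AffineIndependent ℝ t.vertex)
    {i i' : Fin (d + 1)} (hsh : IsSharedSide t t' i i')
    (hconf : t.carrier ∩ t'.carrier = convexHull ℝ (range t.vertex ∩ range t'.vertex)) :
    ‖outwardNormal t (side t t')‖ = 1 ∧ ∃ c : ℝ, 0 < c ∧ ∀ z ∈ side t t', ∀ x,
      inner ℝ (x - z) (outwardNormal t (side t t')) = - (c * (t.basis h).coord i x) := by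
  set S := side t t'
  have hS0 : ∀ z ∈ S, (t.basis h).coord i z = 0 := fun z hz =>
    hsh.coord_eq_zero h (hconf ▸ hz)
  have hex : ∃ n : E d, ‖n‖ = 1 ∧ (∀ x ∈ S, ∀ y ∈ S, inner ℝ (y - x) n = 0) ∧
      ∀ x ∈ S, ∀ y ∈ t.carrier, inner ℝ (y - x) n ≤ 0 := by
    obtain ⟨n, c, hn, hc, hnc⟩ := exists_normal t h hd i
    refine ⟨n, hn, fun x hx y hy => by rw [hnc, hS0 x hx, hS0 y hy]; ring, fun x hx y hy => ?_⟩
    rw [hnc, hS0 x hx]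
    have := mul_nonneg hc.le (coord_nonneg h hy i)
    linarith
  obtain ⟨hn, hperp, hout⟩ := Classical.epsilon_spec hex
  change ‖outwardNormal t S‖ = 1 at hn
  change ∀ x ∈ S, ∀ y ∈ S, inner ℝ (y - x) (outwardNormal t S) = 0 at hperp
  change ∀ x ∈ S, ∀ y ∈ t.carrier, inner ℝ (y - x) (outwardNormal t S) ≤ 0 at hout
  set n := outwardNormal t S
  refine ⟨hn, ?_⟩
  obtain ⟨k, hk⟩ := exists_ne_index hd i
  have hmem : ∀ k, k ≠ i → t.vertex k ∈ S := fun k hk => by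
    refine hconf.superset (subset_convexHull ℝ _ ?_)
    rw [hsh.left]; exact ⟨k, hk, rfl⟩
  set z₀ := t.vertex k
  have hz₀ : z₀ ∈ S := hmem k hk
  let f : E d →ᵃ[ℝ] ℝ := AffineMap.mk' (fun x => inner ℝ (x - z₀) n)
    ((innerSL ℝ n : E d →L[ℝ] ℝ).toLinearMap) z₀ (fun x => by
      simp [real_inner_comm])
  have hf : ∀ x, f x = inner ℝ (x - z₀) n := fun x => rfl
  have hfi : ∀ x, f x = (t.basis h).coord i x * f (t.vertex i) := by
    intro x
    rw [affineMap_apply_eq_sum (t.basis h) f x, Finset.sum_eq_single i]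
    · rfl
    · intro j _ hj
      rw [hf, t.basis_apply h, hperp z₀ hz₀ _ (hmem j hj), mul_zero]
    · simp
  have hle : f (t.vertex i) ≤ 0 := hout z₀ hz₀ _ (t.vertex_mem_carrier i)
  have hne : f (t.vertex i) ≠ 0 := fun h0 => by
    have h1 := hfi (z₀ + n)
    rw [h0, mul_zero, hf, add_sub_cancel_left, real_inner_self_eq_norm_sq, hn] at h1
    norm_num at h1
  refine ⟨-f (t.vertex i), by have := lt_of_le_of_ne hle hne; linarith, fun z hz x => ?_⟩
  have h1 := hperp z₀ hz₀ z hz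
  have h2 : inner ℝ (x - z) n = f x := by
    rw [hf, ← sub_sub_sub_cancel_right x z z₀, inner_sub_left, h1, sub_zero]
  rw [h2, hfi]; ring

/-! ### Locally Lipschitz functions -/

theorem LocallyLipschitz.mul_real {X : Type*} [PseudoEMetricSpace X] {f g : X → ℝ}
    (hf : LocallyLipschitz f) (hg : LocallyLipschitz g) : LocallyLipschitz fun x => f x * g x := by
  have h : LocallyLipschitz fun p : ℝ × ℝ => p.1 * p.2 :=
    (contDiff_fst.mul contDiff_snd : ContDiff ℝ 1 _).locallyLipschitz
  exact h.comp (hf.prodMk hg)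

theorem exists_lipschitzWith_of_compact_support {d : ℕ} {f : E d → ℝ} (hf : LocallyLipschitz f)
    (hc : HasCompactSupport f) : ∃ K : NNReal, LipschitzWith K f := by
  obtain ⟨R, hR⟩ := hc.isCompact.isBounded.subset_ball 0
  obtain ⟨K, hK⟩ := (hf.locallyLipschitzOn (s := Metric.closedBall 0 R)).exists_lipschitzOnWith_of_compact
    (isCompact_closedBall 0 R)
  refine ⟨K, lipschitzWith_of_closed_cover (ι := Bool)
    (C := fun b => if b then Metric.closedBall 0 R else (Metric.ball 0 R)ᶜ) ?_ ?_ ?_⟩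
  · rintro (_ | _)
    · simp [Metric.isOpen_ball]
    · simp [Metric.isClosed_closedBall]
  · intro x
    by_cases hx : x ∈ Metric.closedBall (0 : E d) R
    · exact ⟨true, by simpa using hx⟩
    · exact ⟨false, fun h => hx (Metric.ball_subset_closedBall h)⟩
  · rintro (_ | _)
    · have h0 : ∀ x ∈ (Metric.ball (0 : E d) R)ᶜ, f x = 0 := fun x hx =>
        image_eq_zero_of_notMem_tsupport fun h => hx (hR h)
      intro x hx y hy
      simp only [Bool.false_eq_true, if_false] at hx hy
      rw [h0 x hx, h0 y hy, edist_self]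
      exact bot_le
    · simpa using hK

/-! ### Integration by parts on an element -/

theorem volume_hyperplane {m : ℕ} {n : E (m + 1)} (hn : ‖n‖ = 1) (z : E (m + 1)) :
    volume {x | inner ℝ (x - z) n = 0} = 0 := by
  obtain ⟨b, rfl⟩ := exists_orthonormalBasis_zero hn
  rw [← (measurePreserving_frame b z).measure_preimage_equiv]
  have : frame b z ⁻¹' {x | inner ℝ (x - z) (b 0) = 0} = {0} ×ˢ univ := by
    ext ⟨s, y⟩
    simp only [mem_preimage, mem_ofPred_eq, inner_frame_sub]
    simp
  rw [this, Measure.prod_prod]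
  simp

/-- Apply the half-space formula to the product `a f v`, which vanishes in the half-space outside
the element. The half-space thus replaces the element, and only one of its sides contributes a
boundary term. -/
theorem integral_byParts_element {m : ℕ} {t : Elt (m + 1)} {n z : E (m + 1)} (hn : ‖n‖ = 1)
    (ht : t.carrier ⊆ {x | inner ℝ (x - z) n ≤ 0}) {a f v : E (m + 1) → ℝ} {L K : NNReal}
    (ha : LipschitzWith L a) (hf : ContDiff ℝ 1 f) (hv : LipschitzWith K v)
    (hc : HasCompactSupport v) (h0 : ∀ x, inner ℝ (x - z) n ≤ 0 → x ∉ t.carrier → v x = 0)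
    (e : E (m + 1)) :
    ∫ x in t.carrier, ((fderiv ℝ a x e * f x + a x * fderiv ℝ f x e) * v x +
        a x * f x * fderiv ℝ v x e) =
      inner ℝ e n * ∫ x in {x | inner ℝ (x - z) n = 0}, a x * f x * v x ∂μHE[m] := by
  have hll : LocallyLipschitz fun x => a x * f x * v x :=
    LocallyLipschitz.mul_real (LocallyLipschitz.mul_real ha.locallyLipschitz hf.locallyLipschitz)
      hv.locallyLipschitz
  have hcs : HasCompactSupport fun x => a x * f x * v x := hc.mul_left
  obtain ⟨K', hK'⟩ := exists_lipschitzWith_of_compact_support hll hcs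
  rw [← setIntegral_lineDeriv_halfspace hn z e hK' hcs]
  set H := {x : E (m + 1) | inner ℝ (x - z) n ≤ 0}
  have hHm : MeasurableSet H := (isClosed_le (by fun_prop) continuous_const).measurableSet
  have h1 : ∫ x in H, lineDeriv ℝ (fun x => a x * f x * v x) x e =
      ∫ x in t.carrier, lineDeriv ℝ (fun x => a x * f x * v x) x e := by
    refine setIntegral_eq_of_subset_of_ae_sdiff_eq_zero hHm.nullMeasurableSet ht ?_
    have hnull : ∀ᵐ x : E (m + 1), ¬ inner ℝ (x - z) n = 0 := by
      rw [ae_iff]; simpa using volume_hyperplane hn z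
    filter_upwards [hnull] with x hx hxd
    have hlt : inner ℝ (x - z) n < 0 := lt_of_le_of_ne hxd.1 hx
    have hev : (fun x => a x * f x * v x) =ᶠ[nhds x] fun _ => 0 := by
      have hopen : IsOpen ({y : E (m + 1) | inner ℝ (y - z) n < 0} ∩ t.carrierᶜ) :=
        (isOpen_lt (by fun_prop) continuous_const).inter t.isCompact_carrier.isClosed.isOpen_compl
      filter_upwards [hopen.mem_nhds ⟨hlt, hxd.2⟩] with y hy
      rw [h0 y (le_of_lt hy.1) hy.2, mul_zero]
    rw [hev.lineDeriv_eq]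
    simp [lineDeriv]
  rw [h1]
  refine integral_congr_ae (ae_restrict_of_ae ?_)
  filter_upwards [ha.ae_differentiableAt (μ := volume), hv.ae_differentiableAt (μ := volume)]
    with x hx1 hx2
  have hx3 : DifferentiableAt ℝ f x := hf.differentiable one_ne_zero x
  have h2 := (hx1.hasFDerivAt.mul hx3.hasFDerivAt).mul hx2.hasFDerivAt
  have h3 : HasFDerivAt (fun x => a x * f x * v x) _ x := h2
  rw [h3.differentiableAt.lineDeriv_eq_fderiv, h3.fderiv]
  simp
  ring

/-! ### Bounded functions on an element -/

section Bounded

variable {d : ℕ} {K : Set (E d)}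

theorem memLp_top_of_continuous (hK : IsCompact K) {f : E d → ℝ} (hf : Continuous f) :
    MemLp f ⊤ (volume.restrict K) := by
  obtain ⟨C, hC⟩ := hK.exists_bound_of_continuousOn hf.continuousOn
  exact memLp_top_of_bound hf.aestronglyMeasurable C
    ((ae_restrict_iff' hK.measurableSet).2 (Filter.Eventually.of_forall hC))

theorem memLp_top_fderiv {f : E d → ℝ} {L : NNReal} (hf : LipschitzWith L f) (e : E d) :
    MemLp (fun x => fderiv ℝ f x e) ⊤ (volume.restrict K) := by
  refine memLp_top_of_bound (measurable_fderiv_apply_const ℝ f e).aestronglyMeasurable (L * ‖e‖)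
    (Filter.Eventually.of_forall fun x => ?_)
  exact (ContinuousLinearMap.le_opNorm _ _).trans
    (mul_le_mul_of_nonneg_right (norm_fderiv_le_of_lipschitz ℝ hf) (norm_nonneg _))

theorem MemLp.top_mul {X : Type*} [MeasurableSpace X] {ν : Measure X} {f g : X → ℝ}
    (hf : MemLp f ⊤ ν) (hg : MemLp g ⊤ ν) : MemLp (fun x => f x * g x) ⊤ ν :=
  hg.mul hf

end Bounded

/-! ### Local representation of coefficients and finite element functions -/

/-- On the element `t`, the function `u` is the polynomial `p` and the coefficient `A` has the
Lipschitz extension `α`. -/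
structure IsLocalData {d : ℕ} (A : E d → Matrix (Fin d) (Fin d) ℝ) (u : E d → ℝ) (ℓ : ℕ)
    (t : Elt d) (L : NNReal) (p : E d → ℝ) (α : Fin d → Fin d → E d → ℝ) : Prop where
  indep : AffineIndependent ℝ t.vertex
  poly : IsPoly ℓ p
  eq_poly : ∀ x ∈ t.carrier, u x = p x
  lip : ∀ i j, LipschitzWith L (α i j)
  eq_coeff : ∀ x ∈ interior t.carrier, ∀ i j, A x i j = α i j x

/-- The standard unit vectors. -/
abbrev unitVec {d : ℕ} (i : Fin d) : E d := EuclideanSpace.single i 1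

/-- The `i`-th derivative of the `j`-th derivative. -/
def secondDeriv {d : ℕ} (p : E d → ℝ) (i j : Fin d) (x : E d) : ℝ :=
  fderiv ℝ (fun y => gradient p y j) x (unitVec i)

/-- `∇·(α∇p)` by the product rule. -/
def fluxDiv {d : ℕ} (p : E d → ℝ) (α : Fin d → Fin d → E d → ℝ) (x : E d) : ℝ :=
  ∑ i, ∑ j, (fderiv ℝ (α i j) x (unitVec i) * gradient p x j + α i j x * secondDeriv p i j x)

/-- `α∇p·n`. -/
def normalFlux {d : ℕ} (p : E d → ℝ) (α : Fin d → Fin d → E d → ℝ) (n x : E d) : ℝ :=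
  ∑ i, ∑ j, α i j x * gradient p x j * n i

/-- The interior of an element is a convex open subset of `P`, so the coefficient is Lipschitz there
with a constant depending on `A` only, and it extends to the whole space with the same constant. -/
theorem exists_isLocalData {d : ℕ} {Ω P : Set (E d)} {A : E d → Matrix (Fin d) (Fin d) ℝ}
    {a₁ a₂ : ℝ} (hA : IsDiffusion Ω P A a₁ a₂) (ℓ : ℕ) :
    ∃ L : NNReal, ∀ 𝒯 : Mesh d, IsTriangulation Ω 𝒯 → Matches P 𝒯 → ∀ u ∈ femSpace Ω 𝒯 ℓ,
      ∀ t ∈ 𝒯, ∃ p α, IsLocalData A u ℓ t L p α := by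
  have hAc : ∀ i j, ContinuousOn (fun x => A x i j) P := fun i j => by
    exact ((continuous_apply j).comp (continuous_apply i)).comp_continuousOn hA.continuousOn
  choose L hL using fun i j => exists_lipschitzOnWith_of_memW1Inf hA.isOpen (hAc i j)
    (hA.sobolev i j)
  refine ⟨∑ i, ∑ j, L i j, fun 𝒯 h𝒯 hm u hu t ht => ?_⟩
  obtain ⟨p, hp, hpe⟩ := hu.2.2 t ht
  choose α hα hαe using fun i j => LipschitzOnWith.extend_real
    (hL i j (interior t.carrier) (hm t ht) isOpen_interior t.convex_carrier.interior)
  refine ⟨polyEval p, α, h𝒯.indep t ht, isPoly_polyEval hp, hpe, fun i j => (hα i j).weaken ?_,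
    fun x hx i j => hαe i j hx⟩
  calc L i j ≤ ∑ j, L i j := Finset.single_le_sum (f := fun j => L i j)
        (fun _ _ => bot_le) (Finset.mem_univ j)
    _ ≤ _ := Finset.single_le_sum (f := fun i => ∑ j, L i j)
        (fun _ _ => bot_le) (Finset.mem_univ i)

section LocalData

variable {d : ℕ} {A : E d → Matrix (Fin d) (Fin d) ℝ} {u : E d → ℝ} {ℓ : ℕ} {t : Elt d} {L : NNReal}
  {p : E d → ℝ} {α : Fin d → Fin d → E d → ℝ}

theorem IsPoly.secondDeriv {k : ℕ} {p : E d → ℝ} (hp : IsPoly k p) (i j : Fin d) :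
    IsPoly (k - 2) (secondDeriv p i j) := by
  have := (hp.gradient_apply j).gradient_apply i
  simp only [FEM.gradient_apply (fun x => gradient p x j)] at this
  exact this.mono (by omega)

theorem IsLocalData.gradient_eq (h : IsLocalData A u ℓ t L p α) {x : E d}
    (hx : x ∈ interior t.carrier) : gradient u x = gradient p x :=
  gradient_congr isOpen_interior (fun y hy => h.eq_poly y (interior_subset hy)) hx

theorem ae_mem_interior (t : Elt d) : ∀ᵐ x ∂volume.restrict t.carrier, x ∈ interior t.carrier := by
  rw [← Measure.restrict_congr_set t.interior_ae_eq]
  exact ae_restrict_mem isOpen_interior.measurableSet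

/-- The product rule, valid at almost every point by Rademacher's theorem for the coefficients. -/
theorem IsLocalData.residual_ae (h : IsLocalData A u ℓ t L p α) (B : E d → ℝ) (lam : ℝ) :
    ∀ᵐ x ∂volume.restrict t.carrier,
      residual A B lam u x = - fluxDiv p α x - lam * (B x * u x) := by
  have hdiff : ∀ᵐ x : E d, ∀ i j, DifferentiableAt ℝ (α i j) x :=
    ae_all_iff.2 fun i => ae_all_iff.2 fun j => (h.lip i j).ae_differentiableAt
  filter_upwards [ae_mem_interior t, ae_restrict_of_ae hdiff] with x hx hx1
  set Fv : E d → E d := fun y => WithLp.toLp 2 fun i => ∑ j, α i j y * gradient p y j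
  have hev : (fun y => Matrix.toEuclideanLin (A y) (gradient u y)) =ᶠ[nhds x] Fv := by
    filter_upwards [isOpen_interior.mem_nhds hx] with y hy
    rw [h.gradient_eq hy]
    ext i
    simp [Fv, Matrix.toLpLin_apply, Matrix.mulVec, dotProduct, h.eq_coeff y hy]
  have hcomp : ∀ i j, HasFDerivAt (fun y => α i j y * gradient p y j)
      (α i j x • fderiv ℝ (fun y => gradient p y j) x + gradient p x j • fderiv ℝ (α i j) x) x :=
    fun i j => (hx1 i j).hasFDerivAt.mul
      (((h.poly.gradient_apply j).differentiable x).hasFDerivAt)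
  have hFi : ∀ i, HasFDerivAt (fun y => Fv y i) (∑ j, (α i j x •
      fderiv ℝ (fun y => gradient p y j) x + gradient p x j • fderiv ℝ (α i j) x)) x := fun i => by
    show HasFDerivAt (fun y => ∑ j, α i j y * gradient p y j) _ x
    exact HasFDerivAt.fun_sum fun j _ => hcomp i j
  have hFd : DifferentiableAt ℝ Fv x :=
    differentiableAt_euclidean.2 fun i => (hFi i).differentiableAt
  have hdiv : divergence Fv x = fluxDiv p α x := by
    rw [divergence, fluxDiv]
    refine Finset.sum_congr rfl fun i _ => ?_
    have h1 : HasFDerivAt (fun y => Fv y i)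
        ((EuclideanSpace.proj i : E d →L[ℝ] ℝ).comp (fderiv ℝ Fv x)) x :=
      (EuclideanSpace.proj i : E d →L[ℝ] ℝ).hasFDerivAt.comp x hFd.hasFDerivAt
    have h2 := congrArg (fun T : E d →L[ℝ] ℝ => T (unitVec i)) (h1.unique (hFi i))
    simp only [ContinuousLinearMap.comp_apply] at h2
    refine Eq.trans h2 ?_
    simp only [_root_.sum_apply, _root_.add_apply,
      _root_.smul_apply, smul_eq_mul]
    exact Finset.sum_congr rfl fun j _ => by rw [secondDeriv]; ring
  rw [residual, divergence, hev.fderiv_eq]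
  change - divergence Fv x - _ = _
  rw [hdiv]; ring

theorem IsLocalData.memLp_fluxDiv (h : IsLocalData A u ℓ t L p α) :
    MemLp (fluxDiv p α) ⊤ (volume.restrict t.carrier) := by
  refine memLp_finsetSum _ fun i _ => memLp_finsetSum _ fun j _ => ?_
  have hg := memLp_top_of_continuous t.isCompact_carrier (h.poly.gradient_apply j).continuous
  have hs := memLp_top_of_continuous t.isCompact_carrier (h.poly.secondDeriv i j).continuous
  have ha := memLp_top_of_continuous t.isCompact_carrier (h.lip i j).continuous
  exact (MemLp.top_mul (memLp_top_fderiv (h.lip i j) _) hg).add (MemLp.top_mul ha hs)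

theorem IsLocalData.memLp_left (h : IsLocalData A u ℓ t L p α) :
    MemLp u ⊤ (volume.restrict t.carrier) := by
  refine MemLp.ae_eq ?_ (memLp_top_of_continuous t.isCompact_carrier h.poly.continuous)
  exact (ae_restrict_iff' t.measurableSet_carrier).2
    (Filter.Eventually.of_forall fun x hx => (h.eq_poly x hx).symm)

theorem restrict_carrier_le {Ω : Set (E d)} (htΩ : interior t.carrier ⊆ Ω) :
    (volume.restrict t.carrier : Measure (E d)) ≤ volume.restrict Ω := by
  rw [← Measure.restrict_congr_set t.interior_ae_eq]
  exact Measure.restrict_mono htΩ le_rfl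

theorem IsWeight.memLp {Ω : Set (E d)} {B : E d → ℝ} {b₁ b₂ : ℝ} (hΩ : IsOpen Ω)
    (hB : IsWeight Ω B b₁ b₂) : MemLp B ⊤ (volume.restrict Ω) :=
  memLp_top_of_bound hB.meas b₂ ((ae_restrict_iff' hΩ.measurableSet).2
    (Filter.Eventually.of_forall fun _ hx => hB.abs_le hx))

theorem IsLocalData.memLp_weight {Ω : Set (E d)} {B : E d → ℝ} {b₁ b₂ : ℝ} (hΩ : IsOpen Ω)
    (hB : IsWeight Ω B b₁ b₂) (htΩ : interior t.carrier ⊆ Ω) (h : IsLocalData A u ℓ t L p α) :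
    MemLp (fun x => B x * u x) ⊤ (volume.restrict t.carrier) :=
  MemLp.top_mul ((hB.memLp hΩ).mono_measure (restrict_carrier_le htΩ)) h.memLp_left

instance isFiniteMeasure_carrier (t : Elt d) :
    IsFiniteMeasure (volume.restrict t.carrier : Measure (E d)) :=
  ⟨by simpa using t.isCompact_carrier.measure_lt_top⟩

theorem IsLocalData.memLp_residual {Ω : Set (E d)} {B : E d → ℝ} {b₁ b₂ : ℝ} (hΩ : IsOpen Ω)
    (hB : IsWeight Ω B b₁ b₂) (htΩ : interior t.carrier ⊆ Ω) (h : IsLocalData A u ℓ t L p α)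
    (lam : ℝ) : MemLp (residual A B lam u) ⊤ (volume.restrict t.carrier) := by
  refine MemLp.ae_eq ?_ (h.memLp_fluxDiv.neg.sub ((h.memLp_weight hΩ hB htΩ).const_mul lam))
  filter_upwards [h.residual_ae B lam] with x hx
  rw [hx]; rfl

/-- The continuous extension of `A` from the interior is the Lipschitz extension. A simplex is a set
of unique differentiability, so the gradient within it is that of the polynomial. -/
theorem IsLocalData.inner_traceFlux (h : IsLocalData A u ℓ t L p α) {x : E d}
    (hx : x ∈ t.carrier) (n : E d) :
    inner ℝ (traceFlux A u t x) n = normalFlux p α n x := by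
  have h1 : extendFrom (interior t.carrier) A x = Matrix.of fun i j => α i j x := by
    refine extendFrom_eq (by rwa [t.closure_interior h.indep]) ?_
    refine tendsto_pi_nhds.2 fun i => tendsto_pi_nhds.2 fun j => ?_
    refine ((h.lip i j).continuous.continuousAt.mono_left nhdsWithin_le_nhds).congr' ?_
    filter_upwards [self_mem_nhdsWithin] with y hy
    exact (h.eq_coeff y hy i j).symm
  have h2 : gradientWithin u t.carrier x = gradient p x := by
    have hu : UniqueDiffWithinAt ℝ t.carrier x :=
      uniqueDiffWithinAt_convex t.convex_carrier (t.interior_nonempty h.indep) (_root_.subset_closure hx)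
    rw [gradientWithin, gradient, fderivWithin_congr (fun y hy => h.eq_poly y hy) (h.eq_poly x hx),
      (h.poly.differentiable x).fderivWithin hu]
  rw [traceFlux, h1, h2, inner_toEuclideanLin]
  rfl

theorem IsLocalData.continuous_normalFlux (h : IsLocalData A u ℓ t L p α) (n : E d) :
    Continuous (normalFlux p α n) :=
  continuous_finsetSum _ fun i _ => continuous_finsetSum _ fun j _ =>
    ((h.lip i j).continuous.mul (h.poly.gradient_apply j).continuous).mul continuous_const

end LocalData

/-- Integration by parts for each entry of the coefficient, summed over all entries. It covers
element bubbles, for which the surface term is zero, and side bubbles, for which one side remains.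
-/
theorem IsLocalData.setIntegral_residual_mul {m : ℕ} {A : E (m + 1) → Matrix (Fin (m + 1)) (Fin (m + 1)) ℝ}
    {u v : E (m + 1) → ℝ} {ℓ : ℕ} {t : Elt (m + 1)} {L K : NNReal}
    {p : E (m + 1) → ℝ} {α : Fin (m + 1) → Fin (m + 1) → E (m + 1) → ℝ}
    (h : IsLocalData A u ℓ t L p α) {Ω : Set (E (m + 1))} {B : E (m + 1) → ℝ} {b₁ b₂ : ℝ}
    (hΩ : IsOpen Ω) (hB : IsWeight Ω B b₁ b₂) (htΩ : interior t.carrier ⊆ Ω)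
    (hu : MemH10 Ω u) (hvm : MemH10 Ω v)
    {n z : E (m + 1)} (hn : ‖n‖ = 1) (ht : t.carrier ⊆ {x | inner ℝ (x - z) n ≤ 0})
    (hv : LipschitzWith K v) (hc : HasCompactSupport v)
    (h0 : ∀ x, inner ℝ (x - z) n ≤ 0 → x ∉ t.carrier → v x = 0) (lam : ℝ) :
    ∫ x in t.carrier, residual A B lam u x * v x =
      (∫ x in t.carrier, inner ℝ (Matrix.toEuclideanLin (A x) (weakGrad Ω u x)) (weakGrad Ω v x)) -
      lam * (∫ x in t.carrier, B x * u x * v x) -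
      ∫ x in {x | inner ℝ (x - z) n = 0}, normalFlux p α n x * v x ∂μHE[m] := by
  have hvL := memLp_top_of_continuous t.isCompact_carrier hv.continuous
  set D : Fin (m + 1) → Fin (m + 1) → E (m + 1) → ℝ := fun i j x =>
    fderiv ℝ (α i j) x (unitVec i) * gradient p x j + α i j x * secondDeriv p i j x
  set Q : Fin (m + 1) → Fin (m + 1) → E (m + 1) → ℝ := fun i j x =>
    α i j x * gradient p x j * fderiv ℝ v x (unitVec i)
  have hD : ∀ i j, Integrable (fun x => D i j x * v x) (volume.restrict t.carrier) := fun i j => by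
    have hg := memLp_top_of_continuous t.isCompact_carrier (h.poly.gradient_apply j).continuous
    have hs := memLp_top_of_continuous t.isCompact_carrier (h.poly.secondDeriv i j).continuous
    have ha := memLp_top_of_continuous t.isCompact_carrier (h.lip i j).continuous
    exact (MemLp.top_mul ((MemLp.top_mul (memLp_top_fderiv (h.lip i j) _) hg).add
      (MemLp.top_mul ha hs)) hvL).integrable le_top
  have hQ : ∀ i j, Integrable (Q i j) (volume.restrict t.carrier) := fun i j => by
    have hg := memLp_top_of_continuous t.isCompact_carrier (h.poly.gradient_apply j).continuous
    have ha := memLp_top_of_continuous t.isCompact_carrier (h.lip i j).continuous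
    exact (MemLp.top_mul (MemLp.top_mul ha hg) (memLp_top_fderiv hv _)).integrable le_top
  have hparts : ∀ i j, (∫ x in t.carrier, D i j x * v x) + ∫ x in t.carrier, Q i j x =
      ∫ x in {x | inner ℝ (x - z) n = 0}, α i j x * gradient p x j * n i * v x ∂μHE[m] := by
    intro i j
    rw [← integral_add (hD i j) (hQ i j)]
    have h1 := integral_byParts_element hn ht (h.lip i j)
      ((h.poly.gradient_apply j).contDiff (n := 1)) hv hc h0 (unitVec i)
    refine Eq.trans h1 ?_
    rw [← integral_const_mul]
    have h2 : inner ℝ (unitVec i) n = n i := by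
      rw [EuclideanSpace.inner_single_left]; simp
    rw [h2]
    congr 1; ext x; ring
  -- On the hyperplane, read in an isometric parametrization, the integrand is continuous with
  -- compact support.
  have hsurf : ∀ i j, Integrable (fun x => α i j x * gradient p x j * n i * v x)
      ((μHE[m] : Measure (E (m + 1))).restrict {x | inner ℝ (x - z) n = 0}) := by
    intro i j
    obtain ⟨b, rfl⟩ := exists_orthonormalBasis_zero hn
    rw [← range_planeMap, ← (isometry_planeMap b z).map_euclideanHausdorffMeasure,
      EuclideanSpace.euclideanHausdorffMeasure_eq_volume,
      (isometry_planeMap b z).isClosedEmbedding.measurableEmbedding.integrable_map_iff]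
    refine Continuous.integrable_of_hasCompactSupport ?_ ?_
    · exact ((((h.lip i j).continuous.mul (h.poly.gradient_apply j).continuous).mul
        continuous_const).mul hv.continuous).comp (isometry_planeMap b z).continuous
    · exact (HasCompactSupport.mul_left hc).comp_isClosedEmbedding
        (isometry_planeMap b z).isClosedEmbedding
  have hsum : (∫ x in t.carrier, fluxDiv p α x * v x) + ∫ x in t.carrier, ∑ i, ∑ j, Q i j x =
      ∫ x in {x | inner ℝ (x - z) n = 0}, normalFlux p α n x * v x ∂μHE[m] := by
    have e1 : ∀ x, fluxDiv p α x * v x = ∑ i, ∑ j, D i j x * v x := fun x => by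
      simp only [fluxDiv, Finset.sum_mul, D]
    have e2 : ∀ x, normalFlux p α n x * v x =
        ∑ i, ∑ j, α i j x * gradient p x j * n i * v x := fun x => by
      simp only [normalFlux, Finset.sum_mul]
    simp only [e1, e2]
    rw [integral_finsetSum _ fun i _ => integrable_finsetSum _ fun j _ => hD i j,
      integral_finsetSum _ fun i _ => integrable_finsetSum _ fun j _ => hQ i j,
      integral_finsetSum _ fun i _ => integrable_finsetSum _ fun j _ => hsurf i j,
      ← Finset.sum_add_distrib]
    refine Finset.sum_congr rfl fun i _ => ?_
    rw [integral_finsetSum _ fun j _ => hD i j, integral_finsetSum _ fun j _ => hQ i j,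
      integral_finsetSum _ fun j _ => hsurf i j, ← Finset.sum_add_distrib]
    exact Finset.sum_congr rfl fun j _ => hparts i j
  have hgrad : ∫ x in t.carrier,
      inner ℝ (Matrix.toEuclideanLin (A x) (weakGrad Ω u x)) (weakGrad Ω v x) =
      ∫ x in t.carrier, ∑ i, ∑ j, Q i j x := by
    refine integral_congr_ae ?_
    have hv' := weakGrad_ae_eq_gradient hvm isOpen_interior htΩ hv.lipschitzOnWith
      (fun _ _ => rfl)
    have hpL : ∃ K', LipschitzOnWith K' p (interior t.carrier) := by
      obtain ⟨K', hK'⟩ := (((h.poly.contDiff (n := 1)).locallyLipschitz).locallyLipschitzOn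
        (s := t.carrier)).exists_lipschitzOnWith_of_compact t.isCompact_carrier
      exact ⟨K', hK'.mono interior_subset⟩
    obtain ⟨K', hK'⟩ := hpL
    have hu' := weakGrad_ae_eq_gradient hu isOpen_interior htΩ hK'
      (fun x hx => h.eq_poly x (interior_subset hx))
    rw [Measure.restrict_congr_set t.interior_ae_eq] at hu' hv'
    filter_upwards [hu', hv', ae_mem_interior t] with x hx1 hx2 hx3
    rw [hx1, hx2, inner_toEuclideanLin]
    refine Finset.sum_congr rfl fun i _ => Finset.sum_congr rfl fun j _ => ?_
    rw [h.eq_coeff x hx3, gradient_apply v]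
  have hres : ∫ x in t.carrier, residual A B lam u x * v x =
      -(∫ x in t.carrier, fluxDiv p α x * v x) - lam * ∫ x in t.carrier, B x * u x * v x := by
    have i1 : Integrable (fun x => fluxDiv p α x * v x) (volume.restrict t.carrier) :=
      (MemLp.top_mul h.memLp_fluxDiv hvL).integrable le_top
    have i2 : Integrable (fun x => B x * u x * v x) (volume.restrict t.carrier) :=
      (MemLp.top_mul (h.memLp_weight hΩ hB htΩ) hvL).integrable le_top
    have i3 : Integrable (fun x => -(fluxDiv p α x * v x)) (volume.restrict t.carrier) := i1.neg
    rw [← integral_neg, ← integral_const_mul, ← integral_sub i3 (i2.const_mul lam)]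
    refine integral_congr_ae ?_
    filter_upwards [h.residual_ae B lam] with x hx
    rw [hx]; ring
  rw [hres, hgrad, ← hsum]; ring

/-! ### The projection onto polynomials -/

theorem exists_projection {d : ℕ} (k : ℕ) {ν : Measure (E d)} {f : E d → ℝ} (hf : MemLp f 2 ν)
    (hν : ∀ p : MvPolynomial (Fin d) ℝ, MemLp (polyEval p) 2 ν) :
    ∃ p : MvPolynomial (Fin d) ℝ, p.totalDegree ≤ k ∧ ∀ q : MvPolynomial (Fin d) ℝ,
      q.totalDegree ≤ k → ∫ x, (f x - polyEval p x) * polyEval q x ∂ν = 0 := by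
  let V := MvPolynomial.restrictTotalDegree (Fin d) ℝ k
  let T : V →ₗ[ℝ] Lp ℝ 2 ν :=
    { toFun := fun p => (hν p).toLp
      map_add' := fun p q => by
        rw [← MemLp.toLp_add]
        refine MemLp.toLp_congr _ _ (Filter.Eventually.of_forall fun x => ?_)
        simp [polyEval]
      map_smul' := fun c p => by
        rw [RingHom.id_apply, ← MemLp.toLp_const_smul]
        refine MemLp.toLp_congr _ _ (Filter.Eventually.of_forall fun x => ?_)
        simp [polyEval, MvPolynomial.smul_eval] }
  obtain ⟨p, hp⟩ : (LinearMap.range T).starProjection hf.toLp ∈ LinearMap.range T :=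
    Submodule.starProjection_apply_mem _ _
  refine ⟨p, (MvPolynomial.mem_restrictTotalDegree _ _ _).1 p.2, fun q hq => ?_⟩
  let q' : V := ⟨q, (MvPolynomial.mem_restrictTotalDegree _ _ _).2 hq⟩
  have h1 : inner ℝ (T q') (hf.toLp - T p) = 0 := by
    rw [hp]
    exact Submodule.inner_right_of_mem_orthogonal (LinearMap.mem_range_self T q')
      (Submodule.sub_starProjection_mem_orthogonal _)
  rw [L2.inner_def] at h1
  rw [← h1]
  refine integral_congr_ae ?_
  have e1 : (hf.toLp - T p : Lp ℝ 2 ν) =ᵐ[ν] fun x => f x - polyEval p x := by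
    refine (Lp.coeFn_sub _ _).trans ?_
    filter_upwards [hf.coeFn_toLp, (hν p).coeFn_toLp] with x h1 h2
    rw [Pi.sub_apply, h1]
    congr 1
  filter_upwards [e1, (hν q').coeFn_toLp] with x h1 h2
  rw [h1, show (T q') x = polyEval q x from h2]
  simp

/-- Pythagoras: `f - polyProj k ν f` is orthogonal to the difference of any two polynomials of
degree at most `k`, so the projection error is at most the distance from `f` to `g`. Oscillations
are thereby bounded by any convenient comparison polynomial. -/
theorem l2Norm_sub_polyProj_le {d : ℕ} (k : ℕ) {ν : Measure (E d)} {f : E d → ℝ}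
    (hf : MemLp f 2 ν) (hν : ∀ p : MvPolynomial (Fin d) ℝ, MemLp (polyEval p) 2 ν) {g : E d → ℝ}
    (hg : IsPoly k g) :
    l2Norm ν (fun x => f x - polyProj k ν f x) ≤ l2Norm ν fun x => f x - g x := by
  obtain ⟨q, hq, hqe⟩ := hg
  obtain rfl : g = polyEval q := funext hqe
  obtain ⟨hp, hort⟩ := Classical.epsilon_spec (exists_projection k hf hν)
  change ∀ q : MvPolynomial (Fin d) ℝ, q.totalDegree ≤ k →
    ∫ x, (f x - polyProj k ν f x) * polyEval q x ∂ν = 0 at hort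
  set p := Classical.epsilon fun p : MvPolynomial (Fin d) ℝ => p.totalDegree ≤ k ∧
    ∀ q : MvPolynomial (Fin d) ℝ, q.totalDegree ≤ k →
      ∫ x, (f x - polyEval p x) * polyEval q x ∂ν = 0
  have hpp : polyProj k ν f = polyEval p := rfl
  rw [hpp] at hort ⊢
  have m1 : MemLp (fun x => f x - polyEval p x) 2 ν := hf.sub (hν p)
  have m2 : MemLp (fun x => f x - polyEval q x) 2 ν := hf.sub (hν q)
  have m3 : MemLp (polyEval (p - q)) 2 ν := hν _
  have h0 := hort (p - q) ((MvPolynomial.totalDegree_sub _ _).trans (max_le hp hq))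
  refine le_of_sq_le_sq ?_ (l2Norm_nonneg _ _)
  rw [l2Norm_sq m1, l2Norm_sq m2]
  have i1 : Integrable (fun x => (f x - polyEval p x) * polyEval (p - q) x) ν :=
    integrable_smul_of_memLp_two m1 m3
  have e : ∀ x, ‖f x - polyEval q x‖ ^ 2 = ‖f x - polyEval p x‖ ^ 2 +
      (2 * ((f x - polyEval p x) * polyEval (p - q) x) + ‖polyEval (p - q) x‖ ^ 2) := fun x => by
    have : polyEval (p - q) x = polyEval p x - polyEval q x := by simp [polyEval]
    simp only [this, Real.norm_eq_abs, sq_abs]; ring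
  simp only [e]
  have i4 : Integrable (fun x => 2 * ((f x - polyEval p x) * polyEval (p - q) x) +
      ‖polyEval (p - q) x‖ ^ 2) ν := (i1.const_mul 2).add m3.norm.integrable_sq
  rw [integral_add m1.norm.integrable_sq i4,
    integral_add (i1.const_mul 2) m3.norm.integrable_sq, integral_const_mul, h0]
  have : 0 ≤ ∫ x, ‖polyEval (p - q) x‖ ^ 2 ∂ν := integral_nonneg fun x => by positivity
  linarith

/-! ### Charts of sides -/

/-- An isometric parametrization of the side opposite to vertex `i` of `t` by a simplex. -/
structure IsSideChart {m : ℕ} (t t' : Elt (m + 1)) (ht : AffineIndependent ℝ t.vertex)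
    (i : Fin (m + 2)) (ψ : E m →ᵃ[ℝ] E (m + 1)) (b : AffineBasis (Fin (m + 1)) ℝ (E m)) : Prop where
  isometry : Isometry ψ
  measure_eq : sideMeasure t t' = (volume.restrict (convexHull ℝ (range b))).map ψ
  image_eq : ψ '' convexHull ℝ (range b) = side t t'
  coord_zero : ∀ y, (t.basis ht).coord i (ψ y) = 0
  coord_succAbove : ∀ k y, (t.basis ht).coord (i.succAbove k) (ψ y) = b.coord k y

/-- The hyperplane of the side is parametrized isometrically by `E m`. The preimages of the vertices
of the side span a simplex there, whose barycentric coordinates are those of `t` except the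
vanishing one. -/
theorem exists_isSideChart {m : ℕ} {t t' : Elt (m + 1)} (ht : AffineIndependent ℝ t.vertex)
    {i i' : Fin (m + 2)} (hsh : IsSharedSide t t' i i')
    (hconf : t.carrier ∩ t'.carrier = convexHull ℝ (range t.vertex ∩ range t'.vertex)) :
    ∃ ψ b, IsSideChart t t' ht i ψ b := by
  obtain ⟨n, c, hn, hc, hnc⟩ := exists_normal t ht (Nat.succ_pos m) i
  obtain ⟨k₀, hk₀⟩ := exists_ne_index (Nat.succ_pos m) i
  set z := t.vertex k₀
  have hz : (t.basis ht).coord i z = 0 := (t.basis ht).coord_apply_ne hk₀.symm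
  obtain ⟨o, rfl⟩ := exists_orthonormalBasis_zero hn
  set ψ := planeMap o z
  have hrange : range ψ = {x | (t.basis ht).coord i x = 0} := by
    rw [range_planeMap]
    ext x
    simp only [mem_ofPred_eq]
    rw [hnc, hz]
    simp [hc.ne']
  have hvr : ∀ k, ∃ y, ψ y = t.vertex (i.succAbove k) := fun k => by
    have : t.vertex (i.succAbove k) ∈ range ψ := by
      rw [hrange]; exact (t.basis ht).coord_apply_ne (Fin.succAbove_ne i k).symm
    exact this
  choose y hy using hvr
  have hyi : AffineIndependent ℝ y := by
    refine AffineIndependent.of_comp ψ ?_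
    have : (ψ ∘ y) = t.vertex ∘ i.succAboveEmb := funext fun k => hy k
    rw [this]
    exact ht.comp_embedding i.succAboveEmb
  let b : AffineBasis (Fin (m + 1)) ℝ (E m) :=
    ⟨y, hyi, hyi.affineSpan_eq_top_iff_card_eq_finrank_add_one.2 (by simp)⟩
  have hb : ∀ k, b k = y k := fun _ => rfl
  have himg : ψ '' convexHull ℝ (range b) = side t t' := by
    rw [AffineMap.image_convexHull, side, hconf, hsh.left, ← range_comp]
    congr 1
    ext x
    constructor
    · rintro ⟨k, rfl⟩
      exact ⟨i.succAbove k, Fin.succAbove_ne i k, (hy k).symm⟩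
    · rintro ⟨k, hk, rfl⟩
      obtain ⟨l, rfl⟩ := Fin.exists_succAbove_eq hk
      exact ⟨l, hy l⟩
  have hiso : Isometry ψ := isometry_planeMap o z
  refine ⟨ψ, b, hiso, ?_, himg, fun y => ?_, fun k x => ?_⟩
  · have hS : MeasurableSet (side t t') :=
      t.measurableSet_carrier.inter t'.measurableSet_carrier
    have h1 := map_planeMap_restrict o z hS (himg ▸ image_subset_range _ _)
    rw [sideMeasure]
    refine h1.symm.trans ?_
    rw [← himg, hiso.injective.preimage_image]
  · have : ψ y ∈ range ψ := mem_range_self y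
    rwa [hrange] at this
  · have h1 := affineMap_apply_eq_sum b (((t.basis ht).coord (i.succAbove k)).comp ψ) x
    simp only [AffineMap.comp_apply] at h1
    rw [h1, Finset.sum_eq_single k]
    · rw [hb, hy, ← t.basis_apply ht, AffineBasis.coord_apply_eq, mul_one]
    · intro l _ hl
      rw [hb, hy, ← t.basis_apply ht, AffineBasis.coord_apply_ne, mul_zero]
      exact fun e => hl (Fin.succAbove_right_injective e).symm
    · simp

section Chart

variable {m : ℕ} {t t' : Elt (m + 1)} {ht : AffineIndependent ℝ t.vertex} {i : Fin (m + 2)}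
  {ψ : E m →ᵃ[ℝ] E (m + 1)} {b : AffineBasis (Fin (m + 1)) ℝ (E m)}

theorem isCompact_hull (b : AffineBasis (Fin (m + 1)) ℝ (E m)) :
    IsCompact (convexHull ℝ (range b)) := (finite_range b).isCompact_convexHull ℝ

theorem IsSideChart.measureReal_univ (h : IsSideChart t t' ht i ψ b) :
    (sideMeasure t t').real univ = volume.real (convexHull ℝ (range b)) := by
  rw [h.measure_eq, Measure.real, Measure.map_apply h.isometry.continuous.measurable .univ]
  simp [Measure.real]

theorem IsSideChart.isFiniteMeasure (h : IsSideChart t t' ht i ψ b) :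
    IsFiniteMeasure (sideMeasure t t') := by
  have : IsFiniteMeasure (volume.restrict (convexHull ℝ (range b))) :=
    ⟨by simpa using (isCompact_hull b).measure_lt_top⟩
  rw [h.measure_eq]
  infer_instance

theorem IsSideChart.integral (h : IsSideChart t t' ht i ψ b) (f : E (m + 1) → ℝ) :
    ∫ x, f x ∂sideMeasure t t' = ∫ y in convexHull ℝ (range b), f (ψ y) := by
  rw [h.measure_eq, h.isometry.isClosedEmbedding.measurableEmbedding.integral_map]

theorem IsSideChart.coords (h : IsSideChart t t' ht i ψ b) (y : E m) :
    (t.basis ht).coords (ψ y) = i.insertNth (α := fun _ => ℝ) 0 (b.coords y) := by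
  rw [eq_comm, Fin.insertNth_eq_iff]
  refine ⟨by rw [AffineBasis.coords_apply, h.coord_zero], funext fun k => ?_⟩
  simp [Fin.removeNth, h.coord_succAbove]

theorem measurableSet_side (t t' : Elt (m + 1)) : MeasurableSet (side t t') :=
  t.measurableSet_carrier.inter t'.measurableSet_carrier

theorem ae_mem_side (t t' : Elt (m + 1)) : ∀ᵐ x ∂sideMeasure t t', x ∈ side t t' :=
  ae_restrict_mem (measurableSet_side t t')

theorem isCompact_side (t t' : Elt (m + 1)) : IsCompact (side t t') :=
  t.isCompact_carrier.inter t'.isCompact_carrier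

theorem memLp_side [IsFiniteMeasure (sideMeasure t t')] {f : E (m + 1) → ℝ} (hf : Continuous f) :
    MemLp f 2 (sideMeasure t t') := by
  obtain ⟨C, hC⟩ := (isCompact_side t t').exists_bound_of_continuousOn hf.continuousOn
  exact (memLp_top_of_bound hf.aestronglyMeasurable C
    ((ae_mem_side t t').mono hC)).mono_exponent le_top

end Chart

/-- The measure of a side is comparable to `ρ ^ m`. -/
theorem exists_side_bounds (m : ℕ) (Λ : ℝ) :
    ∃ C : ℝ, 1 ≤ C ∧ ∀ (t t' : Elt (m + 1)) (x₀ : E (m + 1)) (ρ : ℝ) (h : IsShaped Λ t x₀ ρ)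
      (i i' : Fin (m + 2)), IsSharedSide t t' i i' →
      t.carrier ∩ t'.carrier = convexHull ℝ (range t.vertex ∩ range t'.vertex) →
      ∀ ψ b, IsSideChart t t' h.indep i ψ b →
      ρ ^ m ≤ C * volume.real (convexHull ℝ (range b)) ∧
        volume.real (convexHull ℝ (range b)) ≤ C * ρ ^ m := by
  set β := volume.real (Metric.ball (0 : E m) 1)
  have hβ : 0 < β := ENNReal.toReal_pos (Metric.measure_ball_pos _ _ one_pos).ne'
    measure_ball_lt_top.ne
  refine ⟨1 + β⁻¹ + β * (2 * |Λ|) ^ m, ?_, fun t t' x₀ ρ h i i' hsh hconf ψ b hch => ?_⟩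
  · have : 0 ≤ β⁻¹ + β * (2 * |Λ|) ^ m := by positivity
    linarith
  have hΛ : |Λ| = Λ := abs_of_nonneg (zero_le_one.trans (h.one_le (Nat.succ_pos m)))
  have hΛ0 : 0 ≤ Λ := by rw [← hΛ]; exact abs_nonneg _
  rw [hΛ]
  have hρ := h.pos
  have hvol : ∀ (x : E m) (r : ℝ), 0 ≤ r → volume.real (Metric.closedBall x r) = r ^ m * β :=
    fun x r hr => by rw [Measure.addHaar_real_closedBall _ _ hr, finrank_euclideanSpace_fin]
  have hψ : ∀ y y', ψ (y + y') = ψ y + (ψ y' - ψ 0) := fun y y' => by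
    have h1 := ψ.map_vadd y y'
    have h2 := ψ.map_vadd 0 y'
    simp only [vadd_eq_add, add_zero] at h1 h2
    rw [add_comm y y', h1, h2]; abel
  have hmem : ∀ y, y ∈ convexHull ℝ (range b) ↔ ψ y ∈ side t t' := fun y => by
    rw [← hch.image_eq, hch.isometry.injective.mem_set_image]
  have hV0 : 0 ≤ volume.real (convexHull ℝ (range b)) := measureReal_nonneg
  constructor
  · obtain ⟨k, hk⟩ := exists_ne_index (Nat.succ_pos m) i
    have hP : ∀ x ∈ t.carrier, sideProj t h.indep i k x ∈ side t t' := fun x hx =>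
      hconf.superset (sideProj_mem h.indep hk hsh hx)
    obtain ⟨y₁, -, hy₁⟩ := hch.image_eq.superset (hP x₀ h.center_mem)
    -- Moving the centre `x₀` parallel to the side by at most `ρ` stays in the inscribed ball and
    -- does not change the coordinate `i`. The projection along an edge therefore acts as a
    -- translation, and the side contains an `m`-dimensional ball of radius `ρ`.
    have hsub : Metric.closedBall y₁ ρ ⊆ convexHull ℝ (range b) := by
      intro y hy
      rw [hmem]
      have hd : ‖ψ (y - y₁) - ψ 0‖ ≤ ρ := by
        rw [← dist_eq_norm, hch.isometry.dist_eq, dist_zero_right, ← dist_eq_norm]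
        exact hy
      have hx : x₀ + (ψ (y - y₁) - ψ 0) ∈ t.carrier := h.ball_subset <| by
        rw [mem_closedBall_iff_norm, add_sub_cancel_left]; exact hd
      have hcoord : (t.basis h.indep).coord i (x₀ + (ψ (y - y₁) - ψ 0)) =
          (t.basis h.indep).coord i x₀ := by
        have := affineMap_add_smul_sub ((t.basis h.indep).coord i) x₀ (ψ (y - y₁)) (ψ 0) 1
        rw [one_smul, hch.coord_zero, hch.coord_zero] at this
        rw [this]; ring
      have h2 : ψ y = sideProj t h.indep i k (x₀ + (ψ (y - y₁) - ψ 0)) := by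
        have h3 := hψ y₁ (y - y₁)
        rw [add_sub_cancel] at h3
        rw [h3, hy₁, sideProj_apply, sideProj_apply, hcoord]
        abel
      rw [h2]
      exact hP _ hx
    have h1 : ρ ^ m * β ≤ volume.real (convexHull ℝ (range b)) := by
      rw [← hvol y₁ ρ hρ.le]
      exact measureReal_mono hsub (isCompact_hull b).measure_lt_top.ne
    calc ρ ^ m = β⁻¹ * (ρ ^ m * β) := by field_simp
      _ ≤ β⁻¹ * volume.real (convexHull ℝ (range b)) := by gcongr
      _ ≤ _ := mul_le_mul_of_nonneg_right
        (by have : 0 ≤ 1 + β * (2 * Λ) ^ m := by positivity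
            linarith) hV0
  · have hsub : convexHull ℝ (range b) ⊆ Metric.closedBall (b 0) (2 * Λ * ρ) := by
      intro y hy
      have h0 : b 0 ∈ convexHull ℝ (range b) := subset_convexHull ℝ _ (mem_range_self 0)
      rw [Metric.mem_closedBall, ← hch.isometry.dist_eq, dist_eq_norm]
      exact h.norm_sub_le ((hmem y).1 hy).1 ((hmem _).1 h0).1
    have h1 : volume.real (convexHull ℝ (range b)) ≤ (2 * Λ * ρ) ^ m * β := by
      rw [← hvol (b 0) _ (by positivity)]
      exact measureReal_mono hsub (isCompact_closedBall _ _).measure_lt_top.ne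
    calc _ ≤ (β * (2 * Λ) ^ m) * ρ ^ m := by rw [mul_pow] at h1; linarith
      _ ≤ _ := mul_le_mul_of_nonneg_right
        (by have : 0 ≤ 1 + β⁻¹ := by positivity
            linarith) (by positivity)

/-! ### Weighted lower bounds -/

theorem realForm_div {n : ℕ} (g c : Fin n → ℤ) (s : ℝ) :
    realForm g (fun k => (c k : ℝ) / s) = (intForm g c : ℝ) / s := by
  have : (intForm g c : ℝ) = ∑ k, (g k : ℝ) * c k := by
    rw [intForm, ← Fin.sum_univ_def]; push_cast; rfl
  rw [this, realForm, Finset.sum_div]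
  exact Finset.sum_congr rfl fun k _ => by ring

theorem IsBubbleForms.exists_pos {d n : ℕ} {τ : ZMod 3} {F : Finset (Fin (d + 1))}
    {gs : List (Fin (d + 1) → ℤ)} (hgs : IsBubbleForms n τ F gs) (hF : F.Nonempty) :
    ∃ c : Fin (d + 1) → ℝ, (∀ k ∈ F, 0 < c k) ∧ (∀ k ∉ F, c k = 0) ∧ ∑ k, c k = 1 ∧
      0 < bubble gs c := by
  obtain ⟨c, hc0, hcF, hg⟩ := hgs.pos
  set s : ℝ := ∑ k, (c k : ℝ)
  obtain ⟨k₀, hk₀⟩ := hF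
  have hs : 0 < s := by
    refine Finset.sum_pos' (fun k _ => by exact_mod_cast hc0 k) ⟨k₀, Finset.mem_univ _, ?_⟩
    exact_mod_cast (hcF k₀).1 hk₀
  refine ⟨fun k => (c k : ℝ) / s, fun k hk => ?_, fun k hk => ?_, ?_, ?_⟩
  · have : (0 : ℝ) < c k := by exact_mod_cast (hcF k).1 hk
    positivity
  · have : c k = 0 := le_antisymm (not_lt.1 fun h => hk ((hcF k).2 h)) (hc0 k)
    simp [this]
  · rw [← Finset.sum_div, div_self hs.ne']
  · refine bubble_pos fun g hgm => ?_
    rw [realForm_div]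
    have : (0 : ℝ) < intForm g c := by exact_mod_cast hg g hgm
    positivity

/-- The bubble depends on the element only through its type; adding the constants of the three types
removes this dependence. -/
theorem exists_element_lower {d : ℕ} (hd : d = 2 ∨ d = 3) (k : ℕ) :
    ∃ C : ℝ, 0 < C ∧ ∀ (t : Elt d) (ht : AffineIndependent ℝ t.vertex) (f : E d → ℝ), IsPoly k f →
      ∀ x ∈ t.carrier, volume.real t.carrier * f x ^ 2 ≤
        C * ∫ y in t.carrier, f y ^ 2 * bubble (elementForms d t.type) ((t.basis ht).coords y) := by
  choose C hC h using fun τ : ZMod 3 => exists_sq_le_simplex_average (m := d) k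
    (continuous_bubble (elementForms d τ)) (bubble_nonneg _) <| by
      obtain ⟨c, h1, -, h2, h3⟩ := (isBubbleForms_element hd τ).exists_pos
        ⟨0, Finset.mem_univ _⟩
      exact ⟨c, fun i => h1 i (Finset.mem_univ i), h2, h3⟩
  refine ⟨∑ τ, C τ, Finset.sum_pos (fun τ _ => hC τ) ⟨0, Finset.mem_univ _⟩,
    fun t ht f hf x hx => (h t.type (t.basis ht) f hf x hx).trans ?_⟩
  refine mul_le_mul_of_nonneg_right (Finset.single_le_sum (fun τ _ => (hC τ).le)
    (Finset.mem_univ _)) (integral_nonneg fun y => mul_nonneg (sq_nonneg _) (bubble_nonneg _ _))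

/-- In the chart the side bubble is a fixed function of the `m + 1` coordinates, with a zero
inserted at position `i`, so the estimate for simplices of dimension `m` applies. There are finitely
many pairs of a type and an index. -/
theorem exists_side_lower {m : ℕ} (hd : m + 1 = 2 ∨ m + 1 = 3) (k : ℕ) :
    ∃ C : ℝ, 0 < C ∧ ∀ (t t' : Elt (m + 1)) (ht : AffineIndependent ℝ t.vertex) (i : Fin (m + 2)) ψ b,
      IsSideChart t t' ht i ψ b → ∀ f : E (m + 1) → ℝ, IsPoly k f → ∀ x ∈ side t t',
      volume.real (convexHull ℝ (range b)) * f x ^ 2 ≤ C * ∫ y, f y ^ 2 *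
        bubble (sideForms (m + 1) t.type i) ((t.basis ht).coords y) ∂sideMeasure t t' := by
  choose C hC h using fun z : ZMod 3 × Fin (m + 2) => exists_sq_le_simplex_average (m := m) k
    (w := fun c => bubble (sideForms (m + 1) z.1 z.2) (z.2.insertNth (α := fun _ => ℝ) 0 c))
    ((continuous_bubble _).comp (by
      refine continuous_pi fun j => ?_
      rcases Fin.eq_self_or_eq_succAbove z.2 j with rfl | ⟨l, rfl⟩
      · simpa using continuous_const
      · simpa using continuous_apply l)) (fun _ => bubble_nonneg _ _) <| by
      obtain ⟨τ, i⟩ := z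
      obtain ⟨c, h1, h0, h2, h3⟩ := (isBubbleForms_side hd τ i).exists_pos <| by
        obtain ⟨j, hj⟩ := exists_ne_index (Nat.succ_pos m) i
        exact ⟨j, Finset.mem_erase.2 ⟨hj, Finset.mem_univ j⟩⟩
      have hci : c i = 0 := h0 i (by simp)
      refine ⟨fun k => c (i.succAbove k), fun k => h1 _ (by simp), ?_, ?_⟩
      · rw [Fin.sum_univ_succAbove _ i, hci, zero_add] at h2; exact h2
      · convert h3
        rw [Fin.insertNth_eq_iff]
        exact ⟨hci.symm, rfl⟩
  refine ⟨∑ z, C z, Finset.sum_pos (fun τ _ => hC τ) ⟨(0, 0), Finset.mem_univ _⟩,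
    fun t t' ht i ψ b hch f hf x hx => ?_⟩
  rw [← hch.image_eq] at hx
  obtain ⟨y, hy, rfl⟩ := hx
  have h1 := h (t.type, i) b _ (hf.comp_affine ψ) y hy
  rw [hch.integral]
  simp only [hch.coords]
  refine h1.trans ?_
  refine mul_le_mul_of_nonneg_right (Finset.single_le_sum (fun τ _ => (hC τ).le)
    (Finset.mem_univ _)) (integral_nonneg fun y => mul_nonneg (sq_nonneg _) (bubble_nonneg _ _))

/-! ### Sums over elements -/

theorem sum_l2Norm_sq {d : ℕ} {F : Type} [NormedAddCommGroup F] {Ω : Set (E d)} {𝒯 : Mesh d}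
    (h𝒯 : IsTriangulation Ω 𝒯) {S : Finset (Elt d)} (hS : S ⊆ 𝒯) {f : E d → F}
    (hf : MemLp f 2 (volume.restrict (⋃ t ∈ S, t.carrier))) :
    ∑ t ∈ S, l2Norm (volume.restrict t.carrier) f ^ 2 =
      l2Norm (volume.restrict (⋃ t ∈ S, t.carrier)) f ^ 2 := by
  have hft : ∀ t ∈ S, MemLp f 2 (volume.restrict t.carrier) := fun t ht =>
    hf.mono_measure (Measure.restrict_mono (subset_biUnion_of_mem (u := fun t => t.carrier) ht) le_rfl)
  have e : ∀ {ν : Measure (E d)}, MemLp f 2 ν →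
      l2Norm ν f ^ 2 = (∫⁻ x, ENNReal.ofReal (‖f x‖ ^ 2) ∂ν).toReal := fun h => by
    rw [l2Norm_sq h, integral_eq_lintegral_of_nonneg_ae
      (Filter.Eventually.of_forall fun x => by positivity) h.norm.integrable_sq.1]
  have hfin : ∀ t ∈ S, ∫⁻ x in t.carrier, ENNReal.ofReal (‖f x‖ ^ 2) ≠ ⊤ := fun t ht =>
    ((hft t ht).norm.integrable_sq.lintegral_lt_top).ne
  rw [e hf, lintegral_biUnion_finset₀ (fun t ht t' ht' hne => h𝒯.aedisjoint (hS ht) (hS ht') hne)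
    (fun t _ => t.measurableSet_carrier.nullMeasurableSet), ENNReal.toReal_sum hfin]
  exact Finset.sum_congr rfl fun t ht => e (hft t ht)

section Patch

variable {d : ℕ} {Ω : Set (E d)} {𝒯 : Mesh d} {T t : Elt d}

theorem nbrs_subset : nbrs 𝒯 T ⊆ 𝒯 := fun _ => mem_of_mem_nbrs

theorem self_mem_nbrs (hT : T ∈ 𝒯) : T ∈ nbrs 𝒯 T := by
  classical
  exact Finset.mem_filter.2 ⟨hT, T.vertex 0, T.vertex_mem_carrier 0, T.vertex_mem_carrier 0⟩

/-- The interiors of the elements lie in `Ω`, and the boundary of a convex set is null, so the patch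
exceeds `Ω` by a null set only. -/
theorem restrict_patch_le (h𝒯 : IsTriangulation Ω 𝒯) :
    (volume.restrict (patch 𝒯 T) : Measure (E d)) ≤ volume.restrict Ω := by
  refine Measure.restrict_mono' (ae_le_set.2 ?_) le_rfl
  have hsub : patch 𝒯 T \ Ω ⊆ ⋃ t ∈ nbrs 𝒯 T, t.carrier \ Ω := by
    rintro x ⟨hx, hxΩ⟩
    obtain ⟨t, ht, hxt⟩ := mem_iUnion₂.1 hx
    exact mem_iUnion₂.2 ⟨t, ht, hxt, hxΩ⟩
  refine measure_mono_null hsub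
    ((measure_biUnion_null_iff (nbrs 𝒯 T).countable_toSet).2 fun t ht => ?_)
  refine measure_mono_null (sdiff_subset_sdiff_right (h𝒯.subset_closure (nbrs_subset ht))) ?_
  exact ae_le_set.1 t.interior_ae_eq.symm.le

theorem restrict_le_patch (ht : t ∈ nbrs 𝒯 T) :
    (volume.restrict t.carrier : Measure (E d)) ≤ volume.restrict (patch 𝒯 T) :=
  Measure.restrict_mono (subset_biUnion_of_mem (u := fun t : Elt d => t.carrier) ht) le_rfl

theorem h1Norm_nonneg (Ω D : Set (E d)) (u : E d → ℝ) : 0 ≤ h1Norm Ω D u := Real.sqrt_nonneg _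

theorem l2Norm_le_h1Norm (Ω D : Set (E d)) (u : E d → ℝ) :
    l2Norm (volume.restrict D) u ≤ h1Norm Ω D u :=
  Real.le_sqrt_of_sq_le (le_add_of_nonneg_right (sq_nonneg _))

theorem l2Norm_weakGrad_le_h1Norm (Ω D : Set (E d)) (u : E d → ℝ) :
    l2Norm (volume.restrict D) (weakGrad Ω u) ≤ h1Norm Ω D u :=
  Real.le_sqrt_of_sq_le (le_add_of_nonneg_left (sq_nonneg _))

theorem h1Norm_sq (Ω D : Set (E d)) (u : E d → ℝ) : h1Norm Ω D u ^ 2 =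
    l2Norm (volume.restrict D) u ^ 2 + l2Norm (volume.restrict D) (weakGrad Ω u) ^ 2 :=
  Real.sq_sqrt (by positivity)

theorem sum_h1Norm_sq (h𝒯 : IsTriangulation Ω 𝒯) {u : E d → ℝ} (hu : MemH10 Ω u) :
    ∑ t ∈ nbrs 𝒯 T, h1Norm Ω t.carrier u ^ 2 = h1Norm Ω (patch 𝒯 T) u ^ 2 := by
  have pu := isSobolevPair_weakGrad hu
  simp only [h1Norm_sq, Finset.sum_add_distrib]
  rw [sum_l2Norm_sq h𝒯 nbrs_subset (pu.memLp.mono_measure (restrict_patch_le h𝒯)),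
    sum_l2Norm_sq h𝒯 nbrs_subset (pu.memLp_grad.mono_measure (restrict_patch_le h𝒯))]
  rfl

theorem h1Norm_mono {D D' : Set (E d)} {u : E d → ℝ} (hu : MemH10 Ω u)
    (h : volume.restrict D ≤ volume.restrict D')
    (h' : (volume.restrict D' : Measure (E d)) ≤ volume.restrict Ω) :
    h1Norm Ω D u ≤ h1Norm Ω D' u := by
  have pu := isSobolevPair_weakGrad hu
  refine Real.sqrt_le_sqrt (add_le_add ?_ ?_)
  · exact pow_le_pow_left₀ (l2Norm_nonneg _ _) (l2Norm_mono_measure (pu.memLp.mono_measure h') h) 2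
  · exact pow_le_pow_left₀ (l2Norm_nonneg _ _)
      (l2Norm_mono_measure (pu.memLp_grad.mono_measure h') h) 2

theorem h1Norm_le_patch (h𝒯 : IsTriangulation Ω 𝒯) {u : E d → ℝ} (hu : MemH10 Ω u)
    (ht : t ∈ nbrs 𝒯 T) : h1Norm Ω t.carrier u ≤ h1Norm Ω (patch 𝒯 T) u :=
  h1Norm_mono hu (restrict_le_patch ht) (restrict_patch_le h𝒯)

theorem mem_sideNbrs : t ∈ sideNbrs 𝒯 T ↔ t ∈ 𝒯 ∧ (range T.vertex ∩ range t.vertex).ncard = d := by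
  classical
  exact Finset.mem_filter

theorem sideNbrs_subset_nbrs (hd : 0 < d) : sideNbrs 𝒯 T ⊆ nbrs 𝒯 T := by
  classical
  intro t ht
  rw [mem_sideNbrs] at ht
  obtain ⟨z, ⟨k, hk⟩, l, hl⟩ : (range T.vertex ∩ range t.vertex).Nonempty := by
    rw [nonempty_iff_ne_empty]
    intro h
    rw [h, ncard_empty] at ht
    omega
  exact Finset.mem_filter.2 ⟨ht.1, z, hl ▸ t.vertex_mem_carrier l, hk ▸ T.vertex_mem_carrier k⟩

theorem ne_of_mem_sideNbrs (hT : AffineIndependent ℝ T.vertex) (ht : t ∈ sideNbrs 𝒯 T) : T ≠ t := by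
  rintro rfl
  have := (mem_sideNbrs.1 ht).2
  rw [inter_self, ← image_univ, ncard_image_of_injective _ hT.injective, ncard_univ] at this
  simp at this

/-- The centre of the common side is interior to the union of `T` and `t₁`. A different `t₂` through
this centre would have interior points in that union, against the disjointness of elements. -/
theorem IsTriangulation.eq_of_shared (hd : 0 < d) (h𝒯 : IsTriangulation Ω 𝒯) {t₁ t₂ : Elt d}
    (hT : T ∈ 𝒯) (h₁ : t₁ ∈ 𝒯) (h₂ : t₂ ∈ 𝒯) (hne₁ : T ≠ t₁) (hne₂ : T ≠ t₂)
    {i i₁ i₂ : Fin (d + 1)}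
    (hs₁ : IsSharedSide T t₁ i i₁) (hs₂ : IsSharedSide T t₂ i i₂) : t₁ = t₂ := by
  by_contra hne
  have iT := h𝒯.indep T hT
  obtain ⟨x, hx0, hxpos⟩ := exists_side_center hd iT i
  have hxS₁ := mem_hull_of_coord iT hs₁ hx0 fun k hk => (hxpos k hk).le
  have hxS₂ := mem_hull_of_coord iT hs₂ hx0 fun k hk => (hxpos k hk).le
  rw [← h𝒯.conforming T hT t₁ h₁] at hxS₁
  rw [← h𝒯.conforming T hT t₂ h₂] at hxS₂
  have hint := hs₁.mem_interior_union hd iT (h𝒯.indep t₁ h₁) (h𝒯.disjoint_interior hT h₁ hne₁)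
    hxS₁.1 hxpos
  have hx2 := hxS₂.2
  rw [← t₂.closure_interior (h𝒯.indep t₂ h₂)] at hx2
  obtain ⟨y, hy1, hy2⟩ := mem_closure_iff.1 hx2 _ isOpen_interior hint
  rcases interior_subset hy1 with h | h
  · exact disjoint_left.1 (h𝒯.disjoint_interior h₂ hT hne₂.symm) hy2 h
  · exact disjoint_left.1 (h𝒯.disjoint_interior h₂ h₁ (Ne.symm hne)) hy2 h

/-- An element has at most `d + 1` interior sides. -/
theorem IsTriangulation.card_sideNbrs_le (hd : 0 < d) (h𝒯 : IsTriangulation Ω 𝒯) (hT : T ∈ 𝒯) :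
    (sideNbrs 𝒯 T).card ≤ d + 1 := by
  classical
  have hex : ∀ t : sideNbrs 𝒯 T, ∃ i i', IsSharedSide T t.1 i i' := fun t =>
    exists_isSharedSide (h𝒯.indep T hT).injective
      (h𝒯.indep t.1 (mem_sideNbrs.1 t.2).1).injective (mem_sideNbrs.1 t.2).2
  choose i i' hi using hex
  have hinj : Function.Injective i := fun t₁ t₂ h => by
    have h2 := hi t₂
    rw [← h] at h2
    exact Subtype.ext (h𝒯.eq_of_shared hd hT (mem_sideNbrs.1 t₁.2).1 (mem_sideNbrs.1 t₂.2).1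
      (ne_of_mem_sideNbrs (h𝒯.indep T hT) t₁.2) (ne_of_mem_sideNbrs (h𝒯.indep T hT) t₂.2)
      (hi t₁) h2)
  simpa using Fintype.card_le_of_injective i hinj

end Patch

/-! ### Oscillation on an element -/

/-- The inverse estimate for the components of the gradient, which are polynomials themselves. Only
`∇p` appears on the right, not `p`. -/
theorem exists_gradient_bounds (d ℓ : ℕ) (Λ : ℝ) :
    ∃ C : ℝ, 0 < C ∧ ∀ (t : Elt d) (x₀ : E d) (ρ : ℝ), IsShaped Λ t x₀ ρ → ∀ p : E d → ℝ,
      IsPoly ℓ p → ∀ x ∈ t.carrier,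
      √(ρ ^ d) * ‖gradient p x‖ ≤ C * l2Norm (volume.restrict t.carrier) (gradient p) ∧
      ∀ i j, √(ρ ^ d) * (ρ * |secondDeriv p i j x|) ≤
        C * l2Norm (volume.restrict t.carrier) (gradient p) := by
  obtain ⟨C, hC, h⟩ := exists_inverse_estimate d ℓ Λ
  refine ⟨√((d + 1) * C), by positivity, fun t x₀ ρ ht p hp x hx => ?_⟩
  set N := l2Norm (volume.restrict t.carrier) (gradient p)
  have hρ := ht.pos
  have hN : 0 ≤ N := l2Norm_nonneg _ _
  have hmem : MemLp (gradient p) 2 (volume.restrict t.carrier) := by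
    obtain ⟨c, hc⟩ := t.isCompact_carrier.exists_bound_of_continuousOn
      hp.continuous_gradient.continuousOn
    exact (memLp_top_of_bound hp.continuous_gradient.aestronglyMeasurable c
      ((ae_restrict_iff' t.measurableSet_carrier).2 (Filter.Eventually.of_forall hc))).mono_exponent
        le_top
  have hj : ∀ j, ρ ^ d * (gradient p x j ^ 2 +
      ρ ^ 2 * ‖gradient (fun y => gradient p y j) x‖ ^ 2) ≤ C * N ^ 2 := fun j => by
    refine (h x₀ ρ hρ _ ((hp.gradient_apply j).mono (Nat.sub_le _ _)) x (ht.subset_ball hx)).trans ?_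
    refine mul_le_mul_of_nonneg_left ?_ hC.le
    rw [l2Norm_sq hmem]
    have hc := (hp.gradient_apply j).continuous
    calc ∫ y in Metric.closedBall x₀ ρ, gradient p y j ^ 2 ≤ ∫ y in t.carrier, gradient p y j ^ 2 :=
          setIntegral_mono_set ((hc.pow 2).continuousOn.integrableOn_compact t.isCompact_carrier)
            (Filter.Eventually.of_forall fun y => sq_nonneg _)
            (Filter.Eventually.of_forall ht.ball_subset)
      _ ≤ _ := by
          refine integral_mono
            ((hc.pow 2).continuousOn.integrableOn_compact t.isCompact_carrier)
            ((hp.continuous_gradient.norm.pow 2).continuousOn.integrableOn_compact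
              t.isCompact_carrier) fun y => ?_
          rw [← sq_abs]
          exact pow_le_pow_left₀ (abs_nonneg _) (abs_coord_le_norm _ _) 2
  have hCN : 0 ≤ C * N ^ 2 := by positivity
  constructor
  · refine le_of_sq_le_sq ?_ (by positivity)
    rw [mul_pow, mul_pow, Real.sq_sqrt (by positivity), Real.sq_sqrt (by positivity),
      norm_sq_eq_sum, Finset.mul_sum]
    calc ∑ j, ρ ^ d * gradient p x j ^ 2 ≤ ∑ _j : Fin d, C * N ^ 2 := by
          refine Finset.sum_le_sum fun j _ => le_trans ?_ (hj j)
          gcongr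
          exact le_add_of_nonneg_right (by positivity)
      _ = d * (C * N ^ 2) := by simp
      _ ≤ _ := by linarith
  · intro i j
    refine le_of_sq_le_sq ?_ (by positivity)
    rw [mul_pow, mul_pow, mul_pow, Real.sq_sqrt (by positivity), Real.sq_sqrt (by positivity)]
    have h1 : |secondDeriv p i j x| ≤ ‖gradient (fun y => gradient p y j) x‖ := by
      have := abs_coord_le_norm (gradient (fun y => gradient p y j) x) i
      rwa [FEM.gradient_apply (fun y => gradient p y j)] at this
    calc ρ ^ d * (ρ ^ 2 * |secondDeriv p i j x| ^ 2) ≤ ρ ^ d * (gradient p x j ^ 2 +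
          ρ ^ 2 * ‖gradient (fun y => gradient p y j) x‖ ^ 2) := by
          gcongr
          refine le_add_of_nonneg_of_le (sq_nonneg _) ?_
          gcongr
      _ ≤ C * N ^ 2 := hj j
      _ ≤ _ := by nlinarith

/-- Local data on a shape-regular element of the domain. -/
structure IsShapedData {d : ℕ} (Ω : Set (E d)) (A : E d → Matrix (Fin d) (Fin d) ℝ) (u : E d → ℝ)
    (ℓ : ℕ) (L : NNReal) (Λ : ℝ) (t : Elt d) (x₀ : E d) (ρ : ℝ) (p : E d → ℝ)
    (α : Fin d → Fin d → E d → ℝ) : Prop where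
  shaped : IsShaped Λ t x₀ ρ
  data : IsLocalData A u ℓ t L p α
  subset : interior t.carrier ⊆ Ω
  mem : MemH10 Ω u

/-- `-∇·(α(x₀)∇p)`. -/
def frozenResidual {d : ℕ} (p : E d → ℝ) (α : Fin d → Fin d → E d → ℝ) (x₀ x : E d) : ℝ :=
  -∑ i, ∑ j, α i j x₀ * secondDeriv p i j x

/-- `α(x₀)∇p·n`. -/
def frozenFlux {d : ℕ} (p : E d → ℝ) (α : Fin d → Fin d → E d → ℝ) (n x₀ x : E d) : ℝ :=
  ∑ i, ∑ j, α i j x₀ * n i * gradient p x j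

theorem isPoly_frozenResidual {d ℓ : ℕ} {p : E d → ℝ} (hp : IsPoly ℓ p)
    (α : Fin d → Fin d → E d → ℝ) (x₀ : E d) : IsPoly (ℓ - 1) (frozenResidual p α x₀) :=
  (IsPoly.sum fun i _ => IsPoly.sum fun j _ =>
    ((hp.secondDeriv i j).mono (by omega)).const_mul _).neg

theorem isPoly_frozenFlux {d ℓ : ℕ} {p : E d → ℝ} (hp : IsPoly ℓ p)
    (α : Fin d → Fin d → E d → ℝ) (n x₀ : E d) : IsPoly (ℓ - 1) (frozenFlux p α n x₀) :=
  IsPoly.sum fun _ _ => IsPoly.sum fun j _ => (hp.gradient_apply j).const_mul _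

section ShapedData

variable {d : ℕ} {Ω : Set (E d)} {A : E d → Matrix (Fin d) (Fin d) ℝ} {u : E d → ℝ} {ℓ : ℕ}
  {L : NNReal} {Λ : ℝ} {t : Elt d} {x₀ : E d} {ρ : ℝ} {p : E d → ℝ} {α : Fin d → Fin d → E d → ℝ}

theorem IsShapedData.weakGrad_ae (h : IsShapedData Ω A u ℓ L Λ t x₀ ρ p α) :
    weakGrad Ω u =ᵐ[volume.restrict t.carrier] gradient p := by
  obtain ⟨K', hK'⟩ := (((h.data.poly.contDiff (n := 1)).locallyLipschitz).locallyLipschitzOn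
    (s := t.carrier)).exists_lipschitzOnWith_of_compact t.isCompact_carrier
  have hu' := weakGrad_ae_eq_gradient h.mem isOpen_interior h.subset (hK'.mono interior_subset)
    (fun x hx => h.data.eq_poly x (interior_subset hx))
  rwa [Measure.restrict_congr_set t.interior_ae_eq] at hu'

theorem abs_sum_sum_le {f : Fin d → Fin d → ℝ} {c : ℝ} (h : ∀ i j, |f i j| ≤ c) :
    |∑ i, ∑ j, f i j| ≤ (d : ℝ) ^ 2 * c :=
  calc |∑ i, ∑ j, f i j| ≤ ∑ _i : Fin d, ∑ _j : Fin d, c :=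
        (Finset.abs_sum_le_sum_abs _ _).trans (Finset.sum_le_sum fun i _ =>
          (Finset.abs_sum_le_sum_abs _ _).trans (Finset.sum_le_sum fun j _ => h i j))
    _ = _ := by simp; ring

theorem IsShapedData.abs_coeff_sub_le (h : IsShapedData Ω A u ℓ L Λ t x₀ ρ p α) (i j : Fin d)
    {x : E d} (hx : x ∈ t.carrier) : |α i j x - α i j x₀| ≤ L * (2 * Λ * ρ) := by
  have := (h.data.lip i j).dist_le_mul x x₀
  rw [Real.dist_eq, dist_eq_norm] at this
  exact this.trans (mul_le_mul_of_nonneg_left (h.shaped.norm_sub_le hx h.shaped.center_mem) L.2)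

end ShapedData

/-- Up to sign the difference is `∂α · ∇p + (α - α(x₀)) · ∂²p + λBu`. The factor `α - α(x₀)` is of
order `ρ`, and `ρ ∂²p` is controlled by `∇p`, so no negative power of `ρ` is left. -/
theorem exists_element_oscillation {d : ℕ} (hd : 0 < d) (ℓ : ℕ) (L : NNReal) (Λ b₁ b₂ : ℝ) :
    ∃ C : ℝ, 0 < C ∧ ∀ (Ω : Set (E d)) (A : E d → Matrix (Fin d) (Fin d) ℝ) (u B : E d → ℝ)
      (t : Elt d) (x₀ : E d) (ρ : ℝ) (p : E d → ℝ) (α : Fin d → Fin d → E d → ℝ), IsOpen Ω →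
      IsWeight Ω B b₁ b₂ → IsShapedData Ω A u ℓ L Λ t x₀ ρ p α → ∀ lam : ℝ, 0 ≤ lam →
      l2Norm (volume.restrict t.carrier) (fun x => residual A B lam u x - frozenResidual p α x₀ x) ≤
        C * ((1 + lam) * h1Norm Ω t.carrier u) := by
  obtain ⟨C₁, hC₁, hg⟩ := exists_gradient_bounds d ℓ Λ
  obtain ⟨C₂, hC₂, hv⟩ := exists_volume_bounds hd Λ
  have hC₂0 : 0 < C₂ := zero_lt_one.trans_le hC₂
  refine ⟨1 + √C₂ * ((d : ℝ) ^ 2 * (L * (1 + 2 * |Λ|) * C₁)) + |b₂|, by positivity,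
    fun Ω A u B t x₀ ρ p α hΩ hB h lam hlam => ?_⟩
  have hρ := h.shaped.pos
  have hΛ0 : 0 ≤ Λ := zero_le_one.trans (h.shaped.one_le hd)
  have hΛ : |Λ| = Λ := abs_of_nonneg hΛ0
  rw [hΛ]
  set N := l2Norm (volume.restrict t.carrier) (weakGrad Ω u)
  set H := h1Norm Ω t.carrier u
  have hH : 0 ≤ H := h1Norm_nonneg _ _ _
  have hN0 : 0 ≤ N := l2Norm_nonneg _ _
  have hNH : N ≤ H := l2Norm_weakGrad_le_h1Norm _ _ _
  have hNe : l2Norm (volume.restrict t.carrier) (gradient p) = N :=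
    (l2Norm_congr h.weakGrad_ae).symm
  set r := √(ρ ^ d)
  have hr : 0 < r := Real.sqrt_pos.2 (pow_pos hρ d)
  set M := (d : ℝ) ^ 2 * (L * (1 + 2 * Λ) * (C₁ * N / r))
  have hM0 : 0 ≤ M := by positivity
  set f : E d → ℝ := fun x => -(fluxDiv p α x) - frozenResidual p α x₀ x
  have hfb : ∀ x ∈ t.carrier, |f x| ≤ M := by
    intro x hx
    obtain ⟨h1, h2⟩ := hg t x₀ ρ h.shaped p h.data.poly x hx
    rw [hNe] at h1 h2
    have e : f x = -∑ i, ∑ j, (fderiv ℝ (α i j) x (unitVec i) * gradient p x j +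
        (α i j x - α i j x₀) * secondDeriv p i j x) := by
      simp only [f, fluxDiv, frozenResidual, sub_mul, Finset.sum_add_distrib, Finset.sum_sub_distrib]
      ring
    rw [e, abs_neg]
    refine abs_sum_sum_le fun i j => ?_
    have d1 : |fderiv ℝ (α i j) x (unitVec i)| ≤ L := by
      have := (ContinuousLinearMap.le_opNorm (fderiv ℝ (α i j) x) (unitVec i)).trans
        (mul_le_mul_of_nonneg_right (norm_fderiv_le_of_lipschitz ℝ (h.data.lip i j)) (norm_nonneg _))
      simpa using this
    have d2 : ‖gradient p x‖ ≤ C₁ * N / r := by rw [le_div_iff₀ hr]; linarith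
    have d3 : ρ * |secondDeriv p i j x| ≤ C₁ * N / r := by
      rw [le_div_iff₀ hr]; linarith [h2 i j]
    have d4 := h.abs_coeff_sub_le i j hx
    calc _ ≤ |fderiv ℝ (α i j) x (unitVec i)| * |gradient p x j| +
          |α i j x - α i j x₀| * |secondDeriv p i j x| := by
          rw [← abs_mul, ← abs_mul]; exact abs_add_le _ _
      _ ≤ L * (C₁ * N / r) + L * (2 * Λ * ρ) * |secondDeriv p i j x| := by
          gcongr
          exact (abs_coord_le_norm _ _).trans d2
      _ = L * (C₁ * N / r) + L * (2 * Λ) * (ρ * |secondDeriv p i j x|) := by ring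
      _ ≤ L * (C₁ * N / r) + L * (2 * Λ) * (C₁ * N / r) := by gcongr
      _ = _ := by ring
  have hfm : MemLp f 2 (volume.restrict t.carrier) :=
    (h.data.memLp_fluxDiv.neg.sub (memLp_top_of_continuous t.isCompact_carrier
      (isPoly_frozenResidual h.data.poly α x₀).continuous)).mono_exponent le_top
  have hbm : MemLp (fun x => -(lam * (B x * u x))) 2 (volume.restrict t.carrier) :=
    ((h.data.memLp_weight hΩ hB h.subset).const_mul lam).neg.mono_exponent le_top
  have hum : MemLp u 2 (volume.restrict t.carrier) := h.data.memLp_left.mono_exponent le_top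
  have n1 : l2Norm (volume.restrict t.carrier) f ≤ M * √(volume.real t.carrier) := by
    have := l2Norm_le_of_bound (ν := volume.restrict t.carrier) (f := f) hM0
      ((ae_restrict_iff' t.measurableSet_carrier).2 (Filter.Eventually.of_forall hfb))
    simpa [Measure.real] using this
  have n2 : √(volume.real t.carrier) ≤ √C₂ * r := by
    rw [← Real.sqrt_mul hC₂0.le]
    exact Real.sqrt_le_sqrt (hv t x₀ ρ h.shaped).2.2.2
  have n3 : l2Norm (volume.restrict t.carrier) (fun x => -(lam * (B x * u x))) ≤ lam * |b₂| * H := by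
    have h1 : l2Norm (volume.restrict t.carrier) (fun x => -(lam * (B x * u x))) ≤
        l2Norm (volume.restrict t.carrier) (fun x => (lam * |b₂|) * u x) := by
      refine l2Norm_mono (hum.const_mul _) ?_
      filter_upwards [ae_mem_interior t] with x hx
      rw [norm_neg, norm_mul, norm_mul, norm_mul, Real.norm_of_nonneg hlam,
        Real.norm_of_nonneg (by positivity : 0 ≤ lam * |b₂|), ← mul_assoc]
      gcongr
      exact (hB.abs_le (h.subset hx)).trans (le_abs_self _)
    rw [l2Norm_const_mul, abs_of_nonneg (by positivity)] at h1
    exact h1.trans (mul_le_mul_of_nonneg_left (l2Norm_le_h1Norm _ _ _) (by positivity))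
  calc _ = l2Norm (volume.restrict t.carrier) (fun x => f x + -(lam * (B x * u x))) := by
        refine l2Norm_congr ?_
        filter_upwards [h.data.residual_ae B lam] with x hx
        rw [hx]; simp only [f]; ring
    _ ≤ M * √(volume.real t.carrier) + lam * |b₂| * H :=
        (l2Norm_add_le hfm hbm).trans (add_le_add n1 n3)
    _ ≤ M * (√C₂ * r) + lam * |b₂| * H := by gcongr
    _ = √C₂ * ((d : ℝ) ^ 2 * (L * (1 + 2 * Λ) * C₁)) * N + lam * |b₂| * H := by
        simp only [M]; field_simp
    _ ≤ √C₂ * ((d : ℝ) ^ 2 * (L * (1 + 2 * Λ) * C₁)) * H + lam * |b₂| * H := by gcongr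
    _ ≤ _ := by
        have e1 : 0 ≤ √C₂ * ((d : ℝ) ^ 2 * (L * (1 + 2 * Λ) * C₁)) := by positivity
        have e2 : 0 ≤ lam * H := by positivity
        have e3 : 0 ≤ |b₂| * H := by positivity
        nlinarith [mul_nonneg e1 e2]

/-! ### Oscillation on a side -/

theorem side_comm {d : ℕ} (t t' : Elt d) : side t t' = side t' t := inter_comm _ _

theorem sideMeasure_comm {d : ℕ} (t t' : Elt d) : sideMeasure t t' = sideMeasure t' t := by
  rw [sideMeasure, sideMeasure, side_comm]

/-- The elements `t` and `t'` meet in their sides opposite to the vertices `i` and `i'`. -/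
structure IsSidePair {d : ℕ} (t t' : Elt d) (i i' : Fin (d + 1)) : Prop where
  shared : IsSharedSide t t' i i'
  conforming : t.carrier ∩ t'.carrier = convexHull ℝ (range t.vertex ∩ range t'.vertex)
  disjoint : Disjoint (interior t.carrier) t'.carrier
  disjoint' : Disjoint (interior t'.carrier) t.carrier

theorem IsSidePair.symm {d : ℕ} {t t' : Elt d} {i i' : Fin (d + 1)} (h : IsSidePair t t' i i') :
    IsSidePair t' t i' i where
  shared := h.shared.symm
  conforming := by rw [inter_comm, h.conforming, inter_comm]
  disjoint := h.disjoint'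
  disjoint' := h.disjoint

theorem IsTriangulation.exists_isSidePair {d : ℕ} {Ω : Set (E d)} {𝒯 : Mesh d}
    (h𝒯 : IsTriangulation Ω 𝒯) {t t' : Elt d} (ht : t ∈ 𝒯) (ht' : t' ∈ sideNbrs 𝒯 t) :
    ∃ i i', IsSidePair t t' i i' := by
  obtain ⟨h1, h2⟩ := mem_sideNbrs.1 ht'
  have hne := ne_of_mem_sideNbrs (h𝒯.indep t ht) ht'
  obtain ⟨i, i', hsh⟩ := exists_isSharedSide (h𝒯.indep t ht).injective (h𝒯.indep t' h1).injective h2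
  exact ⟨i, i', hsh, h𝒯.conforming t ht t' h1, h𝒯.disjoint_interior ht h1 hne,
    h𝒯.disjoint_interior h1 ht hne.symm⟩

/-- The coefficient differs from its frozen value by `O(ρ)`, and the norm of `∇p` on the side is at
most of order `ρ^{-1/2}` times its norm on the element; the product is `√ρ`. -/
theorem exists_flux_oscillation (m ℓ : ℕ) (L : NNReal) (Λ : ℝ) :
    ∃ C : ℝ, 0 < C ∧ ∀ (Ω : Set (E (m + 1))) (A : E (m + 1) → Matrix (Fin (m + 1)) (Fin (m + 1)) ℝ)
      (u : E (m + 1) → ℝ) (t t' : Elt (m + 1)) (x₀ : E (m + 1)) (ρ : ℝ) (p : E (m + 1) → ℝ)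
      (α : Fin (m + 1) → Fin (m + 1) → E (m + 1) → ℝ) (i i' : Fin (m + 2)),
      IsShapedData Ω A u ℓ L Λ t x₀ ρ p α → IsSidePair t t' i i' → ∀ n : E (m + 1), ‖n‖ = 1 →
      l2Norm (sideMeasure t t') (fun x => normalFlux p α n x - frozenFlux p α n x₀ x) ≤
        C * (√ρ * l2Norm (volume.restrict t.carrier) (weakGrad Ω u)) := by
  obtain ⟨C₁, hC₁, hg⟩ := exists_gradient_bounds (m + 1) ℓ Λ
  obtain ⟨C₂, hC₂, hs⟩ := exists_side_bounds m Λ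
  have hC₂0 : 0 < C₂ := zero_lt_one.trans_le hC₂
  refine ⟨1 + √C₂ * (((m + 1 : ℕ) : ℝ) ^ 2 * (L * (2 * |Λ|) * C₁)), by positivity,
    fun Ω A u t t' x₀ ρ p α i i' h hp n hn => ?_⟩
  have hρ := h.shaped.pos
  have hΛ0 : 0 ≤ Λ := zero_le_one.trans (h.shaped.one_le (Nat.succ_pos m))
  have hΛ : |Λ| = Λ := abs_of_nonneg hΛ0
  rw [hΛ]
  obtain ⟨ψ, b, hch⟩ := exists_isSideChart h.shaped.indep hp.shared hp.conforming
  have := hch.isFiniteMeasure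
  set N := l2Norm (volume.restrict t.carrier) (weakGrad Ω u)
  have hN0 : 0 ≤ N := l2Norm_nonneg _ _
  have hNe : l2Norm (volume.restrict t.carrier) (gradient p) = N :=
    (l2Norm_congr h.weakGrad_ae).symm
  set r := √(ρ ^ m)
  have hr : 0 < r := Real.sqrt_pos.2 (pow_pos hρ m)
  have hsρ : 0 < √ρ := Real.sqrt_pos.2 hρ
  have hr' : √(ρ ^ (m + 1)) = r * √ρ := by rw [pow_succ, Real.sqrt_mul (by positivity)]
  set M := ((m + 1 : ℕ) : ℝ) ^ 2 * (L * (2 * Λ) * (C₁ * N * √ρ / r))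
  have hM0 : 0 ≤ M := by positivity
  have hb : ∀ x ∈ side t t', |normalFlux p α n x - frozenFlux p α n x₀ x| ≤ M := by
    intro x hx
    obtain ⟨h1, -⟩ := hg t x₀ ρ h.shaped p h.data.poly x hx.1
    rw [hNe, hr'] at h1
    have e : normalFlux p α n x - frozenFlux p α n x₀ x =
        ∑ i, ∑ j, (α i j x - α i j x₀) * gradient p x j * n i := by
      simp only [normalFlux, frozenFlux, ← Finset.sum_sub_distrib]
      exact Finset.sum_congr rfl fun i _ => Finset.sum_congr rfl fun j _ => by ring
    rw [e]
    refine abs_sum_sum_le fun i j => ?_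
    have d2 : ρ * ‖gradient p x‖ ≤ C₁ * N * √ρ / r := by
      rw [le_div_iff₀ hr]
      have : ρ = √ρ * √ρ := (Real.mul_self_sqrt hρ.le).symm
      calc ρ * ‖gradient p x‖ * r = √ρ * (r * √ρ * ‖gradient p x‖) := by nth_rw 1 [this]; ring
        _ ≤ √ρ * (C₁ * N) := by gcongr
        _ = _ := by ring
    rw [abs_mul, abs_mul]
    have hni : |n i| ≤ 1 := hn ▸ abs_coord_le_norm n i
    calc |α i j x - α i j x₀| * |gradient p x j| * |n i|
        ≤ L * (2 * Λ * ρ) * ‖gradient p x‖ * 1 := by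
          gcongr
          · exact h.abs_coeff_sub_le i j hx.1
          · exact abs_coord_le_norm _ _
      _ = L * (2 * Λ) * (ρ * ‖gradient p x‖) := by ring
      _ ≤ _ := by gcongr
  have n1 := l2Norm_le_of_bound (ν := sideMeasure t t')
    (f := fun x => normalFlux p α n x - frozenFlux p α n x₀ x) hM0 ((ae_mem_side t t').mono hb)
  rw [hch.measureReal_univ] at n1
  have n2 : √(volume.real (convexHull ℝ (range b))) ≤ √C₂ * r := by
    rw [← Real.sqrt_mul hC₂0.le]
    exact Real.sqrt_le_sqrt (hs t t' x₀ ρ h.shaped i i' hp.shared hp.conforming ψ b hch).2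
  calc _ ≤ M * (√C₂ * r) := n1.trans (by gcongr)
    _ = √C₂ * (((m + 1 : ℕ) : ℝ) ^ 2 * (L * (2 * Λ) * C₁)) * (√ρ * N) := by
        simp only [M]; field_simp
    _ ≤ _ := mul_le_mul_of_nonneg_right (by linarith) (by positivity)

/-- The jump of the flux with coefficients frozen at `x₀` and `x₀'`. -/
def frozenJump {d : ℕ} (t t' : Elt d) (p p' : E d → ℝ) (α α' : Fin d → Fin d → E d → ℝ)
    (x₀ x₀' x : E d) : ℝ :=
  frozenFlux p α (outwardNormal t (side t t')) x₀ x +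
    frozenFlux p' α' (outwardNormal t' (side t t')) x₀' x

theorem isPoly_frozenJump {d ℓ : ℕ} (t t' : Elt d) {p p' : E d → ℝ} (hp : IsPoly ℓ p)
    (hp' : IsPoly ℓ p') (α α' : Fin d → Fin d → E d → ℝ) (x₀ x₀' : E d) :
    IsPoly (ℓ - 1) (frozenJump t t' p p' α α' x₀ x₀') :=
  (isPoly_frozenFlux hp _ _ _).add (isPoly_frozenFlux hp' _ _ _)

section Jump

variable {m ℓ : ℕ} {Ω : Set (E (m + 1))} {A : E (m + 1) → Matrix (Fin (m + 1)) (Fin (m + 1)) ℝ}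
  {u : E (m + 1) → ℝ} {t t' : Elt (m + 1)} {L : NNReal} {Λ : ℝ} {x₀ x₀' : E (m + 1)} {ρ ρ' : ℝ}
  {p p' : E (m + 1) → ℝ} {α α' : Fin (m + 1) → Fin (m + 1) → E (m + 1) → ℝ} {i i' : Fin (m + 2)}

theorem jump_ae (h : IsLocalData A u ℓ t L p α) (h' : IsLocalData A u ℓ t' L p' α') :
    jump A u t t' =ᵐ[sideMeasure t t'] fun x => normalFlux p α (outwardNormal t (side t t')) x +
      normalFlux p' α' (outwardNormal t' (side t t')) x := by
  filter_upwards [ae_mem_side t t'] with x hx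
  rw [jump, h.inner_traceFlux hx.1, h'.inner_traceFlux hx.2]

theorem memLp_jump [IsFiniteMeasure (sideMeasure t t')] (h : IsLocalData A u ℓ t L p α)
    (h' : IsLocalData A u ℓ t' L p' α') : MemLp (jump A u t t') 2 (sideMeasure t t') :=
  MemLp.ae_eq (jump_ae h h').symm
    (memLp_side ((h.continuous_normalFlux _).add (h'.continuous_normalFlux _)))

theorem IsSidePair.norm_outwardNormal (hp : IsSidePair t t' i i')
    (h : AffineIndependent ℝ t.vertex) : ‖outwardNormal t (side t t')‖ = 1 :=
  (outwardNormal_spec (Nat.succ_pos m) h hp.shared hp.conforming).1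

end Jump

theorem exists_jump_oscillation (m ℓ : ℕ) (hm : 1 ≤ m) (L : NNReal) (Λ : ℝ) :
    ∃ C : ℝ, 0 < C ∧ ∀ (Ω : Set (E (m + 1))) (A : E (m + 1) → Matrix (Fin (m + 1)) (Fin (m + 1)) ℝ)
      (u : E (m + 1) → ℝ) (t t' : Elt (m + 1)) (x₀ x₀' : E (m + 1)) (ρ ρ' : ℝ)
      (p p' : E (m + 1) → ℝ)
      (α α' : Fin (m + 1) → Fin (m + 1) → E (m + 1) → ℝ) (i i' : Fin (m + 2)),
      IsShapedData Ω A u ℓ L Λ t x₀ ρ p α → IsShapedData Ω A u ℓ L Λ t' x₀' ρ' p' α' →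
      IsSidePair t t' i i' →
      l2Norm (sideMeasure t t') (fun x => jump A u t t' x - frozenJump t t' p p' α α' x₀ x₀' x) ≤
        C * (√ρ * (l2Norm (volume.restrict t.carrier) (weakGrad Ω u) +
          l2Norm (volume.restrict t'.carrier) (weakGrad Ω u))) := by
  obtain ⟨C, hC, hfl⟩ := exists_flux_oscillation m ℓ L Λ
  refine ⟨C * (1 + √(2 * |Λ|)), by positivity,
    fun Ω A u t t' x₀ x₀' ρ ρ' p p' α α' i i' h h' hp => ?_⟩
  have hΛ0 : 0 ≤ Λ := zero_le_one.trans (h.shaped.one_le (Nat.succ_pos m))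
  rw [abs_of_nonneg hΛ0]
  obtain ⟨ψ, b, hch⟩ := exists_isSideChart h.shaped.indep hp.shared hp.conforming
  have := hch.isFiniteMeasure
  have hn := hp.norm_outwardNormal h.shaped.indep
  have hn' := hp.symm.norm_outwardNormal h'.shaped.indep
  rw [side_comm t' t] at hn'
  have h1 := hfl Ω A u t t' x₀ ρ p α i i' h hp _ hn
  have h2 := hfl Ω A u t' t x₀' ρ' p' α' i' i h' hp.symm _ hn'
  rw [sideMeasure_comm t' t] at h2
  have hρ : √ρ' ≤ √(2 * Λ) * √ρ := by
    rw [← Real.sqrt_mul (by positivity)]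
    exact Real.sqrt_le_sqrt (hp.shared.radius_le (by omega) h.shaped h'.shaped)
  set N := l2Norm (volume.restrict t.carrier) (weakGrad Ω u)
  set N' := l2Norm (volume.restrict t'.carrier) (weakGrad Ω u)
  have hN : 0 ≤ N := l2Norm_nonneg _ _
  have hN' : 0 ≤ N' := l2Norm_nonneg _ _
  have m1 : ∀ {p α n x₀}, IsPoly ℓ p → Continuous (normalFlux p α n) →
      MemLp (fun x => normalFlux p α n x - frozenFlux p α n x₀ x) 2 (sideMeasure t t') :=
    fun hp hc => memLp_side (hc.sub (isPoly_frozenFlux hp _ _ _).continuous)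
  calc _ = l2Norm (sideMeasure t t') (fun x =>
        (normalFlux p α (outwardNormal t (side t t')) x -
          frozenFlux p α (outwardNormal t (side t t')) x₀ x) +
        (normalFlux p' α' (outwardNormal t' (side t t')) x -
          frozenFlux p' α' (outwardNormal t' (side t t')) x₀' x)) := by
        refine l2Norm_congr ?_
        filter_upwards [jump_ae h.data h'.data] with x hx
        rw [hx, frozenJump]; ring
    _ ≤ C * (√ρ * N) + C * (√ρ' * N') :=
        (l2Norm_add_le (m1 h.data.poly (h.data.continuous_normalFlux _))
          (m1 h'.data.poly (h'.data.continuous_normalFlux _))).trans (add_le_add h1 h2)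
    _ ≤ C * (√ρ * N) + C * ((√(2 * Λ) * √ρ) * N') := by gcongr
    _ ≤ _ := by
        have e1 : 0 ≤ C * (√(2 * Λ) * (√ρ * N)) := by positivity
        have e2 : 0 ≤ C * (√ρ * N') := by positivity
        nlinarith

/-! ### The oscillation estimate -/

theorem memLp_polyEval_carrier {d : ℕ} (t : Elt d) (p : MvPolynomial (Fin d) ℝ) :
    MemLp (polyEval p) 2 (volume.restrict t.carrier) :=
  (memLp_top_of_continuous t.isCompact_carrier (isPoly_polyEval le_rfl).continuous).mono_exponent
    le_top

theorem exists_isShapedData {m ℓ : ℕ} {Ω P : Set (E (m + 1))}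
    {A : E (m + 1) → Matrix (Fin (m + 1)) (Fin (m + 1)) ℝ} {a₁ a₂ : ℝ}
    (hA : IsDiffusion Ω P A a₁ a₂) : ∃ L : NNReal, ∀ (κ : ℝ) (𝒯 : Mesh (m + 1)),
      IsTriangulation Ω 𝒯 → Matches P 𝒯 → regularity 𝒯 ≤ κ → ∀ u ∈ femSpace Ω 𝒯 ℓ, ∀ t ∈ 𝒯,
      ∃ x₀ ρ p α, IsShapedData Ω A u ℓ L (2 * κ) t x₀ ρ p α := by
  obtain ⟨L, hL⟩ := exists_isLocalData hA ℓ
  refine ⟨L, fun κ 𝒯 h𝒯 hm hκ u hu t ht => ?_⟩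
  obtain ⟨p, α, h⟩ := hL 𝒯 h𝒯 hm u hu t ht
  obtain ⟨x₀, ρ, h'⟩ := exists_isShaped (Nat.succ_pos m) h𝒯 hκ ht
  exact ⟨x₀, ρ, p, α, h', h, h𝒯.subset_closure ht, hu.1⟩

/-- The frozen residual and the frozen jump are polynomials of degree at most `ℓ - 1`, so best
approximation reduces both terms to the oscillations of elements and sides. For the jumps, `√T.size
* √ρ` is of order `T.size`. -/
theorem exists_oscillation_bound {m : ℕ} (hm : 1 ≤ m) (ℓ : ℕ) {Ω P : Set (E (m + 1))}
    (hΩ : IsOpen Ω) {A : E (m + 1) → Matrix (Fin (m + 1)) (Fin (m + 1)) ℝ} {a₁ a₂ : ℝ}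
    (hA : IsDiffusion Ω P A a₁ a₂) {B : E (m + 1) → ℝ} {b₁ b₂ : ℝ} (hB : IsWeight Ω B b₁ b₂)
    (κ : ℝ) : ∃ C : ℝ, 0 < C ∧ ∀ 𝒯 : Mesh (m + 1), IsTriangulation Ω 𝒯 → Matches P 𝒯 →
      regularity 𝒯 ≤ κ → ∀ T ∈ 𝒯, ∀ lam : ℝ, 0 ≤ lam → ∀ u ∈ femSpace Ω 𝒯 ℓ,
      T.size * residualOsc A B 𝒯 ℓ lam u T + √T.size * jumpOsc A 𝒯 ℓ u T ≤
        C * (T.size * (2 + lam) * h1Norm Ω (patch 𝒯 T) u) := by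
  obtain ⟨L, hL⟩ := exists_isShapedData (ℓ := ℓ) hA
  obtain ⟨C₁, hC₁, he⟩ := exists_element_oscillation (Nat.succ_pos m) ℓ L (2 * κ) b₁ b₂
  obtain ⟨C₂, hC₂, hj⟩ := exists_jump_oscillation m ℓ hm L (2 * κ)
  obtain ⟨C₃, hC₃, hv⟩ := exists_volume_bounds (Nat.succ_pos m) (2 * κ)
  have hC₃0 : 0 < C₃ := zero_lt_one.trans_le hC₃
  -- The bound `d + 1` for the number of interior sides of an element, with `d = m + 1`.
  set c := ((m + 1 + 1 : ℕ) : ℝ)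
  refine ⟨C₁ + √c * (2 * C₂ * √C₃), by positivity, fun 𝒯 h𝒯 hmat hκ T hT lam hlam u hu => ?_⟩
  choose! x₀ ρ p α h using hL κ 𝒯 h𝒯 hmat hκ u hu
  set H := h1Norm Ω (patch 𝒯 T) u
  have hH : 0 ≤ H := h1Norm_nonneg _ _ _
  have hsz : 0 ≤ T.size := Real.rpow_nonneg measureReal_nonneg _
  have hρ := (h T hT).shaped.pos
  have r1 : residualOsc A B 𝒯 ℓ lam u T ≤ C₁ * (1 + lam) * H := by
    refine Real.sqrt_le_iff.2 ⟨by positivity, ?_⟩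
    rw [mul_pow, ← sum_h1Norm_sq h𝒯 hu.1, Finset.mul_sum]
    refine Finset.sum_le_sum fun t ht => ?_
    have ht' := h t (nbrs_subset ht)
    rw [← mul_pow]
    refine pow_le_pow_left₀ (l2Norm_nonneg _ _) ?_ 2
    refine (l2Norm_sub_polyProj_le (ℓ - 1)
      ((ht'.data.memLp_residual hΩ hB ht'.subset lam).mono_exponent le_top)
      (memLp_polyEval_carrier t) (isPoly_frozenResidual ht'.data.poly (α t) (x₀ t))).trans ?_
    exact (he Ω A u B t _ _ _ _ hΩ hB ht' lam hlam).trans (le_of_eq (by ring))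
  have r2 : jumpOsc A 𝒯 ℓ u T ≤ √c * (2 * C₂ * √(ρ T)) * H := by
    refine Real.sqrt_le_iff.2 ⟨by positivity, ?_⟩
    calc _ ≤ ∑ _t ∈ sideNbrs 𝒯 T, (2 * C₂ * √(ρ T) * H) ^ 2 := by
          refine Finset.sum_le_sum fun t ht => ?_
          have htn := sideNbrs_subset_nbrs (Nat.succ_pos m) ht
          have ht' := h t (nbrs_subset htn)
          have hT' := h T hT
          obtain ⟨i, i', hp⟩ := h𝒯.exists_isSidePair hT ht
          obtain ⟨ψ, b, hch⟩ := exists_isSideChart hT'.shaped.indep hp.shared hp.conforming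
          have := hch.isFiniteMeasure
          refine pow_le_pow_left₀ (l2Norm_nonneg _ _) ?_ 2
          refine (l2Norm_sub_polyProj_le (ℓ - 1) (memLp_jump hT'.data ht'.data)
            (fun q => memLp_side (isPoly_polyEval le_rfl).continuous)
            (isPoly_frozenJump T t hT'.data.poly ht'.data.poly (α T) (α t) (x₀ T) (x₀ t))).trans ?_
          refine (hj Ω A u T t _ _ _ _ _ _ _ _ i i' hT' ht' hp).trans ?_
          have k1 : l2Norm (volume.restrict T.carrier) (weakGrad Ω u) ≤ H :=
            (l2Norm_weakGrad_le_h1Norm _ _ _).trans (h1Norm_le_patch h𝒯 hu.1 (self_mem_nbrs hT))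
          have k2 : l2Norm (volume.restrict t.carrier) (weakGrad Ω u) ≤ H :=
            (l2Norm_weakGrad_le_h1Norm _ _ _).trans (h1Norm_le_patch h𝒯 hu.1 htn)
          calc _ ≤ C₂ * (√(ρ T) * (H + H)) := by gcongr
            _ = _ := by ring
      _ = ((sideNbrs 𝒯 T).card : ℝ) * (2 * C₂ * √(ρ T) * H) ^ 2 := by simp
      _ ≤ c * (2 * C₂ * √(ρ T) * H) ^ 2 := by
          gcongr
          exact Nat.cast_le.2 (h𝒯.card_sideNbrs_le (Nat.succ_pos m) hT)
      _ = _ := by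
          rw [mul_assoc √c, mul_pow √c, Real.sq_sqrt (by positivity)]
  have r3 : √(ρ T) ≤ √C₃ * √T.size := by
    rw [← Real.sqrt_mul hC₃0.le]
    exact Real.sqrt_le_sqrt (hv T _ _ (h T hT).shaped).1
  calc _ ≤ T.size * (C₁ * (1 + lam) * H) +
        √T.size * (√c * (2 * C₂ * (√C₃ * √T.size)) * H) := by
        gcongr
        exact r2.trans (by gcongr)
    _ = C₁ * (T.size * (1 + lam) * H) + √c * (2 * C₂ * √C₃) * (T.size * H) := by
        linear_combination (√c * (2 * C₂ * √C₃) * H) * Real.mul_self_sqrt hsz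
    _ ≤ C₁ * (T.size * (2 + lam) * H) + √c * (2 * C₂ * √C₃) * (T.size * (2 + lam) * H) := by
        gcongr
        · linarith
        · nlinarith
    _ = _ := by ring

/-! ### Testing with bubble functions -/

/-- The right-hand side of the local lower bound, on the set `D` and with mesh size `ρ`. -/
def localError {d : ℕ} (Ω D : Set (E d)) (ρ lam μ : ℝ) (u w : E d → ℝ) : ℝ :=
  l2Norm (volume.restrict D) (weakGrad Ω fun x => w x - u x) +
    ρ * l2Norm (volume.restrict D) (fun x => μ * w x) + ρ * (1 + lam) * h1Norm Ω D u

theorem localError_nonneg {d : ℕ} (Ω D : Set (E d)) {ρ lam : ℝ} (hρ : 0 ≤ ρ) (hlam : 0 ≤ lam)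
    (μ : ℝ) (u w : E d → ℝ) : 0 ≤ localError Ω D ρ lam μ u w := by
  have h1 := l2Norm_nonneg (volume.restrict D) (weakGrad Ω fun x => w x - u x)
  have h2 := l2Norm_nonneg (volume.restrict D) (fun x => μ * w x)
  have h3 := h1Norm_nonneg Ω D u
  unfold localError
  positivity

theorem h1Norm_le_localError {d : ℕ} (Ω D : Set (E d)) {ρ lam : ℝ} (hρ : 0 < ρ)
    (μ : ℝ) (u w : E d → ℝ) :
    (1 + lam) * h1Norm Ω D u ≤ localError Ω D ρ lam μ u w / ρ := by
  have h1 := l2Norm_nonneg (volume.restrict D) (weakGrad Ω fun x => w x - u x)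
  have h2 := mul_nonneg hρ.le (l2Norm_nonneg (volume.restrict D) (fun x => μ * w x))
  rw [le_div_iff₀ hρ, localError]
  linarith

theorem localError_mono {d : ℕ} {Ω D D' : Set (E d)} {ρ ρ' c lam : ℝ} {μ : ℝ} {u w : E d → ℝ}
    (hρ : 0 ≤ ρ) (hc : 1 ≤ c) (hρ' : ρ ≤ c * ρ') (hlam : 0 ≤ lam)
    (hu : MemH10 Ω u) (hw : MemH10 Ω w) (hwu : MemH10 Ω fun x => w x - u x)
    (h : volume.restrict D ≤ volume.restrict D')
    (h' : (volume.restrict D' : Measure (E d)) ≤ volume.restrict Ω) :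
    localError Ω D ρ lam μ u w ≤ c * localError Ω D' ρ' lam μ u w := by
  have e1 := l2Norm_mono_measure ((isSobolevPair_weakGrad hwu).memLp_grad.mono_measure h') h
  have e2 := l2Norm_mono_measure (((isSobolevPair_weakGrad hw).memLp.const_mul μ).mono_measure h') h
  have e3 := h1Norm_mono hu h h'
  have n1 := l2Norm_nonneg (volume.restrict D) (weakGrad Ω fun x => w x - u x)
  have n2 := l2Norm_nonneg (volume.restrict D) (fun x => μ * w x)
  have n3 := h1Norm_nonneg Ω D u
  have hcρ : 0 ≤ c * ρ' := hρ.trans hρ'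
  unfold localError
  calc _ ≤ c * l2Norm (volume.restrict D') (weakGrad Ω fun x => w x - u x) +
        c * ρ' * l2Norm (volume.restrict D') (fun x => μ * w x) +
        c * ρ' * (1 + lam) * h1Norm Ω D' u := by
        gcongr
        exact e1.trans (le_mul_of_one_le_left (n1.trans e1) hc)
    _ = _ := by ring

theorem le_of_sq_le_mul {y c : ℝ} (hc : 0 ≤ c) (h : y ^ 2 ≤ c * y) : y ≤ c := by
  by_contra! hlt
  nlinarith

theorem setIntegral_eq_of_ae_zero {d : ℕ} {Ω K : Set (E d)}
    (hK : MeasurableSet K) (hKΩ : volume (K \ Ω) = 0) {f : E d → ℝ}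
    (hf : ∀ᵐ x ∂volume.restrict Ω, x ∉ K → f x = 0) : ∫ x in Ω, f x = ∫ x in K, f x := by
  have h1 : ∫ x in Ω, f x = ∫ x in Ω, K.indicator f x := by
    refine integral_congr_ae ?_
    filter_upwards [hf] with x hx
    by_cases hxK : x ∈ K
    · simp [hxK]
    · simp [hxK, hx hxK]
  rw [h1, setIntegral_indicator hK]
  refine setIntegral_congr_set ?_
  refine Filter.EventuallyLE.antisymm (Filter.Eventually.of_forall fun x hx => hx.2) ?_
  refine ae_le_set.2 ?_
  rwa [sdiff_inter_self_eq_sdiff]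

section Test

variable {d : ℕ} {Ω P : Set (E d)} {A : E d → Matrix (Fin d) (Fin d) ℝ} {B : E d → ℝ}
  {a₁ a₂ b₁ b₂ : ℝ}

theorem gradient_eq_zero_of_notMem {K : Set (E d)} (hK : IsClosed K) {v : E d → ℝ}
    (h0 : ∀ x ∉ K, v x = 0) {x : E d} (hx : x ∉ K) : gradient v x = 0 := by
  rw [gradient_congr hK.isOpen_compl (g := fun _ => 0) (fun y hy => h0 y hy) hx]
  simp [gradient]

theorem form_eq_setIntegral (hΩ : IsOpen Ω) {u v : E d → ℝ} (hv : MemH10 Ω v) {L : NNReal}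
    (hL : LipschitzWith L v) {K : Set (E d)} (hK : IsCompact K) (hKΩ : volume (K \ Ω) = 0)
    (h0 : ∀ x ∉ K, v x = 0) (lam : ℝ) :
    aForm Ω A u v - lam * bForm Ω B u v =
      (∫ x in K, inner ℝ (Matrix.toEuclideanLin (A x) (weakGrad Ω u x)) (weakGrad Ω v x)) -
        lam * ∫ x in K, B x * u x * v x := by
  rw [aForm, bForm, setIntegral_eq_of_ae_zero hK.measurableSet hKΩ,
    setIntegral_eq_of_ae_zero hK.measurableSet hKΩ]
  · exact Filter.Eventually.of_forall fun x hx => by rw [h0 x hx, mul_zero]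
  · have hgv : weakGrad Ω v =ᵐ[volume.restrict Ω] gradient v :=
      weakGrad_ae_eq_gradient hv hΩ subset_rfl hL.lipschitzOnWith (fun _ _ => rfl)
    filter_upwards [hgv] with x hx hxK
    rw [hx, gradient_eq_zero_of_notMem hK.isClosed h0 hxK, inner_zero_right]

theorem norm_gradient_le_of_abs_sub_le {t : Elt d} {v : E d → ℝ} {G : ℝ} (hG : 0 ≤ G)
    (h : ∀ x ∈ t.carrier, ∀ y ∈ t.carrier, |v x - v y| ≤ G * ‖x - y‖) :
    ∀ᵐ x ∂volume.restrict t.carrier, ‖gradient v x‖ ≤ G := by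
  filter_upwards [ae_mem_interior t] with x hx
  have hl : LipschitzOnWith ⟨G, hG⟩ v t.carrier :=
    LipschitzOnWith.of_dist_le_mul fun x hx y hy => by
      rw [Real.dist_eq, dist_eq_norm]; exact h x hx y hy
  exact norm_gradient_le hl (mem_interior_iff_mem_nhds.1 hx)

/-- The residual tested with a function of height `M` and slope `c * (M / ρ)`. -/
theorem abs_form_residual_le_localError (hΩ : IsOpen Ω) (hA : IsDiffusion Ω P A a₁ a₂)
    (hB : IsWeight Ω B b₁ b₂) (ha : 0 ≤ a₂) (hb : 0 ≤ b₂) {u w v : E d → ℝ} (hu : MemH10 Ω u)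
    (hw : MemH10 Ω w) (hv : MemH10 Ω v) (hwu : MemH10 Ω fun x => w x - u x) {lam μ : ℝ}
    (hlam : 0 ≤ lam) (hwv : aForm Ω A w v = μ * bForm Ω B w v) {K : Set (E d)}
    (hK : IsCompact K) (hKΩ : volume (K \ Ω) = 0) {L : NNReal} (hL : LipschitzWith L v)
    (h0 : ∀ x ∉ K, v x = 0) {M c ρ : ℝ} (hM0 : 0 ≤ M) (hρ : 0 < ρ) (hc : 0 ≤ c)
    (hM : ∀ x, |v x| ≤ 8 * M)
    (hG : ∀ᵐ x ∂volume.restrict K, ‖gradient v x‖ ≤ c * (M / ρ)) :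
    |aForm Ω A u v - lam * bForm Ω B u v| ≤ ((d : ℝ) ^ 2 * a₂ * c + 8 * b₂) *
      (√(volume.real K) * M * (localError Ω K ρ lam μ u w / ρ)) := by
  refine (abs_form_residual_le hΩ hA hB ha hb hu hw hv hwu hlam hwv hK hKΩ hL h0
    (by positivity) hM (by positivity) hG).trans ?_
  have n1 := l2Norm_nonneg (volume.restrict K) (weakGrad Ω fun x => w x - u x)
  have n2 := l2Norm_nonneg (volume.restrict K) (fun x => μ * w x)
  have n3 := h1Norm_nonneg Ω K u
  have n4 := l2Norm_nonneg (volume.restrict K) u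
  have n5 := l2Norm_le_h1Norm Ω K u
  unfold localError
  set D := l2Norm (volume.restrict K) (weakGrad Ω fun x => w x - u x)
  set V := l2Norm (volume.restrict K) (fun x => μ * w x)
  set H := h1Norm Ω K u
  set U := l2Norm (volume.restrict K) u
  set q := (d : ℝ) ^ 2 * a₂ * c with hq
  have hq0 : 0 ≤ q := by positivity
  calc _ = √(volume.real K) * (M / ρ) * (q * D + 8 * b₂ * (ρ * V) + 8 * b₂ * (ρ * lam * U)) := by
        rw [hq]; field_simp
    _ ≤ √(volume.real K) * (M / ρ) * (q * (D + ρ * V + ρ * (1 + lam) * H) +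
        8 * b₂ * (D + ρ * V + ρ * (1 + lam) * H)) := by
        have k1 : ρ * lam * U ≤ ρ * (1 + lam) * H := by gcongr; linarith
        have k2 : 0 ≤ ρ * V := by positivity
        have k3 : 0 ≤ ρ * (1 + lam) * H := by positivity
        have k4 : q * D ≤ q * (D + ρ * V + ρ * (1 + lam) * H) := by gcongr; linarith
        have k5 : 8 * b₂ * (ρ * V + ρ * lam * U) ≤ 8 * b₂ * (D + ρ * V + ρ * (1 + lam) * H) := by
          gcongr; linarith
        refine mul_le_mul_of_nonneg_left ?_ (by positivity)
        linarith
    _ = _ := by ring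

/-- A solution of the eigenvalue equation on a space that contains the refined finite element
space. -/
structure IsTestedPair (Ω : Set (E d)) (A : E d → Matrix (Fin d) (Fin d) ℝ) (B : E d → ℝ)
    (V : Set (E d → ℝ)) (μ : ℝ) (u w : E d → ℝ) : Prop where
  left : MemH10 Ω w
  sub : MemH10 Ω fun x => w x - u x
  test : ∀ v ∈ V, aForm Ω A w v = μ * bForm Ω B w v

theorem IsWeight.nonneg (hB : IsWeight Ω B b₁ b₂) (hne : Ω.Nonempty) : 0 ≤ b₂ :=
  (abs_nonneg _).trans (hB.abs_le hne.some_mem)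

theorem volume_carrier_sdiff {t : Elt d} (ht : interior t.carrier ⊆ Ω) :
    volume (t.carrier \ Ω) = 0 :=
  measure_mono_null (sdiff_subset_sdiff_right ht) (ae_le_set.1 t.interior_ae_eq.symm.le)

theorem volume_restrict_real_univ (K : Set (E d)) :
    (volume.restrict K : Measure (E d)).real univ = volume.real K := by
  simp [Measure.real]

end Test

/-! ### Efficiency of the element residual -/

/-- With `q` the frozen residual, `v` its product with the element bubble, `M = max |q|` and `s =
√|t|`, norm equivalence gives `(s M)² ≤ C ∫ q v`. Here `∫ q v` is the residual tested with `v`, up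
to oscillation, and is at most of order `s M` times the local error divided by `ρ`. Cancelling `s M`
bounds `q` and then the residual. -/
theorem exists_element_efficiency {m : ℕ} (hd : m + 1 = 2 ∨ m + 1 = 3) {ℓ : ℕ} (hℓ : 1 ≤ ℓ)
    {Ω P : Set (E (m + 1))} (hΩ : IsOpen Ω) (hΩb : Bornology.IsBounded Ω)
    {A : E (m + 1) → Matrix (Fin (m + 1)) (Fin (m + 1)) ℝ} {a₁ a₂ : ℝ}
    (hA : IsDiffusion Ω P A a₁ a₂) {B : E (m + 1) → ℝ} {b₁ b₂ : ℝ} (hB : IsWeight Ω B b₁ b₂)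
    (L : NNReal) (Λ : ℝ) : ∃ C : ℝ, 0 < C ∧ ∀ 𝒯 : Mesh (m + 1), IsTriangulation Ω 𝒯 →
      ∀ T 𝒯s, IsLocalRefinement Ω 𝒯 T 𝒯s → ∀ t ∈ nbrs 𝒯 T, ∀ u x₀ ρ p α,
      IsShapedData Ω A u ℓ L Λ t x₀ ρ p α → ∀ (lam μ : ℝ) (w : E (m + 1) → ℝ), 0 ≤ lam →
      IsTestedPair Ω A B (femSpace Ω 𝒯s ℓ) μ u w →
      ρ * l2Norm (volume.restrict t.carrier) (residual A B lam u) ≤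
        C * localError Ω t.carrier ρ lam μ u w := by
  obtain ⟨C₁, hC₁, hosc⟩ := exists_element_oscillation (Nat.succ_pos m) ℓ L Λ b₁ b₂
  obtain ⟨C₂, hC₂, hlow⟩ := exists_element_lower hd (ℓ - 1)
  obtain ⟨C₃, hC₃, hlip⟩ := exists_uniform_lipschitz_mul_bubble (d := m + 1) (ℓ - 1) Λ
    (fun τ : ZMod 3 => elementForms (m + 1) τ)
  set c := C₂ * ((((m + 1 : ℕ) : ℝ) ^ 2 * |a₂| * C₃ + 8 * |b₂|) + 8 * C₁) with hc
  refine ⟨C₁ + c, by positivity, fun 𝒯 h𝒯 T 𝒯s href t ht u x₀ ρ p α h lam μ w hlam hw => ?_⟩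
  have hne : Ω.Nonempty := (t.interior_nonempty h.shaped.indep).mono h.subset
  have ha := hA.nonneg (Nat.succ_pos m) hne
  have hb := hB.nonneg hne
  rw [abs_of_nonneg ha, abs_of_nonneg hb] at hc
  have hρ := h.shaped.pos
  set X := localError Ω t.carrier ρ lam μ u w
  have hX : 0 ≤ X := localError_nonneg Ω _ hρ.le hlam μ u w
  set q := frozenResidual p α x₀
  have hq : IsPoly (ℓ - 1) q := isPoly_frozenResidual h.data.poly α x₀
  obtain ⟨xm, hxm, hmax⟩ := t.isCompact_carrier.exists_isMaxOn ⟨x₀, h.shaped.center_mem⟩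
    hq.continuous.abs.continuousOn
  set M := |q xm|
  have hM0 : 0 ≤ M := abs_nonneg _
  have hqM : ∀ x ∈ t.carrier, |q x| ≤ M := fun x hx => hmax hx
  set v := elementBubble t h.shaped.indep q
  have hbub := isBubbleFun_elementBubble hd h.shaped.indep hq
  have hvt : ∀ x ∈ t.carrier, v x = q x *
      bubble (elementForms (m + 1) t.type) ((t.basis h.shaped.indep).coords x) :=
    fun x hx => hbub.eq t (Finset.mem_singleton_self t) h.shaped.indep x hx
  have hv0 : ∀ x ∉ t.carrier, v x = 0 := fun x hx => by simp [v, elementBubble, hx]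
  have hvf : v ∈ femSpace Ω 𝒯s ℓ := by
    have := hbub.mem_femSpace (Nat.succ_pos m) hΩ hΩb h𝒯 href
      (Finset.singleton_subset_iff.2 ht)
    rwa [Nat.sub_add_cancel hℓ] at this
  obtain ⟨K, hK⟩ := hbub.exists_lipschitz fun s hs => by
    rw [Finset.mem_singleton.1 hs]; exact ⟨x₀, ρ, h.shaped⟩
  have hvM : ∀ x, |v x| ≤ 8 * M := fun x => by
    by_cases hx : x ∈ t.carrier
    · rw [hvt x hx, abs_mul, abs_of_nonneg (bubble_nonneg _ _), mul_comm]
      exact mul_le_mul (bubble_le_eight _ _) (hqM x hx) (abs_nonneg _) (by norm_num)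
    · rw [hv0 x hx, abs_zero]; positivity
  have hG : ∀ᵐ x ∂volume.restrict t.carrier, ‖gradient v x‖ ≤ C₃ * (M / ρ) := by
    refine norm_gradient_le_of_abs_sub_le (by positivity) fun x hx y hy => ?_
    rw [hvt x hx, hvt y hy]
    exact hlip t.type t x₀ ρ h.shaped q hq M hqM x hx y hy
  have hKΩ := volume_carrier_sdiff h.subset
  have hform := abs_form_residual_le_localError hΩ hA hB ha hb h.mem hw.left hvf.1 hw.sub hlam
    (hw.test v hvf) t.isCompact_carrier hKΩ hK hv0 hM0 hρ hC₃ hvM hG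
  -- The half-space of the side opposite to vertex `0` is as good as any other: `v` is supported in
  -- the interior of `t`, so the surface term vanishes.
  have hRv : ∫ x in t.carrier, residual A B lam u x * v x =
      aForm Ω A u v - lam * bForm Ω B u v := by
    obtain ⟨n, c, hn, hc, hnc⟩ := exists_normal t h.shaped.indep (Nat.succ_pos m) 0
    obtain ⟨k, hk⟩ := exists_ne_index (Nat.succ_pos m) 0
    have hz : (t.basis h.shaped.indep).coord 0 (t.vertex k) = 0 :=
      (t.basis h.shaped.indep).coord_apply_ne hk.symm
    have hin : ∀ x, inner ℝ (x - t.vertex k) n = -(c * (t.basis h.shaped.indep).coord 0 x) :=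
      fun x => by rw [hnc, hz]; ring
    rw [form_eq_setIntegral hΩ hvf.1 hK t.isCompact_carrier hKΩ hv0,
      h.data.setIntegral_residual_mul hΩ hB h.subset h.mem hvf.1 hn (z := t.vertex k)
        (fun x hx => ?_) hK (HasCompactSupport.intro t.isCompact_carrier hv0)
        (fun x _ hx => hv0 x hx), sub_eq_self]
    · refine setIntegral_eq_zero_of_forall_eq_zero fun x hx => ?_
      have hx0 : (t.basis h.shaped.indep).coord 0 x = 0 := by
        rw [mem_ofPred_eq, hin, neg_eq_zero] at hx
        exact (mul_eq_zero.1 hx).resolve_left hc.ne'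
      have : v x = 0 := by
        by_contra hne
        have hxi := hbub.supp x hne
        simp only [Finset.mem_singleton, iUnion_iUnion_eq_left] at hxi
        rw [t.interior_carrier h.shaped.indep] at hxi
        exact (hxi 0).ne' hx0
      rw [this, mul_zero]
    · rw [mem_ofPred_eq, hin]
      have := mul_nonneg hc.le (coord_nonneg h.shaped.indep hx 0)
      linarith
  have hRm : MemLp (residual A B lam u) 2 (volume.restrict t.carrier) :=
    (h.data.memLp_residual hΩ hB h.subset lam).mono_exponent le_top
  have hqm : MemLp q 2 (volume.restrict t.carrier) :=
    (memLp_top_of_continuous t.isCompact_carrier hq.continuous).mono_exponent le_top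
  have hvm : MemLp v 2 (volume.restrict t.carrier) :=
    (memLp_top_of_continuous t.isCompact_carrier hK.continuous).mono_exponent le_top
  have hosc' := hosc Ω A u B t x₀ ρ p α hΩ hB h lam hlam
  change l2Norm _ (fun x => residual A B lam u x - q x) ≤ _ at hosc'
  have hosc2 : l2Norm (volume.restrict t.carrier) (fun x => residual A B lam u x - q x) ≤
      C₁ * (X / ρ) := hosc'.trans
    (mul_le_mul_of_nonneg_left (h1Norm_le_localError Ω _ hρ μ u w) hC₁.le)
  set s := √(volume.real t.carrier)
  have hs0 : 0 ≤ s := Real.sqrt_nonneg _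
  have hdiff : |∫ x in t.carrier, (residual A B lam u x - q x) * v x| ≤
      8 * M * (s * (C₁ * (X / ρ))) := by
    have := abs_integral_mul_le (ν := volume.restrict t.carrier) (hRm.sub hqm)
      (by positivity : 0 ≤ 8 * M) (Filter.Eventually.of_forall hvM)
    rw [volume_restrict_real_univ] at this
    exact this.trans (by gcongr; exact hosc2)
  have hqv : ∫ x in t.carrier, q x * v x = (∫ x in t.carrier, residual A B lam u x * v x) -
      ∫ x in t.carrier, (residual A B lam u x - q x) * v x := by
    have i1 : Integrable (fun x => residual A B lam u x * v x) (volume.restrict t.carrier) :=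
      integrable_smul_of_memLp_two hRm hvm
    have i2 : Integrable (fun x => (residual A B lam u x - q x) * v x)
      (volume.restrict t.carrier) := integrable_smul_of_memLp_two (hRm.sub hqm) hvm
    rw [← integral_sub i1 i2]
    congr 1; ext x; ring
  have hqq : ∫ y in t.carrier, q y ^ 2 * bubble (elementForms (m + 1) t.type)
      ((t.basis h.shaped.indep).coords y) = ∫ x in t.carrier, q x * v x :=
    setIntegral_congr_fun t.measurableSet_carrier fun x hx => by
      simp only [hvt x hx]; ring
  have hmain : (s * M) ^ 2 ≤ c * (X / ρ) * (s * M) := by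
    have h1 := hlow t h.shaped.indep q hq xm hxm
    rw [hqq, hqv, hRv, ← sq_abs (q xm)] at h1
    have h2 := (abs_le.1 hdiff).1
    have h3 := (le_abs_self _).trans hform
    calc (s * M) ^ 2 = volume.real t.carrier * M ^ 2 := by
          rw [mul_pow, Real.sq_sqrt measureReal_nonneg]
      _ ≤ _ := h1
      _ ≤ C₂ * ((((m + 1 : ℕ) : ℝ) ^ 2 * a₂ * C₃ + 8 * b₂) * (s * M * (X / ρ)) +
          8 * M * (s * (C₁ * (X / ρ)))) := by gcongr; linarith
      _ = _ := by rw [hc]; ring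
  have hsM : s * M ≤ c * (X / ρ) := le_of_sq_le_mul (by positivity) hmain
  have hqn : l2Norm (volume.restrict t.carrier) q ≤ M * s := by
    have := l2Norm_le_of_bound (ν := volume.restrict t.carrier) (f := q) hM0
      ((ae_restrict_iff' t.measurableSet_carrier).2 (Filter.Eventually.of_forall hqM))
    rwa [volume_restrict_real_univ] at this
  have hfin : l2Norm (volume.restrict t.carrier) (residual A B lam u) ≤ (C₁ + c) * (X / ρ) := by
    have := l2Norm_add_le (hRm.sub hqm) hqm
    have e : (fun x => (residual A B lam u - q) x + q x) = residual A B lam u := by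
      ext x; simp
    rw [e] at this
    refine this.trans ?_
    change l2Norm _ (fun x => residual A B lam u x - q x) + _ ≤ _
    linarith
  calc _ ≤ ρ * ((C₁ + c) * (X / ρ)) := by gcongr
    _ = _ := by field_simp

/-! ### Efficiency of the jump residual -/

section Side

variable {m : ℕ} {t t' : Elt (m + 1)} {i i' : Fin (m + 2)}

/-- The neighbour meets the half-space of `t` only in the shared side. -/
theorem IsSidePair.mem_side (hp : IsSidePair t t' i i') (ht : AffineIndependent ℝ t.vertex)
    (ht' : AffineIndependent ℝ t'.vertex) {x : E (m + 1)} (hx : x ∈ t'.carrier)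
    (h : 0 ≤ (t.basis ht).coord i x) : x ∈ side t t' := by
  obtain ⟨c, hc, hneg⟩ := hp.shared.exists_neg (Nat.succ_pos m) ht ht' hp.disjoint
  have h1 := coord_nonneg ht' hx i'
  have h2 : (t'.basis ht').coord i' x = 0 := by
    refine le_antisymm ?_ h1
    rw [hneg]
    have := mul_nonneg hc.le h
    linarith
  rw [side_comm]
  exact hp.symm.conforming.superset
    (mem_hull_of_coord ht' hp.shared.symm h2 fun k _ => coord_nonneg ht' hx k)

theorem IsSidePair.setIntegral_residual_mul (hp : IsSidePair t t' i i')
    {A : E (m + 1) → Matrix (Fin (m + 1)) (Fin (m + 1)) ℝ}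
    {u v : E (m + 1) → ℝ} {ℓ : ℕ} {L K : NNReal} {Λ ρ : ℝ} {x₀ : E (m + 1)}
    {p : E (m + 1) → ℝ} {α : Fin (m + 1) → Fin (m + 1) → E (m + 1) → ℝ}
    {Ω : Set (E (m + 1))} (h : IsShapedData Ω A u ℓ L Λ t x₀ ρ p α)
    (ht' : AffineIndependent ℝ t'.vertex) {B : E (m + 1) → ℝ} {b₁ b₂ : ℝ}
    (hΩ : IsOpen Ω) (hB : IsWeight Ω B b₁ b₂) (hvm : MemH10 Ω v) (hv : LipschitzWith K v)
    (hv0 : ∀ x ∉ t.carrier ∪ t'.carrier, v x = 0) (lam : ℝ) :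
    ∫ x in t.carrier, residual A B lam u x * v x =
      (∫ x in t.carrier, inner ℝ (Matrix.toEuclideanLin (A x) (weakGrad Ω u x)) (weakGrad Ω v x)) -
      lam * (∫ x in t.carrier, B x * u x * v x) -
      ∫ x, normalFlux p α (outwardNormal t (side t t')) x * v x ∂sideMeasure t t' := by
  have ht := h.shaped.indep
  obtain ⟨hn, c, hc, hin⟩ := outwardNormal_spec (Nat.succ_pos m) ht hp.shared hp.conforming
  obtain ⟨z, hz⟩ : (side t t').Nonempty := by
    obtain ⟨z, hz, hzp⟩ := exists_side_center (Nat.succ_pos m) ht i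
    exact ⟨z, hp.conforming.superset (mem_hull_of_coord ht hp.shared hz fun k hk => (hzp k hk).le)⟩
  have hin' := hin z hz
  set n := outwardNormal t (side t t')
  have hoff : ∀ x, 0 ≤ (t.basis ht).coord i x → x ∉ side t t' → x ∉ t.carrier → v x = 0 :=
    fun x hx hxs hxt => hv0 x fun hmem => hmem.elim hxt fun hx' => hxs (hp.mem_side ht ht' hx' hx)
  have hsub : side t t' ⊆ {x | inner ℝ (x - z) n = 0} := fun x hx => by
    have := hin x hx x
    rw [sub_self, inner_zero_left] at this
    rw [mem_ofPred_eq, hin', ← this]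
  have hsurf : ∫ x in {x | inner ℝ (x - z) n = 0}, normalFlux p α n x * v x ∂μHE[m] =
      ∫ x, normalFlux p α n x * v x ∂sideMeasure t t' := by
    refine setIntegral_eq_of_subset_of_forall_sdiff_eq_zero ?_ hsub fun x hx => ?_
    · exact (isClosed_eq (by fun_prop) continuous_const).measurableSet
    · have hx0 : (t.basis ht).coord i x = 0 := by
        have := hx.1
        rw [mem_ofPred_eq, hin', neg_eq_zero] at this
        exact (mul_eq_zero.1 this).resolve_left hc.ne'
      rw [hoff x hx0.ge hx.2 fun hxt => hx.2 (hp.conforming.superset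
        (mem_hull_of_coord ht hp.shared hx0 fun k _ => coord_nonneg ht hxt k)), mul_zero]
  rw [← hsurf]
  refine h.data.setIntegral_residual_mul hΩ hB h.subset h.mem hvm hn (fun x hx => ?_) hv
    (HasCompactSupport.intro (t.isCompact_carrier.union t'.isCompact_carrier) hv0)
    (fun x hx hxt => ?_) lam
  · rw [mem_ofPred_eq, hin']
    have := mul_nonneg hc.le (coord_nonneg ht hx i)
    linarith
  · rw [hin'] at hx
    exact hoff x (nonneg_of_mul_nonneg_right (by linarith) hc) (fun hs => hxt hs.1) hxt

/-- Integration by parts on the two elements, added up: the normal fluxes on the common side combine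
to the jump, and the test function vanishes off the pair. -/
theorem IsSidePair.sum_residual (hp : IsSidePair t t' i i')
    {A : E (m + 1) → Matrix (Fin (m + 1)) (Fin (m + 1)) ℝ}
    {u v : E (m + 1) → ℝ} {ℓ : ℕ} {L K : NNReal} {Λ ρ ρ' : ℝ} {x₀ x₀' : E (m + 1)}
    {p p' : E (m + 1) → ℝ} {α α' : Fin (m + 1) → Fin (m + 1) → E (m + 1) → ℝ}
    {Ω P : Set (E (m + 1))} (h : IsShapedData Ω A u ℓ L Λ t x₀ ρ p α)
    (h' : IsShapedData Ω A u ℓ L Λ t' x₀' ρ' p' α') {a₁ a₂ : ℝ} (hA : IsDiffusion Ω P A a₁ a₂)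
    {B : E (m + 1) → ℝ} {b₁ b₂ : ℝ}
    (hΩ : IsOpen Ω) (hB : IsWeight Ω B b₁ b₂) (hvm : MemH10 Ω v) (hv : LipschitzWith K v)
    (hv0 : ∀ x ∉ t.carrier ∪ t'.carrier, v x = 0) (lam : ℝ) :
    ∫ x, jump A u t t' x * v x ∂sideMeasure t t' = aForm Ω A u v - lam * bForm Ω B u v -
      (∫ x in t.carrier, residual A B lam u x * v x) -
      ∫ x in t'.carrier, residual A B lam u x * v x := by
  obtain ⟨ψ, b, hch⟩ := exists_isSideChart h.shaped.indep hp.shared hp.conforming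
  have := hch.isFiniteMeasure
  have h1 := hp.setIntegral_residual_mul h h'.shaped.indep hΩ hB hvm hv hv0 lam
  have h2 := hp.symm.setIntegral_residual_mul h' h.shaped.indep hΩ hB hvm hv
    (by rwa [union_comm]) lam
  rw [side_comm t' t, sideMeasure_comm t' t] at h2
  have hKΩ : volume ((t.carrier ∪ t'.carrier) \ Ω) = 0 := by
    rw [union_sdiff_distrib]
    exact measure_union_null (volume_carrier_sdiff h.subset) (volume_carrier_sdiff h'.subset)
  have hae : AEDisjoint volume t.carrier t'.carrier := by
    refine AEDisjoint.congr ?_ t.interior_ae_eq.symm (Filter.EventuallyEq.refl _ _)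
    exact hp.disjoint.aedisjoint
  have pu := isSobolevPair_weakGrad h.mem
  have pv := isSobolevPair_weakGrad hvm
  have ia := hA.integrable hΩ pu.memLp_grad pv.memLp_grad
  have ib := hB.integrable hΩ pu.memLp pv.memLp
  rw [form_eq_setIntegral hΩ hvm hv (t.isCompact_carrier.union t'.isCompact_carrier) hKΩ hv0,
    setIntegral_union₀ hae t'.measurableSet_carrier.nullMeasurableSet
      (ia.mono_measure (restrict_carrier_le h.subset))
      (ia.mono_measure (restrict_carrier_le h'.subset)),
    setIntegral_union₀ hae t'.measurableSet_carrier.nullMeasurableSet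
      (ib.mono_measure (restrict_carrier_le h.subset))
      (ib.mono_measure (restrict_carrier_le h'.subset))]
  have i1 : Integrable (fun x => normalFlux p α (outwardNormal t (side t t')) x * v x)
      (sideMeasure t t') := integrable_smul_of_memLp_two
    (memLp_side (h.data.continuous_normalFlux _)) (memLp_side hv.continuous)
  have i2 : Integrable (fun x => normalFlux p' α' (outwardNormal t' (side t t')) x * v x)
      (sideMeasure t t') := integrable_smul_of_memLp_two
    (memLp_side (h'.data.continuous_normalFlux _)) (memLp_side hv.continuous)
  have e : ∫ x, jump A u t t' x * v x ∂sideMeasure t t' =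
      (∫ x, normalFlux p α (outwardNormal t (side t t')) x * v x ∂sideMeasure t t') +
      ∫ x, normalFlux p' α' (outwardNormal t' (side t t')) x * v x ∂sideMeasure t t' := by
    rw [← integral_add i1 i2]
    refine integral_congr_ae ?_
    filter_upwards [jump_ae h.data h'.data] with x hx
    rw [hx, add_mul]
  rw [e]
  linarith

end Side

/-- The volume of two elements with a common side, in terms of the measure of the side. -/
theorem exists_pair_volume (m : ℕ) (hm : 1 ≤ m) (Λ : ℝ) :
    ∃ C : ℝ, 0 < C ∧ ∀ (t t' : Elt (m + 1)) (x₀ x₀' : E (m + 1)) (ρ ρ' : ℝ) (i i' : Fin (m + 2)),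
      IsShaped Λ t x₀ ρ → IsShaped Λ t' x₀' ρ' → IsSidePair t t' i i' →
      volume.real (t.carrier ∪ t'.carrier) ≤ C * (ρ * (sideMeasure t t').real univ) := by
  obtain ⟨C₁, hC₁, hv⟩ := exists_volume_bounds (Nat.succ_pos m) Λ
  obtain ⟨C₂, hC₂, hs⟩ := exists_side_bounds m Λ
  have hC₁0 : 0 < C₁ := zero_lt_one.trans_le hC₁
  have hC₂0 : 0 < C₂ := zero_lt_one.trans_le hC₂
  refine ⟨C₁ * (1 + (2 * |Λ|) ^ (m + 1)) * C₂, by positivity,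
    fun t t' x₀ x₀' ρ ρ' i i' h h' hp => ?_⟩
  have hΛ0 : 0 ≤ Λ := zero_le_one.trans (h.one_le (Nat.succ_pos m))
  rw [abs_of_nonneg hΛ0]
  have hρ := h.pos
  have hρ' := h'.pos
  obtain ⟨ψ, b, hch⟩ := exists_isSideChart h.indep hp.shared hp.conforming
  rw [hch.measureReal_univ]
  have h1 := (hv t x₀ ρ h).2.2.2
  have h2 := (hv t' x₀' ρ' h').2.2.2
  have h3 := hp.shared.radius_le (by omega) h h'
  have h4 := (hs t t' x₀ ρ h i i' hp.shared hp.conforming ψ b hch).1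
  calc volume.real (t.carrier ∪ t'.carrier) ≤ volume.real t.carrier + volume.real t'.carrier :=
        measureReal_union_le _ _
    _ ≤ C₁ * ρ ^ (m + 1) + C₁ * (2 * Λ * ρ) ^ (m + 1) := by
        refine add_le_add h1 (h2.trans ?_)
        gcongr
    _ = C₁ * (1 + (2 * Λ) ^ (m + 1)) * (ρ * ρ ^ m) := by ring
    _ ≤ C₁ * (1 + (2 * Λ) ^ (m + 1)) *
        (ρ * (C₂ * volume.real (convexHull ℝ (range b)))) := by gcongr
    _ = _ := by ring

-- The argument for elements, with the frozen jump and a side bubble in place of the frozen residual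
-- and the element bubble. The element residuals of both neighbours enter as additional terms and
-- are bounded by `exists_element_efficiency`.
set_option maxHeartbeats 400000 in
open Classical in
theorem exists_side_efficiency {m : ℕ} (hd : m + 1 = 2 ∨ m + 1 = 3) {ℓ : ℕ} (hℓ : 1 ≤ ℓ)
    {Ω P : Set (E (m + 1))} (hΩ : IsOpen Ω) (hΩb : Bornology.IsBounded Ω)
    {A : E (m + 1) → Matrix (Fin (m + 1)) (Fin (m + 1)) ℝ} {a₁ a₂ : ℝ}
    (hA : IsDiffusion Ω P A a₁ a₂) {B : E (m + 1) → ℝ} {b₁ b₂ : ℝ} (hB : IsWeight Ω B b₁ b₂)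
    (L : NNReal) (Λ : ℝ) : ∃ C : ℝ, 0 < C ∧ ∀ 𝒯 : Mesh (m + 1), IsTriangulation Ω 𝒯 →
      ∀ T ∈ 𝒯, ∀ 𝒯s, IsLocalRefinement Ω 𝒯 T 𝒯s → ∀ t ∈ sideNbrs 𝒯 T, ∀ u x₀ ρ p α x₀' ρ' p' α',
      IsShapedData Ω A u ℓ L Λ T x₀ ρ p α → IsShapedData Ω A u ℓ L Λ t x₀' ρ' p' α' →
      ∀ (lam μ : ℝ) (w : E (m + 1) → ℝ), 0 ≤ lam →
      IsTestedPair Ω A B (femSpace Ω 𝒯s ℓ) μ u w →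
      √ρ * l2Norm (sideMeasure T t) (jump A u T t) ≤
        C * localError Ω (patch 𝒯 T) ρ lam μ u w := by
  have hm : 1 ≤ m := by omega
  obtain ⟨C₁, hC₁, hosc⟩ := exists_jump_oscillation m ℓ hm L Λ
  obtain ⟨C₂, hC₂, hlow⟩ := exists_side_lower hd (ℓ - 1)
  obtain ⟨C₃, hC₃, hlip⟩ := exists_uniform_lipschitz_mul_bubble (d := m + 1) (ℓ - 1) Λ
    (fun z : ZMod 3 × Fin (m + 2) => sideForms (m + 1) z.1 z.2)
  obtain ⟨C₄, hC₄, hvol⟩ := exists_pair_volume m hm Λ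
  obtain ⟨C₅, hC₅, helt⟩ := exists_element_efficiency hd hℓ hΩ hΩb hA hB L Λ
  set e := 1 + 2 * |Λ|
  have he1 : 1 ≤ e := le_add_of_nonneg_right (by positivity)
  have he0 : 0 < e := zero_lt_one.trans_le he1
  set c := C₂ * (√C₄ * ((((m + 1 : ℕ) : ℝ) ^ 2 * |a₂| * (C₃ * e) + 8 * |b₂|) + 8 * C₅ +
    8 * (e * (C₅ * e))) + 8 * (2 * C₁)) with hc
  refine ⟨2 * C₁ + c, by positivity,
    fun 𝒯 h𝒯 T hT 𝒯s href t ht u x₀ ρ p α x₀' ρ' p' α' h h' lam μ w hlam hw => ?_⟩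
  have hne : Ω.Nonempty := (T.interior_nonempty h.shaped.indep).mono h.subset
  have ha := hA.nonneg (Nat.succ_pos m) hne
  have hb := hB.nonneg hne
  rw [abs_of_nonneg ha, abs_of_nonneg hb] at hc
  have hρ := h.shaped.pos
  have hρ' := h'.shaped.pos
  have hΛ0 : 0 ≤ Λ := zero_le_one.trans (h.shaped.one_le (Nat.succ_pos m))
  have heΛ : 2 * Λ ≤ e := by simp only [e, abs_of_nonneg hΛ0]; linarith
  obtain ⟨i, i', hp⟩ := h𝒯.exists_isSidePair hT ht
  have hneT := ne_of_mem_sideNbrs h.shaped.indep ht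
  have hTn := self_mem_nbrs hT
  have htn := sideNbrs_subset_nbrs (Nat.succ_pos m) ht
  have r1 : ρ' ≤ e * ρ := (hp.shared.radius_le (by omega) h.shaped h'.shaped).trans (by gcongr)
  have r2 : ρ ≤ e * ρ' := (hp.symm.shared.radius_le (by omega) h'.shaped h.shaped).trans (by gcongr)
  obtain ⟨ψ, b, hch⟩ := exists_isSideChart h.shaped.indep hp.shared hp.conforming
  have := hch.isFiniteMeasure
  set K := T.carrier ∪ t.carrier
  have hKc : IsCompact K := T.isCompact_carrier.union t.isCompact_carrier
  have hKΩ : volume (K \ Ω) = 0 := by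
    rw [union_sdiff_distrib]
    exact measure_union_null (volume_carrier_sdiff h.subset) (volume_carrier_sdiff h'.subset)
  have hpΩ := restrict_patch_le (T := T) h𝒯
  have hKp : (volume.restrict K : Measure (E (m + 1))) ≤ volume.restrict (patch 𝒯 T) :=
    Measure.restrict_mono (union_subset
      (subset_biUnion_of_mem (u := fun t : Elt (m + 1) => t.carrier) hTn)
      (subset_biUnion_of_mem (u := fun t : Elt (m + 1) => t.carrier) htn)) le_rfl
  set X := localError Ω (patch 𝒯 T) ρ lam μ u w
  have hX : 0 ≤ X := localError_nonneg Ω _ hρ.le hlam μ u w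
  have hXK : localError Ω K ρ lam μ u w ≤ X := by
    have := localError_mono (μ := μ) hρ.le le_rfl (one_mul ρ).ge hlam h.mem hw.left hw.sub hKp hpΩ
    rwa [one_mul] at this
  have hRT : l2Norm (volume.restrict T.carrier) (residual A B lam u) ≤ C₅ * (X / ρ) := by
    have h1 := helt 𝒯 h𝒯 T 𝒯s href T hTn u x₀ ρ p α h lam μ w hlam hw
    have h2 := localError_mono (μ := μ) hρ.le le_rfl (one_mul ρ).ge hlam h.mem hw.left hw.sub
      (restrict_le_patch hTn) hpΩ
    rw [one_mul] at h2
    rw [← mul_div_assoc, le_div_iff₀ hρ, mul_comm]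
    exact h1.trans (by gcongr)
  have hRt : l2Norm (volume.restrict t.carrier) (residual A B lam u) ≤ e * (C₅ * e) * (X / ρ) := by
    have h1 := helt 𝒯 h𝒯 T 𝒯s href t htn u x₀' ρ' p' α' h' lam μ w hlam hw
    have h2 := localError_mono (μ := μ) hρ'.le he1 r1 hlam h.mem hw.left hw.sub
      (restrict_le_patch htn) hpΩ
    rw [← mul_div_assoc, le_div_iff₀ hρ]
    have n0 := l2Norm_nonneg (volume.restrict t.carrier) (residual A B lam u)
    calc _ ≤ l2Norm (volume.restrict t.carrier) (residual A B lam u) * (e * ρ') := by gcongr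
      _ = e * (ρ' * l2Norm (volume.restrict t.carrier) (residual A B lam u)) := by ring
      _ ≤ e * (C₅ * (e * X)) :=
        mul_le_mul_of_nonneg_left (h1.trans (mul_le_mul_of_nonneg_left h2 hC₅.le)) he0.le
      _ = _ := by ring
  set q := frozenJump T t p p' α α' x₀ x₀'
  have hq : IsPoly (ℓ - 1) q := isPoly_frozenJump T t h.data.poly h'.data.poly α α' x₀ x₀'
  have hSne : (side T t).Nonempty := by
    rw [← hch.image_eq]
    exact ⟨_, b 0, subset_convexHull ℝ _ (mem_range_self 0), rfl⟩
  obtain ⟨xm, hxm, hmax⟩ := (isCompact_side T t).exists_isMaxOn hSne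
    hq.continuous.abs.continuousOn
  set M := |q xm|
  have hM0 : 0 ≤ M := abs_nonneg _
  have hqM : ∀ x ∈ side T t, |q x| ≤ M := fun x hx => hmax hx
  obtain ⟨v, Q, j, hbub, hvS, hQ, hv0⟩ := exists_sideBubble hd h𝒯 href hTn htn hneT
    h.shaped.indep hp.shared hq
  have hvf : v ∈ femSpace Ω 𝒯s ℓ := by
    have := hbub.mem_femSpace (Nat.succ_pos m) hΩ hΩb h𝒯 href (by
      intro s hs
      rcases Finset.mem_insert.1 hs with rfl | hs
      · exact hTn
      · rw [Finset.mem_singleton.1 hs]; exact htn)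
    rwa [Nat.sub_add_cancel hℓ] at this
  have hTm : T ∈ ({T, t} : Finset (Elt (m + 1))) := Finset.mem_insert_self _ _
  have htm : t ∈ ({T, t} : Finset (Elt (m + 1))) :=
    Finset.mem_insert_of_mem (Finset.mem_singleton_self t)
  obtain ⟨Kv, hKv⟩ := hbub.exists_lipschitz (Λ := Λ) fun s hs => by
    rcases Finset.mem_insert.1 hs with rfl | hs
    · exact ⟨x₀, ρ, h.shaped⟩
    · rw [Finset.mem_singleton.1 hs]; exact ⟨x₀', ρ', h'.shaped⟩
  have hQM : ∀ s ∈ ({T, t} : Finset (Elt (m + 1))), ∀ x ∈ s.carrier, |Q s x| ≤ M :=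
    fun s hs x hx => by
      obtain ⟨y, hy, hQy⟩ := hQ s hs x hx
      rw [hQy]; exact hqM y hy
  have hvb : ∀ s ∈ ({T, t} : Finset (Elt (m + 1))), AffineIndependent ℝ s.vertex →
      ∀ x ∈ s.carrier, |v x| ≤ 8 * M := fun s hs hi x hx => by
    rw [hbub.eq s hs hi x hx, abs_mul, abs_of_nonneg (bubble_nonneg _ _), mul_comm]
    exact mul_le_mul (bubble_le_eight _ _) (hQM s hs x hx) (abs_nonneg _) (by norm_num)
  have hvM : ∀ x, |v x| ≤ 8 * M := fun x => by
    by_cases hx : x ∈ K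
    · exact hx.elim (hvb T hTm h.shaped.indep x) (hvb t htm h'.shaped.indep x)
    · rw [hv0 x hx, abs_zero]; positivity
  have hGs : ∀ s ∈ ({T, t} : Finset (Elt (m + 1))), ∀ y₀ σ, IsShaped Λ s y₀ σ → ρ ≤ e * σ →
      ∀ᵐ x ∂volume.restrict s.carrier, ‖gradient v x‖ ≤ C₃ * e * (M / ρ) := by
    intro s hs y₀ σ hsh hσ
    have hσ0 := hsh.pos
    have hle : M / σ ≤ e * (M / ρ) := by
      rw [← mul_div_assoc, div_le_div_iff₀ hσ0 hρ]
      calc M * ρ ≤ M * (e * σ) := by gcongr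
        _ = _ := by ring
    refine norm_gradient_le_of_abs_sub_le (by positivity) fun x hx y hy => ?_
    rw [hbub.eq s hs hsh.indep x hx, hbub.eq s hs hsh.indep y hy]
    refine (hlip (s.type, j s) s y₀ σ hsh (Q s) (hbub.poly s hs) M (hQM s hs) x hx y hy).trans ?_
    rw [mul_assoc C₃ e]
    gcongr
  have hG : ∀ᵐ x ∂volume.restrict K, ‖gradient v x‖ ≤ C₃ * e * (M / ρ) := by
    rw [ae_restrict_union_iff]
    exact ⟨hGs T hTm x₀ ρ h.shaped (le_mul_of_one_le_left hρ.le he1), hGs t htm x₀' ρ' h'.shaped r2⟩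
  have hform := abs_form_residual_le_localError hΩ hA hB ha hb h.mem hw.left hvf.1 hw.sub hlam
    (hw.test v hvf) hKc hKΩ hKv hv0 hM0 hρ (by positivity) hvM hG
  have hsum := hp.sum_residual h h' hA hΩ hB hvf.1 hKv hv0 lam
  set s := √((sideMeasure T t).real univ)
  have hs0 : 0 ≤ s := Real.sqrt_nonneg _
  have hsρ : 0 < √ρ := Real.sqrt_pos.2 hρ
  set k := √(volume.real K)
  have hk : k ≤ √C₄ * (√ρ * s) := by
    rw [← Real.sqrt_mul hρ.le, ← Real.sqrt_mul hC₄.le]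
    exact Real.sqrt_le_sqrt (hvol T t x₀ x₀' ρ ρ' i i' h.shaped h'.shaped hp)
  -- The volume of the pair is at most of order `ρ` times the measure of the side. This converts
  -- volume terms into side terms and turns `X / ρ` into `X / √ρ`.
  have hkX : k * M * (X / ρ) ≤ √C₄ * (s * M * (X / √ρ)) := by
    calc k * M * (X / ρ) ≤ √C₄ * (√ρ * s) * M * (X / ρ) := by gcongr
      _ = √C₄ * (s * M * (X * (√ρ / ρ))) := by ring
      _ = _ := by rw [Real.sqrt_div_self, ← div_eq_mul_inv]
  have hkT : √(volume.real T.carrier) ≤ k :=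
    Real.sqrt_le_sqrt (measureReal_mono subset_union_left hKc.measure_lt_top.ne)
  have hkt : √(volume.real t.carrier) ≤ k :=
    Real.sqrt_le_sqrt (measureReal_mono subset_union_right hKc.measure_lt_top.ne)
  have hRv : ∀ {s : Elt (m + 1)} {y₀ σ p α} {c' : ℝ}, IsShapedData Ω A u ℓ L Λ s y₀ σ p α →
      √(volume.real s.carrier) ≤ k → 0 ≤ c' →
      l2Norm (volume.restrict s.carrier) (residual A B lam u) ≤ c' * (X / ρ) →
      |∫ x in s.carrier, residual A B lam u x * v x| ≤ 8 * c' * (k * M * (X / ρ)) := by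
    intro s y₀ σ p α c' hs hks hc' hle
    have h1 := abs_integral_mul_le (ν := volume.restrict s.carrier)
      ((hs.data.memLp_residual hΩ hB hs.subset lam).mono_exponent (p := 2) le_top)
      (by positivity : 0 ≤ 8 * M) (Filter.Eventually.of_forall hvM)
    rw [volume_restrict_real_univ] at h1
    have n0 := l2Norm_nonneg (volume.restrict s.carrier) (residual A B lam u)
    calc _ ≤ _ := h1
      _ ≤ 8 * M * (k * (c' * (X / ρ))) := by gcongr
      _ = _ := by ring
  have hRv1 := hRv h hkT hC₅.le hRT
  have hRv2 := hRv h' hkt (by positivity) hRt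
  have hJm : MemLp (jump A u T t) 2 (sideMeasure T t) := memLp_jump h.data h'.data
  have hqm : MemLp q 2 (sideMeasure T t) := memLp_side hq.continuous
  have hvm : MemLp v 2 (sideMeasure T t) := memLp_side hKv.continuous
  have hosc2 : l2Norm (sideMeasure T t) (fun x => jump A u T t x - q x) ≤ 2 * C₁ * (X / √ρ) := by
    refine (hosc Ω A u T t x₀ x₀' ρ ρ' p p' α α' i i' h h' hp).trans ?_
    set H := h1Norm Ω (patch 𝒯 T) u
    have hH : 0 ≤ H := h1Norm_nonneg _ _ _
    have k1 : l2Norm (volume.restrict T.carrier) (weakGrad Ω u) ≤ H :=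
      (l2Norm_weakGrad_le_h1Norm _ _ _).trans (h1Norm_le_patch h𝒯 h.mem hTn)
    have k2 : l2Norm (volume.restrict t.carrier) (weakGrad Ω u) ≤ H :=
      (l2Norm_weakGrad_le_h1Norm _ _ _).trans (h1Norm_le_patch h𝒯 h.mem htn)
    have k3 : H ≤ X / ρ :=
      le_trans (by nlinarith) (h1Norm_le_localError Ω (patch 𝒯 T) (lam := lam) hρ μ u w)
    calc _ ≤ C₁ * (√ρ * (X / ρ + X / ρ)) := by gcongr <;> linarith
      _ = 2 * C₁ * (X * (√ρ / ρ)) := by ring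
      _ = _ := by rw [Real.sqrt_div_self, ← div_eq_mul_inv]
  have hdiff : |∫ x, (jump A u T t x - q x) * v x ∂sideMeasure T t| ≤
      8 * M * (s * (2 * C₁ * (X / √ρ))) := by
    refine (abs_integral_mul_le (ν := sideMeasure T t) (hJm.sub hqm)
      (by positivity : 0 ≤ 8 * M) (Filter.Eventually.of_forall hvM)).trans ?_
    gcongr
    exact hosc2
  have hqv : ∫ x, q x * v x ∂sideMeasure T t = (∫ x, jump A u T t x * v x ∂sideMeasure T t) -
      ∫ x, (jump A u T t x - q x) * v x ∂sideMeasure T t := by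
    have i1 : Integrable (fun x => jump A u T t x * v x) (sideMeasure T t) :=
      integrable_smul_of_memLp_two hJm hvm
    have i2 : Integrable (fun x => (jump A u T t x - q x) * v x) (sideMeasure T t) :=
      integrable_smul_of_memLp_two (hJm.sub hqm) hvm
    rw [← integral_sub i1 i2]
    congr 1; ext x; ring
  have hqq : ∫ y, q y ^ 2 * bubble (sideForms (m + 1) T.type i)
      ((T.basis h.shaped.indep).coords y) ∂sideMeasure T t = ∫ x, q x * v x ∂sideMeasure T t := by
    refine integral_congr_ae ?_
    filter_upwards [ae_mem_side T t] with x hx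
    rw [hvS x hx]; ring
  -- The integral of the jump against `v` splits into the tested residual and the two element
  -- residuals. The first three bounds all carry the factor `k * M * (X / ρ)`; the freezing error
  -- already has the scaling of the side.
  have hmain : (s * M) ^ 2 ≤ c * (X / √ρ) * (s * M) := by
    have h1 := hlow T t h.shaped.indep i ψ b hch q hq xm hxm
    rw [hqq, hqv, hsum, ← sq_abs (q xm), ← hch.measureReal_univ] at h1
    have h2 := (abs_le.1 hdiff).1
    have h3 := (le_abs_self _).trans hform
    have h4 := (abs_le.1 hRv1).1
    have h5 := (abs_le.1 hRv2).1
    set Y := k * M * (X / ρ)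
    set g := ((m + 1 : ℕ) : ℝ) ^ 2 * a₂ * (C₃ * e) + 8 * b₂
    have hg : 0 ≤ g := by positivity
    have h6 : g * (k * M * (localError Ω K ρ lam μ u w / ρ)) ≤ g * Y :=
      mul_le_mul_of_nonneg_left (mul_le_mul_of_nonneg_left
        (div_le_div_of_nonneg_right hXK hρ.le) (by positivity)) hg
    calc (s * M) ^ 2 = (sideMeasure T t).real univ * M ^ 2 := by
          rw [mul_pow, Real.sq_sqrt measureReal_nonneg]
      _ ≤ _ := h1
      _ ≤ C₂ * ((g + 8 * C₅ + 8 * (e * (C₅ * e))) * Y + 8 * M * (s * (2 * C₁ * (X / √ρ)))) := by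
          refine mul_le_mul_of_nonneg_left ?_ hC₂.le
          linarith
      _ ≤ C₂ * ((g + 8 * C₅ + 8 * (e * (C₅ * e))) * (√C₄ * (s * M * (X / √ρ))) +
          8 * M * (s * (2 * C₁ * (X / √ρ)))) := by gcongr
      _ = _ := by rw [hc]; ring
  have hsM : s * M ≤ c * (X / √ρ) := le_of_sq_le_mul (by positivity) hmain
  have hqn : l2Norm (sideMeasure T t) q ≤ M * s :=
    l2Norm_le_of_bound (ν := sideMeasure T t) (f := q) hM0 ((ae_mem_side T t).mono hqM)
  have hfin : l2Norm (sideMeasure T t) (jump A u T t) ≤ (2 * C₁ + c) * (X / √ρ) := by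
    have := l2Norm_add_le (hJm.sub hqm) hqm
    have e : (fun x => (jump A u T t - q) x + q x) = jump A u T t := by
      ext x; simp
    rw [e] at this
    refine this.trans ?_
    change l2Norm _ (fun x => jump A u T t x - q x) + _ ≤ _
    linarith
  calc _ ≤ √ρ * ((2 * C₁ + c) * (X / √ρ)) := by gcongr
    _ = _ := by field_simp

/-! ### The local lower bound -/

/-- Normalization gives `b(u,u) = 1`, so the eigenvalue equals `a(u,u)`. -/
theorem IsEigenpair.nonneg {d : ℕ} {Ω P : Set (E d)} (hΩ : IsOpen Ω)
    {A : E d → Matrix (Fin d) (Fin d) ℝ} {a₁ a₂ : ℝ} (hA : IsDiffusion Ω P A a₁ a₂) {B : E d → ℝ}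
    {V : Set (E d → ℝ)} {lam : ℝ} {u : E d → ℝ} (h : IsEigenpair Ω A B V lam u) : 0 ≤ lam := by
  have hb : bForm Ω B u u = 1 := Real.sqrt_eq_one.1 h.norm
  have ha := h.eq u h.mem
  rw [hb, mul_one] at ha
  rw [← ha]
  exact setIntegral_nonneg hΩ.measurableSet fun x hx =>
    (mul_nonneg hA.pos.le (sq_nonneg _)).trans (hA.lower x hx _)

/-- The radius `ρ` is comparable with the size of the element, so the element bound and the at most
`d + 1` side bounds can be expressed by the size and added up in squares. -/
theorem exists_estimator_bound {m : ℕ} (hd : m + 1 = 2 ∨ m + 1 = 3) {ℓ : ℕ} (hℓ : 1 ≤ ℓ)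
    {Ω P : Set (E (m + 1))} (hΩ : IsOpen Ω) (hΩb : Bornology.IsBounded Ω)
    {A : E (m + 1) → Matrix (Fin (m + 1)) (Fin (m + 1)) ℝ} {a₁ a₂ : ℝ}
    (hA : IsDiffusion Ω P A a₁ a₂) {B : E (m + 1) → ℝ} {b₁ b₂ : ℝ} (hB : IsWeight Ω B b₁ b₂)
    (κ : ℝ) : ∃ C : ℝ, 0 < C ∧ ∀ 𝒯 : Mesh (m + 1), IsTriangulation Ω 𝒯 → Matches P 𝒯 →
      regularity 𝒯 ≤ κ → ∀ T ∈ 𝒯, ∀ 𝒯s, IsLocalRefinement Ω 𝒯 T 𝒯s →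
      ∀ (lam μ : ℝ) (u w : E (m + 1) → ℝ), 0 ≤ lam → u ∈ femSpace Ω 𝒯 ℓ →
      IsTestedPair Ω A B (femSpace Ω 𝒯s ℓ) μ u w →
      estimator A B 𝒯 lam u T ≤ C * localError Ω (patch 𝒯 T) T.size lam μ u w := by
  obtain ⟨L, hL⟩ := exists_isShapedData (ℓ := ℓ) hA
  obtain ⟨C₁, hC₁, helt⟩ := exists_element_efficiency hd hℓ hΩ hΩb hA hB L (2 * κ)
  obtain ⟨C₂, hC₂, hside⟩ := exists_side_efficiency hd hℓ hΩ hΩb hA hB L (2 * κ)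
  obtain ⟨C₃, hC₃, hv⟩ := exists_volume_bounds (Nat.succ_pos m) (2 * κ)
  have hC₃0 : 0 < C₃ := zero_lt_one.trans_le hC₃
  set c := ((m + 1 + 1 : ℕ) : ℝ)
  set K₁ := C₃ * (C₁ * C₃)
  set K₂ := √C₃ * (C₂ * C₃)
  refine ⟨K₁ + √c * K₂, by positivity,
    fun 𝒯 h𝒯 hmat hκ T hT 𝒯s href lam μ u w hlam hu hw => ?_⟩
  choose! x₀ ρ p α h using hL κ 𝒯 h𝒯 hmat hκ u hu
  have hT' := h T hT
  have hρ := hT'.shaped.pos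
  obtain ⟨s1, s2, -, -⟩ := hv T _ _ hT'.shaped
  have hsz : 0 ≤ T.size := Real.rpow_nonneg measureReal_nonneg _
  have hTn := self_mem_nbrs hT
  have hpΩ := restrict_patch_le (T := T) h𝒯
  set Y := localError Ω (patch 𝒯 T) T.size lam μ u w
  have hY : 0 ≤ Y := localError_nonneg Ω _ hsz hlam μ u w
  have hR : T.size * l2Norm (volume.restrict T.carrier) (residual A B lam u) ≤ K₁ * Y := by
    have h1 := helt 𝒯 h𝒯 T 𝒯s href T hTn u _ _ _ _ hT' lam μ w hlam hw
    have h2 := localError_mono (μ := μ) hρ.le hC₃ s1 hlam hu.1 hw.left hw.sub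
      (restrict_le_patch hTn) hpΩ
    have n0 := l2Norm_nonneg (volume.restrict T.carrier) (residual A B lam u)
    calc _ ≤ C₃ * ρ T * l2Norm (volume.restrict T.carrier) (residual A B lam u) := by gcongr
      _ = C₃ * (ρ T * l2Norm (volume.restrict T.carrier) (residual A B lam u)) := by ring
      _ ≤ C₃ * (C₁ * (C₃ * Y)) := mul_le_mul_of_nonneg_left
          (h1.trans (mul_le_mul_of_nonneg_left h2 hC₁.le)) hC₃0.le
      _ = _ := by simp only [K₁]; ring
  have hJ : ∀ t ∈ sideNbrs 𝒯 T, √T.size * l2Norm (sideMeasure T t) (jump A u T t) ≤ K₂ * Y := by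
    intro t ht
    have h1 := hside 𝒯 h𝒯 T hT 𝒯s href t ht u _ _ _ _ _ _ _ _ hT'
      (h t (mem_sideNbrs.1 ht).1) lam μ w hlam hw
    have h2 := localError_mono (μ := μ) hρ.le hC₃ s1 hlam hu.1 hw.left hw.sub le_rfl hpΩ
    have n0 := l2Norm_nonneg (sideMeasure T t) (jump A u T t)
    have s3 : √T.size ≤ √C₃ * √(ρ T) := by
      rw [← Real.sqrt_mul hC₃0.le]; exact Real.sqrt_le_sqrt s2
    calc _ ≤ √C₃ * √(ρ T) * l2Norm (sideMeasure T t) (jump A u T t) := by gcongr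
      _ = √C₃ * (√(ρ T) * l2Norm (sideMeasure T t) (jump A u T t)) := by ring
      _ ≤ √C₃ * (C₂ * (C₃ * Y)) := mul_le_mul_of_nonneg_left
          (h1.trans (mul_le_mul_of_nonneg_left h2 hC₂.le)) (Real.sqrt_nonneg _)
      _ = _ := by simp only [K₂]; ring
  refine Real.sqrt_le_iff.2 ⟨by positivity, ?_⟩
  have n1 : T.size ^ 2 * l2Norm (volume.restrict T.carrier) (residual A B lam u) ^ 2 ≤
      (K₁ * Y) ^ 2 := by
    rw [← mul_pow]
    exact pow_le_pow_left₀ (mul_nonneg hsz (l2Norm_nonneg _ _)) hR 2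
  have n2 : T.size * ∑ t ∈ sideNbrs 𝒯 T, l2Norm (sideMeasure T t) (jump A u T t) ^ 2 ≤
      (√c * K₂ * Y) ^ 2 := by
    rw [Finset.mul_sum]
    calc _ ≤ ∑ _t ∈ sideNbrs 𝒯 T, (K₂ * Y) ^ 2 := by
          refine Finset.sum_le_sum fun t ht => ?_
          have := pow_le_pow_left₀ (mul_nonneg (Real.sqrt_nonneg _) (l2Norm_nonneg _ _)) (hJ t ht) 2
          rwa [mul_pow, Real.sq_sqrt hsz] at this
      _ = ((sideNbrs 𝒯 T).card : ℝ) * (K₂ * Y) ^ 2 := by simp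
      _ ≤ c * (K₂ * Y) ^ 2 := by
          gcongr
          exact Nat.cast_le.2 (h𝒯.card_sideNbrs_le (Nat.succ_pos m) hT)
      _ = _ := by rw [mul_assoc √c, mul_pow √c, Real.sq_sqrt (by positivity)]
  have n3 : 0 ≤ (K₁ * Y) * (√c * K₂ * Y) := by positivity
  calc _ ≤ (K₁ * Y) ^ 2 + (√c * K₂ * Y) ^ 2 := add_le_add n1 n2
    _ ≤ _ := by nlinarith

end FEM

end

/-! ### Conclusion: both estimates with one constant -/

theorem mainTheorem7 (d : ℕ) (hd : d = 2 ∨ d = 3) (ℓ : ℕ) (hℓ : 1 ≤ ℓ)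
    (Ω P : Set (FEM.E d)) (hΩ : IsOpen Ω) (hΩb : Bornology.IsBounded Ω)
    (A : FEM.E d → Matrix (Fin d) (Fin d) ℝ) (a₁ a₂ : ℝ) (hA : FEM.IsDiffusion Ω P A a₁ a₂)
    (B : FEM.E d → ℝ) (b₁ b₂ : ℝ) (hB : FEM.IsWeight Ω B b₁ b₂) (κ : ℝ) :
    ∃ C : ℝ, 0 < C ∧
      ∀ 𝒯 : FEM.Mesh d, FEM.IsTriangulation Ω 𝒯 → FEM.Matches P 𝒯 → FEM.regularity 𝒯 ≤ κ →
      ∀ T ∈ 𝒯, ∀ 𝒯s : FEM.Mesh d, FEM.IsLocalRefinement Ω 𝒯 T 𝒯s →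
      ∀ (lam : ℝ) (u : FEM.E d → ℝ), FEM.IsEigenpair Ω A B (FEM.femSpace Ω 𝒯 ℓ) lam u →
      ∀ W : Submodule ℝ (FEM.E d → ℝ), (∀ v ∈ W, FEM.MemH10 Ω v) →
        FEM.femSpace Ω 𝒯s ℓ ⊆ (W : Set (FEM.E d → ℝ)) →
      ∀ (μ : ℝ) (w : FEM.E d → ℝ), FEM.IsEigenpair Ω A B (W : Set (FEM.E d → ℝ)) μ w →
        T.size * FEM.residualOsc A B 𝒯 ℓ lam u T + √T.size * FEM.jumpOsc A 𝒯 ℓ u T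
            ≤ C * (T.size * (2 + lam) * FEM.h1Norm Ω (FEM.patch 𝒯 T) u) ∧
        FEM.estimator A B 𝒯 lam u T
            ≤ C * (FEM.l2Norm (MeasureTheory.volume.restrict (FEM.patch 𝒯 T))
                    (FEM.weakGrad Ω (fun x => w x - u x))
                + T.size * FEM.l2Norm (MeasureTheory.volume.restrict (FEM.patch 𝒯 T))
                    (fun x => μ * w x)
                + T.size * (1 + lam) * FEM.h1Norm Ω (FEM.patch 𝒯 T) u) := by
  obtain ⟨m, rfl⟩ : ∃ m, d = m + 1 := ⟨d - 1, by omega⟩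
  obtain ⟨C₁, hC₁, h₁⟩ := FEM.exists_oscillation_bound (by omega) ℓ hΩ hA hB κ
  obtain ⟨C₂, hC₂, h₂⟩ := FEM.exists_estimator_bound hd hℓ hΩ hΩb hA hB κ
  refine ⟨C₁ + C₂, by positivity,
    fun 𝒯 h𝒯 hmat hκ T hT 𝒯s href lam u hu W hW hVW μ w hw => ?_⟩
  have hlam := hu.nonneg hΩ hA
  have hsz : 0 ≤ T.size := Real.rpow_nonneg MeasureTheory.measureReal_nonneg _
  -- The spaces are nested: a polynomial on an element is one on its descendants. Hence `u` lies in
  -- the subspace `W`, and so does `w - u`, which makes its weak gradient meaningful.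
  have huW : u ∈ W := hVW (FEM.femSpace_subset_of_refinement href.refines hu.mem)
  have hpair : FEM.IsTestedPair Ω A B (FEM.femSpace Ω 𝒯s ℓ) μ u w :=
    ⟨hW w hw.mem, hW _ (W.sub_mem hw.mem huW), fun v hv => hw.eq v (hVW hv)⟩
  constructor
  · refine (h₁ 𝒯 h𝒯 hmat hκ T hT lam hlam u hu.mem).trans ?_
    refine mul_le_mul_of_nonneg_right (by linarith) ?_
    exact mul_nonneg (mul_nonneg hsz (by linarith)) (FEM.h1Norm_nonneg _ _ _)
  · refine (h₂ 𝒯 h𝒯 hmat hκ T hT 𝒯s href lam μ u w hlam hu.mem hpair).trans ?_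
    exact mul_le_mul_of_nonneg_right (by linarith) (FEM.localError_nonneg Ω _ hsz hlam μ u w)
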